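/- **Theorem 1.2.** Let $\sigma>0$ and let $w:\mathbb R^3\to\mathbb R$ be an even function with $w\in L^1(\mathbb R^3)$ and $e^{\sigma|s|}\widehat w\in L^1(\mathbb R^3)$, where $\widehat w(s)=\int e^{-i\langle s,x\rangle}w(x)\,dx$. For $\hbar>0$ and $N\ge 1$ let $$H_N=-\sum_{i=1}^N\frac{\hbar^2}{2}\Delta_i+\frac1N\sum_{1\le i<j\le N}w(x_i-x_j)$$ on $L^2(\mathbb R^{3N})$. Let $\psi\in L^2(\mathbb R^3)$, $\|\psi\|=1$, let $\Psi_N(t)$ be the solution of $i\hbar\,\partial_t\Psi_N=H_N\Psi_N$ with the product initial state $\Psi_N(0)=\psi(x_1)\cdots\psi(x_N)$, and let $\psi_t$ be the solution of the Hartree equation $$i\hbar\,\partial_t\psi_t=-\frac{\hbar^2}{2}\Delta\psi_t+(w*|\psi_t|^2)\psi_t,\qquad \psi_{t=0}=\psi$$ (both are solutions on $[0,\infty)$, continuous with values in $L^2$, of the equation in the sense of distributions). Define the Wigner functions $$W_N^{\Psi_N}(X_N,\Xi_N;t)=(2\pi)^{-3N}\int_{\mathbb R^{3N}}e^{i\langle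 Y,\Xi_N\rangle}\,\Psi_N(X_N+\tfrac{\hbar Y}{2},t)\,\overline{\Psi_N(X_N-\tfrac{\hbar Y}{2},t)}\,dY,$$ $$W(\psi)(x,\xi;t)=(2\pi)^{-3}\int_{\mathbb R^3}e^{i\langle y,\xi\rangle}\,\psi_t(x+\tfrac{\hbar y}{2})\,\overline{\psi_t(x-\tfrac{\hbar y}{2})}\,dy ,$$ and, for $1\le p\le N$, the $p$-particle marginal $W_p^{\Psi_N}(X_p,\Xi_p;t)=\int W_N^{\Psi_N}(X_N,\Xi_N;t)\,dX_{N-p}\,d\Xi_{N-p}$ over the last $N-p$ particles. The latter is a tempered distribution on $\mathbb R^{6p}$: its value at $\varphi\in\mathcal S(\mathbb R^{6p})$ is the limit, as $R\to\infty$, of the integral of $W_N^{\Psi_N}(X_N,\Xi_N;t)\,\varphi(X_p,\Xi_p)\,\eta(X_{N-p}/R,\Xi_{N-p}/R)$; this limit exists and is the same for every Schwartz function $\eta$ with $\eta(0)=1$. Put $\epsilon:=\|w\|_\infty t$. Then for every $p\ge1$ there are constants $C_p,K_p>0$ and a Schwartz norm $\|\cdot\|_{k,n}$ (the maximum of $\sup_z|z|^l|D^m\varphi(z)|$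 over $l\le k$, $m\le n$), depending only on $p$, $w$ and $\sigma$, and in particular independent of $\hbar$, $N$, $t$ and $\psi$, such that for all $\hbar>0$, $N\ge p$, $t\ge0$, all normalized $\psi$ and all $\varphi\in\mathcal S(\mathbb R^{6p})$ $$\Bigl|\bigl\langle W_p^{\Psi_N}(t),\varphi\bigr\rangle-\int_{\mathbb R^{6p}}\prod_{j=1}^pW(\psi)(x_j,\xi_j;t)\,\varphi(X_p,\Xi_p)\,dX_p\,d\Xi_p\Bigr|\le\Bigl(\frac{C_p}{N}+K_p\,e^{-1/\sqrt{\epsilon}}\Bigr)\|\varphi\|_{k,n},$$ where $e^{-1/\sqrt\epsilon}$ is read as $0$ for $\epsilon=0$. That is, as tempered distributions and uniformly in $\hbar$, $$W_p^{\Psi_N}=\prod_{j=1}^pW(\psi)(x_j,\xi_j;t)+\frac{C_p}{N}+O\bigl(e^{-1/\sqrt\epsilon}\bigr).$$ -/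

import Mathlib

open MeasureTheory Filter Topology
open scoped FourierTransform SchwartzMap Laplacian ComplexConjugate RealInnerProductSpace ENNReal

noncomputable section

/-- The one-particle position (or momentum) space `ℝ³`. -/
abbrev Space : Type := EuclideanSpace ℝ (Fin 3)

/-- The configuration space `ℝ^{3n}` of `n` particles; the coordinate `(i, a)` is the `a`-th
component of the position of particle `i`. -/
abbrev Config (n : ℕ) : Type := EuclideanSpace ℝ (Fin n × Fin 3)

/-- The phase space `ℝ^{3n} × ℝ^{3n}` of `n` particles. -/
abbrev Phase (n : ℕ) : Type := Config n × Config n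

/-- Complex square-integrable functions on a space of real coordinates. -/
abbrev L2 (ι : Type) [Fintype ι] : Type := Lp ℂ 2 (volume : Measure (EuclideanSpace ℝ ι))

/-- The position of particle `i` in a configuration. -/
def particle {n : ℕ} (X : Config n) (i : Fin n) : Space :=
  WithLp.toLp 2 fun a => X (i, a)

/-- The configuration of `N` particles whose first `p` particles are given by `X` and whose last
`N - p` particles are given by `Y`. -/
def joinConfig {p N : ℕ} (X : Config p) (Y : Config (N - p)) : Config N :=
  WithLp.toLp 2 fun k =>
    if h : k.1.1 < p then X (⟨k.1.1, h⟩, k.2)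
    else Y (⟨k.1.1 - p, by have := k.1.2; omega⟩, k.2)

/-- The analytic class of (real) two-body potentials: `w ∈ L¹` and `e^{σ|s|} ŵ(s) ∈ L¹`, where
`ŵ(s) = ∫ e^{-i⟨s,x⟩} w(x) dx`. Mathlib's Fourier transform uses the frequency `k = s / (2π)`. -/
def MemAnalyticClass (σ : ℝ) (w : Space → ℝ) : Prop :=
  Integrable w ∧
    Integrable fun k : Space =>
      (Real.exp (σ * ‖(2 * Real.pi) • k‖) : ℂ) * 𝓕 (fun x : Space => (w x : ℂ)) k

/-- `‖w‖_∞`, the essential supremum of `|w|`. -/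
def supNorm (w : Space → ℝ) : ℝ := (eLpNorm w ⊤ volume).toReal

/-- The mean-field interaction `N⁻¹ ∑_{i<j} w(x_i - x_j)`. -/
def pairPotential (w : Space → ℝ) (N : ℕ) (X : Config N) : ℝ :=
  (N : ℝ)⁻¹ * ∑ i : Fin N, ∑ j ∈ Finset.Ioi i, w (particle X i - particle X j)

/-- The Hartree potential `w ∗ |ψ|²`. -/
def hartreePotential (w : Space → ℝ) (ψ : L2 (Fin 3)) (x : Space) : ℝ :=
  ∫ y : Space, w (x - y) * ‖ψ y‖ ^ 2

/-- `Ψ` is a solution on `[0, ∞)`, continuous with values in `L²`, of the Schrödinger equation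
`iħ ∂_t Ψ = -(ħ²/2) Δ Ψ + V_t Ψ`, in the sense of distributions in the space variable: for every
Schwartz function `χ` and every `t > 0`,
`iħ (d/dt) ∫ χ Ψ_t = ∫ (-(ħ²/2) Δ χ + V_t χ) Ψ_t`. -/
def IsSchrodingerSolution {ι : Type} [Fintype ι] (ħ : ℝ) (V : ℝ → EuclideanSpace ℝ ι → ℝ)
    (Ψ : ℝ → L2 ι) : Prop :=
  ContinuousOn Ψ (Set.Ici 0) ∧
    ∀ χ : 𝓢(EuclideanSpace ℝ ι, ℂ), ∀ t : ℝ, 0 < t →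
      HasDerivAt (fun s : ℝ => ∫ x, χ x * Ψ s x)
        ((Complex.I * (ħ : ℂ))⁻¹ *
          ∫ x, (-((ħ : ℂ) ^ 2 / 2) * (Δ χ) x + (V t x : ℂ) * χ x) * Ψ t x) t

/-- `Ψ` solves the `N`-body Schrödinger equation with Hamiltonian
`-∑ (ħ²/2) Δ_i + N⁻¹ ∑_{i<j} w(x_i - x_j)`. -/
def IsNBodySolution (ħ : ℝ) (w : Space → ℝ) (N : ℕ) (Ψ : ℝ → L2 (Fin N × Fin 3)) : Prop :=
  IsSchrodingerSolution ħ (fun _ => pairPotential w N) Ψ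

/-- `ψ` solves the Hartree equation `iħ ∂_t ψ = -(ħ²/2) Δ ψ + (w ∗ |ψ|²) ψ`. -/
def IsHartreeSolution (ħ : ℝ) (w : Space → ℝ) (ψ : ℝ → L2 (Fin 3)) : Prop :=
  IsSchrodingerSolution ħ (fun t => hartreePotential w (ψ t)) ψ

/-- `Ψ(x_1, …, x_N) = ψ(x_1) ⋯ ψ(x_N)` almost everywhere. -/
def IsProductState {N : ℕ} (ψ : L2 (Fin 3)) (Ψ : L2 (Fin N × Fin 3)) : Prop :=
  ∀ᵐ X : Config N, Ψ X = ∏ i, ψ (particle X i)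

/-- The Wigner function
`(2π)^{-d} ∫ e^{i⟨y,ξ⟩} Ψ(x + ħy/2) conj(Ψ(x - ħy/2)) dy` on `ℝ^d × ℝ^d`. For `Ψ` in `L²` and
`ħ > 0` the integral converges absolutely for every `(x, ξ)`. -/
def wigner {ι : Type} [Fintype ι] (ħ : ℝ) (Ψ : L2 ι) (x ξ : EuclideanSpace ℝ ι) : ℂ :=
  (((2 * Real.pi) ^ Fintype.card ι : ℝ) : ℂ)⁻¹ *
    ∫ y : EuclideanSpace ℝ ι, Complex.exp (Complex.I * (⟪y, ξ⟫ : ℝ)) *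
      Ψ (x + (ħ / 2) • y) * conj (Ψ (x - (ħ / 2) • y))

/-- `T` is the `p`-particle marginal `∫ F dX_{N-p} dΞ_{N-p}` of a function `F` on the `N`-particle
phase space, as a tempered distribution. Wigner functions are in general not absolutely
integrable, so the integral over the last `N - p` particles is the limit obtained by inserting a
cutoff `η(X_{N-p} / R, Ξ_{N-p} / R)` and letting `R → ∞`; the limit must be the same for all Schwartz
functions `η` with `η(0) = 1`. -/
def IsMarginal {p N : ℕ} (F : Config N → Config N → ℂ) (T : 𝓢'(Phase p, ℂ)) : Prop :=
  ∀ φ : 𝓢(Phase p, ℂ), ∀ η : 𝓢(Phase (N - p), ℂ), η 0 = 1 →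
    Tendsto
      (fun R : ℝ => ∫ q : Phase p × Phase (N - p),
        F (joinConfig q.1.1 q.2.1) (joinConfig q.1.2 q.2.2) * φ q.1 * η (R⁻¹ • q.2))
      atTop (𝓝 (T φ))

/-- `e^{-1/√ε}` for `ε > 0`, extended by its limit `0` at `ε = 0`. -/
def expSmall (ε : ℝ) : ℝ := if ε = 0 then 0 else Real.exp (-1 / Real.sqrt ε)

/-- The `(k, n)`-th Schwartz norm: the maximum of `sup_z |z|^l |D^m φ(z)|` over `l ≤ k`, `m ≤ n`. -/
def schwartzNorm {p : ℕ} (k n : ℕ) (φ : 𝓢(Phase p, ℂ)) : ℝ :=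
  ((Finset.Iic (k, n)).sup (schwartzSeminormFamily ℂ (Phase p) ℂ)) φ

end

/-! The error term tolerates losses in time. Away from ε = 0 the quantity e^{-1/√ε} is bounded
below, and a bound by a constant is trivial: the Fourier transform of the Wigner function of a
normalized Ψ is z ↦ ⟨Ψ, W(z)Ψ⟩ with unitary Weyl operators W(z), hence bounded by 1. Everything
therefore rests on an O(1/N) estimate, uniform in ħ, on a time interval [0, T] whose length depends
only on w. Taking the marginal restricts the characteristic function to the frequencies of the first
p particles, and pairing with φ integrates it against the Fourier transform of φ. The claim thus
becomes propagation of chaos for Weyl operators, ⟨Ψ_t, W_1(z_1)⋯W_p(z_p) Ψ_t⟩ = ∏ ⟨ψ_t, W(z_j) ψ_t⟩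
+ O((1+|z|)²/N), which is `IsManyBodyWeyl.norm_inner_opProd_sub_prod_le`. The quadratic growth in z
is paid for by the Schwartz norm.

The free evolution moves Weyl operators along the classical free flow. In the interaction picture
both equations therefore have bounded generators, built from plane waves with the coefficients a =
ŵ. A further conjugation by the propagator of N independent particles in the Hartree potential
completes the square: up to a scalar the generator becomes (N/2) ∫ a(κ) δ_κ δ_{-κ} dκ divided by iħ,
where δ_κ is the empirical average of the plane wave κ minus its Hartree expectation.

At time zero a centred average applied to the product state has norm O(N^{-1/2}), by orthogonality,
and its expectation vanishes. Later growth comes only from commutators with the generator. Operators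
of different particles commute, which gains 1/N, and a plane wave commutes with a one-body
observable up to O(ħ); the two gains compensate the prefactor N/ħ. Hence the norm stays O(N^{-1/2})
(`IsMeanFieldFlow.norm_waveFluct_state_le`). In the derivative of the expectation every term is a
product of two fluctuations, a term of order 1/N, or the same kind of expectation again, so the
expectation stays O(1/N) (`IsMeanFieldFlow.norm_inner_fluct_le`). Permutation symmetry then replaces
the operator of one particle by the empirical average, and the factorization follows by induction on
the number of factors.

Uniformity in ħ requires that first and second phase-space differences of Heisenberg-evolved Weyl
operators be O(ħ) and O(ħ²). These bounds are propagated in time with the help of |1 -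
e^{iħσ(z,z')}| ≤ 2ħ|z||z'|. Each of the resulting inequalities bounds a supremum over all
frequencies and times by data plus at most half of itself, provided T·Λ ≤ 1/8 with Λ the fourth
weighted moment of a. They are closed by the bootstrap `le_of_forall_improve`. The exponential decay
of ŵ guarantees that Λ is finite. -/

set_option linter.unusedSectionVars false

noncomputable section

/-! ### Bootstrap and differential inequalities in Hilbert space -/

section Analysis

variable {H K : Type*} [NormedAddCommGroup H] [InnerProductSpace ℂ H]
  [NormedAddCommGroup K] [InnerProductSpace ℂ K]

/-- If every admissible constant `M` can be improved to `c + M / 2`, then `2 * c` is admissible. -/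
theorem le_of_forall_improve {α : Type*} {n g : α → ℝ} {c M : ℝ} (hc : 0 ≤ c) (hM0 : 0 ≤ M)
    (hM : ∀ i, n i ≤ M * g i)
    (step : ∀ M, 0 ≤ M → (∀ i, n i ≤ M * g i) → ∀ i, n i ≤ (c + M / 2) * g i) (i : α) :
    n i ≤ 2 * c * g i := by
  -- The map M ↦ c + M/2 has the fixed point 2c; its j-th iterate is 2c + (M - 2c)/2^j, so the
  -- starting constant disappears in the limit.
  have key : ∀ j : ℕ, 0 ≤ 2 * c + (M - 2 * c) * (1 / 2) ^ j ∧
      ∀ i, n i ≤ (2 * c + (M - 2 * c) * (1 / 2) ^ j) * g i := by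
    intro j
    induction j with
    | zero => exact ⟨by simpa using hM0, fun i => by simpa using hM i⟩
    | succ j ih =>
      have e : 2 * c + (M - 2 * c) * (1 / 2) ^ (j + 1)
          = c + (2 * c + (M - 2 * c) * (1 / 2) ^ j) / 2 := by ring
      rw [e]
      exact ⟨by linarith [ih.1], fun i => step _ ih.1 ih.2 i⟩
  have lim : Tendsto (fun j : ℕ => (2 * c + (M - 2 * c) * (1 / 2) ^ j) * g i) atTop
      (𝓝 ((2 * c + (M - 2 * c) * 0) * g i)) := by
    have h := tendsto_pow_atTop_nhds_zero_of_lt_one (r := (1 / 2 : ℝ)) (by norm_num) (by norm_num)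
    exact ((h.const_mul _).const_add _).mul_const _
  have := ge_of_tendsto' lim (fun j => (key j).2 i)
  simpa using this

/-- A strongly differentiable, uniformly bounded family of operators applied to a differentiable
family of vectors. -/
theorem hasDerivAt_strong_apply {A : ℝ → H →L[ℂ] K} {C : ℝ} (hA : ∀ s x, ‖A s x‖ ≤ C * ‖x‖)
    {y : ℝ → H} {y' : H} {d : K} {s : ℝ} (hy : HasDerivAt y y' s)
    (hd : HasDerivAt (fun r => A r (y s)) d s) (hc : ContinuousAt (fun r => A r y') s) :
    HasDerivAt (fun r => A r (y r)) (d + A s y') s := by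
  -- Only strong, not norm, differentiability of A is available. The uniform bound controls A r on
  -- the remainder of y, and strong continuity is needed on the single vector y'.
  have e : (fun r => A r (y r)) = fun r => A r (y s) + A r (y r - y s) := by
    funext r; rw [← map_add]; simp
  rw [e]
  refine hd.add ?_
  rw [hasDerivAt_iff_isLittleO]
  have h1 : (fun r => A r (y r - y s - (r - s) • y')) =o[𝓝 s] fun r => r - s := by
    have := hasDerivAt_iff_isLittleO.1 hy
    refine Asymptotics.IsBigO.trans_isLittleO ?_ this
    exact Asymptotics.IsBigO.of_bound C (Eventually.of_forall fun r => hA r _)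
  have h2 : (fun r => (r - s) • (A r y' - A s y')) =o[𝓝 s] fun r => r - s := by
    have h3 : (fun r => A r y' - A s y') =o[𝓝 s] fun _ => (1 : ℝ) := by
      rw [Asymptotics.isLittleO_one_iff]
      simpa using hc.tendsto.sub_const (A s y')
    have := (Asymptotics.isBigO_refl (fun r => r - s) (𝓝 s)).smul_isLittleO h3
    simpa using this
  refine (h1.add h2).congr_left fun r => ?_
  have : A r ((r - s) • y') = (r - s) • A r y' := by
    rw [← Complex.coe_smul, map_smul, Complex.coe_smul]
  simp only [map_sub, this, smul_sub, sub_self, map_zero, sub_zero]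
  abel

/-- Growth of the norm of a curve, controlled by the radial part of its velocity. -/
theorem norm_le_add_mul_of_re_inner_le {v v' : ℝ → H} {t G : ℝ} (ht : 0 ≤ t) (hG : 0 ≤ G)
    (hc : ContinuousOn v (Set.Icc 0 t)) (hv : ∀ s ∈ Set.Ioo 0 t, HasDerivAt v (v' s) s)
    (hb : ∀ s ∈ Set.Ioo 0 t, (inner ℂ (v s) (v' s)).re ≤ ‖v s‖ * G) :
    ‖v t‖ ≤ ‖v 0‖ + t * G := by
  -- The norm is not differentiable at zero, so √(‖v‖² + ε) is differentiated instead and ε tends to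
  -- 0 at the end.
  have key : ∀ ε : ℝ, 0 < ε → Real.sqrt (‖v t‖ ^ 2 + ε) ≤ Real.sqrt (‖v 0‖ ^ 2 + ε) + t * G := by
    intro ε hε
    have hpos : ∀ s, 0 < ‖v s‖ ^ 2 + ε := fun s => by positivity
    have hcont : ContinuousOn (fun s => Real.sqrt (‖v s‖ ^ 2 + ε) - s * G) (Set.Icc 0 t) :=
      ((hc.norm.pow 2).add_const ε).sqrt.sub (continuousOn_id.mul_const G)
    have hder : ∀ s ∈ interior (Set.Icc 0 t),
        HasDerivWithinAt (fun s => Real.sqrt (‖v s‖ ^ 2 + ε) - s * G)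
          ((2 * (inner ℂ (v s) (v' s)).re) / (2 * Real.sqrt (‖v s‖ ^ 2 + ε)) - G)
          (interior (Set.Icc 0 t)) s := by
      intro s hs
      rw [interior_Icc] at hs
      have h1 := hv s hs
      have h2 : HasDerivAt (fun s => ‖v s‖ ^ 2) (2 * (inner ℂ (v s) (v' s)).re) s := by
        let _ : InnerProductSpace ℝ H := InnerProductSpace.rclikeToReal ℂ H
        have := h1.norm_sq
        exact this
      have h3 := (h2.add_const ε).sqrt (hpos s).ne'
      have h4 := h3.sub ((hasDerivAt_id s).mul_const G)
      rw [interior_Icc]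
      exact (h4.congr_deriv (by simp)).hasDerivWithinAt
    have hanti : AntitoneOn (fun s => Real.sqrt (‖v s‖ ^ 2 + ε) - s * G) (Set.Icc 0 t) := by
      refine antitoneOn_of_hasDerivWithinAt_nonpos (convex_Icc 0 t) hcont hder ?_
      intro s hs
      rw [interior_Icc] at hs
      have hsq : 0 < Real.sqrt (‖v s‖ ^ 2 + ε) := Real.sqrt_pos.2 (hpos s)
      have hle : ‖v s‖ ≤ Real.sqrt (‖v s‖ ^ 2 + ε) := Real.le_sqrt_of_sq_le (by linarith)
      rw [sub_nonpos, div_le_iff₀ (by positivity)]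
      nlinarith [hb s hs, mul_le_mul_of_nonneg_right hle hG]
    have := hanti (Set.left_mem_Icc.2 ht) (Set.right_mem_Icc.2 ht) ht
    simp only [zero_mul, sub_zero] at this
    linarith
  have lim1 : Tendsto (fun ε : ℝ => Real.sqrt (‖v t‖ ^ 2 + ε)) (𝓝[>] 0)
      (𝓝 (Real.sqrt (‖v t‖ ^ 2 + 0))) :=
    ((continuous_const.add continuous_id).sqrt.tendsto 0).mono_left nhdsWithin_le_nhds
  have lim2 : Tendsto (fun ε : ℝ => Real.sqrt (‖v 0‖ ^ 2 + ε) + t * G) (𝓝[>] 0)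
      (𝓝 (Real.sqrt (‖v 0‖ ^ 2 + 0) + t * G)) :=
    (((continuous_const.add continuous_id).sqrt.add_const _).tendsto 0).mono_left nhdsWithin_le_nhds
  have := le_of_tendsto_of_tendsto lim1 lim2
    (eventually_nhdsWithin_of_forall fun ε hε => key ε hε)
  simpa [Real.sqrt_sq] using this

/-- The norm is conserved along curves whose velocity is orthogonal to the position. -/
theorem norm_eq_of_re_inner_eq_zero {v v' : ℝ → H} (hv : ∀ s, HasDerivAt v (v' s) s)
    (hb : ∀ s, (inner ℂ (v s) (v' s)).re = 0) (s t : ℝ) : ‖v s‖ = ‖v t‖ := by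
  have h2 : ∀ s, HasDerivAt (fun s => ‖v s‖ ^ 2) 0 s := by
    intro s
    let _ : InnerProductSpace ℝ H := InnerProductSpace.rclikeToReal ℂ H
    have := (hv s).norm_sq
    have e : inner ℝ (v s) (v' s) = 0 := hb s
    simpa [e] using this
  have := is_const_of_deriv_eq_zero (fun s => (h2 s).differentiableAt) (fun s => (h2 s).deriv) s t
  exact (sq_eq_sq₀ (norm_nonneg _) (norm_nonneg _)).1 this

end Analysis

/-! ### Unitary propagators of bounded, strongly continuous skew generators -/

section Propagator

variable {H : Type*} [NormedAddCommGroup H] [InnerProductSpace ℂ H]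

/-- Composing a linear vector field with this retraction makes it globally bounded, so that
Picard–Lindelöf applies on intervals of any length. -/
theorem lipschitzWith_unitBall_retraction :
    LipschitzWith 2 (fun x : H => (max 1 ‖x‖)⁻¹ • x) := by
  refine LipschitzWith.of_dist_le_mul fun x y => ?_
  rw [dist_eq_norm, dist_eq_norm]
  have hx : 0 < max 1 ‖x‖ := lt_max_of_lt_left one_pos
  have hy : 0 < max 1 ‖y‖ := lt_max_of_lt_left one_pos
  have e : (max 1 ‖x‖)⁻¹ • x - (max 1 ‖y‖)⁻¹ • y
      = (max 1 ‖x‖)⁻¹ • (x - y) + ((max 1 ‖x‖)⁻¹ * (max 1 ‖y‖ - max 1 ‖x‖) * (max 1 ‖y‖)⁻¹) • y := by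
    have : (max 1 ‖x‖)⁻¹ * (max 1 ‖y‖ - max 1 ‖x‖) * (max 1 ‖y‖)⁻¹
        = (max 1 ‖x‖)⁻¹ - (max 1 ‖y‖)⁻¹ := by field_simp
    rw [this, sub_smul, smul_sub]; abel
  have h1 : (max 1 ‖x‖)⁻¹ ≤ 1 := inv_le_one_of_one_le₀ (le_max_left _ _)
  have h2 : (max 1 ‖y‖)⁻¹ * ‖y‖ ≤ 1 := by
    rw [inv_mul_le_iff₀ hy]; simp
  have h3 : |max 1 ‖y‖ - max 1 ‖x‖| ≤ ‖x - y‖ := by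
    have := abs_max_sub_max_le_max 1 ‖y‖ 1 ‖x‖
    simp only [sub_self, abs_zero] at this
    refine this.trans (max_le (norm_nonneg _) ?_)
    rw [norm_sub_rev]; exact abs_norm_sub_norm_le y x
  rw [e]
  refine (norm_add_le _ _).trans ?_
  rw [norm_smul, norm_smul, norm_mul, norm_mul, Real.norm_eq_abs, Real.norm_eq_abs, Real.norm_eq_abs,
    abs_of_pos (inv_pos.2 hx), abs_of_pos (inv_pos.2 hy)]
  have h4 : (max 1 ‖x‖)⁻¹ * ‖x - y‖ ≤ 1 * ‖x - y‖ := by gcongr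
  have h5 : (max 1 ‖x‖)⁻¹ * |max 1 ‖y‖ - max 1 ‖x‖| * (max 1 ‖y‖)⁻¹ * ‖y‖ ≤ 1 * ‖x - y‖ * 1 := by
    rw [mul_assoc ((max 1 ‖x‖)⁻¹ * _)]
    gcongr
  push_cast
  linarith

variable [CompleteSpace H] {A : ℝ → H →L[ℂ] H} {C : ℝ}

/-- Picard–Lindelöf needs continuity in time only at fixed points, so strong continuity of A
suffices. For the retracted field the velocity is at most C and a solution exists on the whole
interval. Skewness conserves its norm, so it never leaves the unit ball and the retraction is never
active. -/
theorem exists_hasDerivAt_of_skew_on (hC : ∀ s, ‖A s‖ ≤ C)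
    (hcont : ∀ x, Continuous fun s => A s x) (hskew : ∀ s x, (inner ℂ x (A s x)).re = 0)
    (t₀ : ℝ) (R : ℝ) (hR : 0 < R) (x₀ : H) (hx₀ : ‖x₀‖ ≤ 1) :
    ∃ x : ℝ → H, x t₀ = x₀ ∧ ∀ s ∈ Set.Ioo (t₀ - R) (t₀ + R), HasDerivAt x (A s (x s)) s := by
  have hC0 : 0 ≤ C := (norm_nonneg _).trans (hC 0)
  set ret : H → H := fun x => (max 1 ‖x‖)⁻¹ • x with hret
  have hret1 : ∀ x, ‖ret x‖ ≤ 1 := by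
    intro x
    have hx : 0 < max 1 ‖x‖ := lt_max_of_lt_left one_pos
    rw [hret]
    simp only [norm_smul, norm_inv, Real.norm_eq_abs, abs_of_pos hx]
    rw [inv_mul_le_iff₀ hx]; simp
  let t₀' : Set.Icc (t₀ - R) (t₀ + R) := ⟨t₀, by constructor <;> linarith⟩
  have hPL : IsPicardLindelof (fun s x => A s (ret x)) t₀' x₀
      (C * R).toNNReal 0 C.toNNReal (C.toNNReal * 2) := by
    constructor
    · intro t _
      refine LipschitzWith.lipschitzOnWith ?_
      refine LipschitzWith.comp ?_ lipschitzWith_unitBall_retraction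
      refine (A t).lipschitz.weaken ?_
      rw [← NNReal.coe_le_coe, Real.coe_toNNReal _ hC0]; exact hC t
    · intro x _; exact (hcont _).continuousOn
    · intro t _ x _
      rw [Real.coe_toNNReal _ hC0]
      calc ‖A t (ret x)‖ ≤ ‖A t‖ * ‖ret x‖ := (A t).le_opNorm _
        _ ≤ C * 1 := by gcongr; exacts [hC t, hret1 x]
        _ = C := mul_one C
    · simp only [t₀', NNReal.coe_zero, sub_zero]
      rw [Real.coe_toNNReal _ hC0, Real.coe_toNNReal _ (by positivity)]
      have : max (t₀ + R - t₀) (t₀ - (t₀ - R)) = R := by simp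
      rw [this]
  obtain ⟨x, hx0, hx⟩ := hPL.exists_eq_forall_mem_Icc_hasDerivWithinAt₀
  have hx' : ∀ s ∈ Set.Ioo (t₀ - R) (t₀ + R), HasDerivAt x (A s (ret (x s))) s :=
    fun s hs => (hx s (Set.Ioo_subset_Icc_self hs)).hasDerivAt (Icc_mem_nhds hs.1 hs.2)
  have hnorm : ∀ s ∈ Set.Ioo (t₀ - R) (t₀ + R), ‖x s‖ ≤ 1 := by
    intro s hs
    have h2 : ∀ s ∈ Set.Ioo (t₀ - R) (t₀ + R), HasDerivAt (fun s => ‖x s‖ ^ 2) 0 s := by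
      intro s hs
      let _ : InnerProductSpace ℝ H := InnerProductSpace.rclikeToReal ℂ H
      have := (hx' s hs).norm_sq
      have e : inner ℝ (x s) (A s (ret (x s))) = 0 := by
        have e1 : A s (ret (x s)) = (((max 1 ‖x s‖)⁻¹ : ℝ) : ℂ) • A s (x s) := by
          rw [← map_smul, Complex.coe_smul]
        change (inner ℂ (x s) (A s (ret (x s)))).re = 0
        rw [e1, inner_smul_right, Complex.re_ofReal_mul, hskew, mul_zero]
      simpa [e] using this
    have h3 := isOpen_Ioo.is_const_of_deriv_eq_zero (isPreconnected_Ioo)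
      (fun s hs => (h2 s hs).differentiableAt.differentiableWithinAt)
      (fun s hs => (h2 s hs).deriv) hs (y := t₀) (by constructor <;> linarith)
    have h4 : ‖x s‖ = ‖x t₀‖ := (sq_eq_sq₀ (norm_nonneg _) (norm_nonneg _)).1 h3
    rw [h4, hx0]; exact hx₀
  refine ⟨x, hx0, fun s hs => ?_⟩
  have := hx' s hs
  have e : ret (x s) = x s := by simp [hret, max_eq_left (hnorm s hs)]
  rwa [e] at this

/-- Solutions on growing intervals are glued by uniqueness, after scaling the initial vector into
the unit ball. -/
theorem exists_hasDerivAt_of_skew (hC : ∀ s, ‖A s‖ ≤ C)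
    (hcont : ∀ x, Continuous fun s => A s x) (hskew : ∀ s x, (inner ℂ x (A s x)).re = 0)
    (t₀ : ℝ) (x₀ : H) :
    ∃ x : ℝ → H, x t₀ = x₀ ∧ ∀ s, HasDerivAt x (A s (x s)) s := by
  have unit : ∀ x₀ : H, ‖x₀‖ ≤ 1 →
      ∃ x : ℝ → H, x t₀ = x₀ ∧ ∀ s, HasDerivAt x (A s (x s)) s := by
    intro x₀ hx₀
    choose! X hX0 hX using fun (R : ℝ) (hR : 0 < R) =>
      exists_hasDerivAt_of_skew_on hC hcont hskew t₀ R hR x₀ hx₀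
    have hC0 : 0 ≤ C := (norm_nonneg _).trans (hC 0)
    have agree : ∀ R R' : ℝ, 0 < R → R ≤ R' → ∀ s ∈ Set.Ioo (t₀ - R) (t₀ + R), X R s = X R' s := by
      intro R R' hR hRR s hs
      refine ODE_solution_unique_of_mem_Ioo (v := fun s x => A s x) (s := fun _ => Set.univ)
        (K := C.toNNReal) (t₀ := t₀) (a := t₀ - R) (b := t₀ + R) (fun t _ => ?_) ?_
        (fun t ht => ⟨hX R hR t ht, Set.mem_univ _⟩)
        (fun t ht => ⟨hX R' (hR.trans_le hRR) t ?_, Set.mem_univ _⟩) ?_ hs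
      · refine LipschitzWith.lipschitzOnWith ((A t).lipschitz.weaken ?_)
        rw [← NNReal.coe_le_coe, Real.coe_toNNReal _ hC0]; exact hC t
      · constructor <;> linarith
      · exact ⟨by linarith [ht.1], by linarith [ht.2]⟩
      · rw [hX0 R hR, hX0 R' (hR.trans_le hRR)]
    -- The radius varies with s; near a given s all the solutions used agree with the one of radius
    -- |s - t₀| + 2, which is therefore the one to differentiate.
    refine ⟨fun s => X (|s - t₀| + 1) s, ?_, fun s => ?_⟩
    · exact hX0 _ (by positivity)
    · have hR : 0 < |s - t₀| + 2 := by positivity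
      have hs : s ∈ Set.Ioo (t₀ - (|s - t₀| + 2)) (t₀ + (|s - t₀| + 2)) := by
        constructor <;> [linarith [neg_abs_le (s - t₀)]; linarith [le_abs_self (s - t₀)]]
      have ev : (fun r => X (|r - t₀| + 1) r) =ᶠ[𝓝 s] X (|s - t₀| + 2) := by
        have : ∀ᶠ r in 𝓝 s, |r - t₀| < |s - t₀| + 1 :=
          ((continuous_id.sub continuous_const).abs.tendsto s).eventually_lt_const (by simp)
        filter_upwards [this] with r hr
        refine agree _ _ (by positivity) (by linarith) r ?_
        constructor <;> [linarith [neg_abs_le (r - t₀)]; linarith [le_abs_self (r - t₀)]]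
      have := (hX _ hR s hs).congr_of_eventuallyEq ev
      rwa [← ev.self_of_nhds] at this
  obtain ⟨x, hx0, hx⟩ := unit (((‖x₀‖ + 1)⁻¹ : ℝ) • x₀) (by
    rw [norm_smul, norm_inv, Real.norm_eq_abs, abs_of_pos (by positivity),
      inv_mul_le_iff₀ (by positivity)]
    linarith)
  refine ⟨fun s => (‖x₀‖ + 1 : ℝ) • x s, ?_, fun s => ?_⟩
  · have : (‖x₀‖ + 1 : ℝ) ≠ 0 := by positivity
    simp [hx0, smul_smul, this]
  · refine ((hx s).fun_const_smul (‖x₀‖ + 1 : ℝ)).congr_deriv ?_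
    change _ = A s ((‖x₀‖ + 1 : ℝ) • x s)
    rw [← Complex.coe_smul, ← Complex.coe_smul, map_smul]

/-- The unitary propagator generated by a strongly continuous, bounded, skew family. -/
theorem exists_unitary_propagator (hC : ∀ s, ‖A s‖ ≤ C)
    (hcont : ∀ x, Continuous fun s => A s x) (hskew : ∀ s x, (inner ℂ x (A s x)).re = 0) :
    ∃ U : ℝ → H ≃ₗᵢ[ℂ] H, (∀ x, U 0 x = x) ∧
      (∀ s x, HasDerivAt (fun r => U r x) (A s (U s x)) s) ∧
      ∀ s x, HasDerivAt (fun r => (U r).symm x) (-(U s).symm (A s x)) s := by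
  have uniq : ∀ {x y : ℝ → H}, (∀ s, HasDerivAt x (A s (x s)) s) →
      (∀ s, HasDerivAt y (A s (y s)) s) → ∀ t, x t = y t → x = y := by
    intro x y hx hy t h
    funext s
    have := norm_eq_of_re_inner_eq_zero (v := fun s => x s - y s)
      (v' := fun s => A s (x s - y s)) (fun s => ((hx s).fun_sub (hy s)).congr_deriv (by simp))
      (fun s => hskew s _) s t
    simpa [h, sub_eq_zero] using this
  choose X hX0 hX using fun x₀ : H => exists_hasDerivAt_of_skew hC hcont hskew 0 x₀
  have hnorm : ∀ x s, ‖X x s‖ = ‖x‖ := fun x s => by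
    rw [norm_eq_of_re_inner_eq_zero (hX x) (fun s => hskew s _) s 0, hX0]
  let L : ℝ → H →ₗᵢ[ℂ] H := fun s =>
    { toFun := fun x => X x s
      map_add' := fun x y => by
        have := uniq (hX (x + y)) (y := fun s => X x s + X y s)
          (fun s => ((hX x s).fun_add (hX y s)).congr_deriv (by simp)) 0 (by simp [hX0])
        exact congrFun this s
      map_smul' := fun c x => by
        have := uniq (hX (c • x)) (y := fun s => c • X x s)
          (fun s => ((hX x s).fun_const_smul c).congr_deriv (by simp)) 0 (by simp [hX0])
        exact congrFun this s
      norm_map' := fun x => hnorm x s }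
  -- A preimage of y is the value at time 0 of the solution that passes through y at time s.
  have hsurj : ∀ s, Function.Surjective (L s) := by
    intro s y
    obtain ⟨z, hz0, hz⟩ := exists_hasDerivAt_of_skew hC hcont hskew s y
    refine ⟨z 0, ?_⟩
    have := uniq (hX (z 0)) hz 0 (hX0 _)
    exact (congrFun this s).trans hz0
  let U : ℝ → H ≃ₗᵢ[ℂ] H := fun s => LinearIsometryEquiv.ofSurjective (L s) (hsurj s)
  have hU : ∀ s x, HasDerivAt (fun r => U r x) (A s (U s x)) s := fun s x => hX x s
  refine ⟨U, hX0, hU, fun s x => ?_⟩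
  have hsymm : ∀ y, ContinuousAt (fun r => (U r).symm y) s := by
    intro y
    rw [ContinuousAt, tendsto_iff_norm_sub_tendsto_zero]
    have h1 : ∀ r, ‖(U r).symm y - (U s).symm y‖ = ‖y - U r ((U s).symm y)‖ := by
      intro r
      rw [← (U r).norm_map ((U r).symm y - (U s).symm y), map_sub, LinearIsometryEquiv.apply_symm_apply]
    simp only [h1]
    have h2 := ((hU s ((U s).symm y)).continuousAt.tendsto.const_sub y).norm
    simpa using h2
  -- In U_r⁻¹ x = U_s⁻¹ x + U_r⁻¹(x - U_r U_s⁻¹ x) the argument of the last term vanishes at r = s.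
  -- Only its velocity matters, and strong continuity of the inverses is enough.
  have hy : HasDerivAt (fun r => x - U r ((U s).symm x)) (-(A s x)) s := by
    have := (hU s ((U s).symm x)).const_sub x
    rwa [LinearIsometryEquiv.apply_symm_apply] at this
  have := hasDerivAt_strong_apply (A := fun r => ((U r).symm : H →L[ℂ] H)) (C := 1)
    (fun r y => by simp) hy (d := 0) (by simpa using hasDerivAt_const s (0 : H)) (hsymm _)
  have e : (fun r => (U r).symm x) = fun r => (U s).symm x + (U r).symm (x - U r ((U s).symm x)) := by
    funext r; simp
  rw [e]
  have h2 := this.const_add ((U s).symm x)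
  refine h2.congr_deriv ?_
  simp

end Propagator

/-! ### Weyl relations and symplectic phases -/

section WeylSystems

/-- The symplectic form on the one-particle phase space, in the variables `(k, y)` dual to
`(x, ξ)`. -/
def symp (z z' : Space × Space) : ℝ := inner ℝ z.2 z'.1 - inner ℝ z.1 z'.2

/-- The phase-space frequency at time `s` of the freely evolved plane wave `e^{2πi⟨κ, x⟩}`. -/
def planeWave (s : ℝ) (κ : Space) : Space × Space :=
  ((2 * Real.pi) • κ, (s * (2 * Real.pi)) • κ)

/-- An upper bound for `‖planeWave s κ‖`, `0 ≤ s ≤ T`. -/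
def waveBound (T : ℝ) (κ : Space) : ℝ := 2 * Real.pi * (1 + T) * ‖κ‖

/-- The moment of the coefficient `a` controlling all error terms up to time `T`. -/
def couplingMoment (a : Space → ℂ) (T : ℝ) : ℝ := ∫ κ, ‖a κ‖ * (1 + waveBound T κ) ^ 4

theorem abs_symp_le (z z' : Space × Space) : |symp z z'| ≤ 2 * ‖z‖ * ‖z'‖ := by
  have h1 : |inner ℝ z.2 z'.1| ≤ ‖z‖ * ‖z'‖ :=
    (abs_real_inner_le_norm _ _).trans (mul_le_mul (norm_snd_le z) (norm_fst_le z')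
      (norm_nonneg _) (norm_nonneg _))
  have h2 : |inner ℝ z.1 z'.2| ≤ ‖z‖ * ‖z'‖ :=
    (abs_real_inner_le_norm _ _).trans (mul_le_mul (norm_fst_le z) (norm_snd_le z')
      (norm_nonneg _) (norm_nonneg _))
  calc |symp z z'| ≤ |inner ℝ z.2 z'.1| + |inner ℝ z.1 z'.2| := abs_sub _ _
    _ ≤ _ := by linarith

theorem symp_neg_right (z z' : Space × Space) : symp z (-z') = -symp z z' := by
  simp [symp, inner_neg_right]; ring

theorem symp_neg_left (z z' : Space × Space) : symp (-z) z' = -symp z z' := by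
  simp [symp, inner_neg_left]; ring

theorem symp_swap (z z' : Space × Space) : symp z' z = -symp z z' := by
  simp only [symp, real_inner_comm z.1, real_inner_comm z.2]; ring

theorem symp_self (z : Space × Space) : symp z z = 0 := by
  simp only [symp, real_inner_comm z.1]; ring

theorem symp_add_right (z z₁ z₂ : Space × Space) : symp z (z₁ + z₂) = symp z z₁ + symp z z₂ := by
  simp [symp, inner_add_right]; ring

theorem continuous_planeWave : Continuous fun q : ℝ × Space => planeWave q.1 q.2 := by
  unfold planeWave; fun_prop

theorem planeWave_neg (s : ℝ) (κ : Space) : planeWave s (-κ) = -planeWave s κ := by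
  simp [planeWave]

theorem waveBound_nonneg {T : ℝ} (hT : 0 ≤ T) (κ : Space) : 0 ≤ waveBound T κ := by
  unfold waveBound; positivity

theorem waveBound_neg (T : ℝ) (κ : Space) : waveBound T (-κ) = waveBound T κ := by
  simp [waveBound]

theorem norm_planeWave_le {T s : ℝ} (hs : s ∈ Set.Icc 0 T) (κ : Space) :
    ‖planeWave s κ‖ ≤ waveBound T κ := by
  have hT : 0 ≤ T := hs.1.trans hs.2
  have hpi := Real.pi_pos
  rw [Prod.norm_def, max_le_iff]
  simp only [planeWave, waveBound, norm_smul, norm_mul, Real.norm_eq_abs, abs_of_pos hpi,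
    abs_of_nonneg hs.1, abs_of_pos (two_pos : (0 : ℝ) < 2)]
  constructor
  · gcongr ?_ * _; nlinarith
  · gcongr ?_ * _; nlinarith [hs.2]

/-- The phase `e^{iħ σ(z, z')}`. -/
def sympPhase (ħ : ℝ) (z z' : Space × Space) : ℂ := Complex.exp (Complex.I * (ħ * symp z z' : ℝ))

theorem norm_sympPhase (ħ : ℝ) (z z' : Space × Space) : ‖sympPhase ħ z z'‖ = 1 := by
  rw [sympPhase, mul_comm, Complex.norm_exp_ofReal_mul_I]

/-- This factor ħ cancels the 1/ħ in the Heisenberg equation; it is the source of the uniformity in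
ħ. -/
theorem norm_one_sub_sympPhase_le {ħ : ℝ} (hħ : 0 ≤ ħ) (z z' : Space × Space) :
    ‖1 - sympPhase ħ z z'‖ ≤ 2 * ħ * ‖z‖ * ‖z'‖ := by
  rw [norm_sub_rev, sympPhase]
  refine (Real.norm_exp_I_mul_ofReal_sub_one_le).trans ?_
  rw [norm_mul, Real.norm_of_nonneg hħ, Real.norm_eq_abs]
  nlinarith [mul_le_mul_of_nonneg_left (abs_symp_le z z') hħ]

theorem norm_one_sub_sympPhase_le_two (ħ : ℝ) (z z' : Space × Space) :
    ‖1 - sympPhase ħ z z'‖ ≤ 2 := by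
  refine (norm_sub_le _ _).trans ?_
  rw [norm_sympPhase, norm_one]; norm_num

theorem sympPhase_neg_right (ħ : ℝ) (z z' : Space × Space) :
    sympPhase ħ z (-z') * sympPhase ħ z z' = 1 := by
  rw [sympPhase, sympPhase, ← Complex.exp_add, symp_neg_right, ← mul_add, ← Complex.ofReal_add]
  simp

theorem sympPhase_add_right (ħ : ℝ) (z z₁ z₂ : Space × Space) :
    sympPhase ħ z (z₁ + z₂) = sympPhase ħ z z₁ * sympPhase ħ z z₂ := by
  rw [sympPhase, sympPhase, sympPhase, ← Complex.exp_add, symp_add_right, ← mul_add,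
    ← Complex.ofReal_add, mul_add]

/-- A strongly continuous projective unitary representation of the phase-space translations, with
the Weyl form of the canonical commutation relations. -/
structure IsWeylSystem {H : Type*} [NormedAddCommGroup H] [InnerProductSpace ℂ H] (ħ : ℝ)
    (W : Space × Space → H →L[ℂ] H) : Prop where
  norm_map : ∀ z x, ‖W z x‖ = ‖x‖
  map_zero : ∀ x, W 0 x = x
  map_map : ∀ z z' x,
    W z (W z' x) = Complex.exp (Complex.I * (ħ * symp z z' / 2 : ℝ)) • W (z + z') x
  strong_continuous : ∀ x, Continuous fun z => W z x

namespace IsWeylSystem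

variable {H : Type*} [NormedAddCommGroup H] [InnerProductSpace ℂ H] {ħ : ℝ}
  {W : Space × Space → H →L[ℂ] H}

theorem map_neg_map (hW : IsWeylSystem ħ W) (z : Space × Space) (x : H) : W (-z) (W z x) = x := by
  rw [hW.map_map, symp_neg_left, symp_self]; simp [hW.map_zero]

theorem map_map_neg (hW : IsWeylSystem ħ W) (z : Space × Space) (x : H) : W z (W (-z) x) = x := by
  rw [hW.map_map, symp_neg_right, symp_self]; simp [hW.map_zero]

theorem comm (hW : IsWeylSystem ħ W) (z z' : Space × Space) (x : H) :
    W z (W z' x) = sympPhase ħ z z' • W z' (W z x) := by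
  rw [hW.map_map, hW.map_map, smul_smul, add_comm z' z, sympPhase, ← Complex.exp_add, symp_swap z z']
  congr 2
  push_cast; ring

theorem inner_map_left (hW : IsWeylSystem ħ W) (z : Space × Space) (x y : H) :
    inner ℂ (W z x) y = inner ℂ x (W (-z) y) := by
  let L : H →ₗᵢ[ℂ] H := ⟨(W z).toLinearMap, hW.norm_map z⟩
  have := L.inner_map_map x (W (-z) y)
  rw [← this]
  change _ = inner ℂ (W z x) (W z (W (-z) y))
  rw [hW.map_map_neg]

theorem opNorm_le (hW : IsWeylSystem ħ W) (z : Space × Space) : ‖W z‖ ≤ 1 :=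
  ContinuousLinearMap.opNorm_le_bound _ zero_le_one fun x => by rw [hW.norm_map, one_mul]

end IsWeylSystem

end WeylSystems

/-! ### Weyl operators evolved in a common potential -/

section HeisenbergFlows

/-- `a` is a coupling function with enough moments up to time `T`. -/
structure HasCouplingMoment (a : Space → ℂ) (T : ℝ) : Prop where
  measurable : AEStronglyMeasurable a volume
  integrable : Integrable fun κ => ‖a κ‖ * (1 + waveBound T κ) ^ 4

theorem HasCouplingMoment.norm_integral_le {E : Type*} [NormedAddCommGroup E] [NormedSpace ℝ E]
    {a : Space → ℂ} {T : ℝ} (ha : HasCouplingMoment a T) {F : Space → E} {c : ℝ}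
    (hF : ∀ κ, ‖F κ‖ ≤ ‖a κ‖ * (c * (1 + waveBound T κ) ^ 4)) :
    ‖∫ κ, F κ‖ ≤ c * couplingMoment a T := by
  rw [couplingMoment, ← integral_const_mul]
  refine norm_integral_le_of_norm_le (ha.integrable.const_mul c) (Eventually.of_forall fun κ => ?_)
  refine (hF κ).trans (le_of_eq (by ring))

theorem HasCouplingMoment.integrable_norm {a : Space → ℂ} {T : ℝ} (hT : 0 ≤ T)
    (ha : HasCouplingMoment a T) : Integrable fun κ => ‖a κ‖ := by
  refine ha.integrable.mono ha.measurable.norm (Eventually.of_forall fun κ => ?_)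
  have h := waveBound_nonneg hT κ
  rw [Real.norm_of_nonneg (norm_nonneg _), Real.norm_of_nonneg (by positivity)]
  exact le_mul_of_one_le_right (norm_nonneg _) (one_le_pow₀ (by linarith))

theorem couplingMoment_nonneg (a : Space → ℂ) {T : ℝ} (hT : 0 ≤ T) : 0 ≤ couplingMoment a T :=
  integral_nonneg fun κ => by have := waveBound_nonneg hT κ; positivity

/-- A time-dependent coefficient dominated by the coupling function `a`. -/
structure IsCoupling (a : Space → ℂ) (b : ℝ → Space → ℂ) : Prop where
  measurable : ∀ s, AEStronglyMeasurable (b s) volume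
  norm_le : ∀ s κ, ‖b s κ‖ ≤ ‖a κ‖

variable {H : Type*} [NormedAddCommGroup H] [InnerProductSpace ℂ H]
  {H₁ : Type*} [NormedAddCommGroup H₁] [InnerProductSpace ℂ H₁] [CompleteSpace H₁]
  {H₂ : Type*} [NormedAddCommGroup H₂] [InnerProductSpace ℂ H₂] [CompleteSpace H₂]

/-- The Heisenberg evolution of a Weyl system in the time-dependent potential
`∫ b_s(κ) W(planeWave s κ) dκ`. -/
structure IsHeisenbergFlow (ħ : ℝ) (b : ℝ → Space → ℂ) (Q : ℝ → Space × Space → H →L[ℂ] H) :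
    Prop where
  weyl : ∀ s, IsWeylSystem ħ (Q s)
  -- The right side is (i/ħ)[V, Q(z)] for the potential V = ∫ b(κ) Q(planeWave κ) dκ: moving Q(z) to
  -- the left past each plane wave produces the factor 1 minus the symplectic phase.
  hasDerivAt : ∀ s z x, HasDerivAt (fun r => Q r z x)
    (-(Complex.I / ħ) • Q s z (∫ κ, (b s κ * (1 - sympPhase ħ (planeWave s κ) z)) •
      Q s (planeWave s κ) x)) s

theorem IsWeylSystem.integrable_coupling {ħ : ℝ} {W : Space × Space → H →L[ℂ] H}
    (hW : IsWeylSystem ħ W) {a : Space → ℂ} {T : ℝ} (hT : 0 ≤ T) (ha : HasCouplingMoment a T)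
    {g : Space → ℂ} (hg : AEStronglyMeasurable g volume) {C : ℝ} (hga : ∀ κ, ‖g κ‖ ≤ C * ‖a κ‖)
    (s : ℝ) (x : H) :
    Integrable fun κ => g κ • W (planeWave s κ) x := by
  have hc : Continuous fun κ => W (planeWave s κ) x :=
    (hW.strong_continuous x).comp (continuous_planeWave.comp (Continuous.prodMk_right s))
  refine ((ha.integrable_norm hT).mul_const (C * ‖x‖)).mono' (hg.smul hc.aestronglyMeasurable)
    (Eventually.of_forall fun κ => ?_)
  rw [norm_smul, hW.norm_map]
  calc ‖g κ‖ * ‖x‖ ≤ (C * ‖a κ‖) * ‖x‖ := by gcongr; exact hga κ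
    _ = _ := by ring

theorem IsCoupling.aestronglyMeasurable_mul_phase {a : Space → ℂ} {b : ℝ → Space → ℂ}
    (hb : IsCoupling a b) (ħ s : ℝ) (z : Space × Space) :
    AEStronglyMeasurable (fun κ => b s κ * (1 - sympPhase ħ (planeWave s κ) z)) volume := by
  have h : Continuous fun κ => sympPhase ħ (planeWave s κ) z := by
    unfold sympPhase symp planeWave; fun_prop
  exact (hb.measurable s).mul (continuous_const.sub h).aestronglyMeasurable

theorem IsCoupling.norm_mul_phase_le {a : Space → ℂ} {b : ℝ → Space → ℂ}
    (hb : IsCoupling a b) (ħ s : ℝ) (z : Space × Space) (κ : Space) :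
    ‖b s κ * (1 - sympPhase ħ (planeWave s κ) z)‖ ≤ 2 * ‖a κ‖ := by
  rw [norm_mul]
  have h1 := norm_one_sub_sympPhase_le_two ħ (planeWave s κ) z
  have h2 := hb.norm_le s κ
  nlinarith [norm_nonneg (b s κ), norm_nonneg (a κ)]

variable {ħ : ℝ} {a : Space → ℂ} {b : ℝ → Space → ℂ} {T : ℝ}
  {Q : ℝ → Space × Space → H →L[ℂ] H}
  {Q₁ : ℝ → Space × Space → H₁ →L[ℂ] H₁} {Q₂ : ℝ → Space × Space → H₂ →L[ℂ] H₂}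

/-- Both flows have the same coefficients b, so the derivative of Q₂(z) B Q₁(-z) contains B only
through its failure to intertwine plane waves. This is what makes a closed estimate for the defect
possible. -/
theorem IsHeisenbergFlow.hasDerivAt_conj (hQ₁ : IsHeisenbergFlow ħ b Q₁)
    (hQ₂ : IsHeisenbergFlow ħ b Q₂) (hb : IsCoupling a b) (hT : 0 ≤ T)
    (ha : HasCouplingMoment a T) (B : H₁ →L[ℂ] H₂) (s : ℝ) (z : Space × Space) (x : H₁) :
    HasDerivAt (fun r => Q₂ r z (B (Q₁ r (-z) x)))
      (-(Complex.I / ħ) • Q₂ s z (∫ κ, (b s κ * (1 - sympPhase ħ (planeWave s κ) z)) •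
        (Q₂ s (planeWave s κ) (B (Q₁ s (-z) x)) - B (Q₁ s (planeWave s κ) (Q₁ s (-z) x))))) s := by
  have hy := hQ₁.hasDerivAt s (-z) x
  have hBy : HasDerivAt (fun r => B (Q₁ r (-z) x)) _ s :=
    (B.restrictScalars ℝ).hasFDerivAt.comp_hasDerivAt s hy
  have key := hasDerivAt_strong_apply (A := fun r => Q₂ r z) (C := 1)
    (fun r y => by rw [(hQ₂.weyl r).norm_map, one_mul]) hBy (hQ₂.hasDerivAt s z _)
    (hQ₂.hasDerivAt s z _).continuousAt
  refine key.congr_deriv ?_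
  set v := Q₁ s (-z) x with hv
  have int1 : ∀ y : H₁, Integrable fun κ =>
      (b s κ * (1 - sympPhase ħ (planeWave s κ) z)) • Q₁ s (planeWave s κ) y := fun y =>
    (hQ₁.weyl s).integrable_coupling hT ha (hb.aestronglyMeasurable_mul_phase ħ s z)
      (hb.norm_mul_phase_le ħ s z) s y
  have int1' : Integrable fun κ =>
      (b s κ * (1 - sympPhase ħ (planeWave s κ) (-z))) • Q₁ s (planeWave s κ) x :=
    (hQ₁.weyl s).integrable_coupling hT ha (hb.aestronglyMeasurable_mul_phase ħ s (-z))
      (hb.norm_mul_phase_le ħ s (-z)) s x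
  have int2 : Integrable fun κ =>
      (b s κ * (1 - sympPhase ħ (planeWave s κ) z)) • Q₂ s (planeWave s κ) (B v) :=
    (hQ₂.weyl s).integrable_coupling hT ha (hb.aestronglyMeasurable_mul_phase ħ s z)
      (hb.norm_mul_phase_le ħ s z) s _
  -- Moving Q₁(-z) inside inverts the phase, and 1 minus the inverse phase, multiplied by the phase,
  -- equals minus 1 minus the phase in parentheses: p(1 - p⁻¹) = -(1 - p).
  have e1 : Q₁ s (-z) (∫ κ, (b s κ * (1 - sympPhase ħ (planeWave s κ) (-z))) •
      Q₁ s (planeWave s κ) x) = -∫ κ, (b s κ * (1 - sympPhase ħ (planeWave s κ) z)) •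
      Q₁ s (planeWave s κ) v := by
    rw [← ContinuousLinearMap.integral_comp_comm _ int1', ← integral_neg]
    congr 1; funext κ
    have h1 := (hQ₁.weyl s).comm (planeWave s κ) (-z) x
    have h2 := sympPhase_neg_right ħ (planeWave s κ) z
    rw [map_smul, hv, h1, smul_smul, ← neg_smul]
    congr 1
    linear_combination (-b s κ) * h2
  have e2 : B (∫ κ, (b s κ * (1 - sympPhase ħ (planeWave s κ) z)) • Q₁ s (planeWave s κ) v)
      = ∫ κ, (b s κ * (1 - sympPhase ħ (planeWave s κ) z)) • B (Q₁ s (planeWave s κ) v) := by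
    rw [← ContinuousLinearMap.integral_comp_comm _ (int1 v)]
    simp only [map_smul]
  have int3 : Integrable fun κ =>
      (b s κ * (1 - sympPhase ħ (planeWave s κ) z)) • B (Q₁ s (planeWave s κ) v) := by
    simpa only [map_smul] using B.integrable_comp (int1 v)
  simp only [ContinuousLinearMap.coe_restrictScalars', smul_sub]
  rw [integral_sub int2 int3, e1, map_smul, map_smul, map_neg, map_neg, e2, map_sub, smul_sub,
    smul_neg, sub_eq_add_neg]

end HeisenbergFlows

/-! ### The intertwining defect -/

section Defect

variable {H₁ : Type*} [NormedAddCommGroup H₁] [InnerProductSpace ℂ H₁]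
  {H₂ : Type*} [NormedAddCommGroup H₂] [InnerProductSpace ℂ H₂] {ħ : ℝ}

/-- The failure of `B` to intertwine `W₁` and `W₂` at `z`. -/
def defect (W₁ : Space × Space → H₁ →L[ℂ] H₁) (W₂ : Space × Space → H₂ →L[ℂ] H₂)
    (B : H₁ →L[ℂ] H₂) (z : Space × Space) : H₁ →L[ℂ] H₂ :=
  W₂ z ∘L B - B ∘L W₁ z

theorem defect_apply (W₁ : Space × Space → H₁ →L[ℂ] H₁) (W₂ : Space × Space → H₂ →L[ℂ] H₂)
    (B : H₁ →L[ℂ] H₂) (z : Space × Space) (x : H₁) :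
    defect W₁ W₂ B z x = W₂ z (B x) - B (W₁ z x) := rfl

theorem norm_defect_le {W₁ : Space × Space → H₁ →L[ℂ] H₁} {W₂ : Space × Space → H₂ →L[ℂ] H₂}
    (hW₁ : IsWeylSystem ħ W₁) (hW₂ : IsWeylSystem ħ W₂)
    (B : H₁ →L[ℂ] H₂) (z : Space × Space) : ‖defect W₁ W₂ B z‖ ≤ 2 * ‖B‖ := by
  refine ContinuousLinearMap.opNorm_le_bound _ (by positivity) fun x => ?_
  rw [defect_apply]
  refine (norm_sub_le _ _).trans ?_
  rw [hW₂.norm_map]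
  have h1 := B.le_opNorm x
  have h2 := B.le_opNorm (W₁ z x)
  rw [hW₁.norm_map] at h2
  linarith

end Defect

/-! ### First-order phase-space bounds, uniform in ħ -/

section FirstOrder

variable {H₁ : Type*} [NormedAddCommGroup H₁] [InnerProductSpace ℂ H₁] [CompleteSpace H₁]
  {H₂ : Type*} [NormedAddCommGroup H₂] [InnerProductSpace ℂ H₂] [CompleteSpace H₂]
  {ħ : ℝ} {a : Space → ℂ} {b : ℝ → Space → ℂ} {T : ℝ}
  {Q₁ : ℝ → Space × Space → H₁ →L[ℂ] H₁} {Q₂ : ℝ → Space × Space → H₂ →L[ℂ] H₂}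

theorem norm_neg_I_div {ħ : ℝ} (hħ : 0 < ħ) : ‖-(Complex.I / ħ)‖ = ħ⁻¹ := by
  rw [norm_neg, norm_div, Complex.norm_I, Complex.norm_real, Real.norm_of_nonneg hħ.le, one_div]

/-- The equation for Q₂(z) B Q₁(-z) is integrated from t to s, the phase compensating 1/ħ. The input
G concerns defects at plane waves only, while the output holds at every z, so the estimate can be
fed back into itself. -/
theorem IsHeisenbergFlow.norm_defect_le_add (hħ : 0 < ħ) (hQ₁ : IsHeisenbergFlow ħ b Q₁)
    (hQ₂ : IsHeisenbergFlow ħ b Q₂) (hb : IsCoupling a b) (hT : 0 ≤ T)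
    (ha : HasCouplingMoment a T) (B : H₁ →L[ℂ] H₂) {G : ℝ} (hG0 : 0 ≤ G)
    (hG : ∀ s ∈ Set.Icc 0 T, ∀ κ, ‖defect (Q₁ s) (Q₂ s) B (planeWave s κ)‖ * waveBound T κ ≤
      G * (1 + waveBound T κ) ^ 4)
    {s t : ℝ} (hs : s ∈ Set.Icc 0 T) (ht : t ∈ Set.Icc 0 T) (z : Space × Space) :
    ‖defect (Q₁ s) (Q₂ s) B z‖ ≤
      ‖defect (Q₁ t) (Q₂ t) B z‖ + T * (2 * ‖z‖ * G * couplingMoment a T) := by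
  have hΛ := couplingMoment_nonneg a hT
  refine ContinuousLinearMap.opNorm_le_bound _ (by positivity) fun y => ?_
  set x := Q₁ s z y with hx
  have hxy : ‖x‖ = ‖y‖ := (hQ₁.weyl s).norm_map z y
  have hder := fun r => hQ₁.hasDerivAt_conj hQ₂ hb hT ha B r z x
  have hbound : ∀ r ∈ Set.Icc 0 T, ‖(-(Complex.I / ħ) • Q₂ r z
      (∫ κ, (b r κ * (1 - sympPhase ħ (planeWave r κ) z)) •
        (Q₂ r (planeWave r κ) (B (Q₁ r (-z) x)) - B (Q₁ r (planeWave r κ) (Q₁ r (-z) x)))))‖ ≤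
      2 * ‖z‖ * G * couplingMoment a T * ‖x‖ := by
    intro r hr
    rw [norm_smul, norm_neg_I_div hħ, (hQ₂.weyl r).norm_map, inv_mul_le_iff₀ hħ]
    refine (ha.norm_integral_le (c := ħ * (2 * ‖z‖ * G) * ‖x‖) fun κ => ?_).trans
      (le_of_eq (by ring))
    have hω := waveBound_nonneg hT κ
    have h1 : ‖Q₂ r (planeWave r κ) (B (Q₁ r (-z) x)) -
        B (Q₁ r (planeWave r κ) (Q₁ r (-z) x))‖ ≤
        ‖defect (Q₁ r) (Q₂ r) B (planeWave r κ)‖ * ‖x‖ := by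
      have := (defect (Q₁ r) (Q₂ r) B (planeWave r κ)).le_opNorm (Q₁ r (-z) x)
      rwa [defect_apply, (hQ₁.weyl r).norm_map] at this
    have h2 : ‖1 - sympPhase ħ (planeWave r κ) z‖ ≤ 2 * ħ * waveBound T κ * ‖z‖ := by
      refine (norm_one_sub_sympPhase_le hħ.le _ _).trans ?_
      gcongr
      exact norm_planeWave_le hr κ
    rw [norm_smul, norm_mul]
    calc ‖b r κ‖ * ‖1 - sympPhase ħ (planeWave r κ) z‖ * _
        ≤ ‖a κ‖ * (2 * ħ * waveBound T κ * ‖z‖) *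
          (‖defect (Q₁ r) (Q₂ r) B (planeWave r κ)‖ * ‖x‖) := by
          gcongr
          exact hb.norm_le r κ
      _ = ‖a κ‖ * (2 * ħ * ‖z‖ * ‖x‖ *
          (‖defect (Q₁ r) (Q₂ r) B (planeWave r κ)‖ * waveBound T κ)) := by ring
      _ ≤ ‖a κ‖ * (2 * ħ * ‖z‖ * ‖x‖ * (G * (1 + waveBound T κ) ^ 4)) := by
          exact mul_le_mul_of_nonneg_left (mul_le_mul_of_nonneg_left (hG r hr κ) (by positivity))
            (norm_nonneg _)
      _ = _ := by ring
  have hmv := (convex_Icc (0 : ℝ) T).norm_image_sub_le_of_norm_hasDerivWithin_le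
    (fun r _ => (hder r).hasDerivWithinAt) hbound ht hs
  have hst : ‖s - t‖ ≤ T := by
    rw [Real.norm_eq_abs, abs_le]
    constructor <;> linarith [hs.1, hs.2, ht.1, ht.2]
  have h0 : ‖Q₂ t z (B (Q₁ t (-z) x)) - B x‖ ≤ ‖defect (Q₁ t) (Q₂ t) B z‖ * ‖x‖ := by
    have := (defect (Q₁ t) (Q₂ t) B z).le_opNorm (Q₁ t (-z) x)
    rwa [defect_apply, (hQ₁.weyl t).map_map_neg, (hQ₁.weyl t).norm_map] at this
  have hs' : defect (Q₁ s) (Q₂ s) B z y = Q₂ s z (B (Q₁ s (-z) x)) - B x := by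
    rw [defect_apply, hx, (hQ₁.weyl s).map_neg_map]
  rw [hs', ← hxy]
  calc ‖Q₂ s z (B (Q₁ s (-z) x)) - B x‖
      ≤ ‖Q₂ s z (B (Q₁ s (-z) x)) - Q₂ t z (B (Q₁ t (-z) x))‖ +
        ‖Q₂ t z (B (Q₁ t (-z) x)) - B x‖ := norm_sub_le_norm_sub_add_norm_sub _ _ _
    _ ≤ 2 * ‖z‖ * G * couplingMoment a T * ‖x‖ * T + ‖defect (Q₁ t) (Q₂ t) B z‖ * ‖x‖ := by
        refine add_le_add (hmv.trans ?_) h0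
        gcongr
    _ = _ := by ring

/-- Propagation of a Lipschitz bound on the intertwining defect. -/
theorem IsHeisenbergFlow.norm_defect_le (hħ : 0 < ħ) (hQ₁ : IsHeisenbergFlow ħ b Q₁)
    (hQ₂ : IsHeisenbergFlow ħ b Q₂) (hb : IsCoupling a b) (hT : 0 ≤ T)
    (ha : HasCouplingMoment a T) (hsmall : T * couplingMoment a T ≤ 1 / 8)
    (B : H₁ →L[ℂ] H₂) {L : ℝ} (hL0 : 0 ≤ L) {t : ℝ} (ht : t ∈ Set.Icc 0 T)
    (hL : ∀ z, ‖defect (Q₁ t) (Q₂ t) B z‖ ≤ L * (ħ * ‖z‖))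
    {s : ℝ} (hs : s ∈ Set.Icc 0 T) (z : Space × Space) :
    ‖defect (Q₁ s) (Q₂ s) B z‖ ≤ 2 * L * (ħ * ‖z‖) := by
  have step : ∀ G, 0 ≤ G → (∀ s ∈ Set.Icc 0 T, ∀ κ,
      ‖defect (Q₁ s) (Q₂ s) B (planeWave s κ)‖ * waveBound T κ ≤ G * (1 + waveBound T κ) ^ 4) →
      ∀ i : Set.Icc 0 T × (Space × Space), ‖defect (Q₁ i.1) (Q₂ i.1) B i.2‖ ≤
        (L + G / ħ / 4) * (ħ * ‖i.2‖) := by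
    rintro G hG0 hG ⟨⟨r, hr⟩, z⟩
    refine (hQ₁.norm_defect_le_add hħ hQ₂ hb hT ha B hG0 hG hr ht z).trans ?_
    have h1 : T * (2 * ‖z‖ * G * couplingMoment a T) ≤ 2 * ‖z‖ * G * (1 / 8) := by
      calc _ = 2 * ‖z‖ * G * (T * couplingMoment a T) := by ring
        _ ≤ _ := by gcongr
    have h2 : (L + G / ħ / 4) * (ħ * ‖z‖) = L * (ħ * ‖z‖) + 2 * ‖z‖ * G * (1 / 8) := by
      field_simp; ring
    rw [h2]
    exact add_le_add (hL z) h1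
  refine le_of_forall_improve
    (n := fun i : Set.Icc 0 T × (Space × Space) => ‖defect (Q₁ i.1) (Q₂ i.1) B i.2‖)
    (g := fun i => ħ * ‖i.2‖) (c := L) (M := L + 2 * ‖B‖ / ħ / 4) hL0 (by positivity) ?_ ?_
    (⟨s, hs⟩, z)
  -- The bootstrap needs some admissible constant to start from. The trivial bound 2‖B‖ gives one
  -- that blows up as ħ → 0, which is harmless because the start does not enter the conclusion.
  · refine step (2 * ‖B‖) (by positivity) fun r hr κ => ?_
    have hω := waveBound_nonneg hT κ
    have h1 := _root_.norm_defect_le (hQ₁.weyl r) (hQ₂.weyl r) B (planeWave r κ)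
    have h2 : waveBound T κ ≤ (1 + waveBound T κ) ^ 4 := by nlinarith [pow_nonneg hω 3, pow_nonneg hω 2, pow_nonneg hω 4]
    exact mul_le_mul h1 h2 hω (by positivity)
  · intro M hM0 hM i
    have := step (M * ħ) (by positivity) (fun r hr κ => ?_) i
    · refine this.trans ?_
      have e : M * ħ / ħ = M := by field_simp
      rw [e]
      gcongr
      linarith
    · have hω := waveBound_nonneg hT κ
      have h1 := hM (⟨r, hr⟩, planeWave r κ)
      have h2 := norm_planeWave_le hr κ
      have h3 : waveBound T κ * waveBound T κ ≤ (1 + waveBound T κ) ^ 4 := by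
        nlinarith [pow_nonneg hω 3, pow_nonneg hω 2, pow_nonneg hω 4]
      calc _ ≤ M * (ħ * waveBound T κ) * waveBound T κ := by
            gcongr
            exact h1.trans (by gcongr)
        _ = M * ħ * (waveBound T κ * waveBound T κ) := by ring
        _ ≤ _ := by gcongr

end FirstOrder

/-! ### Second differences in phase space -/

section SecondOrder

variable {H : Type*} [NormedAddCommGroup H] [InnerProductSpace ℂ H] {ħ : ℝ}
  {W : Space × Space → H →L[ℂ] H}

/-- Conjugation of an operator by a Weyl operator. -/
def conjBy (W : Space × Space → H →L[ℂ] H) (B : H →L[ℂ] H) (z : Space × Space) : H →L[ℂ] H :=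
  W z ∘L B ∘L W (-z)

theorem conjBy_apply (B : H →L[ℂ] H) (z : Space × Space) (x : H) :
    conjBy W B z x = W z (B (W (-z) x)) := rfl

/-- The second-order phase-space difference of an operator. -/
def secondDiff (W : Space × Space → H →L[ℂ] H) (B : H →L[ℂ] H) (z z' : Space × Space) :
    H →L[ℂ] H :=
  conjBy W B (z + z') - conjBy W B z - conjBy W B z' + B

theorem secondDiff_comm (B : H →L[ℂ] H) (z z' : Space × Space) :
    secondDiff W B z z' = secondDiff W B z' z := by
  simp only [secondDiff, add_comm z z']; abel

theorem IsWeylSystem.norm_conjBy_apply (hW : IsWeylSystem ħ W) (B : H →L[ℂ] H)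
    (z : Space × Space) (x : H) : ‖conjBy W B z x‖ = ‖B (W (-z) x)‖ := by
  rw [conjBy_apply, hW.norm_map]

theorem IsWeylSystem.norm_conjBy_le (hW : IsWeylSystem ħ W) (B : H →L[ℂ] H)
    (z : Space × Space) : ‖conjBy W B z‖ ≤ ‖B‖ := by
  refine ContinuousLinearMap.opNorm_le_bound _ (norm_nonneg _) fun x => ?_
  rw [hW.norm_conjBy_apply, ← hW.norm_map (-z) x]
  exact B.le_opNorm _

theorem conjBy_sub (B C : H →L[ℂ] H) (z : Space × Space) :
    conjBy W (B - C) z = conjBy W B z - conjBy W C z := by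
  ext x; simp [conjBy_apply]

/-- The cocycle phases on the two sides of B are inverse to each other, so conjugation is a genuine
action of the phase-space translations although W is only projective. -/
theorem IsWeylSystem.conjBy_add (hW : IsWeylSystem ħ W) (B : H →L[ℂ] H) (z z' : Space × Space) :
    conjBy W B (z + z') = conjBy W (conjBy W B z') z := by
  ext x
  simp only [conjBy_apply]
  rw [hW.map_map (-z') (-z), hW.map_map z z', map_smul, map_smul, smul_smul, ← Complex.exp_add,
    symp_neg_left, symp_neg_right, symp_swap z z', neg_neg, neg_add, add_comm (-z')]
  have : Complex.I * (ħ * symp z z' / 2 : ℝ) + Complex.I * (ħ * -symp z z' / 2 : ℝ) = 0 := by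
    push_cast; ring
  rw [this, Complex.exp_zero, one_smul]

theorem IsWeylSystem.conjBy_comp (hW : IsWeylSystem ħ W) (B C : H →L[ℂ] H) (z : Space × Space) :
    conjBy W (B ∘L C) z = conjBy W B z ∘L conjBy W C z := by
  ext x
  simp only [conjBy_apply, ContinuousLinearMap.comp_apply, hW.map_neg_map]

theorem IsWeylSystem.conjBy_self (hW : IsWeylSystem ħ W) (z z' : Space × Space) :
    conjBy W (W z') z = sympPhase ħ z z' • W z' := by
  ext x
  rw [conjBy_apply, hW.comm, hW.map_map_neg]; rfl

theorem IsWeylSystem.defect_eq (hW : IsWeylSystem ħ W) (B : H →L[ℂ] H) (z : Space × Space) :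
    defect W W B z = (conjBy W B z - B) ∘L W z := by
  ext x
  simp [defect_apply, conjBy_apply, hW.map_neg_map]

/-- The defect is the first difference composed with the unitary W z. -/
theorem IsWeylSystem.norm_defect_eq (hW : IsWeylSystem ħ W) (B : H →L[ℂ] H) (z : Space × Space) :
    ‖defect W W B z‖ = ‖conjBy W B z - B‖ := by
  apply le_antisymm
  · rw [hW.defect_eq]
    refine (ContinuousLinearMap.opNorm_comp_le _ _).trans ?_
    exact mul_le_of_le_one_right (norm_nonneg _) (hW.opNorm_le z)
  · have : conjBy W B z - B = defect W W B z ∘L W (-z) := by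
      ext x
      simp [defect_apply, conjBy_apply, hW.map_map_neg]
    rw [this]
    refine (ContinuousLinearMap.opNorm_comp_le _ _).trans ?_
    exact mul_le_of_le_one_right (norm_nonneg _) (hW.opNorm_le _)

/-- The defect at e is a first difference composed with W e. Conjugation by z changes the first
difference by a second difference, and multiplies W e by a phase only. -/
theorem IsWeylSystem.norm_conjBy_defect_sub_le (hW : IsWeylSystem ħ W) (hħ : 0 ≤ ħ)
    (B : H →L[ℂ] H) (z e : Space × Space) :
    ‖conjBy W (defect W W B e) z - defect W W B e‖ ≤
      ‖secondDiff W B z e‖ + 2 * ħ * ‖z‖ * ‖e‖ * ‖defect W W B e‖ := by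
  have key : conjBy W (defect W W B e) z - defect W W B e =
      sympPhase ħ z e • (secondDiff W B z e ∘L W e) -
        (1 - sympPhase ħ z e) • defect W W B e := by
    rw [hW.defect_eq B e, hW.conjBy_comp, hW.conjBy_self, conjBy_sub, ← hW.conjBy_add]
    ext x
    simp only [secondDiff, _root_.sub_apply, _root_.add_apply,
      ContinuousLinearMap.comp_apply, _root_.smul_apply, map_smul]
    module
  rw [key]
  refine (norm_sub_le _ _).trans (add_le_add ?_ ?_)
  · rw [norm_smul, norm_sympPhase, one_mul]
    refine (ContinuousLinearMap.opNorm_comp_le _ _).trans ?_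
    exact mul_le_of_le_one_right (norm_nonneg _) (hW.opNorm_le _)
  · rw [norm_smul]
    gcongr
    exact norm_one_sub_sympPhase_le hħ z e

/-- A second difference is a first difference of a first difference; this crude bound starts the
second-order bootstrap. -/
theorem IsWeylSystem.norm_secondDiff_le (hW : IsWeylSystem ħ W) (B : H →L[ℂ] H)
    (z z' : Space × Space) : ‖secondDiff W B z z'‖ ≤ 2 * ‖defect W W B z'‖ := by
  have e : secondDiff W B z z' = conjBy W (conjBy W B z' - B) z - (conjBy W B z' - B) := by
    rw [secondDiff, conjBy_sub, hW.conjBy_add]; abel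
  rw [e, hW.norm_defect_eq]
  refine (norm_sub_le _ _).trans ?_
  have := hW.norm_conjBy_le (conjBy W B z' - B) z
  linarith

theorem IsWeylSystem.norm_defect_self_le (hW : IsWeylSystem ħ W) (hħ : 0 ≤ ħ)
    (z₀ z : Space × Space) : ‖defect W W (W z₀) z‖ ≤ 2 * ‖z₀‖ * (ħ * ‖z‖) := by
  have e : defect W W (W z₀) z = -((1 - sympPhase ħ z z₀) • (W z₀ ∘L W z)) := by
    ext x
    simp only [defect_apply, hW.comm z z₀, _root_.neg_apply,
      _root_.smul_apply, ContinuousLinearMap.comp_apply]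
    module
  rw [e, norm_neg, norm_smul]
  have h1 := norm_one_sub_sympPhase_le hħ z z₀
  have h2 : ‖W z₀ ∘L W z‖ ≤ 1 := by
    refine (ContinuousLinearMap.opNorm_comp_le _ _).trans ?_
    exact mul_le_one₀ (hW.opNorm_le _) (norm_nonneg _) (hW.opNorm_le _)
  calc _ ≤ (2 * ħ * ‖z‖ * ‖z₀‖) * 1 := by gcongr
    _ = _ := by ring

/-- Weyl operators are eigenvectors of conjugation, so the second difference is W z₀ times a product
of two factors 1 minus phase, each of order ħ. -/
theorem IsWeylSystem.norm_secondDiff_self_le (hW : IsWeylSystem ħ W) (hħ : 0 ≤ ħ)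
    (z₀ z z' : Space × Space) :
    ‖secondDiff W (W z₀) z z'‖ ≤ 4 * ‖z₀‖ ^ 2 * (ħ ^ 2 * ‖z‖ * ‖z'‖) := by
  have e : secondDiff W (W z₀) z z' =
      ((1 - sympPhase ħ z z₀) * (1 - sympPhase ħ z' z₀)) • W z₀ := by
    rw [secondDiff, hW.conjBy_add]
    simp only [hW.conjBy_self]
    ext x
    have : conjBy W (sympPhase ħ z' z₀ • W z₀) z x
        = sympPhase ħ z' z₀ • sympPhase ħ z z₀ • W z₀ x := by
      have h := DFunLike.congr_fun (hW.conjBy_self z z₀) x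
      rw [conjBy_apply] at h ⊢
      simp only [_root_.smul_apply, map_smul] at h ⊢
      rw [h]
    simp only [_root_.sub_apply, _root_.add_apply,
      _root_.smul_apply, this]
    module
  rw [e, norm_smul, norm_mul]
  have h1 := norm_one_sub_sympPhase_le hħ z z₀
  have h2 := norm_one_sub_sympPhase_le hħ z' z₀
  calc _ ≤ ((2 * ħ * ‖z‖ * ‖z₀‖) * (2 * ħ * ‖z'‖ * ‖z₀‖)) * 1 := by
        gcongr
        exact hW.opNorm_le _
    _ = _ := by ring

variable {a : Space → ℂ} {b : ℝ → Space → ℂ} {T : ℝ}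
  {Q : ℝ → Space × Space → H →L[ℂ] H}

theorem IsHeisenbergFlow.integrable_conj (hQ : IsHeisenbergFlow ħ b Q)
    (hb : IsCoupling a b) (hT : 0 ≤ T) (ha : HasCouplingMoment a T) (B : H →L[ℂ] H) (s : ℝ)
    (z : Space × Space) (x : H) :
    Integrable fun κ => (b s κ * (1 - sympPhase ħ (planeWave s κ) z)) •
      conjBy (Q s) (defect (Q s) (Q s) B (planeWave s κ)) z x := by
  have int : ∀ y : H, Integrable fun κ =>
      (b s κ * (1 - sympPhase ħ (planeWave s κ) z)) • Q s (planeWave s κ) y := fun y =>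
    (hQ.weyl s).integrable_coupling hT ha (hb.aestronglyMeasurable_mul_phase ħ s z)
      (hb.norm_mul_phase_le ħ s z) s y
  have h1 := (Q s z).integrable_comp ((int (B (Q s (-z) x))).sub
    (B.integrable_comp (int (Q s (-z) x))))
  refine h1.congr (Eventually.of_forall fun κ => ?_)
  simp [conjBy_apply, defect_apply, smul_sub]

theorem IsHeisenbergFlow.hasDerivAt_conjBy [CompleteSpace H] (hQ : IsHeisenbergFlow ħ b Q)
    (hb : IsCoupling a b) (hT : 0 ≤ T) (ha : HasCouplingMoment a T) (B : H →L[ℂ] H) (s : ℝ)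
    (z : Space × Space) (x : H) :
    HasDerivAt (fun r => conjBy (Q r) B z x)
      (-(Complex.I / ħ) • ∫ κ, (b s κ * (1 - sympPhase ħ (planeWave s κ) z)) •
        conjBy (Q s) (defect (Q s) (Q s) B (planeWave s κ)) z x) s := by
  refine (hQ.hasDerivAt_conj hQ hb hT ha B s z x).congr_deriv ?_
  have int : ∀ y : H, Integrable fun κ =>
      (b s κ * (1 - sympPhase ħ (planeWave s κ) z)) • Q s (planeWave s κ) y := fun y =>
    (hQ.weyl s).integrable_coupling hT ha (hb.aestronglyMeasurable_mul_phase ħ s z)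
      (hb.norm_mul_phase_le ħ s z) s y
  congr 1
  have h1 : Integrable fun κ => (b s κ * (1 - sympPhase ħ (planeWave s κ) z)) •
      (Q s (planeWave s κ) (B (Q s (-z) x)) - B (Q s (planeWave s κ) (Q s (-z) x))) := by
    refine ((int (B (Q s (-z) x))).sub (B.integrable_comp (int (Q s (-z) x)))).congr
      (Eventually.of_forall fun κ => ?_)
    simp [smul_sub]
  rw [← ContinuousLinearMap.integral_comp_comm _ h1]
  simp [conjBy_apply, defect_apply]

end SecondOrder

/-! ### Propagation of second differences in time -/

section SecondOrderPropagation

variable {H : Type*} [NormedAddCommGroup H] [InnerProductSpace ℂ H] [CompleteSpace H] {ħ : ℝ}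
  {a : Space → ℂ} {b : ℝ → Space → ℂ} {T : ℝ} {Q : ℝ → Space × Space → H →L[ℂ] H}

/-- A discrete Leibniz rule: since the phase is multiplicative, 1 - pp' = (1 - p) + (1 - p') - (1 -
p)(1 - p'). Either both differences fall on phases, or one falls on a phase and the other on the
conjugated defect. Three terms of size 4 make the constant 12. -/
theorem IsWeylSystem.norm_second_order_integrand_le {W : Space × Space → H →L[ℂ] H}
    (hW : IsWeylSystem ħ W) (hħ : 0 ≤ ħ) (B : H →L[ℂ] H) (z z' e : Space × Space) (x : H) :
    ‖(1 - sympPhase ħ e (z + z')) • conjBy W (defect W W B e) (z + z') x -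
        (1 - sympPhase ħ e z) • conjBy W (defect W W B e) z x -
        (1 - sympPhase ħ e z') • conjBy W (defect W W B e) z' x‖ ≤
      (2 * ħ * ‖e‖ * (‖z‖ * ‖secondDiff W B z' e‖ + ‖z'‖ * ‖secondDiff W B z e‖) +
        12 * ħ ^ 2 * ‖e‖ ^ 2 * ‖z‖ * ‖z'‖ * ‖defect W W B e‖) * ‖x‖ := by
  set Y := defect W W B e with hY
  have hp := norm_one_sub_sympPhase_le hħ e z
  have hp' := norm_one_sub_sympPhase_le hħ e z'
  have h1 : ‖conjBy W Y (z + z') x - conjBy W Y z x‖ ≤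
      (‖secondDiff W B z' e‖ + 2 * ħ * ‖z'‖ * ‖e‖ * ‖Y‖) * ‖x‖ := by
    have : conjBy W Y (z + z') x - conjBy W Y z x = conjBy W (conjBy W Y z' - Y) z x := by
      rw [conjBy_sub, hW.conjBy_add]; rfl
    rw [this, hW.norm_conjBy_apply, ← hW.norm_map (-z) x]
    exact ContinuousLinearMap.le_of_opNorm_le _ (hW.norm_conjBy_defect_sub_le hħ B z' e) _
  have h2 : ‖conjBy W Y (z + z') x - conjBy W Y z' x‖ ≤
      (‖secondDiff W B z e‖ + 2 * ħ * ‖z‖ * ‖e‖ * ‖Y‖) * ‖x‖ := by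
    have : conjBy W Y (z + z') x - conjBy W Y z' x = conjBy W (conjBy W Y z - Y) z' x := by
      rw [conjBy_sub, add_comm, hW.conjBy_add]; rfl
    rw [this, hW.norm_conjBy_apply, ← hW.norm_map (-z') x]
    exact ContinuousLinearMap.le_of_opNorm_le _ (hW.norm_conjBy_defect_sub_le hħ B z e) _
  have h3 : ‖conjBy W Y (z + z') x‖ ≤ ‖Y‖ * ‖x‖ :=
    ContinuousLinearMap.le_of_opNorm_le _ (hW.norm_conjBy_le Y _) _
  have key : (1 - sympPhase ħ e (z + z')) • conjBy W Y (z + z') x -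
        (1 - sympPhase ħ e z) • conjBy W Y z x - (1 - sympPhase ħ e z') • conjBy W Y z' x =
      (1 - sympPhase ħ e z) • (conjBy W Y (z + z') x - conjBy W Y z x) +
      (1 - sympPhase ħ e z') • (conjBy W Y (z + z') x - conjBy W Y z' x) -
      ((1 - sympPhase ħ e z) * (1 - sympPhase ħ e z')) • conjBy W Y (z + z') x := by
    rw [sympPhase_add_right]
    module
  rw [key]
  have h5 : ‖(1 - sympPhase ħ e z) • (conjBy W Y (z + z') x - conjBy W Y z x)‖ ≤
      (2 * ħ * ‖e‖ * ‖z‖) * ((‖secondDiff W B z' e‖ + 2 * ħ * ‖z'‖ * ‖e‖ * ‖Y‖) * ‖x‖) := by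
    rw [norm_smul]; gcongr
  have h6 : ‖(1 - sympPhase ħ e z') • (conjBy W Y (z + z') x - conjBy W Y z' x)‖ ≤
      (2 * ħ * ‖e‖ * ‖z'‖) * ((‖secondDiff W B z e‖ + 2 * ħ * ‖z‖ * ‖e‖ * ‖Y‖) * ‖x‖) := by
    rw [norm_smul]; gcongr
  have h4 : ‖((1 - sympPhase ħ e z) * (1 - sympPhase ħ e z')) • conjBy W Y (z + z') x‖ ≤
      (2 * ħ * ‖e‖ * ‖z‖) * (2 * ħ * ‖e‖ * ‖z'‖) * (‖Y‖ * ‖x‖) := by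
    rw [norm_smul, norm_mul]; gcongr
  refine (norm_sub_le _ _).trans ((add_le_add ((norm_add_le _ _).trans (add_le_add h5 h6))
    h4).trans (le_of_eq ?_))
  ring

/-- On the right only second differences with a plane wave in one slot appear, so the estimate can
be iterated. The first-order bound L enters with the third power of the frequency, which the weight
of the coupling moment absorbs. -/
theorem IsHeisenbergFlow.norm_secondDiff_le_add (hħ : 0 < ħ) (hQ : IsHeisenbergFlow ħ b Q)
    (hb : IsCoupling a b) (hT : 0 ≤ T) (ha : HasCouplingMoment a T) (B : H →L[ℂ] H)
    {L : ℝ} (hL0 : 0 ≤ L)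
    (hL : ∀ s ∈ Set.Icc 0 T, ∀ z, ‖defect (Q s) (Q s) B z‖ ≤ L * (ħ * ‖z‖))
    (z z' : Space × Space) {P P' : ℝ} (hP0 : 0 ≤ P) (hP0' : 0 ≤ P')
    (hP : ∀ s ∈ Set.Icc 0 T, ∀ κ,
      ‖secondDiff (Q s) B z (planeWave s κ)‖ * waveBound T κ ≤ P * (1 + waveBound T κ) ^ 4)
    (hP' : ∀ s ∈ Set.Icc 0 T, ∀ κ,
      ‖secondDiff (Q s) B z' (planeWave s κ)‖ * waveBound T κ ≤ P' * (1 + waveBound T κ) ^ 4)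
    {s t : ℝ} (hs : s ∈ Set.Icc 0 T) (ht : t ∈ Set.Icc 0 T) :
    ‖secondDiff (Q s) B z z'‖ ≤ ‖secondDiff (Q t) B z z'‖ +
      T * ((2 * ‖z‖ * P' + 2 * ‖z'‖ * P + 12 * L * (ħ ^ 2 * ‖z‖ * ‖z'‖)) *
        couplingMoment a T) := by
  have hΛ := couplingMoment_nonneg a hT
  set R := 2 * ‖z‖ * P' + 2 * ‖z'‖ * P + 12 * L * (ħ ^ 2 * ‖z‖ * ‖z'‖) with hR
  have hR0 : 0 ≤ R := by positivity
  let F : ℝ → H → Space → H := fun r x κ => b r κ •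
    ((1 - sympPhase ħ (planeWave r κ) (z + z')) •
        conjBy (Q r) (defect (Q r) (Q r) B (planeWave r κ)) (z + z') x -
      (1 - sympPhase ħ (planeWave r κ) z) •
        conjBy (Q r) (defect (Q r) (Q r) B (planeWave r κ)) z x -
      (1 - sympPhase ħ (planeWave r κ) z') •
        conjBy (Q r) (defect (Q r) (Q r) B (planeWave r κ)) z' x)
  have hder : ∀ r x, HasDerivAt (fun r => secondDiff (Q r) B z z' x)
      (-(Complex.I / ħ) • ∫ κ, F r x κ) r := by
    intro r x
    have i1 := hQ.integrable_conj hb hT ha B r (z + z') x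
    have i2 := hQ.integrable_conj hb hT ha B r z x
    have i3 := hQ.integrable_conj hb hT ha B r z' x
    refine ((((hQ.hasDerivAt_conjBy hb hT ha B r (z + z') x).fun_sub
      (hQ.hasDerivAt_conjBy hb hT ha B r z x)).fun_sub
        (hQ.hasDerivAt_conjBy hb hT ha B r z' x)).add_const (B x)).congr_deriv ?_
    have i12 := i1.sub i2
    rw [← smul_sub, ← smul_sub, ← integral_sub i1 i2]
    refine congrArg _ ((integral_sub i12 i3).symm.trans (integral_congr_ae (ae_of_all _ fun κ => ?_)))
    simp only [F, mul_smul, smul_sub, Pi.sub_apply]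
  have hbound : ∀ r ∈ Set.Icc 0 T, ∀ x, ‖-(Complex.I / (ħ : ℂ)) • ∫ κ, F r x κ‖ ≤
      R * couplingMoment a T * ‖x‖ := by
    intro r hr x
    rw [norm_smul, norm_neg_I_div hħ, inv_mul_le_iff₀ hħ]
    refine (ha.norm_integral_le (c := ħ * R * ‖x‖) fun κ => ?_).trans (le_of_eq (by ring))
    have hω := waveBound_nonneg hT κ
    have he := norm_planeWave_le hr κ
    set ω := waveBound T κ
    rw [norm_smul]
    have h0 := (hQ.weyl r).norm_second_order_integrand_le hħ.le B z z' (planeWave r κ) x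
    have hd : ‖defect (Q r) (Q r) B (planeWave r κ)‖ ≤ L * (ħ * ω) :=
      (hL r hr _).trans (by gcongr)
    have hω3 : ω ^ 3 ≤ (1 + ω) ^ 4 := by
      nlinarith [pow_nonneg hω 3, pow_nonneg hω 2, pow_nonneg hω 4]
    refine mul_le_mul (hb.norm_le r κ) (h0.trans ?_) (norm_nonneg _) (norm_nonneg _)
    calc _ ≤ (2 * ħ * ω * (‖z‖ * ‖secondDiff (Q r) B z' (planeWave r κ)‖ +
          ‖z'‖ * ‖secondDiff (Q r) B z (planeWave r κ)‖) +
          12 * ħ ^ 2 * ω ^ 2 * ‖z‖ * ‖z'‖ * (L * (ħ * ω))) * ‖x‖ := by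
          gcongr
      _ = (2 * ħ * ‖z‖ * (‖secondDiff (Q r) B z' (planeWave r κ)‖ * ω) +
          2 * ħ * ‖z'‖ * (‖secondDiff (Q r) B z (planeWave r κ)‖ * ω) +
          ħ * (12 * L * (ħ ^ 2 * ‖z‖ * ‖z'‖)) * ω ^ 3) * ‖x‖ := by ring
      _ ≤ (2 * ħ * ‖z‖ * (P' * (1 + ω) ^ 4) + 2 * ħ * ‖z'‖ * (P * (1 + ω) ^ 4) +
          ħ * (12 * L * (ħ ^ 2 * ‖z‖ * ‖z'‖)) * (1 + ω) ^ 4) * ‖x‖ := by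
          gcongr ((_ * ?_ + _ * ?_) + _ * ?_) * _
          exacts [hP' r hr κ, hP r hr κ]
      _ = _ := by rw [hR]; ring
  have hst : ‖s - t‖ ≤ T := by
    rw [Real.norm_eq_abs, abs_le]
    constructor <;> linarith [hs.1, hs.2, ht.1, ht.2]
  have hdiff : ‖secondDiff (Q s) B z z' - secondDiff (Q t) B z z'‖ ≤
      T * (R * couplingMoment a T) := by
    refine ContinuousLinearMap.opNorm_le_bound _ (by positivity) fun x => ?_
    have hmv := (convex_Icc (0 : ℝ) T).norm_image_sub_le_of_norm_hasDerivWithin_le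
      (fun r _ => (hder r x).hasDerivWithinAt) (fun r hr => hbound r hr x) ht hs
    refine hmv.trans ?_
    calc _ ≤ R * couplingMoment a T * ‖x‖ * T := by gcongr
      _ = _ := by ring
  have := norm_le_norm_add_norm_sub' (secondDiff (Q s) B z z') (secondDiff (Q t) B z z')
  linarith

/-- Propagation of a second-order bound on an operator. -/
theorem IsHeisenbergFlow.norm_secondDiff_le (hħ : 0 < ħ) (hQ : IsHeisenbergFlow ħ b Q)
    (hb : IsCoupling a b) (hT : 0 ≤ T) (ha : HasCouplingMoment a T)
    (hsmall : T * couplingMoment a T ≤ 1 / 8) (B : H →L[ℂ] H) {L M : ℝ} (hL0 : 0 ≤ L)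
    (hM0 : 0 ≤ M)
    (hL : ∀ s ∈ Set.Icc 0 T, ∀ z, ‖defect (Q s) (Q s) B z‖ ≤ L * (ħ * ‖z‖))
    {t : ℝ} (ht : t ∈ Set.Icc 0 T)
    (hM : ∀ z z', ‖secondDiff (Q t) B z z'‖ ≤ M * (ħ ^ 2 * ‖z‖ * ‖z'‖))
    {s : ℝ} (hs : s ∈ Set.Icc 0 T) (z z' : Space × Space) :
    ‖secondDiff (Q s) B z z'‖ ≤ 2 * (M + 3 / 2 * L) * (ħ ^ 2 * ‖z‖ * ‖z'‖) := by
  have step : ∀ G, 0 ≤ G → (∀ s ∈ Set.Icc 0 T, ∀ z κ,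
      ‖secondDiff (Q s) B z (planeWave s κ)‖ * waveBound T κ ≤
        G * ‖z‖ * (1 + waveBound T κ) ^ 4) →
      ∀ i : Set.Icc 0 T × (Space × Space) × (Space × Space),
        ‖secondDiff (Q i.1) B i.2.1 i.2.2‖ ≤
        (M + 3 / 2 * L + G / ħ ^ 2 / 2) * (ħ ^ 2 * ‖i.2.1‖ * ‖i.2.2‖) := by
    rintro G hG0 hG ⟨⟨r, hr⟩, z, z'⟩
    refine (hQ.norm_secondDiff_le_add hħ hb hT ha B hL0 hL z z' (P := G * ‖z‖)
      (P' := G * ‖z'‖) (by positivity) (by positivity) (fun s hs κ => hG s hs z κ)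
      (fun s hs κ => hG s hs z' κ) hr ht).trans ?_
    -- The smallness of T times the moment turns 4G into the contracting G/2, and 12L into the 3/2·L
    -- of the final constant.
    have h1 : T * ((2 * ‖z‖ * (G * ‖z'‖) + 2 * ‖z'‖ * (G * ‖z‖) +
        12 * L * (ħ ^ 2 * ‖z‖ * ‖z'‖)) * couplingMoment a T) ≤
        (4 * G * (‖z‖ * ‖z'‖) + 12 * L * (ħ ^ 2 * ‖z‖ * ‖z'‖)) * (1 / 8) := by
      calc _ = (4 * G * (‖z‖ * ‖z'‖) + 12 * L * (ħ ^ 2 * ‖z‖ * ‖z'‖)) *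
            (T * couplingMoment a T) := by ring
        _ ≤ _ := by gcongr
    have h2 : (M + 3 / 2 * L + G / ħ ^ 2 / 2) * (ħ ^ 2 * ‖z‖ * ‖z'‖) =
        (M + 3 / 2 * L) * (ħ ^ 2 * ‖z‖ * ‖z'‖) + G / 2 * (‖z‖ * ‖z'‖) := by
      field_simp
    have := hM z z'
    dsimp only
    rw [h2]
    linarith
  refine le_of_forall_improve
    (n := fun i : Set.Icc 0 T × (Space × Space) × (Space × Space) =>
      ‖secondDiff (Q i.1) B i.2.1 i.2.2‖)
    (g := fun i => ħ ^ 2 * ‖i.2.1‖ * ‖i.2.2‖) (c := M + 3 / 2 * L)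
    (M := M + 3 / 2 * L + 2 * (L * ħ) / ħ ^ 2 / 2) (by positivity) (by positivity) ?_ ?_
    (⟨s, hs⟩, z, z')
  -- The starting constant is taken from the first-order bound at z, by symmetry of the second
  -- difference, so that it already carries the factor ‖z‖.
  · refine step (2 * (L * ħ)) (by positivity) fun r hr z κ => ?_
    have hω := waveBound_nonneg hT κ
    have h1 := (hQ.weyl r).norm_secondDiff_le B (planeWave r κ) z
    rw [secondDiff_comm] at h1
    have h2 : waveBound T κ ≤ (1 + waveBound T κ) ^ 4 := by
      nlinarith [pow_nonneg hω 3, pow_nonneg hω 2, pow_nonneg hω 4]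
    have h3 := hL r hr z
    refine mul_le_mul (h1.trans ?_) h2 hω (by positivity)
    linarith
  · intro G hG0 hG i
    have := step (G * ħ ^ 2) (by positivity) (fun r hr z κ => ?_) i
    · have e : G * ħ ^ 2 / ħ ^ 2 = G := by field_simp
      rwa [e] at this
    · have hω := waveBound_nonneg hT κ
      have h1 := hG (⟨r, hr⟩, z, planeWave r κ)
      have h2 := norm_planeWave_le hr κ
      have h3 : waveBound T κ * waveBound T κ ≤ (1 + waveBound T κ) ^ 4 := by
        nlinarith [pow_nonneg hω 3, pow_nonneg hω 2, pow_nonneg hω 4]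
      calc _ ≤ G * (ħ ^ 2 * ‖z‖ * waveBound T κ) * waveBound T κ := by
            gcongr
            exact h1.trans (by gcongr)
        _ = G * ħ ^ 2 * ‖z‖ * (waveBound T κ * waveBound T κ) := by ring
        _ ≤ _ := by gcongr

end SecondOrderPropagation

/-! ### Empirical averages over the particles -/

section Averages

variable {H : Type*} [NormedAddCommGroup H] [InnerProductSpace ℂ H] {N : ℕ}

/-- The average of a family of one-particle operators over the particles. -/
def particleMean (B : Fin N → H →L[ℂ] H) : H →L[ℂ] H := (N : ℂ)⁻¹ • ∑ i, B i

theorem particleMean_apply (B : Fin N → H →L[ℂ] H) (x : H) :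
    particleMean B x = (N : ℂ)⁻¹ • ∑ i, B i x := by
  simp [particleMean]

theorem norm_inv_smul_sum_le {E : Type*} [NormedAddCommGroup E] [NormedSpace ℂ E] (v : Fin N → E)
    {β : ℝ} (hβ : 0 ≤ β) (h : ∀ i, ‖v i‖ ≤ β) : ‖(N : ℂ)⁻¹ • ∑ i, v i‖ ≤ β := by
  rcases Nat.eq_zero_or_pos N with rfl | hN
  · simpa using hβ
  have hN' : (0 : ℝ) < N := by exact_mod_cast hN
  rw [norm_smul, norm_inv, Complex.norm_natCast, inv_mul_le_iff₀ hN']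
  refine (norm_sum_le _ _).trans ((Finset.sum_le_sum fun i _ => h i).trans ?_)
  simp

theorem norm_particleMean_le {B : Fin N → H →L[ℂ] H} {β : ℝ} (hβ : 0 ≤ β) (h : ∀ i, ‖B i‖ ≤ β) :
    ‖particleMean B‖ ≤ β := norm_inv_smul_sum_le B hβ h

/-- Averages of families of operators acting on distinct particles commute up to `1 / N`. -/
theorem particleMean_commutator {B C : Fin N → H →L[ℂ] H}
    (h : ∀ i j, i ≠ j → ∀ x, B i (C j x) = C j (B i x)) (x : H) :
    particleMean B (particleMean C x) - particleMean C (particleMean B x) =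
      (N : ℂ)⁻¹ • particleMean (fun i => B i ∘L C i - C i ∘L B i) x := by
  simp only [particleMean_apply, map_smul, map_sum, ← Finset.smul_sum]
  rw [← smul_sub, ← smul_sub]
  congr 2
  rw [Finset.sum_comm (f := fun j i => B i (C j x)), ← Finset.sum_sub_distrib]
  refine Finset.sum_congr rfl fun i _ => ?_
  rw [← Finset.sum_sub_distrib, Finset.sum_eq_single i]
  · rfl
  · intro j _ hj
    rw [h i j hj.symm, sub_self]
  · simp

/-- The fluctuation of an particleMean around the scalar `c`. -/
def fluct (B : Fin N → H →L[ℂ] H) (c : ℂ) : H →L[ℂ] H := particleMean B - c • ContinuousLinearMap.id ℂ H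

theorem fluct_apply (B : Fin N → H →L[ℂ] H) (c : ℂ) (x : H) :
    fluct B c x = particleMean B x - c • x := rfl

theorem particleMean_apply_eq (B : Fin N → H →L[ℂ] H) (c : ℂ) (x : H) :
    particleMean B x = fluct B c x + c • x := by
  rw [fluct_apply]; abel

theorem fluct_commutator {B C : Fin N → H →L[ℂ] H} (c d : ℂ)
    (h : ∀ i j, i ≠ j → ∀ x, B i (C j x) = C j (B i x)) (x : H) :
    fluct B c (fluct C d x) - fluct C d (fluct B c x) =
      (N : ℂ)⁻¹ • particleMean (fun i => B i ∘L C i - C i ∘L B i) x := by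
  rw [← particleMean_commutator h]
  simp only [fluct_apply, map_sub, map_smul]
  module

theorem norm_fluct_le {B : Fin N → H →L[ℂ] H} {c : ℂ} {β : ℝ} (hβ : 0 ≤ β) (h : ∀ i, ‖B i‖ ≤ β)
    (hc : ‖c‖ ≤ β) (x : H) : ‖fluct B c x‖ ≤ 2 * β * ‖x‖ := by
  rw [fluct_apply]
  refine (norm_sub_le _ _).trans ?_
  have h1 := (particleMean B).le_of_opNorm_le (norm_particleMean_le hβ h) x
  have h2 : ‖c • x‖ ≤ β * ‖x‖ := by rw [norm_smul]; gcongr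
  linarith

theorem norm_inv_natCast_smul_le {E : Type*} [NormedAddCommGroup E] [NormedSpace ℂ E] {v : E}
    {β : ℝ} (h : ‖v‖ ≤ β) : ‖(N : ℂ)⁻¹ • v‖ ≤ β / N := by
  rw [norm_smul, norm_inv, Complex.norm_natCast, div_eq_inv_mul]
  gcongr

/-- The average of orthogonal vectors of length at most `β`. -/
theorem norm_inv_smul_sum_orthogonal_le (hN : 0 < N) (v : Fin N → H) {β : ℝ} (hβ : 0 ≤ β)
    (h : ∀ i, ‖v i‖ ≤ β) (ho : ∀ i j, i ≠ j → inner ℂ (v i) (v j) = 0) :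
    ‖(N : ℂ)⁻¹ • ∑ i, v i‖ ≤ β / Real.sqrt N := by
  have hN' : (0 : ℝ) < N := by exact_mod_cast hN
  have h1 : ‖∑ i, v i‖ ^ 2 ≤ N * β ^ 2 := by
    have e : (inner ℂ (∑ i, v i) (∑ i, v i) : ℂ) = ∑ i, (‖v i‖ : ℂ) ^ 2 := by
      rw [sum_inner]
      refine Finset.sum_congr rfl fun i _ => ?_
      rw [inner_sum, Finset.sum_eq_single i]
      · exact inner_self_eq_norm_sq_to_K _
      · exact fun j _ hj => ho i j hj.symm
      · simp
    rw [inner_self_eq_norm_sq_to_K] at e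
    have e' : ‖∑ i, v i‖ ^ 2 = ∑ i, ‖v i‖ ^ 2 := by
      apply Complex.ofReal_injective; push_cast; exact e
    rw [e']
    refine (Finset.sum_le_sum fun i _ => pow_le_pow_left₀ (norm_nonneg _) (h i) 2).trans ?_
    simp
  have h2 : ‖∑ i, v i‖ ≤ Real.sqrt N * β := by
    rw [← Real.sqrt_sq (norm_nonneg (∑ i, v i)), ← Real.sqrt_sq hβ, ← Real.sqrt_mul hN'.le]
    exact Real.sqrt_le_sqrt h1
  rw [norm_smul, norm_inv, Complex.norm_natCast, inv_mul_le_iff₀ hN']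
  refine h2.trans (le_of_eq ?_)
  have : Real.sqrt N ≠ 0 := (Real.sqrt_pos.2 hN').ne'
  field_simp
  rw [Real.sq_sqrt hN'.le]; ring

end Averages

/-! ### N particles in a common mean field, and one-body families -/

section MeanFieldFlow

variable {H₀ : Type*} [NormedAddCommGroup H₀] [InnerProductSpace ℂ H₀]
  {H : Type*} [NormedAddCommGroup H] [InnerProductSpace ℂ H]

/-- Strong continuity of a family of isometries is joint continuity. -/
theorem IsWeylSystem.continuous_apply {ħ : ℝ} {W : Space × Space → H →L[ℂ] H}
    (hW : IsWeylSystem ħ W) {X : Type*} [TopologicalSpace X] {z : X → Space × Space} {y : X → H}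
    (hz : Continuous z) (hy : Continuous y) : Continuous fun x => W (z x) (y x) := by
  rw [continuous_iff_continuousAt]
  intro x₀
  have h1 : Tendsto (fun x => W (z x) (y x - y x₀)) (𝓝 x₀) (𝓝 0) := by
    rw [tendsto_zero_iff_norm_tendsto_zero]
    simp only [hW.norm_map]
    rw [← tendsto_zero_iff_norm_tendsto_zero]
    have := (hy.tendsto x₀).sub_const (y x₀)
    rwa [sub_self] at this
  have h2 : Tendsto (fun x => W (z x) (y x₀)) (𝓝 x₀) (𝓝 (W (z x₀) (y x₀))) :=
    ((hW.strong_continuous (y x₀)).comp hz).tendsto x₀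
  have := h1.add h2
  simp only [map_sub, sub_add_cancel, zero_add] at this
  exact this

/-- Weyl systems of `N` distinguishable particles on `H` and a copy of the one-particle space for
each of them, in the mean field of the potential `∫ b_s(κ) e^{2πi⟨κ,x⟩} dκ`. All algebraic
relations are imposed at time zero only. -/
structure IsMeanFieldFlow (ħ T : ℝ) (a : Space → ℂ) (b : ℝ → Space → ℂ) {N : ℕ}
    (Q₀ : ℝ → Space × Space → H₀ →L[ℂ] H₀) (Q : Fin N → ℝ → Space × Space → H →L[ℂ] H)
    (f : H₀) (ι : Fin N → H₀ →L[ℂ] H) (F : H) : Prop where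
  hbar_pos : 0 < ħ
  card_pos : 0 < N
  time_nonneg : 0 ≤ T
  coupling : IsCoupling a b
  moment : HasCouplingMoment a T
  small : T * couplingMoment a T ≤ 1 / 8
  flow₀ : IsHeisenbergFlow ħ b Q₀
  flow : ∀ i, IsHeisenbergFlow ħ b (Q i)
  commute_zero : ∀ i j, i ≠ j → ∀ z z' x, Q i 0 z (Q j 0 z' x) = Q j 0 z' (Q i 0 z x)
  intertwine_zero : ∀ i z g, Q i 0 z (ι i g) = ι i (Q₀ 0 z g)
  norm_state : ‖f‖ = 1
  norm_embed : ∀ i g, ‖ι i g‖ = ‖g‖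
  embed_state : ∀ i, ι i f = F
  inner_embed : ∀ i j, i ≠ j → ∀ g h, inner ℂ (ι i g) (ι j h) = inner ℂ g f * inner ℂ f h

variable [CompleteSpace H₀] [CompleteSpace H] {ħ T : ℝ} {a : Space → ℂ} {b : ℝ → Space → ℂ}
  {N : ℕ} {Q₀ : ℝ → Space × Space → H₀ →L[ℂ] H₀} {Q : Fin N → ℝ → Space × Space → H →L[ℂ] H}
  {f : H₀} {ι : Fin N → H₀ →L[ℂ] H} {F : H}

/-- Two Heisenberg flows in the same potential intertwined at time zero stay so. -/
theorem IsHeisenbergFlow.intertwine {Q₁ : ℝ → Space × Space → H₀ →L[ℂ] H₀}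
    {Q₂ : ℝ → Space × Space → H →L[ℂ] H} (hħ : 0 < ħ) (hQ₁ : IsHeisenbergFlow ħ b Q₁)
    (hQ₂ : IsHeisenbergFlow ħ b Q₂) (hb : IsCoupling a b) (hT : 0 ≤ T)
    (ha : HasCouplingMoment a T) (hsmall : T * couplingMoment a T ≤ 1 / 8) {B : H₀ →L[ℂ] H}
    (h : ∀ z x, Q₂ 0 z (B x) = B (Q₁ 0 z x)) {s : ℝ} (hs : s ∈ Set.Icc 0 T)
    (z : Space × Space) (x : H₀) : Q₂ s z (B x) = B (Q₁ s z x) := by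
  -- Exact intertwining at time zero is the first-order bound with L = 0, which propagates as 2L =
  -- 0.
  have h1 := IsHeisenbergFlow.norm_defect_le hħ hQ₁ hQ₂ hb hT ha hsmall B (L := 0) le_rfl
    (t := 0) ⟨le_rfl, hT⟩ (fun z => ?_) hs z
  · have h2 : defect (Q₁ s) (Q₂ s) B z = 0 := by
      rw [← norm_le_zero_iff]; simpa using h1
    have := congrArg (fun A => A x) h2
    simpa [defect_apply, sub_eq_zero] using this
  · have : defect (Q₁ 0) (Q₂ 0) B z = 0 := by
      ext x; simp [defect_apply, h]
    simp [this]

namespace IsMeanFieldFlow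

/-- Commutation is a case of intertwining, with the other operator in the role of B. It is applied
twice, evolving one particle at a time, which gives the relation at unequal times; observables
frozen at time t have to be compared with plane waves at time s. -/
theorem commute (hM : IsMeanFieldFlow ħ T a b Q₀ Q f ι F) {i j : Fin N} (hij : i ≠ j) {s t : ℝ}
    (hs : s ∈ Set.Icc 0 T) (ht : t ∈ Set.Icc 0 T) (z z' : Space × Space) (x : H) :
    Q i s z (Q j t z' x) = Q j t z' (Q i s z x) := by
  have h1 : ∀ z z' x, Q i s z (Q j 0 z' x) = Q j 0 z' (Q i s z x) := fun z z' x =>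
    (hM.flow i).intertwine hM.hbar_pos (hM.flow i) hM.coupling hM.time_nonneg hM.moment hM.small
      (fun z x => hM.commute_zero i j hij z z' x) hs z x
  exact ((hM.flow j).intertwine hM.hbar_pos (hM.flow j) hM.coupling hM.time_nonneg hM.moment
    hM.small (fun z' x => (h1 z z' x).symm) ht z' x).symm

theorem intertwine (hM : IsMeanFieldFlow ħ T a b Q₀ Q f ι F) (i : Fin N) {s : ℝ}
    (hs : s ∈ Set.Icc 0 T) (z : Space × Space) (g : H₀) : Q i s z (ι i g) = ι i (Q₀ s z g) :=
  hM.flow₀.intertwine hM.hbar_pos (hM.flow i) hM.coupling hM.time_nonneg hM.moment hM.small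
    (fun z x => hM.intertwine_zero i z x) hs z g

end IsMeanFieldFlow

/-- A family of one-particle operators `B i`, copies of `B₀`, of size `β` and with first-order
phase-space variation `ℓ`. -/
structure IsOneBodyFamily (ħ T : ℝ) {N : ℕ} (Q : Fin N → ℝ → Space × Space → H →L[ℂ] H)
    (ι : Fin N → H₀ →L[ℂ] H) (B : Fin N → H →L[ℂ] H) (B₀ : H₀ →L[ℂ] H₀) (β ℓ : ℝ) : Prop where
  size_nonneg : 0 ≤ β
  variation_nonneg : 0 ≤ ℓ
  norm_le₀ : ‖B₀‖ ≤ β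
  intertwine : ∀ i g, B i (ι i g) = ι i (B₀ g)
  commute : ∀ i j, i ≠ j → ∀ s ∈ Set.Icc 0 T, ∀ z x, B i (Q j s z x) = Q j s z (B i x)
  norm_defect_le : ∀ i, ∀ s ∈ Set.Icc 0 T, ∀ z, ‖defect (Q i s) (Q i s) (B i) z‖ ≤ ℓ * (ħ * ‖z‖)

namespace IsMeanFieldFlow

/-- At its own time a Weyl operator has variation 2‖z‖; propagation to other times doubles it. -/
theorem isOneBodyFamily (hM : IsMeanFieldFlow ħ T a b Q₀ Q f ι F) {t : ℝ} (ht : t ∈ Set.Icc 0 T)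
    (z : Space × Space) :
    IsOneBodyFamily ħ T Q ι (fun i => Q i t z) (Q₀ t z) 1 (4 * ‖z‖) where
  size_nonneg := zero_le_one
  variation_nonneg := by positivity
  norm_le₀ := (hM.flow₀.weyl t).opNorm_le z
  intertwine i g := hM.intertwine i ht z g
  commute i j hij s hs z' x := hM.commute hij ht hs z z' x
  norm_defect_le i s hs z' := by
    refine (IsHeisenbergFlow.norm_defect_le hM.hbar_pos (hM.flow i) (hM.flow i) hM.coupling
      hM.time_nonneg hM.moment hM.small (Q i t z) (L := 2 * ‖z‖) (by positivity) ht
      (fun z' => ((hM.flow i).weyl t).norm_defect_self_le hM.hbar_pos.le z z') hs z').trans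
      (le_of_eq (by ring))

theorem norm_secondDiff_le (hM : IsMeanFieldFlow ħ T a b Q₀ Q f ι F) {s t : ℝ}
    (ht : t ∈ Set.Icc 0 T) (hs : s ∈ Set.Icc 0 T) (z₀ : Space × Space) (i : Fin N)
    (z z' : Space × Space) :
    ‖secondDiff (Q i s) (Q i t z₀) z z'‖ ≤ 12 * (1 + ‖z₀‖) ^ 2 * (ħ ^ 2 * ‖z‖ * ‖z'‖) := by
  have hħ := hM.hbar_pos
  refine ((hM.flow i).norm_secondDiff_le hM.hbar_pos hM.coupling hM.time_nonneg hM.moment hM.small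
    (Q i t z₀) (L := 4 * ‖z₀‖) (M := 4 * ‖z₀‖ ^ 2) (by positivity) (by positivity)
    (fun s hs z => (hM.isOneBodyFamily ht z₀).norm_defect_le i s hs z) ht
    (fun z z' => ((hM.flow i).weyl t).norm_secondDiff_self_le hM.hbar_pos.le z₀ z z')
    hs z z').trans ?_
  have h0 := norm_nonneg z₀
  -- A single polynomial dominates the linear contribution, from first-order variation, and the
  -- quadratic one, from the second difference at time t.
  have h1 : 2 * (4 * ‖z₀‖ ^ 2 + 3 / 2 * (4 * ‖z₀‖)) ≤ 12 * (1 + ‖z₀‖) ^ 2 := by nlinarith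
  exact mul_le_mul_of_nonneg_right h1 (by positivity)

/-- The commutator of a one-body family with a plane wave is again a one-body family. -/
theorem isOneBodyFamily_defect (hM : IsMeanFieldFlow ħ T a b Q₀ Q f ι F)
    {B : Fin N → H →L[ℂ] H} {B₀ : H₀ →L[ℂ] H₀} {β ℓ M : ℝ} (hB : IsOneBodyFamily ħ T Q ι B B₀ β ℓ)
    (hM0 : 0 ≤ M)
    (hB2 : ∀ i, ∀ s ∈ Set.Icc 0 T, ∀ z z', ‖secondDiff (Q i s) (B i) z z'‖ ≤ M * (ħ ^ 2 * ‖z‖ * ‖z'‖))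
    {s : ℝ} (hs : s ∈ Set.Icc 0 T) (e : Space × Space) {ω : ℝ} (he : ‖e‖ ≤ ω)
    (hB₀ : ‖defect (Q₀ s) (Q₀ s) B₀ e‖ ≤ ℓ * (ħ * ‖e‖)) :
    IsOneBodyFamily ħ T Q ι (fun i => defect (Q i s) (Q i s) (B i) e)
      (defect (Q₀ s) (Q₀ s) B₀ e) (ħ * (ω * ℓ)) (ħ * (2 * ω * (M + 2 * ω * ℓ))) := by
  have hħ := hM.hbar_pos
  have hℓ := hB.variation_nonneg
  have hω : 0 ≤ ω := (norm_nonneg e).trans he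
  refine ⟨by positivity, by positivity, ?_, fun i g => ?_, ?_, ?_⟩
  · refine hB₀.trans ?_
    calc ℓ * (ħ * ‖e‖) ≤ ℓ * (ħ * ω) := by gcongr
      _ = _ := by ring
  · simp only [defect_apply, hM.intertwine i hs, hB.intertwine, map_sub]
  · intro i j hij r hr z x
    simp only [defect_apply, map_sub, hM.commute hij hs hr, hB.commute i j hij r hr]
  · intro i r hr z
    -- The defect of a defect is a second difference plus a phase error, both of order ħ². This
    -- holds at time s, and first-order propagation carries it to the other times.
    have h0 : ∀ z, ‖defect (Q i s) (Q i s) (defect (Q i s) (Q i s) (B i) e) z‖ ≤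
        (ħ * (ω * (M + 2 * ω * ℓ))) * (ħ * ‖z‖) := by
      intro z
      rw [((hM.flow i).weyl s).norm_defect_eq]
      refine (((hM.flow i).weyl s).norm_conjBy_defect_sub_le hħ.le (B i) z e).trans ?_
      have h1 := hB2 i s hs z e
      have h2 := hB.norm_defect_le i s hs e
      calc _ ≤ M * (ħ ^ 2 * ‖z‖ * ω) + 2 * ħ * ‖z‖ * ω * (ℓ * (ħ * ω)) := by
            gcongr
            · exact h1.trans (by gcongr)
            · exact h2.trans (by gcongr)
        _ = _ := by ring
    refine (IsHeisenbergFlow.norm_defect_le hħ (hM.flow i) (hM.flow i) hM.coupling hM.time_nonneg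
      hM.moment hM.small _ (by positivity) hs h0 hr z).trans (le_of_eq (by ring))

end IsMeanFieldFlow

end MeanFieldFlow

/-! ### The fluctuation dynamics and its commutators -/

section FluctuationDynamics

variable {H₀ : Type*} [NormedAddCommGroup H₀] [InnerProductSpace ℂ H₀]
  {H : Type*} [NormedAddCommGroup H] [InnerProductSpace ℂ H] {N : ℕ}

theorem inner_fluct_left {B B' : Fin N → H →L[ℂ] H} (c : ℂ)
    (h : ∀ i x y, inner ℂ (B i x) y = inner ℂ x (B' i y)) (x y : H) :
    inner ℂ (fluct B c x) y = inner ℂ x (fluct B' (conj c) y) := by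
  simp only [fluct_apply, particleMean_apply, inner_sub_left, inner_sub_right, inner_smul_left,
    inner_smul_right, sum_inner, inner_sum, h]
  simp

/-- The fluctuation of the empirical average of the plane wave of frequency `κ` around its
expectation in the mean-field state. -/
def waveFluct (Q₀ : ℝ → Space × Space → H₀ →L[ℂ] H₀) (Q : Fin N → ℝ → Space × Space → H →L[ℂ] H)
    (f : H₀) (s : ℝ) (κ : Space) : H →L[ℂ] H :=
  fluct (fun i => Q i s (planeWave s κ)) (inner ℂ f (Q₀ s (planeWave s κ) f))

/-- The generator of the fluctuation dynamics. -/
def fluctGenerator (ħ : ℝ) (a : Space → ℂ) (Q₀ : ℝ → Space × Space → H₀ →L[ℂ] H₀)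
    (Q : Fin N → ℝ → Space × Space → H →L[ℂ] H) (f : H₀) (s : ℝ) (c : ℝ) (x : H) : H :=
  -(Complex.I / ħ) • ((N / 2 : ℂ) •
    (∫ κ, a κ • waveFluct Q₀ Q f s κ (waveFluct Q₀ Q f s (-κ) x)) + (c : ℂ) • x)

/-- `φ` is the `N`-body state in the mean-field Heisenberg frame. -/
structure IsFluctuationDynamics (ħ T : ℝ) (a : Space → ℂ)
    (Q₀ : ℝ → Space × Space → H₀ →L[ℂ] H₀) (Q : Fin N → ℝ → Space × Space → H →L[ℂ] H)
    (f : H₀) (F : H) (φ : ℝ → H) : Prop where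
  real : ∀ κ, conj (a κ) = a κ
  continuousOn : ContinuousOn φ (Set.Icc 0 T)
  map_zero : φ 0 = F
  hasDerivAt : ∃ c : ℝ → ℝ, ∀ s ∈ Set.Ioo 0 T,
    HasDerivAt φ (fluctGenerator ħ a Q₀ Q f s (c s) (φ s)) s

variable {ħ T : ℝ} {a : Space → ℂ} {b : ℝ → Space → ℂ}
  {Q₀ : ℝ → Space × Space → H₀ →L[ℂ] H₀} {Q : Fin N → ℝ → Space × Space → H →L[ℂ] H}
  {f : H₀} {ι : Fin N → H₀ →L[ℂ] H} {F : H} {φ : ℝ → H}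

namespace IsMeanFieldFlow

theorem inner_waveFluct_left (hM : IsMeanFieldFlow ħ T a b Q₀ Q f ι F) (s : ℝ) (κ : Space)
    (x y : H) : inner ℂ (waveFluct Q₀ Q f s κ x) y = inner ℂ x (waveFluct Q₀ Q f s (-κ) y) := by
  rw [waveFluct, inner_fluct_left (B' := fun i => Q i s (planeWave s (-κ)))]
  · rw [waveFluct, inner_conj_symm, (hM.flow₀.weyl s).inner_map_left, planeWave_neg]
  · intro i x y
    rw [((hM.flow i).weyl s).inner_map_left, planeWave_neg]

theorem continuous_waveFluct (hM : IsMeanFieldFlow ħ T a b Q₀ Q f ι F) (s : ℝ)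
    {g : Space → Space} {y : Space → H} (hg : Continuous g) (hy : Continuous y) :
    Continuous fun κ => waveFluct Q₀ Q f s (g κ) (y κ) := by
  have hp : Continuous fun κ => planeWave s (g κ) :=
    continuous_planeWave.comp (Continuous.prodMk continuous_const hg)
  simp only [waveFluct, fluct_apply, particleMean_apply]
  refine ((continuous_finsetSum _ fun i _ =>
    ((hM.flow i).weyl s).continuous_apply hp hy).const_smul _).sub (Continuous.smul ?_ hy)
  exact continuous_const.inner (((hM.flow₀.weyl s).strong_continuous f).comp hp)

theorem norm_inner_state_le (hM : IsMeanFieldFlow ħ T a b Q₀ Q f ι F) {B : H₀ →L[ℂ] H₀} {β : ℝ}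
    (hB : ‖B‖ ≤ β) : ‖inner ℂ f (B f)‖ ≤ β := by
  refine (norm_inner_le_norm _ _).trans ?_
  have := B.le_of_opNorm_le hB f
  rw [hM.norm_state] at this ⊢
  linarith

theorem norm_waveFluct_le (hM : IsMeanFieldFlow ħ T a b Q₀ Q f ι F) (s : ℝ) (κ : Space) (x : H) :
    ‖waveFluct Q₀ Q f s κ x‖ ≤ 2 * ‖x‖ := by
  have := norm_fluct_le zero_le_one (fun i => ((hM.flow i).weyl s).opNorm_le (planeWave s κ))
    (hM.norm_inner_state_le ((hM.flow₀.weyl s).opNorm_le (planeWave s κ))) x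
  rwa [mul_one] at this

theorem integrable_pairing (hM : IsMeanFieldFlow ħ T a b Q₀ Q f ι F) (s : ℝ) (x : H) :
    Integrable fun κ => a κ • waveFluct Q₀ Q f s κ (waveFluct Q₀ Q f s (-κ) x) := by
  have hc := hM.continuous_waveFluct s continuous_id
    (hM.continuous_waveFluct s continuous_neg (continuous_const (y := x)))
  refine ((hM.moment.integrable_norm hM.time_nonneg).mul_const (2 * (2 * ‖x‖))).mono'
    (hM.moment.measurable.smul hc.aestronglyMeasurable) (Eventually.of_forall fun κ => ?_)
  rw [norm_smul]
  gcongr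
  exact (hM.norm_waveFluct_le s _ _).trans (by gcongr; exact hM.norm_waveFluct_le s _ _)

variable [CompleteSpace H₀] [CompleteSpace H]

/-- The adjoint of the fluctuation at κ is the one at -κ, so with real coefficients every δ_κ δ_{-κ}
is symmetric. The generator is therefore skew, whatever the real scalar c is. -/
theorem inner_pairing_left (hM : IsMeanFieldFlow ħ T a b Q₀ Q f ι F)
    (hr : ∀ κ, conj (a κ) = a κ) (s : ℝ) (x y : H) :
    inner ℂ (∫ κ, a κ • waveFluct Q₀ Q f s κ (waveFluct Q₀ Q f s (-κ) x)) y =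
      inner ℂ x (∫ κ, a κ • waveFluct Q₀ Q f s κ (waveFluct Q₀ Q f s (-κ) y)) := by
  rw [← inner_conj_symm, ← integral_inner (hM.integrable_pairing s x),
    ← integral_inner (hM.integrable_pairing s y), ← integral_conj]
  congr 1; funext κ
  rw [inner_conj_symm, inner_smul_left, inner_smul_right, hr, hM.inner_waveFluct_left,
    hM.inner_waveFluct_left, neg_neg]

theorem inner_fluctGenerator_left (hM : IsMeanFieldFlow ħ T a b Q₀ Q f ι F)
    (hr : ∀ κ, conj (a κ) = a κ) (s c : ℝ) (x y : H) :
    inner ℂ (fluctGenerator ħ a Q₀ Q f s c x) y = -inner ℂ x (fluctGenerator ħ a Q₀ Q f s c y) := by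
  simp only [fluctGenerator, inner_smul_left, inner_smul_right, inner_add_left, inner_add_right,
    hM.inner_pairing_left hr]
  simp [map_ofNat]
  ring

theorem re_inner_fluctGenerator (hM : IsMeanFieldFlow ħ T a b Q₀ Q f ι F)
    (hr : ∀ κ, conj (a κ) = a κ) (s c : ℝ) (x : H) :
    (inner ℂ x (fluctGenerator ħ a Q₀ Q f s c x)).re = 0 := by
  have h := hM.inner_fluctGenerator_left hr s c x x
  rw [← inner_conj_symm] at h
  have := congrArg Complex.re h
  simp only [Complex.conj_re, Complex.neg_re] at this
  linarith

theorem norm_state_le (hM : IsMeanFieldFlow ħ T a b Q₀ Q f ι F)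
    (hφ : IsFluctuationDynamics ħ T a Q₀ Q f F φ) {t : ℝ} (ht : t ∈ Set.Icc 0 T) : ‖φ t‖ ≤ 1 := by
  obtain ⟨c, hc⟩ := hφ.hasDerivAt
  have h := norm_le_add_mul_of_re_inner_le (G := 0) ht.1 le_rfl
    (hφ.continuousOn.mono (Set.Icc_subset_Icc_right ht.2))
    (fun s hs => hc s ⟨hs.1, hs.2.trans_le ht.2⟩)
    (fun s _ => by rw [hM.re_inner_fluctGenerator hφ.real, mul_zero])
  rw [hφ.map_zero, ← hM.embed_state ⟨0, hM.card_pos⟩, hM.norm_embed, hM.norm_state] at h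
  simpa using h

/-- The commutator of a one-body fluctuation with the pairing of two plane-wave fluctuations. -/
def pairingCommutator (Q₀ : ℝ → Space × Space → H₀ →L[ℂ] H₀)
    (Q : Fin N → ℝ → Space × Space → H →L[ℂ] H) (f : H₀) (D : H →L[ℂ] H) (s : ℝ) (κ : Space)
    (x : H) : H :=
  D (waveFluct Q₀ Q f s κ (waveFluct Q₀ Q f s (-κ) x)) -
    waveFluct Q₀ Q f s κ (waveFluct Q₀ Q f s (-κ) (D x))

/-- The average of the commutators of the operators `B i` with the plane waves. -/
def waveDefect (Q : Fin N → ℝ → Space × Space → H →L[ℂ] H) (B : Fin N → H →L[ℂ] H) (s : ℝ)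
    (κ : Space) : Fin N → H →L[ℂ] H :=
  fun i => defect (Q i s) (Q i s) (B i) (planeWave s κ)

/-- The first term is skew and does not change the norm of D x; the growth of D along the dynamics
is due to the commutator alone. -/
theorem _root_.map_fluctGenerator (hM : IsMeanFieldFlow ħ T a b Q₀ Q f ι F) (D : H →L[ℂ] H)
    (s c : ℝ) (x : H) :
    D (fluctGenerator ħ a Q₀ Q f s c x) = fluctGenerator ħ a Q₀ Q f s c (D x) +
      -(Complex.I / ħ) • (N / 2 : ℂ) • ∫ κ, a κ • pairingCommutator Q₀ Q f D s κ x := by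
  have h1 := hM.integrable_pairing s x
  have h2 := hM.integrable_pairing s (D x)
  have h3 := D.integrable_comp h1
  have e : ∫ κ, a κ • pairingCommutator Q₀ Q f D s κ x =
      D (∫ κ, a κ • waveFluct Q₀ Q f s κ (waveFluct Q₀ Q f s (-κ) x)) -
        ∫ κ, a κ • waveFluct Q₀ Q f s κ (waveFluct Q₀ Q f s (-κ) (D x)) := by
    rw [← D.integral_comp_comm h1, ← integral_sub h3 h2]
    congr 1; funext κ
    rw [pairingCommutator, smul_sub, map_smul]
  rw [e]
  simp only [fluctGenerator, map_smul, map_add]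
  module

variable {B : Fin N → H →L[ℂ] H} {B₀ : H₀ →L[ℂ] H₀} {β ℓ : ℝ}

/-- Among the N² pairs of particles only the N diagonal ones fail to commute, and scalars drop out.
This is where one factor 1/N is gained. -/
theorem fluct_waveFluct_commutator (hB : IsOneBodyFamily ħ T Q ι B B₀ β ℓ) (c : ℂ) {s : ℝ}
    (hs : s ∈ Set.Icc 0 T) (κ : Space) (x : H) :
    fluct B c (waveFluct Q₀ Q f s κ x) - waveFluct Q₀ Q f s κ (fluct B c x) =
      -((N : ℂ)⁻¹ • particleMean (waveDefect Q B s κ) x) := by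
  rw [waveFluct, fluct_commutator _ _ (fun i j hij x => hB.commute i j hij s hs _ x), ← smul_neg]
  congr 1
  rw [← _root_.neg_apply]
  congr 1
  rw [particleMean, particleMean, ← smul_neg, ← Finset.sum_neg_distrib]
  congr 2; funext i
  rw [waveDefect, defect]; abel

theorem norm_waveDefect_le (hB : IsOneBodyFamily ħ T Q ι B B₀ β ℓ) (hħ : 0 ≤ ħ) {s : ℝ}
    (hs : s ∈ Set.Icc 0 T) (κ : Space) (i : Fin N) :
    ‖waveDefect Q B s κ i‖ ≤ ħ * (waveBound T κ * ℓ) := by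
  have hℓ := hB.variation_nonneg
  refine (hB.norm_defect_le i s hs _).trans ?_
  calc _ ≤ ℓ * (ħ * waveBound T κ) := by gcongr; exact norm_planeWave_le hs κ
    _ = _ := by ring

/-- Used to move a plane-wave fluctuation next to the state. The prefactor 1/N comes from the
diagonal and ħ from the inner defect; the outer commutator is estimated trivially. -/
theorem norm_waveFluct_waveDefect_commutator_le (hM : IsMeanFieldFlow ħ T a b Q₀ Q f ι F)
    (hB : IsOneBodyFamily ħ T Q ι B B₀ β ℓ) {s : ℝ}
    (hs : s ∈ Set.Icc 0 T) (κ κ' : Space) (x : H) :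
    ‖waveFluct Q₀ Q f s κ (particleMean (waveDefect Q B s κ') x) -
      particleMean (waveDefect Q B s κ') (waveFluct Q₀ Q f s κ x)‖ ≤
      2 * (ħ * (waveBound T κ' * ℓ)) / N * ‖x‖ := by
  have hℓ := hB.variation_nonneg
  have hħ := hM.hbar_pos
  have hω := waveBound_nonneg hM.time_nonneg κ'
  have h := fluct_commutator (B := fun i => Q i s (planeWave s κ)) (C := waveDefect Q B s κ')
    (inner ℂ f (Q₀ s (planeWave s κ) f)) 0 (fun i j hij x => by
      simp only [waveDefect, defect_apply, map_sub]
      rw [hM.commute hij hs hs, ← hB.commute j i hij.symm s hs,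
        ← hB.commute j i hij.symm s hs, hM.commute hij hs hs]) x
  have e : ∀ y, fluct (waveDefect Q B s κ') 0 y = particleMean (waveDefect Q B s κ') y := by
    intro y; simp [fluct_apply]
  rw [e, e] at h
  rw [waveFluct, h, div_mul_eq_mul_div]
  refine norm_inv_natCast_smul_le ?_
  refine (particleMean _).le_of_opNorm_le (norm_particleMean_le (by positivity) fun i => ?_) x
  have h1 := _root_.norm_defect_le ((hM.flow i).weyl s) ((hM.flow i).weyl s)
    (waveDefect Q B s κ' i) (planeWave s κ)
  have h2 := norm_waveDefect_le hB hħ.le hs κ' i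
  refine h1.trans (by gcongr)

theorem pairingCommutator_eq (hB : IsOneBodyFamily ħ T Q ι B B₀ β ℓ) (c : ℂ) {s : ℝ}
    (hs : s ∈ Set.Icc 0 T) (κ : Space) (x : H) :
    pairingCommutator Q₀ Q f (fluct B c) s κ x = -((N : ℂ)⁻¹ •
      (particleMean (waveDefect Q B s κ) (waveFluct Q₀ Q f s (-κ) x) +
        waveFluct Q₀ Q f s κ (particleMean (waveDefect Q B s (-κ)) x))) := by
  have h1 := fluct_waveFluct_commutator (Q₀ := Q₀) (f := f) hB c hs κ (waveFluct Q₀ Q f s (-κ) x)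
  have h2 := congrArg (waveFluct Q₀ Q f s κ)
    (fluct_waveFluct_commutator (Q₀ := Q₀) (f := f) hB c hs (-κ) x)
  rw [map_sub, map_neg, map_smul] at h2
  rw [pairingCommutator, smul_add, neg_add, ← h1, ← h2]
  abel

/-- Both terms of `pairingCommutator_eq` are brought to the form of an averaged defect acting on a
fluctuation of x, at the cost of one commutator of order ħ/N. The outcome is (ħ/N)(G + 1/N), just
enough to compensate the N/ħ of the generator. -/
theorem norm_pairingCommutator_le (hM : IsMeanFieldFlow ħ T a b Q₀ Q f ι F)
    (hB : IsOneBodyFamily ħ T Q ι B B₀ β ℓ) (c : ℂ) {s : ℝ}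
    (hs : s ∈ Set.Icc 0 T) (κ : Space) {x : H} (hx : ‖x‖ ≤ 1) {G : ℝ}
    (hG : ∀ κ, ‖waveFluct Q₀ Q f s κ x‖ ≤ G * (1 + waveBound T κ)) :
    ‖pairingCommutator Q₀ Q f (fluct B c) s κ x‖ ≤
      2 * (ħ * (waveBound T κ * ℓ)) * (G * (1 + waveBound T κ) + 1 / N) / N := by
  have hℓ := hB.variation_nonneg
  have hħ := hM.hbar_pos
  have hω := waveBound_nonneg hM.time_nonneg κ
  rw [pairingCommutator_eq hB c hs, norm_neg]
  refine norm_inv_natCast_smul_le ?_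
  have h0 : ∀ κ', waveBound T κ' = waveBound T κ →
      ‖particleMean (waveDefect Q B s κ')‖ ≤ ħ * (waveBound T κ * ℓ) := fun κ' h' =>
    norm_particleMean_le (by positivity) fun i => h' ▸ norm_waveDefect_le hB hħ.le hs κ' i
  have h1 := (particleMean (waveDefect Q B s κ)).le_of_opNorm_le (h0 κ rfl)
    (waveFluct Q₀ Q f s (-κ) x)
  have h2 := (particleMean (waveDefect Q B s (-κ))).le_of_opNorm_le (h0 (-κ) (waveBound_neg T κ))
    (waveFluct Q₀ Q f s κ x)
  have h3 := hM.norm_waveFluct_waveDefect_commutator_le hB hs κ (-κ) x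
  rw [waveBound_neg] at h3
  have h4 := hG (-κ)
  rw [waveBound_neg] at h4
  have h5 := norm_le_norm_add_norm_sub' (waveFluct Q₀ Q f s κ
    (particleMean (waveDefect Q B s (-κ)) x))
      (particleMean (waveDefect Q B s (-κ)) (waveFluct Q₀ Q f s κ x))
  refine (norm_add_le _ _).trans ?_
  have h6 : ħ * (waveBound T κ * ℓ) * ‖waveFluct Q₀ Q f s (-κ) x‖ ≤
      ħ * (waveBound T κ * ℓ) * (G * (1 + waveBound T κ)) := by gcongr
  have h7 : ħ * (waveBound T κ * ℓ) * ‖waveFluct Q₀ Q f s κ x‖ ≤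
      ħ * (waveBound T κ * ℓ) * (G * (1 + waveBound T κ)) := by gcongr; exact hG κ
  have h8 : 2 * (ħ * (waveBound T κ * ℓ)) / N * ‖x‖ ≤ 2 * (ħ * (waveBound T κ * ℓ)) / N :=
    mul_le_of_le_one_right (by positivity) hx
  have h9 : 2 * (ħ * (waveBound T κ * ℓ)) * (G * (1 + waveBound T κ) + 1 / N) =
    ħ * (waveBound T κ * ℓ) * (G * (1 + waveBound T κ)) +
    ħ * (waveBound T κ * ℓ) * (G * (1 + waveBound T κ)) +
    2 * (ħ * (waveBound T κ * ℓ)) / N := by ring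
  linarith

/-- The law of large numbers in Hilbert space: after subtraction of its expectation, B₀ f is
orthogonal to f, so its copies in different slots are mutually orthogonal by `inner_embed`. -/
theorem norm_fluct_state_le (hM : IsMeanFieldFlow ħ T a b Q₀ Q f ι F)
    (hB : IsOneBodyFamily ħ T Q ι B B₀ β ℓ) :
    ‖fluct B (inner ℂ f (B₀ f)) F‖ ≤ 2 * β / Real.sqrt N := by
  have hβ := hB.size_nonneg
  set g := B₀ f - (inner ℂ f (B₀ f) : ℂ) • f with hg
  have hf1 : (inner ℂ f f : ℂ) = 1 := by
    rw [inner_self_eq_norm_sq_to_K, hM.norm_state]; simp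
  have hgf : inner ℂ f g = 0 := by
    rw [hg, inner_sub_right, inner_smul_right, hf1, mul_one, sub_self]
  have hgβ : ‖g‖ ≤ 2 * β := by
    refine (norm_sub_le _ _).trans ?_
    have h1 := B₀.le_of_opNorm_le hB.norm_le₀ f
    have h2 := hM.norm_inner_state_le hB.norm_le₀
    rw [norm_smul]
    rw [hM.norm_state] at h1 ⊢
    linarith
  have hN : (N : ℂ) ≠ 0 := by exact_mod_cast hM.card_pos.ne'
  have e : fluct B (inner ℂ f (B₀ f)) F = (N : ℂ)⁻¹ • ∑ i, ι i g := by
    have h1 : ∀ i, ι i g = B i F - (inner ℂ f (B₀ f) : ℂ) • F := by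
      intro i
      rw [hg, map_sub, map_smul, hM.embed_state, ← hB.intertwine, hM.embed_state]
    simp only [h1, Finset.sum_sub_distrib, smul_sub, fluct_apply, particleMean_apply]
    congr 1
    rw [Finset.sum_const, Finset.card_univ, Fintype.card_fin, ← Nat.cast_smul_eq_nsmul ℂ,
      smul_smul, smul_smul, inv_mul_cancel₀ hN, one_mul]
  rw [e]
  refine norm_inv_smul_sum_orthogonal_le hM.card_pos _ (by positivity) (fun i => ?_) ?_
  · rw [hM.norm_embed]; exact hgβ
  · intro i j hij
    rw [hM.inner_embed i j hij, hgf, mul_zero]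

/-- Growth of one-body fluctuations, given a bound on the plane-wave fluctuations. -/
theorem norm_fluct_le_add (hM : IsMeanFieldFlow ħ T a b Q₀ Q f ι F)
    (hφ : IsFluctuationDynamics ħ T a Q₀ Q f F φ) (hB : IsOneBodyFamily ħ T Q ι B B₀ β ℓ)
    {G : ℝ} (hG0 : 0 ≤ G)
    (hG : ∀ s ∈ Set.Icc 0 T, ∀ κ, ‖waveFluct Q₀ Q f s κ (φ s)‖ ≤ G * (1 + waveBound T κ))
    {t : ℝ} (ht : t ∈ Set.Icc 0 T) :
    ‖fluct B (inner ℂ f (B₀ f)) (φ t)‖ ≤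
      2 * β / Real.sqrt N + ℓ * (G + 1 / N) * (T * couplingMoment a T) := by
  obtain ⟨c, hc⟩ := hφ.hasDerivAt
  have hℓ := hB.variation_nonneg
  have hħ := hM.hbar_pos
  have hN : (0 : ℝ) < N := by exact_mod_cast hM.card_pos
  have hΛ := couplingMoment_nonneg a hM.time_nonneg
  set D := fluct B (inner ℂ f (B₀ f)) with hD
  -- The prefactor N/(2ħ) cancels the factor 2ħ/N in the commutator bound, leaving a rate
  -- independent of ħ and N apart from G and 1/N.
  have hR : ∀ s ∈ Set.Ioo 0 T, ‖-(Complex.I / ħ) • (N / 2 : ℂ) • ∫ κ, a κ •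
      pairingCommutator Q₀ Q f D s κ (φ s)‖ ≤ ℓ * (G + 1 / N) * couplingMoment a T := by
    intro s hs
    have hs' : s ∈ Set.Icc 0 T := ⟨hs.1.le, hs.2.le⟩
    rw [norm_smul, norm_neg_I_div hħ, norm_smul, norm_div, Complex.norm_natCast]
    have h1 := hM.moment.norm_integral_le (c := 2 * (ħ * ℓ) * (G + 1 / N) / N)
      (F := fun κ => a κ • pairingCommutator Q₀ Q f D s κ (φ s)) (fun κ => by
        have hω := waveBound_nonneg hM.time_nonneg κ
        rw [norm_smul]
        gcongr
        refine (hM.norm_pairingCommutator_le hB _ hs' κ (hM.norm_state_le hφ hs')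
          (hG s hs')).trans ?_
        calc _ = 2 * (ħ * ℓ) / N *
              (G * (waveBound T κ * (1 + waveBound T κ)) + 1 / N * waveBound T κ) := by ring
          _ ≤ 2 * (ħ * ℓ) / N * (G * (1 + waveBound T κ) ^ 4 + 1 / N * (1 + waveBound T κ) ^ 4) := by
              gcongr
              · nlinarith [pow_nonneg hω 3, pow_nonneg hω 2, pow_nonneg hω 4]
              · nlinarith [pow_nonneg hω 3, pow_nonneg hω 2, pow_nonneg hω 4]
          _ = _ := by ring)
    calc _ ≤ ħ⁻¹ * (N / ‖(2 : ℂ)‖ * (2 * (ħ * ℓ) * (G + 1 / N) / N * couplingMoment a T)) := by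
          gcongr
      _ = _ := by rw [Complex.norm_ofNat]; field_simp
  have h := norm_le_add_mul_of_re_inner_le (v := fun s => D (φ s)) ht.1
    (G := ℓ * (G + 1 / N) * couplingMoment a T) (by positivity)
    (D.continuous.comp_continuousOn (hφ.continuousOn.mono (Set.Icc_subset_Icc_right ht.2)))
    (fun s hs => (D.restrictScalars ℝ).hasFDerivAt.comp_hasDerivAt s
      (hc s ⟨hs.1, hs.2.trans_le ht.2⟩))
    (fun s hs => by
      change (inner ℂ (D (φ s)) (D (fluctGenerator ħ a Q₀ Q f s (c s) (φ s)))).re ≤ _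
      rw [map_fluctGenerator hM, inner_add_right, Complex.add_re,
        hM.re_inner_fluctGenerator hφ.real, zero_add]
      refine (Complex.re_le_norm _).trans ((norm_inner_le_norm _ _).trans ?_)
      gcongr
      exact hR s ⟨hs.1, hs.2.trans_le ht.2⟩)
  rw [hφ.map_zero] at h
  refine h.trans (add_le_add (hM.norm_fluct_state_le hB) ?_)
  calc t * (ℓ * (G + 1 / N) * couplingMoment a T) ≤ T * (ℓ * (G + 1 / N) * couplingMoment a T) := by
        gcongr; exact ht.2
    _ = _ := by ring

end IsMeanFieldFlow

end FluctuationDynamics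

/-! ### Sizes of fluctuations: norm of order N^{-1/2}, expectation of order 1/N -/

section FluctuationBounds

variable {H₀ : Type*} [NormedAddCommGroup H₀] [InnerProductSpace ℂ H₀] [CompleteSpace H₀]
  {H : Type*} [NormedAddCommGroup H] [InnerProductSpace ℂ H] [CompleteSpace H] {N : ℕ}
  {ħ T : ℝ} {a : Space → ℂ} {b : ℝ → Space → ℂ}
  {Q₀ : ℝ → Space × Space → H₀ →L[ℂ] H₀} {Q : Fin N → ℝ → Space × Space → H →L[ℂ] H}
  {f : H₀} {ι : Fin N → H₀ →L[ℂ] H} {F : H} {φ : ℝ → H}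
  {B : Fin N → H →L[ℂ] H} {B₀ : H₀ →L[ℂ] H₀} {β ℓ : ℝ}

theorem one_div_le_one_div_sqrt {N : ℕ} (hN : 0 < N) : 1 / (N : ℝ) ≤ 1 / Real.sqrt N := by
  have hN1 : (1 : ℝ) ≤ N := by exact_mod_cast hN
  have hs : 1 ≤ Real.sqrt N := Real.one_le_sqrt.2 hN1
  have h2 : Real.sqrt N ≤ N := by
    nlinarith [Real.mul_self_sqrt (zero_le_one.trans hN1)]
  exact one_div_le_one_div_of_le (by linarith) h2

namespace IsMeanFieldFlow

/-- Fluctuations of plane waves are of order `1 / √N`. -/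
theorem norm_waveFluct_state_le (hM : IsMeanFieldFlow ħ T a b Q₀ Q f ι F)
    (hφ : IsFluctuationDynamics ħ T a Q₀ Q f F φ) {s : ℝ} (hs : s ∈ Set.Icc 0 T) (κ : Space) :
    ‖waveFluct Q₀ Q f s κ (φ s)‖ ≤ 5 / Real.sqrt N * (1 + waveBound T κ) := by
  have hN : (0 : ℝ) < N := by exact_mod_cast hM.card_pos
  have hsq := Real.sqrt_pos.2 hN
  -- The trivial bound ‖δφ‖ ≤ 2 corresponds to M = 2√N. One pass gives 2 + ω(M + 1)/2 ≤ (5/2 +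
  -- M/2)(1 + ω), whence c = 5/2.
  have key := le_of_forall_improve (α := Set.Icc (0 : ℝ) T × Space)
    (n := fun i => ‖waveFluct Q₀ Q f i.1 i.2 (φ i.1)‖)
    (g := fun i => (1 + waveBound T i.2) / Real.sqrt N) (c := 5 / 2) (M := 2 * Real.sqrt N)
    (by norm_num) (by positivity) ?_ ?_ (⟨s, hs⟩, κ)
  · refine key.trans (le_of_eq ?_)
    ring
  · rintro ⟨⟨r, hr⟩, κ⟩
    have hω := waveBound_nonneg hM.time_nonneg κ
    have h1 := hM.norm_waveFluct_le r κ (φ r)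
    have h2 := hM.norm_state_le hφ hr
    dsimp only
    calc ‖waveFluct Q₀ Q f r κ (φ r)‖ ≤ 2 * (1 + waveBound T κ) := by linarith
      _ = _ := by field_simp
  · rintro M hM0 hn ⟨⟨r, hr⟩, κ⟩
    have hω := waveBound_nonneg hM.time_nonneg κ
    dsimp only
    have h1 := hM.norm_fluct_le_add hφ (hM.isOneBodyFamily hr (planeWave r κ))
      (G := M / Real.sqrt N) (by positivity) (fun s hs κ => (hn (⟨s, hs⟩, κ)).trans
        (le_of_eq (by ring))) hr
    refine h1.trans ?_
    have h2 := norm_planeWave_le hr κ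
    have h3 := one_div_le_one_div_sqrt hM.card_pos
    have h4 := hM.small
    have h5 : 0 ≤ T * couplingMoment a T :=
      mul_nonneg hM.time_nonneg (couplingMoment_nonneg a hM.time_nonneg)
    calc _ ≤ 2 * 1 / Real.sqrt N +
          4 * waveBound T κ * (M / Real.sqrt N + 1 / Real.sqrt N) * (1 / 8) := by gcongr
      _ = (2 + waveBound T κ * (M + 1) / 2) / Real.sqrt N := by ring
      _ ≤ ((5 / 2 + M / 2) * (1 + waveBound T κ)) / Real.sqrt N := by
          gcongr
          nlinarith
      _ = _ := by ring

/-- One-body fluctuations are of order `1 / √N`. -/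
theorem norm_fluct_le (hM : IsMeanFieldFlow ħ T a b Q₀ Q f ι F)
    (hφ : IsFluctuationDynamics ħ T a Q₀ Q f F φ) (hB : IsOneBodyFamily ħ T Q ι B B₀ β ℓ)
    {t : ℝ} (ht : t ∈ Set.Icc 0 T) :
    ‖fluct B (inner ℂ f (B₀ f)) (φ t)‖ ≤
      (2 * β + 6 * ℓ * (T * couplingMoment a T)) / Real.sqrt N := by
  have hN : (0 : ℝ) < N := by exact_mod_cast hM.card_pos
  have hℓ := hB.variation_nonneg
  have hsq := Real.sqrt_pos.2 hN
  refine (hM.norm_fluct_le_add hφ hB (G := 5 / Real.sqrt N) (by positivity)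
    (fun s hs κ => hM.norm_waveFluct_state_le hφ hs κ) ht).trans ?_
  have h3 := one_div_le_one_div_sqrt hM.card_pos
  have h5 : 0 ≤ T * couplingMoment a T :=
    mul_nonneg hM.time_nonneg (couplingMoment_nonneg a hM.time_nonneg)
  calc _ ≤ 2 * β / Real.sqrt N + ℓ * (5 / Real.sqrt N + 1 / Real.sqrt N) *
        (T * couplingMoment a T) := by gcongr
    _ = _ := by ring

/-- The fluctuation is exactly centred in the product state, so the estimate of its expectation has
no initial term. -/
theorem inner_fluct_state (hM : IsMeanFieldFlow ħ T a b Q₀ Q f ι F)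
    (hB : IsOneBodyFamily ħ T Q ι B B₀ β ℓ) :
    inner ℂ F (fluct B (inner ℂ f (B₀ f)) F) = 0 := by
  have hN : (N : ℂ) ≠ 0 := by exact_mod_cast hM.card_pos.ne'
  have hi : ∀ i g, inner ℂ F (ι i g) = inner ℂ f g := fun i g => by
    rw [← hM.embed_state i]
    exact (⟨(ι i).toLinearMap, hM.norm_embed i⟩ : H₀ →ₗᵢ[ℂ] H).inner_map_map f g
  have h1 : ∀ i, inner ℂ F (B i F) = inner ℂ f (B₀ f) := fun i => by
    rw [← hi i (B₀ f), ← hB.intertwine, hM.embed_state]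
  have h2 : inner ℂ F F = (1 : ℂ) := by
    have h3 := hi ⟨0, hM.card_pos⟩ f
    rw [hM.embed_state] at h3
    rw [h3, inner_self_eq_norm_sq_to_K, hM.norm_state]; simp
  simp only [fluct_apply, particleMean_apply, inner_sub_right, inner_smul_right, inner_sum, h1, h2]
  simp [hN]

/-- The averaged defect is split into its own fluctuation and its expectation. The first part meets
δ_κ φ in a product of two vectors of size N^{-1/2}; the second is of order ħ times the expectation
of δ_κ, the quantity being estimated. That the fluctuation of the defect still carries a factor ħ is
what the second-order bounds are for. -/
theorem norm_inner_waveFluct_waveDefect_le (hM : IsMeanFieldFlow ħ T a b Q₀ Q f ι F)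
    (hφ : IsFluctuationDynamics ħ T a Q₀ Q f F φ) {t : ℝ} (ht : t ∈ Set.Icc 0 T)
    (z : Space × Space) {ε : ℝ} {s : ℝ} (hs : s ∈ Set.Icc 0 T) (κ : Space)
    (hε : ‖inner ℂ (φ s) (waveFluct Q₀ Q f s κ (φ s))‖ ≤ ε * (1 + waveBound T κ) ^ 2) :
    ‖inner ℂ (waveFluct Q₀ Q f s κ (φ s))
      (particleMean (waveDefect Q (fun i => Q i t z) s κ) (φ s))‖ ≤
      ħ * (1 + ‖z‖) ^ 2 * (1 + waveBound T κ) ^ 4 * (130 / N + 4 * ε) := by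
  have hħ := hM.hbar_pos
  have hω := waveBound_nonneg hM.time_nonneg κ
  have hN : (0 : ℝ) < N := by exact_mod_cast hM.card_pos
  have hsq := Real.sqrt_pos.2 hN
  have h5 : 0 ≤ T * couplingMoment a T :=
    mul_nonneg hM.time_nonneg (couplingMoment_nonneg a hM.time_nonneg)
  have hz := norm_nonneg z
  have hB := hM.isOneBodyFamily ht z
  have hC := hM.isOneBodyFamily_defect hB (M := 12 * (1 + ‖z‖) ^ 2) (by positivity)
    (fun i s hs z' z'' => hM.norm_secondDiff_le ht hs z i z' z'') hs (planeWave s κ)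
    (norm_planeWave_le hs κ)
    ((IsHeisenbergFlow.norm_defect_le hħ hM.flow₀ hM.flow₀ hM.coupling
      hM.time_nonneg hM.moment hM.small (Q₀ t z) (L := 2 * ‖z‖) (by positivity) ht
      (fun z' => (hM.flow₀.weyl t).norm_defect_self_le hħ.le z z') hs (planeWave s κ)).trans
      (le_of_eq (by ring)))
  have h1 := hM.norm_fluct_le hφ hC hs
  have h2 := hM.norm_inner_state_le hC.norm_le₀
  have h3 := hM.norm_waveFluct_state_le hφ hs κ
  change ‖inner ℂ (waveFluct Q₀ Q f s κ (φ s))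
      (particleMean (fun i => defect (Q i s) (Q i s) (Q i t z) (planeWave s κ)) (φ s))‖ ≤ _
  rw [particleMean_apply_eq _ (inner ℂ f (defect (Q₀ s) (Q₀ s) (Q₀ t z) (planeWave s κ) f)),
    inner_add_right, inner_smul_right]
  have hε' : ‖inner ℂ (waveFluct Q₀ Q f s κ (φ s)) (φ s)‖ ≤ ε * (1 + waveBound T κ) ^ 2 := by
    rwa [norm_inner_symm]
  have hε0 : 0 ≤ ε := by
    by_contra hneg
    have : ε * (1 + waveBound T κ) ^ 2 < 0 := mul_neg_of_neg_of_pos (not_le.1 hneg) (by positivity)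
    linarith [norm_nonneg (inner ℂ (waveFluct Q₀ Q f s κ (φ s)) (φ s))]
  set ω := waveBound T κ
  have hζ : ‖z‖ ≤ (1 + ‖z‖) ^ 2 := by nlinarith
  have hq := hM.small
  refine (norm_add_le _ _).trans ?_
  have h6 := (norm_inner_le_norm (𝕜 := ℂ) _ _).trans
    (mul_le_mul h3 h1 (norm_nonneg _) (by positivity))
  rw [norm_mul]
  have h7 := mul_le_mul h2 hε' (norm_nonneg _) (by positivity)
  refine (add_le_add h6 h7).trans ?_
  have e1 : Real.sqrt N * Real.sqrt N = N := Real.mul_self_sqrt hN.le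
  set Y := (1 + ‖z‖) ^ 2
  have hY : 0 ≤ Y := by positivity
  -- The variation term contributes 18ω + 12ω² because of the factor 1/8, the size term 8ω;
  -- multiplied by the 5 of the plane-wave bound, 26 becomes 130.
  have h8 : (2 * (ħ * (ω * (4 * ‖z‖))) +
      6 * (ħ * (2 * ω * (12 * Y + 2 * ω * (4 * ‖z‖)))) * (T * couplingMoment a T)) ≤
      26 * ħ * Y * (1 + ω) ^ 2 := by
    calc _ ≤ 2 * (ħ * (ω * (4 * Y))) +
          6 * (ħ * (2 * ω * (12 * Y + 2 * ω * (4 * Y)))) * (1 / 8) := by gcongr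
      _ = ħ * Y * (26 * ω + 12 * ω ^ 2) := by ring
      _ ≤ ħ * Y * (26 * (1 + ω) ^ 2) := by gcongr; nlinarith
      _ = _ := by ring
  have hω3 : (1 + ω) ^ 3 ≤ (1 + ω) ^ 4 := pow_le_pow_right₀ (by linarith) (by norm_num)
  calc _ ≤ 5 / Real.sqrt N * (1 + ω) * (26 * ħ * Y * (1 + ω) ^ 2 / Real.sqrt N) +
        ħ * (ω * (4 * Y)) * (ε * (1 + ω) ^ 2) := by gcongr
    _ = 130 * ħ * Y * (1 + ω) ^ 3 / (Real.sqrt N * Real.sqrt N) +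
        4 * ε * ħ * Y * (ω * (1 + ω) ^ 2) := by ring
    _ ≤ 130 * ħ * Y * (1 + ω) ^ 4 / N + 4 * ε * ħ * Y * (1 + ω) ^ 4 := by
        rw [e1]
        gcongr
        nlinarith [pow_nonneg hω 3, pow_nonneg hω 2, pow_nonneg hω 4]
    _ = _ := by ring

/-- In an expectation a fluctuation may act on the state from the left: both terms are rewritten
with δ applied to φ on one side and the averaged defect applied to φ on the other. The single
commutator needed costs 8ħ/N, which raises 130 to 134. -/
theorem norm_inner_pairingCommutator_le (hM : IsMeanFieldFlow ħ T a b Q₀ Q f ι F)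
    (hφ : IsFluctuationDynamics ħ T a Q₀ Q f F φ) {t : ℝ} (ht : t ∈ Set.Icc 0 T)
    (z : Space × Space) {ε : ℝ} (c : ℂ) {s : ℝ} (hs : s ∈ Set.Icc 0 T)
    (hε : ∀ κ, ‖inner ℂ (φ s) (waveFluct Q₀ Q f s κ (φ s))‖ ≤ ε * (1 + waveBound T κ) ^ 2)
    (κ : Space) :
    ‖inner ℂ (φ s) (pairingCommutator Q₀ Q f (fluct (fun i => Q i t z) c) s κ (φ s))‖ ≤
      2 * ħ * (1 + ‖z‖) ^ 2 * (134 / N + 4 * ε) / N * (1 + waveBound T κ) ^ 4 := by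
  have hħ := hM.hbar_pos
  have hω := waveBound_nonneg hM.time_nonneg κ
  have hN : (0 : ℝ) < N := by exact_mod_cast hM.card_pos
  have hB := hM.isOneBodyFamily ht z
  have h1 := hM.norm_inner_waveFluct_waveDefect_le hφ ht z hs κ (hε κ)
  have h2 := hM.norm_inner_waveFluct_waveDefect_le hφ ht z hs (-κ) (hε (-κ))
  rw [waveBound_neg] at h2
  have h3 := hM.norm_waveFluct_waveDefect_commutator_le hB hs (-κ) κ (φ s)
  rw [norm_sub_rev] at h3
  have h4 := hM.norm_state_le hφ hs
  have h5 := (norm_inner_le_norm (𝕜 := ℂ) (φ s) _).trans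
    (mul_le_mul h4 h3 (norm_nonneg _) zero_le_one)
  rw [pairingCommutator_eq hB c hs, inner_neg_right, norm_neg, inner_smul_right]
  have key := norm_inv_natCast_smul_le (N := N) (β := 2 * ħ * (1 + ‖z‖) ^ 2 * (134 / N + 4 * ε) *
    (1 + waveBound T κ) ^ 4) (v := (inner ℂ (φ s)
      (particleMean (waveDefect Q (fun i => Q i t z) s κ) (waveFluct Q₀ Q f s (-κ) (φ s)) +
        waveFluct Q₀ Q f s κ (particleMean (waveDefect Q (fun i => Q i t z) s (-κ)) (φ s))) : ℂ)) ?_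
  · rw [smul_eq_mul] at key
    exact key.trans (le_of_eq (by ring))
  set m := particleMean (waveDefect Q (fun i => Q i t z) s κ)
  set δ := waveFluct Q₀ Q f s (-κ)
  have e : m (δ (φ s)) = (m (δ (φ s)) - δ (m (φ s))) + δ (m (φ s)) := by abel
  rw [e, inner_add_right, inner_add_right]
  have e2 : inner ℂ (φ s) (δ (m (φ s))) = inner ℂ (waveFluct Q₀ Q f s κ (φ s)) (m (φ s)) :=
    (hM.inner_waveFluct_left s κ _ _).symm
  have e3 : inner ℂ (φ s) (waveFluct Q₀ Q f s κ
      (particleMean (waveDefect Q (fun i => Q i t z) s (-κ)) (φ s))) =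
      inner ℂ (waveFluct Q₀ Q f s (-κ) (φ s))
        (particleMean (waveDefect Q (fun i => Q i t z) s (-κ)) (φ s)) := by
    rw [hM.inner_waveFluct_left, neg_neg]
  rw [e2, e3]
  refine (norm_add₃_le).trans ((add_le_add (add_le_add h5 h1) h2).trans ?_)
  set ω := waveBound T κ
  have hz := norm_nonneg z
  have h6 : ω * ‖z‖ ≤ (1 + ‖z‖) ^ 2 * (1 + ω) ^ 4 := by
    have h7 : ‖z‖ ≤ (1 + ‖z‖) ^ 2 := by nlinarith
    have h8 : ω ≤ (1 + ω) ^ 4 := by nlinarith [pow_nonneg hω 3, pow_nonneg hω 2, pow_nonneg hω 4]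
    rw [mul_comm]
    exact mul_le_mul h7 h8 hω (by positivity)
  have h9 : 1 * (2 * (ħ * (ω * (4 * ‖z‖))) / N * ‖φ s‖) ≤
      8 * ħ / N * ((1 + ‖z‖) ^ 2 * (1 + ω) ^ 4) := by
    calc _ = 8 * ħ / N * (ω * ‖z‖) * ‖φ s‖ := by ring
      _ ≤ 8 * ħ / N * ((1 + ‖z‖) ^ 2 * (1 + ω) ^ 4) * 1 := by gcongr
      _ = _ := mul_one _
  refine (add_le_add_left (add_le_add_left h9 _) _).trans (le_of_eq ?_)
  field_simp
  ring

/-- In the derivative of ⟨φ, Dφ⟩, with D frozen at time t, the two generator terms cancel by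
skewness; only the expectation of the commutator is left, and the initial value is zero. -/
theorem norm_inner_fluct_le_add (hM : IsMeanFieldFlow ħ T a b Q₀ Q f ι F)
    (hφ : IsFluctuationDynamics ħ T a Q₀ Q f F φ) {t : ℝ} (ht : t ∈ Set.Icc 0 T)
    (z : Space × Space) {ε : ℝ} (hε0 : 0 ≤ ε)
    (hε : ∀ s ∈ Set.Icc 0 T, ∀ κ,
      ‖inner ℂ (φ s) (waveFluct Q₀ Q f s κ (φ s))‖ ≤ ε * (1 + waveBound T κ) ^ 2) :
    ‖inner ℂ (φ t) (fluct (fun i => Q i t z) (inner ℂ f (Q₀ t z f)) (φ t))‖ ≤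
      T * couplingMoment a T * (1 + ‖z‖) ^ 2 * (134 / N + 4 * ε) := by
  obtain ⟨c, hc⟩ := hφ.hasDerivAt
  have hħ := hM.hbar_pos
  have hN : (0 : ℝ) < N := by exact_mod_cast hM.card_pos
  have hΛ := couplingMoment_nonneg a hM.time_nonneg
  have hB := hM.isOneBodyFamily ht z
  set D := fluct (fun i => Q i t z) (inner ℂ f (Q₀ t z f)) with hD
  have hint : ∀ s, Integrable fun κ => a κ • pairingCommutator Q₀ Q f D s κ (φ s) := by
    intro s
    have := (D.integrable_comp (hM.integrable_pairing s (φ s))).sub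
      (hM.integrable_pairing s (D (φ s)))
    refine this.congr (Eventually.of_forall fun κ => ?_)
    simp only [pairingCommutator, smul_sub, Pi.sub_apply, map_smul]
  have hR : ∀ s ∈ Set.Ioo 0 T, ‖inner ℂ (φ s) (-(Complex.I / ħ) • (N / 2 : ℂ) • ∫ κ, a κ •
      pairingCommutator Q₀ Q f D s κ (φ s))‖ ≤
      (1 + ‖z‖) ^ 2 * (134 / N + 4 * ε) * couplingMoment a T := by
    intro s hs
    have hs' : s ∈ Set.Icc 0 T := ⟨hs.1.le, hs.2.le⟩
    rw [inner_smul_right, inner_smul_right, norm_mul, norm_neg_I_div hħ, norm_mul, norm_div,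
      Complex.norm_natCast, ← integral_inner (hint s)]
    have h1 := hM.moment.norm_integral_le (c := 2 * ħ * (1 + ‖z‖) ^ 2 * (134 / N + 4 * ε) / N)
      (F := fun κ => inner ℂ (φ s) (a κ • pairingCommutator Q₀ Q f D s κ (φ s))) (fun κ => by
        rw [inner_smul_right, norm_mul]
        gcongr
        exact hM.norm_inner_pairingCommutator_le hφ ht z _ hs' (hε s hs') κ)
    calc _ ≤ ħ⁻¹ * (N / ‖(2 : ℂ)‖ * (2 * ħ * (1 + ‖z‖) ^ 2 * (134 / N + 4 * ε) / N *
          couplingMoment a T)) := by gcongr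
      _ = _ := by rw [Complex.norm_ofNat]; field_simp
  have hsub : Set.Icc 0 t ⊆ Set.Icc 0 T := Set.Icc_subset_Icc_right ht.2
  have h := norm_le_add_mul_of_re_inner_le
    (v := fun s => (inner ℂ (φ s) (D (φ s)) : ℂ)) ht.1
    (v' := fun s => inner ℂ (φ s) (-(Complex.I / ħ) • (N / 2 : ℂ) • ∫ κ, a κ •
      pairingCommutator Q₀ Q f D s κ (φ s)))
    (G := (1 + ‖z‖) ^ 2 * (134 / N + 4 * ε) * couplingMoment a T) (by positivity)
    ((hφ.continuousOn.mono hsub).inner (D.continuous.comp_continuousOn (hφ.continuousOn.mono hsub)))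
    (fun s hs => by
      have h1 := hc s ⟨hs.1, hs.2.trans_le ht.2⟩
      have h2 : HasDerivAt (fun r => D (φ r)) (D (fluctGenerator ħ a Q₀ Q f s (c s) (φ s))) s :=
        (D.restrictScalars ℝ).hasFDerivAt.comp_hasDerivAt s h1
      refine (h1.inner ℂ h2).congr_deriv ?_
      rw [map_fluctGenerator hM, inner_add_right, hM.inner_fluctGenerator_left hφ.real]
      ring)
    (fun s hs => (Complex.re_le_norm _).trans ((norm_inner_le_norm _ _).trans (by
      gcongr
      exact hR s ⟨hs.1, hs.2.trans_le ht.2⟩)))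
  simp only [hφ.map_zero] at h
  rw [hM.inner_fluct_state hB, norm_zero, zero_add] at h
  refine h.trans ?_
  calc _ ≤ T * ((1 + ‖z‖) ^ 2 * (134 / N + 4 * ε) * couplingMoment a T) := by
        gcongr; exact ht.2
    _ = _ := by ring

/-- Expectations of one-body fluctuations are of order `1 / N`. -/
theorem norm_inner_fluct_le (hM : IsMeanFieldFlow ħ T a b Q₀ Q f ι F)
    (hφ : IsFluctuationDynamics ħ T a Q₀ Q f F φ) {t : ℝ} (ht : t ∈ Set.Icc 0 T)
    (z : Space × Space) :
    ‖inner ℂ (φ t) (fluct (fun i => Q i t z) (inner ℂ f (Q₀ t z f)) (φ t))‖ ≤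
      268 * (T * couplingMoment a T) * (1 + ‖z‖) ^ 2 / N := by
  have hN : (0 : ℝ) < N := by exact_mod_cast hM.card_pos
  have hq0 : 0 ≤ T * couplingMoment a T :=
    mul_nonneg hM.time_nonneg (couplingMoment_nonneg a hM.time_nonneg)
  have hq := hM.small
  set q := T * couplingMoment a T with hqdef
  have key : ∀ s ∈ Set.Icc 0 T, ∀ κ, ‖inner ℂ (φ s) (waveFluct Q₀ Q f s κ (φ s))‖ ≤
      268 * q / N * (1 + waveBound T κ) ^ 2 := by
    intro s hs κ
    -- In q(134 + 4M) the bound q ≤ 1/8 is spent on the second term only, making it M/2. The first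
    -- keeps its factor q, so the estimate vanishes with the interaction.
    have := le_of_forall_improve (α := Set.Icc (0 : ℝ) T × Space)
      (n := fun i => ‖inner ℂ (φ i.1) (waveFluct Q₀ Q f i.1 i.2 (φ i.1))‖)
      (g := fun i => (1 + waveBound T i.2) ^ 2 / N) (c := 134 * q) (M := 2 * N)
      (by positivity) (by positivity) ?_ ?_ (⟨s, hs⟩, κ)
    · exact this.trans (le_of_eq (by ring))
    · rintro ⟨⟨r, hr⟩, κ⟩
      have hω := waveBound_nonneg hM.time_nonneg κ
      have h1 := hM.norm_waveFluct_le r κ (φ r)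
      have h2 := hM.norm_state_le hφ hr
      have h3 := norm_inner_le_norm (𝕜 := ℂ) (φ r) (waveFluct Q₀ Q f r κ (φ r))
      dsimp only
      calc _ ≤ 1 * (2 * 1) := h3.trans (mul_le_mul h2 (h1.trans (by gcongr)) (norm_nonneg _)
            zero_le_one)
        _ ≤ 2 * (1 + waveBound T κ) ^ 2 := by nlinarith
        _ = _ := by field_simp
    · rintro M hM0 hn ⟨⟨r, hr⟩, κ⟩
      have hω := waveBound_nonneg hM.time_nonneg κ
      dsimp only
      have h1 := hM.norm_inner_fluct_le_add hφ hr (planeWave r κ) (ε := M / N) (by positivity)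
        (fun s hs κ => (hn (⟨s, hs⟩, κ)).trans (le_of_eq (by ring)))
      refine h1.trans ?_
      have h2 := norm_planeWave_le hr κ
      rw [← hqdef]
      calc q * (1 + ‖planeWave r κ‖) ^ 2 * (134 / N + 4 * (M / N))
          ≤ q * (1 + waveBound T κ) ^ 2 * (134 / N + 4 * (M / N)) := by gcongr
        _ = (134 * q + q * (4 * M)) * ((1 + waveBound T κ) ^ 2 / N) := by ring
        _ ≤ (134 * q + 1 / 8 * (4 * M)) * ((1 + waveBound T κ) ^ 2 / N) := by gcongr
        _ = _ := by ring
  refine (hM.norm_inner_fluct_le_add hφ ht z (by positivity) key).trans ?_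
  rw [← hqdef]
  -- One more pass extends the bound from plane waves to arbitrary z, and 134 + 4·268/8 = 268
  -- reproduces the constant.
  calc q * (1 + ‖z‖) ^ 2 * (134 / N + 4 * (268 * q / N))
      ≤ q * (1 + ‖z‖) ^ 2 * (134 / N + 4 * (268 * (1 / 8) / N)) := by gcongr
    _ = _ := by ring

end IsMeanFieldFlow

end FluctuationBounds

/-! ### From fluctuations to products of one-particle observables -/

section ManyBodyObservables

variable {H₀ : Type*} [NormedAddCommGroup H₀] [InnerProductSpace ℂ H₀] [CompleteSpace H₀]
  {H : Type*} [NormedAddCommGroup H] [InnerProductSpace ℂ H] [CompleteSpace H] {N : ℕ}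
  {ħ T : ℝ} {a : Space → ℂ} {b : ℝ → Space → ℂ}
  {Q₀ : ℝ → Space × Space → H₀ →L[ℂ] H₀} {Q : Fin N → ℝ → Space × Space → H →L[ℂ] H}
  {f : H₀} {ι : Fin N → H₀ →L[ℂ] H} {F : H} {φ : ℝ → H}

/-- The permutations of the particles are implemented by isometries fixing the state `F`. -/
def IsPermutationSymmetric (Q : Fin N → ℝ → Space × Space → H →L[ℂ] H) (F : H) : Prop :=
  ∀ σ : Equiv.Perm (Fin N), ∃ S : H →L[ℂ] H, (∀ x, ‖S x‖ = ‖x‖) ∧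
    (∀ i z x, S (Q i 0 z x) = Q (σ i) 0 z (S x)) ∧ S F = F

/-- The product of the operators `W i z`, `(i, z) ∈ l`. -/
def opProd (W : Fin N → Space × Space → H →L[ℂ] H) : List (Fin N × (Space × Space)) → H →L[ℂ] H
  | [] => ContinuousLinearMap.id ℂ H
  | q :: l => opProd W l ∘L W q.1 q.2

theorem norm_opProd_apply {W : Fin N → Space × Space → H →L[ℂ] H} (hW : ∀ i z x, ‖W i z x‖ = ‖x‖)
    (l : List (Fin N × (Space × Space))) (x : H) : ‖opProd W l x‖ = ‖x‖ := by
  induction l generalizing x with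
  | nil => rfl
  | cons q l ih => rw [opProd, ContinuousLinearMap.comp_apply, ih, hW]

theorem map_opProd {W : Fin N → Space × Space → H →L[ℂ] H} {S : H →L[ℂ] H}
    {l : List (Fin N × (Space × Space))}
    (h : ∀ q ∈ l, ∀ x, S (W q.1 q.2 x) = W q.1 q.2 (S x)) (x : H) :
    S (opProd W l x) = opProd W l (S x) := by
  induction l generalizing x with
  | nil => rfl
  | cons q l ih =>
    simp only [opProd, ContinuousLinearMap.comp_apply]
    rw [ih (fun q' hq' => h q' (List.mem_cons_of_mem _ hq')), h q List.mem_cons_self]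

/-- An average over the particles that vanishes outside a list of indices. -/
theorem norm_inv_smul_sum_le_of_list {E : Type*} [NormedAddCommGroup E] [NormedSpace ℂ E]
    (l : List (Fin N)) (v : Fin N → E) {β : ℝ} (hβ : 0 ≤ β) (h0 : ∀ i, i ∉ l → v i = 0)
    (h : ∀ i, ‖v i‖ ≤ β) : ‖(N : ℂ)⁻¹ • ∑ i, v i‖ ≤ l.length * β / N := by
  refine norm_inv_natCast_smul_le ?_
  have e : ∑ i, v i = ∑ i ∈ l.toFinset, v i :=
    (Finset.sum_subset (Finset.subset_univ _) fun i _ hi => h0 i (by simpa using hi)).symm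
  rw [e]
  refine (norm_sum_le _ _).trans ((Finset.sum_le_sum fun i _ => h i).trans ?_)
  rw [Finset.sum_const, nsmul_eq_mul]
  gcongr
  exact l.toFinset_card_le

namespace IsMeanFieldFlow

theorem intertwine_permutation (hM : IsMeanFieldFlow ħ T a b Q₀ Q f ι F)
    {σ : Equiv.Perm (Fin N)} {S : H →L[ℂ] H} (hS : ∀ i z x, S (Q i 0 z x) = Q (σ i) 0 z (S x))
    {s : ℝ} (hs : s ∈ Set.Icc 0 T) (i : Fin N) (z : Space × Space) (x : H) :
    S (Q i s z x) = Q (σ i) s z (S x) :=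
  ((hM.flow i).intertwine hM.hbar_pos (hM.flow (σ i)) hM.coupling hM.time_nonneg hM.moment
    hM.small (fun z x => (hS i z x).symm) hs z x).symm

theorem map_fluct_permutation (hM : IsMeanFieldFlow ħ T a b Q₀ Q f ι F)
    {σ : Equiv.Perm (Fin N)} {S : H →L[ℂ] H} (hS : ∀ i z x, S (Q i 0 z x) = Q (σ i) 0 z (S x))
    {s : ℝ} (hs : s ∈ Set.Icc 0 T) (z : Space × Space) (c : ℂ) (x : H) :
    S (fluct (fun i => Q i s z) c x) = fluct (fun i => Q i s z) c (S x) := by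
  simp only [fluct_apply, particleMean_apply, map_sub, map_smul, map_sum,
    hM.intertwine_permutation hS hs]
  rw [Equiv.sum_comp σ fun i => Q i s z (S x)]

/-- Permutations commute with the generator, so Sφ - φ solves the same linear skew equation with
zero initial value. -/
theorem map_state_permutation (hM : IsMeanFieldFlow ħ T a b Q₀ Q f ι F)
    (hφ : IsFluctuationDynamics ħ T a Q₀ Q f F φ)
    {σ : Equiv.Perm (Fin N)} {S : H →L[ℂ] H} (hS : ∀ i z x, S (Q i 0 z x) = Q (σ i) 0 z (S x))
    (hF : S F = F) {t : ℝ} (ht : t ∈ Set.Icc 0 T) : S (φ t) = φ t := by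
  obtain ⟨c, hc⟩ := hφ.hasDerivAt
  have hgen : ∀ s ∈ Set.Icc 0 T, ∀ x, S (fluctGenerator ħ a Q₀ Q f s (c s) x) =
      fluctGenerator ħ a Q₀ Q f s (c s) (S x) := by
    intro s hs x
    rw [map_fluctGenerator hM]
    simp only [pairingCommutator]
    have : ∀ κ y, S (waveFluct Q₀ Q f s κ y) = waveFluct Q₀ Q f s κ (S y) := fun κ y =>
      hM.map_fluct_permutation hS hs _ _ y
    simp [this]
  have hsub : Set.Icc 0 t ⊆ Set.Icc 0 T := Set.Icc_subset_Icc_right ht.2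
  have hlin : ∀ s x y, fluctGenerator ħ a Q₀ Q f s (c s) (x - y) =
      fluctGenerator ħ a Q₀ Q f s (c s) x - fluctGenerator ħ a Q₀ Q f s (c s) y := by
    intro s x y
    simp only [fluctGenerator, map_sub, smul_sub]
    rw [integral_sub (hM.integrable_pairing s x) (hM.integrable_pairing s y)]
    module
  have h := norm_le_add_mul_of_re_inner_le (v := fun s => S (φ s) - φ s) (G := 0) ht.1 le_rfl
    (v' := fun s => fluctGenerator ħ a Q₀ Q f s (c s) (S (φ s) - φ s))
    ((S.continuous.comp_continuousOn (hφ.continuousOn.mono hsub)).sub (hφ.continuousOn.mono hsub))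
    (fun s hs => by
      have h1 := hc s ⟨hs.1, hs.2.trans_le ht.2⟩
      have h2 : HasDerivAt (fun r => S (φ r)) (S (fluctGenerator ħ a Q₀ Q f s (c s) (φ s))) s :=
        (S.restrictScalars ℝ).hasFDerivAt.comp_hasDerivAt s h1
      refine (h2.fun_sub h1).congr_deriv ?_
      rw [hgen s ⟨hs.1.le, (hs.2.trans_le ht.2).le⟩, hlin])
    (fun s _ => by rw [hM.re_inner_fluctGenerator hφ.real, mul_zero])
  simp only [hφ.map_zero, hF, sub_self, norm_zero, mul_zero, add_zero] at h
  exact sub_eq_zero.1 (norm_le_zero_iff.1 h)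

theorem inner_self_state (hM : IsMeanFieldFlow ħ T a b Q₀ Q f ι F)
    (hφ : IsFluctuationDynamics ħ T a Q₀ Q f F φ) {t : ℝ} (ht : t ∈ Set.Icc 0 T) :
    (inner ℂ (φ t) (φ t) : ℂ) = 1 := by
  obtain ⟨c, hc⟩ := hφ.hasDerivAt
  have hsub : Set.Icc 0 t ⊆ Set.Icc 0 T := Set.Icc_subset_Icc_right ht.2
  have h := norm_le_add_mul_of_re_inner_le (v := fun s => (inner ℂ (φ s) (φ s) : ℂ) - 1) (G := 0)
    ht.1 le_rfl (v' := fun _ => 0)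
    (((hφ.continuousOn.mono hsub).inner (hφ.continuousOn.mono hsub)).sub continuousOn_const)
    (fun s hs => by
      have h1 := hc s ⟨hs.1, hs.2.trans_le ht.2⟩
      refine ((h1.inner ℂ h1).sub_const 1).congr_deriv ?_
      rw [hM.inner_fluctGenerator_left hφ.real, add_neg_cancel])
    (fun s _ => by simp)
  have hF : (inner ℂ F F : ℂ) = 1 := by
    rw [inner_self_eq_norm_sq_to_K, ← hM.embed_state ⟨0, hM.card_pos⟩, hM.norm_embed,
      hM.norm_state]; simp
  simp only [hφ.map_zero, hF, sub_self, norm_zero, mul_zero, add_zero] at h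
  exact sub_eq_zero.1 (norm_le_zero_iff.1 h)

/-- In a permutation-symmetric state, a one-particle operator may be replaced by its average. -/
theorem norm_inner_opProd_sub_particleMean_le (hM : IsMeanFieldFlow ħ T a b Q₀ Q f ι F)
    (hφ : IsFluctuationDynamics ħ T a Q₀ Q f F φ) (hsym : IsPermutationSymmetric Q F)
    {t : ℝ} (ht : t ∈ Set.Icc 0 T) (l : List (Fin N × (Space × Space)))
    {i : Fin N} (hi : i ∉ l.map Prod.fst) (z : Space × Space) {x : H}
    (hx : ∀ (σ : Equiv.Perm (Fin N)) (S : H →L[ℂ] H),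
      (∀ i z x, S (Q i 0 z x) = Q (σ i) 0 z (S x)) → S F = F → S x = x) :
    ‖inner ℂ (φ t) (opProd (fun i => Q i t) l (Q i t z x)) -
      inner ℂ (φ t) (opProd (fun i => Q i t) l (particleMean (fun i => Q i t z) x))‖ ≤
      2 * l.length / N * ‖x‖ := by
  have hN : (N : ℂ) ≠ 0 := by exact_mod_cast hM.card_pos.ne'
  set g : Fin N → ℂ := fun j => inner ℂ (φ t) (opProd (fun i => Q i t) l (Q j t z x)) with hg
  have hgb : ∀ j, ‖g j‖ ≤ ‖x‖ := fun j => by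
    refine (norm_inner_le_norm _ _).trans ?_
    rw [norm_opProd_apply fun i z x => ((hM.flow i).weyl t).norm_map z x,
      ((hM.flow j).weyl t).norm_map]
    exact mul_le_of_le_one_left (norm_nonneg _) (hM.norm_state_le hφ ht)
  -- The transposition of i and j fixes the state, x and all factors in l, so the two expectations
  -- are equal. Only the indices in l can contribute to the difference from the average.
  have hge : ∀ j, j ∉ l.map Prod.fst → g i - g j = 0 := by
    intro j hj
    obtain ⟨S, hSn, hSQ, hSF⟩ := hsym (Equiv.swap i j)
    have hinner : ∀ u v, inner ℂ (S u) (S v) = (inner ℂ u v : ℂ) := fun u v =>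
      (⟨S.toLinearMap, hSn⟩ : H →ₗᵢ[ℂ] H).inner_map_map u v
    have h1 : S (opProd (fun i => Q i t) l (Q i t z x)) =
        opProd (fun i => Q i t) l (Q j t z x) := by
      rw [map_opProd, hM.intertwine_permutation hSQ ht, Equiv.swap_apply_left, hx _ S hSQ hSF]
      intro q hq y
      have h2 : q.1 ∈ l.map Prod.fst := List.mem_map_of_mem hq
      rw [hM.intertwine_permutation hSQ ht, Equiv.swap_apply_of_ne_of_ne]
      · rintro rfl; exact hi h2
      · rintro rfl; exact hj h2
    rw [sub_eq_zero, hg]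
    dsimp only
    rw [← hinner, h1, hM.map_state_permutation hφ hSQ hSF ht]
  have e : g i - inner ℂ (φ t) (opProd (fun i => Q i t) l
      (particleMean (fun i => Q i t z) x)) = (N : ℂ)⁻¹ • ∑ j, (g i - g j) := by
    rw [Finset.sum_sub_distrib, smul_sub, Finset.sum_const, Finset.card_univ, Fintype.card_fin,
      ← Nat.cast_smul_eq_nsmul ℂ, smul_smul, inv_mul_cancel₀ hN, one_smul]
    simp only [particleMean_apply, map_smul, map_sum, inner_smul_right, inner_sum, hg, smul_eq_mul]
  rw [e]
  refine (norm_inv_smul_sum_le_of_list (l.map Prod.fst) (fun j => g i - g j) (β := 2 * ‖x‖)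
    (by positivity) hge (fun j => (norm_sub_le _ _).trans (by linarith [hgb i, hgb j]))).trans
    (le_of_eq ?_)
  rw [List.length_map]; ring

/-- A summand of the average commutes with the product unless its particle occurs in l. -/
theorem norm_opProd_fluct_commutator_le (hM : IsMeanFieldFlow ħ T a b Q₀ Q f ι F)
    {t : ℝ} (ht : t ∈ Set.Icc 0 T) (l : List (Fin N × (Space × Space))) (z : Space × Space)
    (c : ℂ) (x : H) :
    ‖opProd (fun i => Q i t) l (fluct (fun i => Q i t z) c x) -
      fluct (fun i => Q i t z) c (opProd (fun i => Q i t) l x)‖ ≤ 2 * l.length / N * ‖x‖ := by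
  have e : opProd (fun i => Q i t) l (fluct (fun i => Q i t z) c x) -
      fluct (fun i => Q i t z) c (opProd (fun i => Q i t) l x) = (N : ℂ)⁻¹ • ∑ j,
        (opProd (fun i => Q i t) l (Q j t z x) - Q j t z (opProd (fun i => Q i t) l x)) := by
    simp only [fluct_apply, particleMean_apply, map_sub, map_smul, map_sum,
      Finset.sum_sub_distrib]
    module
  rw [e]
  have hn := norm_opProd_apply (W := fun i => Q i t)
    (fun i z x => ((hM.flow i).weyl t).norm_map z x) l
  refine (norm_inv_smul_sum_le_of_list (l.map Prod.fst) _ (β := 2 * ‖x‖)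
    (by positivity) (fun j hj => ?_) (fun j => (norm_sub_le _ _).trans ?_)).trans (le_of_eq ?_)
  · rw [sub_eq_zero, ← map_opProd]
    intro q hq y
    have h2 : q.1 ∈ l.map Prod.fst := List.mem_map_of_mem hq
    have hne : j ≠ q.1 := by rintro rfl; exact hj h2
    exact hM.commute hne ht ht _ _ _
  · rw [hn, ((hM.flow j).weyl t).norm_map, ((hM.flow j).weyl t).norm_map, hn]; linarith
  · rw [List.length_map]; ring

theorem norm_fluct_state_flow_le (hM : IsMeanFieldFlow ħ T a b Q₀ Q f ι F)
    (hφ : IsFluctuationDynamics ħ T a Q₀ Q f F φ) {t : ℝ} (ht : t ∈ Set.Icc 0 T)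
    {z : Space × Space} {ζ : ℝ} (hz : ‖z‖ ≤ ζ) :
    ‖fluct (fun i => Q i t z) (inner ℂ f (Q₀ t z f)) (φ t)‖ ≤
      (2 + 24 * ζ * (T * couplingMoment a T)) / Real.sqrt N := by
  have hq0 : 0 ≤ T * couplingMoment a T :=
    mul_nonneg hM.time_nonneg (couplingMoment_nonneg a hM.time_nonneg)
  refine (hM.norm_fluct_le hφ (hM.isOneBodyFamily ht z) ht).trans ?_
  refine div_le_div_of_nonneg_right ?_ (Real.sqrt_nonneg _)
  nlinarith [mul_le_mul_of_nonneg_right hz hq0]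

/-- Induction on the factors in front of the fluctuation x. The operator of the first particle is
replaced by its average, that is by a scalar of modulus at most 1 plus a fluctuation. The scalar
leads back to the shorter product. The fluctuation is commuted to the left and applied to φ, where
it meets x in a product of two vectors of size N^{-1/2}. -/
theorem norm_inner_opProd_fluct_le (hM : IsMeanFieldFlow ħ T a b Q₀ Q f ι F)
    (hφ : IsFluctuationDynamics ħ T a Q₀ Q f F φ) (hsym : IsPermutationSymmetric Q F)
    {t : ℝ} (ht : t ∈ Set.Icc 0 T) {ζ : ℝ} (hζ : 0 ≤ ζ) {z : Space × Space} (hz : ‖z‖ ≤ ζ)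
    (l : List (Fin N × (Space × Space))) (hl : (l.map Prod.fst).Nodup)
    (hlζ : ∀ q ∈ l, ‖q.2‖ ≤ ζ) :
    ‖inner ℂ (φ t) (opProd (fun i => Q i t) l
      (fluct (fun i => Q i t z) (inner ℂ f (Q₀ t z f)) (φ t)))‖ ≤
      268 * (T * couplingMoment a T) * (1 + ζ) ^ 2 / N +
        l.length * ((2 + 24 * ζ * (T * couplingMoment a T)) ^ 2 / N) + 8 * l.length ^ 2 / N := by
  have hN : (0 : ℝ) < N := by exact_mod_cast hM.card_pos
  have hq0 : 0 ≤ T * couplingMoment a T :=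
    mul_nonneg hM.time_nonneg (couplingMoment_nonneg a hM.time_nonneg)
  set q := T * couplingMoment a T with hqdef
  set x := fluct (fun i => Q i t z) (inner ℂ f (Q₀ t z f)) (φ t) with hxdef
  have hx2 : ‖x‖ ≤ 2 := by
    have h1 := _root_.norm_fluct_le (B := fun i => Q i t z) (c := inner ℂ f (Q₀ t z f))
      zero_le_one (fun i => ((hM.flow i).weyl t).opNorm_le z)
      (hM.norm_inner_state_le ((hM.flow₀.weyl t).opNorm_le z)) (φ t)
    have h2 := hM.norm_state_le hφ ht
    linarith
  have hxγ : ‖x‖ ≤ (2 + 24 * ζ * q) / Real.sqrt N := hM.norm_fluct_state_flow_le hφ ht hz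
  induction l with
  | nil =>
    refine (hM.norm_inner_fluct_le hφ ht z).trans ?_
    simp only [List.length_nil, Nat.cast_zero, zero_mul, add_zero, ne_eq, OfNat.ofNat_ne_zero,
      not_false_eq_true, zero_pow, mul_zero, zero_div]
    gcongr
  | cons p l ih =>
    have hl' := List.nodup_cons.1 hl
    have ih := ih hl'.2 fun q hq => hlζ q (List.mem_cons_of_mem _ hq)
    have hpζ := hlζ p List.mem_cons_self
    have h1 := hM.norm_inner_opProd_sub_particleMean_le hφ hsym ht l hl'.1 p.2 (x := x)
      (fun σ S hS hF => by
        rw [hxdef, hM.map_fluct_permutation hS ht, hM.map_state_permutation hφ hS hF ht])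
    set S := opProd (fun i => Q i t) l with hS
    set r := inner ℂ f (Q₀ t p.2 f) with hr
    have hr1 : ‖r‖ ≤ 1 := hM.norm_inner_state_le ((hM.flow₀.weyl t).opNorm_le p.2)
    rw [particleMean_apply_eq _ r, map_add, map_smul, inner_add_right, inner_smul_right] at h1
    have h2 := hM.norm_opProd_fluct_commutator_le ht l p.2 r x
    have h3 := norm_inner_le_norm (𝕜 := ℂ) (φ t) (S (fluct (fun i => Q i t p.2) r x) -
      fluct (fun i => Q i t p.2) r (S x))
    rw [inner_sub_right] at h3
    have h4 : inner ℂ (φ t) (fluct (fun i => Q i t p.2) r (S x)) =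
        inner ℂ (fluct (fun i => Q i t (-p.2)) (inner ℂ f (Q₀ t (-p.2) f)) (φ t)) (S x) := by
      rw [inner_fluct_left (B' := fun i => Q i t p.2)]
      · rw [inner_conj_symm, (hM.flow₀.weyl t).inner_map_left, neg_neg]
      · intro i x y
        rw [((hM.flow i).weyl t).inner_map_left, neg_neg]
    have h5 : ‖inner ℂ (φ t) (fluct (fun i => Q i t p.2) r (S x))‖ ≤
        (2 + 24 * ζ * q) ^ 2 / N := by
      rw [h4]
      refine (norm_inner_le_norm _ _).trans ?_
      have h6 := hM.norm_fluct_state_flow_le hφ ht (z := -p.2) (ζ := ζ) (by rwa [norm_neg])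
      have h7 : ‖S x‖ = ‖x‖ :=
        norm_opProd_apply (fun i z x => ((hM.flow i).weyl t).norm_map z x) l x
      refine (mul_le_mul h6 (h7.le.trans hxγ) (norm_nonneg _) (by positivity)).trans
        (le_of_eq ?_)
      rw [div_mul_div_comm, Real.mul_self_sqrt hN.le, ← sq]
    have hφ1 := hM.norm_state_le hφ ht
    have h8 : 2 * l.length / N * ‖x‖ ≤ 4 * l.length / N := by
      calc 2 * l.length / N * ‖x‖ ≤ 2 * l.length / N * 2 := by gcongr
        _ = _ := by ring
    have h9 : ‖r * inner ℂ (φ t) (S x)‖ ≤ ‖inner ℂ (φ t) (S x)‖ := by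
      rw [norm_mul]; exact mul_le_of_le_one_left (norm_nonneg _) hr1
    have h10 : ‖φ t‖ * ‖S (fluct (fun i => Q i t p.2) r x) - fluct (fun i => Q i t p.2) r (S x)‖ ≤
        4 * l.length / N :=
      (mul_le_of_le_one_left (norm_nonneg _) hφ1).trans (h2.trans h8)
    change ‖inner ℂ (φ t) (S (Q p.1 t p.2 x))‖ ≤ _
    set X := inner ℂ (φ t) (S (Q p.1 t p.2 x))
    set A := inner ℂ (φ t) (S (fluct (fun i => Q i t p.2) r x))
    set A' := inner ℂ (φ t) (fluct (fun i => Q i t p.2) r (S x))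
    set R := r * inner ℂ (φ t) (S x)
    have h11 : ‖X‖ ≤ ‖X - (A + R)‖ + ‖A - A'‖ + ‖A'‖ + ‖R‖ := by
      have : X = (X - (A + R)) + (A - A') + A' + R := by ring
      calc ‖X‖ = ‖(X - (A + R)) + (A - A') + A' + R‖ := by rw [← this]
        _ ≤ _ := norm_add₄_le
    have h12 : (8 : ℝ) * ((l.length : ℝ) + 1) ^ 2 / N =
        8 * (l.length : ℝ) ^ 2 / N + 4 * l.length / N + 4 * l.length / N +
          (8 * l.length + 8) / N := by ring
    have h13 : 0 ≤ (8 * (l.length : ℝ) + 8) / N := by positivity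
    rw [List.length_cons]
    push_cast
    rw [h12]
    linarith

/-- Propagation of chaos: in the state `φ t` the expectation of a product of Weyl operators of
distinct particles factorizes up to `O(1 / N)`. -/
theorem norm_inner_opProd_sub_prod_le (hM : IsMeanFieldFlow ħ T a b Q₀ Q f ι F)
    (hφ : IsFluctuationDynamics ħ T a Q₀ Q f F φ) (hsym : IsPermutationSymmetric Q F)
    {t : ℝ} (ht : t ∈ Set.Icc 0 T) {ζ : ℝ} (hζ : 0 ≤ ζ)
    (l : List (Fin N × (Space × Space))) (hl : (l.map Prod.fst).Nodup)
    (hlζ : ∀ q ∈ l, ‖q.2‖ ≤ ζ) :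
    ‖inner ℂ (φ t) (opProd (fun i => Q i t) l (φ t)) -
      (l.map fun q => inner ℂ f (Q₀ t q.2 f)).prod‖ ≤
      l.length ^ 3 * (18 + 412 * (T * couplingMoment a T) * (1 + ζ) ^ 2) / N := by
  have hN : (0 : ℝ) < N := by exact_mod_cast hM.card_pos
  have hq0 : 0 ≤ T * couplingMoment a T :=
    mul_nonneg hM.time_nonneg (couplingMoment_nonneg a hM.time_nonneg)
  have hq8 := hM.small
  induction l with
  | nil =>
    have h := hM.inner_self_state hφ ht
    change ‖inner ℂ (φ t) (φ t) - 1‖ ≤ _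
    rw [h]; simp
  | cons p l ih =>
    have hl' := List.nodup_cons.1 hl
    have hlζ' : ∀ q ∈ l, ‖q.2‖ ≤ ζ := fun q hq => hlζ q (List.mem_cons_of_mem _ hq)
    have ih := ih hl'.2 hlζ'
    have h0 := hM.norm_inner_opProd_fluct_le hφ hsym ht hζ (hlζ p List.mem_cons_self) l hl'.2 hlζ'
    set q := T * couplingMoment a T with hqdef
    have h1 := hM.norm_inner_opProd_sub_particleMean_le hφ hsym ht l hl'.1 p.2 (x := φ t)
      (fun σ S hS hF => hM.map_state_permutation hφ hS hF ht)
    set S := opProd (fun i => Q i t) l with hS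
    set r := inner ℂ f (Q₀ t p.2 f) with hr
    have hr1 : ‖r‖ ≤ 1 := hM.norm_inner_state_le ((hM.flow₀.weyl t).opNorm_le p.2)
    rw [particleMean_apply_eq _ r, map_add, map_smul, inner_add_right, inner_smul_right] at h1
    have hφ1 := hM.norm_state_le hφ ht
    have h2 : 2 * (l.length : ℝ) / N * ‖φ t‖ ≤ 2 * l.length / N :=
      mul_le_of_le_one_right (by positivity) hφ1
    change ‖inner ℂ (φ t) (S (Q p.1 t p.2 (φ t))) - _‖ ≤ _
    rw [List.map_cons, List.prod_cons, ← hr]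
    set P := (l.map fun q => inner ℂ f (Q₀ t q.2 f)).prod
    set X := inner ℂ (φ t) (S (Q p.1 t p.2 (φ t)))
    set A := inner ℂ (φ t) (S (fluct (fun i => Q i t p.2) r (φ t)))
    set Y := inner ℂ (φ t) (S (φ t))
    have h3 : ‖X - r * P‖ ≤ ‖X - (A + r * Y)‖ + ‖A‖ + ‖Y - P‖ := by
      have : X - r * P = (X - (A + r * Y)) + A + r * (Y - P) := by ring
      rw [this]
      refine norm_add₃_le.trans ?_
      rw [norm_mul]
      gcongr
      exact mul_le_of_le_one_left (norm_nonneg _) hr1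
    -- Only one of the two factors q in the quadratic term is estimated by 1/8. A factor q in front
    -- of (1 + ζ)² must survive: for w = 0 it removes the dependence on the unbounded time hidden in
    -- ζ.
    have h4 : (2 + 24 * ζ * q) ^ 2 ≤ 8 + 144 * q * (1 + ζ) ^ 2 := by
      have h5 : (2 + 24 * ζ * q) ^ 2 ≤ 8 + 1152 * (ζ ^ 2 * q ^ 2) := by
        nlinarith [sq_nonneg (2 - 24 * ζ * q)]
      have h6 : q ^ 2 ≤ q * (1 / 8) := by rw [sq]; gcongr
      have h7 : ζ ^ 2 * q ^ 2 ≤ (1 + ζ) ^ 2 * (q * (1 / 8)) := by gcongr; linarith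
      linarith
    have h5 : (l.length : ℝ) * ((2 + 24 * ζ * q) ^ 2 / N) ≤
        l.length * ((8 + 144 * q * (1 + ζ) ^ 2) / N) := by gcongr
    rw [List.length_cons]
    push_cast
    set n : ℝ := (l.length : ℝ)
    have hn : 0 ≤ n := Nat.cast_nonneg _
    set Z := q * (1 + ζ) ^ 2 with hZ
    have hZ0 : 0 ≤ Z := by positivity
    -- Each additional factor costs an amount quadratic in the number n of factors already present,
    -- which the increment from n³ to (n + 1)³, with these constants, dominates.
    have h6 : 2 * n / N + (268 * Z / N + n * ((8 + 144 * Z) / N) + 8 * n ^ 2 / N) +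
        n ^ 3 * (18 + 412 * Z) / N ≤ (n + 1) ^ 3 * (18 + 412 * Z) / N := by
      rw [← sub_nonneg]
      have : (n + 1) ^ 3 * (18 + 412 * Z) / N - (2 * n / N + (268 * Z / N +
          n * ((8 + 144 * Z) / N) + 8 * n ^ 2 / N) + n ^ 3 * (18 + 412 * Z) / N) =
          ((46 * n ^ 2 + 44 * n + 18) + (1236 * n ^ 2 + 1092 * n + 144) * Z) / N := by ring
      rw [this]
      positivity
    have e1 : 268 * q * (1 + ζ) ^ 2 / N = 268 * Z / N := by rw [hZ]; ring
    have e2 : 8 + 144 * q * (1 + ζ) ^ 2 = 8 + 144 * Z := by rw [hZ]; ring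
    have e3 : 18 + 412 * q * (1 + ζ) ^ 2 = 18 + 412 * Z := by rw [hZ]; ring
    rw [e1] at h0
    rw [e2] at h5
    rw [e3] at ih ⊢
    linarith

end IsMeanFieldFlow

end ManyBodyObservables

/-! ### Construction of the mean-field propagator and its Heisenberg flow -/

section MeanFieldPropagator

variable {H : Type*} [NormedAddCommGroup H] [InnerProductSpace ℂ H] {ħ T : ℝ} {a : Space → ℂ}

/-- The potential with Fourier coefficients `g` in the frame of the free evolution. -/
def weylPotential (W : Space × Space → H →L[ℂ] H) (g : Space → ℂ) (s : ℝ) (x : H) : H :=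
  ∫ κ, g κ • W (planeWave s κ) x

theorem IsWeylSystem.integrable_weylPotential {W : Space × Space → H →L[ℂ] H}
    (hW : IsWeylSystem ħ W) (hT : 0 ≤ T) (ha : HasCouplingMoment a T) {g : Space → ℂ}
    (hg : AEStronglyMeasurable g volume) (hga : ∀ κ, ‖g κ‖ ≤ ‖a κ‖) (s : ℝ) (x : H) :
    Integrable fun κ => g κ • W (planeWave s κ) x :=
  hW.integrable_coupling hT ha hg (C := 1) (fun κ => by rw [one_mul]; exact hga κ) s x

theorem IsWeylSystem.exists_weylPotential_clm {W : Space × Space → H →L[ℂ] H}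
    (hW : IsWeylSystem ħ W) (hT : 0 ≤ T) (ha : HasCouplingMoment a T) {g : Space → ℂ}
    (hg : AEStronglyMeasurable g volume) (hga : ∀ κ, ‖g κ‖ ≤ ‖a κ‖) (s : ℝ) :
    ∃ V : H →L[ℂ] H, (∀ x, V x = weylPotential W g s x) ∧ ‖V‖ ≤ ∫ κ, ‖a κ‖ := by
  have hint := hW.integrable_weylPotential hT ha hg hga s
  have hb : ∀ x, ‖weylPotential W g s x‖ ≤ (∫ κ, ‖a κ‖) * ‖x‖ := by
    intro x
    rw [weylPotential, ← integral_mul_const]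
    refine norm_integral_le_of_norm_le ((ha.integrable_norm hT).mul_const _)
      (Eventually.of_forall fun κ => ?_)
    rw [norm_smul, hW.norm_map]
    gcongr
    exact hga κ
  let L : H →ₗ[ℂ] H :=
    { toFun := weylPotential W g s
      map_add' := fun x y => by
        simp only [weylPotential, map_add, smul_add]
        exact integral_add (hint x) (hint y)
      map_smul' := fun c x => by
        simp only [weylPotential, map_smul, RingHom.id_apply]
        rw [← integral_smul]
        simp only [smul_comm c] }
  refine ⟨L.mkContinuous _ hb, fun x => rfl, ?_⟩
  exact L.mkContinuous_norm_le (integral_nonneg fun κ => norm_nonneg _) hb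

theorem IsWeylSystem.continuous_weylPotential {W : Space × Space → H →L[ℂ] H}
    (hW : IsWeylSystem ħ W) (hT : 0 ≤ T) (ha : HasCouplingMoment a T) {b : ℝ → Space → ℂ}
    (hb : IsCoupling a b) (hbc : ∀ κ, Continuous fun s => b s κ) (x : H) :
    Continuous fun s => weylPotential W (b s) s x := by
  refine continuous_of_dominated (bound := fun κ => ‖a κ‖ * ‖x‖)
    (fun s => (hW.integrable_weylPotential hT ha (hb.measurable s)
      (hb.norm_le s) s x).aestronglyMeasurable) (fun s => Eventually.of_forall fun κ => ?_)
    ((ha.integrable_norm hT).mul_const _) (Eventually.of_forall fun κ => ?_)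
  · rw [norm_smul, hW.norm_map]
    gcongr
    exact hb.norm_le s κ
  · exact (hbc κ).smul ((hW.strong_continuous x).comp
      (continuous_planeWave.comp (Continuous.prodMk continuous_id continuous_const)))

/-- The symmetry g(-κ) = conj g(κ) says that the potential is real; the substitution κ ↦ -κ absorbs
the adjoint. -/
theorem IsWeylSystem.inner_weylPotential_left [CompleteSpace H] {W : Space × Space → H →L[ℂ] H}
    (hW : IsWeylSystem ħ W) (hT : 0 ≤ T) (ha : HasCouplingMoment a T) {g : Space → ℂ}
    (hg : AEStronglyMeasurable g volume) (hga : ∀ κ, ‖g κ‖ ≤ ‖a κ‖)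
    (hgr : ∀ κ, g (-κ) = conj (g κ)) (s : ℝ) (x y : H) :
    inner ℂ (weylPotential W g s x) y = inner ℂ x (weylPotential W g s y) := by
  have hint := hW.integrable_weylPotential hT ha hg hga s
  rw [weylPotential, weylPotential, ← inner_conj_symm, ← integral_inner (hint x),
    ← integral_inner (hint y), ← integral_conj, ← integral_neg_eq_self]
  congr 1; funext κ
  rw [inner_conj_symm, inner_smul_left, inner_smul_right, hW.inner_map_left, hgr,
    Complex.conj_conj, planeWave_neg, neg_neg]

theorem weylPotential_map_sub [CompleteSpace H] {W : Space × Space → H →L[ℂ] H}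
    (hW : IsWeylSystem ħ W) (hT : 0 ≤ T) (ha : HasCouplingMoment a T) {g : Space → ℂ}
    (hg : AEStronglyMeasurable g volume) (hga : ∀ κ, ‖g κ‖ ≤ ‖a κ‖) (s : ℝ)
    (z : Space × Space) (x : H) :
    weylPotential W g s (W z x) - W z (weylPotential W g s x) =
      -W z (∫ κ, (g κ * (1 - sympPhase ħ (planeWave s κ) z)) • W (planeWave s κ) x) := by
  have hint := hW.integrable_weylPotential hT ha hg hga s
  have hm : AEStronglyMeasurable (fun κ => g κ * (1 - sympPhase ħ (planeWave s κ) z)) volume := by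
    have h : Continuous fun κ => sympPhase ħ (planeWave s κ) z := by
      unfold sympPhase symp planeWave; fun_prop
    exact hg.mul (continuous_const.sub h).aestronglyMeasurable
  have hint2 := hW.integrable_coupling hT ha hm (C := 2) (fun κ => by
    rw [norm_mul, mul_comm]
    gcongr
    · exact norm_one_sub_sympPhase_le_two _ _ _
    · exact hga κ) s x
  rw [weylPotential, weylPotential, ← (W z).integral_comp_comm (hint x),
    ← (W z).integral_comp_comm hint2, ← integral_sub (hint _) ((W z).integrable_comp (hint x)),
    ← integral_neg]
  congr 1; funext κ
  rw [map_smul, map_smul, hW.comm]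
  module

/-- The Heisenberg picture of an operator. -/
def heisenberg (U : H ≃ₗᵢ[ℂ] H) (W : H →L[ℂ] H) : H →L[ℂ] H :=
  (U.symm : H →L[ℂ] H) ∘L W ∘L (U : H →L[ℂ] H)

theorem heisenberg_apply (U : H ≃ₗᵢ[ℂ] H) (W : H →L[ℂ] H) (x : H) :
    heisenberg U W x = U.symm (W (U x)) := rfl

theorem IsWeylSystem.heisenberg {W : Space × Space → H →L[ℂ] H} (hW : IsWeylSystem ħ W)
    (U : H ≃ₗᵢ[ℂ] H) : IsWeylSystem ħ fun z => heisenberg U (W z) where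
  norm_map z x := by rw [heisenberg_apply, U.symm.norm_map, hW.norm_map, U.norm_map]
  map_zero x := by rw [heisenberg_apply, hW.map_zero, U.symm_apply_apply]
  map_map z z' x := by
    simp only [heisenberg_apply, U.apply_symm_apply, hW.map_map, map_smul]
  strong_continuous x := U.symm.continuous.comp (hW.strong_continuous (U x))

/-- The propagator of particles in a common mean-field potential, and the Heisenberg flow that it
generates. -/
theorem exists_mean_field_propagator [CompleteSpace H] {n : ℕ}
    {W : Fin n → Space × Space → H →L[ℂ] H} (hW : ∀ i, IsWeylSystem ħ (W i))
    (hcomm : ∀ i j, i ≠ j → ∀ z z' x, W i z (W j z' x) = W j z' (W i z x)) (hT : 0 ≤ T)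
    (ha : HasCouplingMoment a T) {b : ℝ → Space → ℂ} (hb : IsCoupling a b)
    (hbc : ∀ κ, Continuous fun s => b s κ) (hbr : ∀ s κ, b s (-κ) = conj (b s κ)) :
    ∃ U : ℝ → H ≃ₗᵢ[ℂ] H, (∀ x, U 0 x = x) ∧
      (∀ s x, HasDerivAt (fun r => U r x)
        (-(Complex.I / ħ) • ∑ i, weylPotential (W i) (b s) s (U s x)) s) ∧
      (∀ s x, HasDerivAt (fun r => (U r).symm x)
        ((Complex.I / ħ) • (U s).symm (∑ i, weylPotential (W i) (b s) s x)) s) ∧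
      ∀ i, IsHeisenbergFlow ħ b fun s z => heisenberg (U s) (W i z) := by
  choose V hV hVn using fun i s => (hW i).exists_weylPotential_clm hT ha (hb.measurable s)
    (hb.norm_le s) s
  let A : ℝ → H →L[ℂ] H := fun s => -(Complex.I / ħ) • ∑ i, V i s
  have hA : ∀ s x, A s x = -(Complex.I / ħ) • ∑ i, weylPotential (W i) (b s) s x := by
    intro s x
    simp only [A, _root_.smul_apply, ContinuousLinearMap.sum_apply, hV]
  obtain ⟨U, hU0, hU, hUs⟩ := exists_unitary_propagator (A := A)
    (C := ‖-(Complex.I / (ħ : ℂ))‖ * ∑ _i : Fin n, ∫ κ, ‖a κ‖)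
    (fun s => by
      rw [norm_smul]
      gcongr
      exact (norm_sum_le _ _).trans (Finset.sum_le_sum fun i _ => hVn i s))
    (fun x => by
      simp only [hA]
      exact (continuous_finsetSum _ fun i _ =>
        (hW i).continuous_weylPotential hT ha hb hbc x).const_smul _)
    (fun s x => by
      have h : ∀ i, conj (inner ℂ x (weylPotential (W i) (b s) s x)) =
          (inner ℂ x (weylPotential (W i) (b s) s x) : ℂ) := fun i => by
        rw [inner_conj_symm, (hW i).inner_weylPotential_left hT ha (hb.measurable s)
          (hb.norm_le s) (hbr s)]
      rw [hA, inner_smul_right, inner_sum]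
      have h2 : conj (∑ i, inner ℂ x (weylPotential (W i) (b s) s x)) =
          (∑ i, inner ℂ x (weylPotential (W i) (b s) s x) : ℂ) := by
        rw [map_sum]; exact Finset.sum_congr rfl fun i _ => h i
      obtain ⟨r, hr⟩ := Complex.conj_eq_iff_real.1 h2
      rw [hr]
      simp [Complex.div_re])
  have hUsymm : ∀ s x, HasDerivAt (fun r => (U r).symm x)
      ((Complex.I / ħ) • (U s).symm (∑ i, weylPotential (W i) (b s) s x)) s := by
    intro s x
    refine (hUs s x).congr_deriv ?_
    rw [hA, map_smul, neg_smul, neg_neg]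
  refine ⟨U, hU0, fun s x => (hU s x).congr_deriv (hA s _), hUsymm, fun i => ⟨fun s =>
    (hW i).heisenberg (U s), fun s z x => ?_⟩⟩
  simp only [heisenberg_apply, LinearIsometryEquiv.apply_symm_apply]
  have hy : HasDerivAt (fun r => W i z (U r x)) (W i z (A s (U s x))) s :=
    ((W i z).restrictScalars ℝ).hasFDerivAt.comp_hasDerivAt s (hU s x)
  have key := hasDerivAt_strong_apply (A := fun r => ((U r).symm : H →L[ℂ] H)) (C := 1)
    (fun r y => by simp) hy (hUsymm s _) (hUsymm s _).continuousAt
  refine key.congr_deriv ?_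
  change (Complex.I / ħ) • (U s).symm (∑ j, weylPotential (W j) (b s) s (W i z (U s x))) +
    (U s).symm (W i z (A s (U s x))) = _
  -- The potentials of the other particles commute with W i, so only the force on particle i
  -- remains.
  have hsum : ∑ j, weylPotential (W j) (b s) s (W i z (U s x)) -
      W i z (∑ j, weylPotential (W j) (b s) s (U s x)) = -W i z (∫ κ,
        (b s κ * (1 - sympPhase ħ (planeWave s κ) z)) • W i (planeWave s κ) (U s x)) := by
    rw [map_sum, ← Finset.sum_sub_distrib, Finset.sum_eq_single i]
    · exact weylPotential_map_sub (hW i) hT ha (hb.measurable s) (hb.norm_le s) s z _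
    · intro j _ hj
      rw [sub_eq_zero, weylPotential, weylPotential, ← (W i z).integral_comp_comm
        ((hW j).integrable_weylPotential hT ha (hb.measurable s) (hb.norm_le s) s _)]
      congr 1; funext κ
      rw [map_smul, hcomm i j hj.symm]
    · simp
  rw [hA, map_smul, map_smul, neg_smul, ← sub_eq_add_neg, ← smul_sub, ← map_sub, hsum, map_neg,
    smul_neg, ← neg_smul]
  have hint := (((hW i).heisenberg (U s)).integrable_coupling hT ha
    (hb.aestronglyMeasurable_mul_phase ħ s z) (hb.norm_mul_phase_le ħ s z) s x)
  have e : U s (∫ κ, (b s κ * (1 - sympPhase ħ (planeWave s κ) z)) •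
      (U s).symm (W i (planeWave s κ) (U s x))) = ∫ κ,
        (b s κ * (1 - sympPhase ħ (planeWave s κ) z)) • W i (planeWave s κ) (U s x) := by
    refine (((U s : H →L[ℂ] H)).integral_comp_comm hint).symm.trans ?_
    congr 1; funext κ
    simp [heisenberg_apply]
  rw [e]

end MeanFieldPropagator

/-! ### Hartree frame, completion of the square, propagation of chaos -/

section MeanFieldLimit

variable {H₀ : Type*} [NormedAddCommGroup H₀] [InnerProductSpace ℂ H₀] [CompleteSpace H₀]
  {H : Type*} [NormedAddCommGroup H] [InnerProductSpace ℂ H] [CompleteSpace H] {N : ℕ}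
  {ħ T : ℝ} {a : Space → ℂ}

/-- `N` copies of the Weyl system `W₀` acting on the product state `F = f ⊗ ⋯ ⊗ f`. -/
structure IsManyBodyWeyl (ħ : ℝ) (W₀ : Space × Space → H₀ →L[ℂ] H₀)
    (W : Fin N → Space × Space → H →L[ℂ] H) (f : H₀) (ι : Fin N → H₀ →L[ℂ] H) (F : H) : Prop where
  weyl₀ : IsWeylSystem ħ W₀
  weyl : ∀ i, IsWeylSystem ħ (W i)
  commute : ∀ i j, i ≠ j → ∀ z z' x, W i z (W j z' x) = W j z' (W i z x)
  intertwine : ∀ i z g, W i z (ι i g) = ι i (W₀ z g)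
  norm_state : ‖f‖ = 1
  norm_embed : ∀ i g, ‖ι i g‖ = ‖g‖
  embed_state : ∀ i, ι i f = F
  inner_embed : ∀ i j, i ≠ j → ∀ g h, inner ℂ (ι i g) (ι j h) = inner ℂ g f * inner ℂ f h
  symmetric : ∀ σ : Equiv.Perm (Fin N), ∃ S : H →L[ℂ] H, (∀ x, ‖S x‖ = ‖x‖) ∧
    (∀ i z x, S (W i z x) = W (σ i) z (S x)) ∧ S F = F

/-- The Fourier coefficients of the Hartree potential generated by `f`. -/
def hartreeCoupling (a : Space → ℂ) (W₀ : Space × Space → H₀ →L[ℂ] H₀) (s : ℝ) (f : H₀)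
    (κ : Space) : ℂ := a κ * inner ℂ f (W₀ (planeWave s (-κ)) f)

/-- The mean-field pair interaction with Fourier coefficients `a`, self-interaction included. -/
def pairInteraction (a : Space → ℂ) (W : Fin N → Space × Space → H →L[ℂ] H) (s : ℝ) (x : H) : H :=
  (N / 2 : ℂ) • ∫ κ, a κ • particleMean (fun i => W i (planeWave s κ))
    (particleMean (fun i => W i (planeWave s (-κ))) x)

theorem HasCouplingMoment.const_mul (ha : HasCouplingMoment a T) (c : ℂ) :
    HasCouplingMoment (fun κ => c * a κ) T where
  measurable := ha.measurable.const_mul c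
  integrable := by
    simpa only [norm_mul, mul_assoc] using ha.integrable.const_mul ‖c‖

section Hartree

variable {W₀ : Space × Space → H₀ →L[ℂ] H₀}

theorem continuous_hartreeCoupling (hW₀ : IsWeylSystem ħ W₀) {s : ℝ → ℝ} {f : ℝ → H₀}
    (hs : Continuous s) (hf : Continuous f) (κ : Space) :
    Continuous fun r => hartreeCoupling a W₀ (s r) (f r) κ := by
  have hp : Continuous fun r => planeWave (s r) (-κ) :=
    continuous_planeWave.comp (hs.prodMk continuous_const)
  exact continuous_const.mul (hf.inner (hW₀.continuous_apply hp hf))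

theorem aestronglyMeasurable_hartreeCoupling (hW₀ : IsWeylSystem ħ W₀)
    (ha : AEStronglyMeasurable a volume) (s : ℝ) (f : H₀) :
    AEStronglyMeasurable (hartreeCoupling a W₀ s f) volume := by
  have hp : Continuous fun κ => planeWave s (-κ) :=
    continuous_planeWave.comp (continuous_const.prodMk continuous_neg)
  have h : Continuous fun κ => inner ℂ f (W₀ (planeWave s (-κ)) f) :=
    continuous_const.inner ((hW₀.strong_continuous f).comp hp)
  exact ha.mul h.aestronglyMeasurable

theorem norm_hartreeCoupling_le (hW₀ : IsWeylSystem ħ W₀) (s : ℝ) (f : H₀) (κ : Space) :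
    ‖hartreeCoupling a W₀ s f κ‖ ≤ ‖f‖ ^ 2 * ‖a κ‖ := by
  rw [hartreeCoupling, norm_mul, mul_comm]
  gcongr
  refine (norm_inner_le_norm _ _).trans ?_
  rw [hW₀.norm_map, sq]

theorem hartreeCoupling_neg (hW₀ : IsWeylSystem ħ W₀) (hr : ∀ κ, conj (a κ) = a κ)
    (he : ∀ κ, a (-κ) = a κ) (s : ℝ) (f : H₀) (κ : Space) :
    hartreeCoupling a W₀ s f (-κ) = conj (hartreeCoupling a W₀ s f κ) := by
  rw [hartreeCoupling, hartreeCoupling, map_mul, hr, he, inner_conj_symm, hW₀.inner_map_left,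
    ← planeWave_neg]

/-- For each fixed f the Hartree potential is symmetric, so the nonlinear equation conserves the
norm. Normalization is needed before the mean-field flow can be set up: it gives ‖b s κ‖ ≤ ‖a κ‖. -/
theorem norm_eq_one_of_hartree (hT : 0 ≤ T) (ha : HasCouplingMoment a T)
    (hr : ∀ κ, conj (a κ) = a κ) (he : ∀ κ, a (-κ) = a κ) (hW₀ : IsWeylSystem ħ W₀) {f : ℝ → H₀}
    (hfc : ContinuousOn f (Set.Ici 0)) (hf : ∀ s, 0 < s → HasDerivAt f (-(Complex.I / ħ) •
      weylPotential W₀ (hartreeCoupling a W₀ s (f s)) s (f s)) s) (hf0 : ‖f 0‖ = 1) {t : ℝ}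
    (ht : 0 ≤ t) : ‖f t‖ = 1 := by
  have hsub : Set.Icc 0 t ⊆ Set.Ici (0 : ℝ) := fun s hs => hs.1
  have key : ∀ s, conj (inner ℂ (f s) (weylPotential W₀ (hartreeCoupling a W₀ s (f s)) s (f s))) =
      (inner ℂ (f s) (weylPotential W₀ (hartreeCoupling a W₀ s (f s)) s (f s)) : ℂ) := by
    intro s
    rw [inner_conj_symm, hW₀.inner_weylPotential_left hT (ha.const_mul ((‖f s‖ : ℂ) ^ 2))
      (aestronglyMeasurable_hartreeCoupling hW₀ ha.measurable s (f s)) (fun κ => ?_)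
      (hartreeCoupling_neg hW₀ hr he s (f s))]
    refine (norm_hartreeCoupling_le hW₀ s (f s) κ).trans (le_of_eq ?_)
    simp
  have h := norm_le_add_mul_of_re_inner_le (v := fun s => (inner ℂ (f s) (f s) : ℂ) - 1) (G := 0)
    ht le_rfl (v' := fun _ => 0)
    (((hfc.mono hsub).inner (hfc.mono hsub)).sub continuousOn_const)
    (fun s hs => by
      refine (((hf s hs.1).inner ℂ (hf s hs.1)).sub_const 1).congr_deriv ?_
      have h1 := key s
      rw [inner_conj_symm] at h1
      rw [inner_smul_left, inner_smul_right, h1]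
      simp only [map_neg, map_div₀, Complex.conj_I, Complex.conj_ofReal]
      ring)
    (fun s _ => by simp)
  have e : ∀ s, (inner ℂ (f s) (f s) : ℂ) = ((‖f s‖ ^ 2 : ℝ) : ℂ) := fun s => by
    rw [inner_self_eq_norm_sq_to_K]; norm_cast
  simp only [e, hf0, one_pow, Complex.ofReal_one, sub_self, norm_zero, mul_zero, add_zero] at h
  have h2 := sub_eq_zero.1 (norm_le_zero_iff.1 h)
  have h3 : ‖f t‖ ^ 2 = 1 := by exact_mod_cast h2
  exact (pow_eq_one_iff_of_nonneg (norm_nonneg _) two_ne_zero).1 h3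

end Hartree

theorem continuousOn_isometry_apply {S : Set ℝ} {U : ℝ → H ≃ₗᵢ[ℂ] H} {y : ℝ → H}
    (hU : ∀ x, Continuous fun s => U s x) (hy : ContinuousOn y S) :
    ContinuousOn (fun s => U s (y s)) S := by
  intro s₀ hs₀
  have h1 : Tendsto (fun s => U s (y s - y s₀)) (𝓝[S] s₀) (𝓝 0) := by
    rw [tendsto_zero_iff_norm_tendsto_zero]
    simp only [LinearIsometryEquiv.norm_map]
    rw [← tendsto_zero_iff_norm_tendsto_zero]
    have := (hy s₀ hs₀).tendsto.sub_const (y s₀)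
    rwa [sub_self] at this
  have h2 : Tendsto (fun s => U s (y s₀)) (𝓝[S] s₀) (𝓝 (U s₀ (y s₀))) :=
    ((hU (y s₀)).tendsto s₀).mono_left nhdsWithin_le_nhds
  have := h1.add h2
  simp only [map_sub, sub_add_cancel, zero_add] at this
  exact this

variable {W₀ : Space × Space → H₀ →L[ℂ] H₀} {W : Fin N → Space × Space → H →L[ℂ] H} {f₀ : H₀}
  {ι : Fin N → H₀ →L[ℂ] H} {F : H}

theorem continuous_particleMean_apply (hW : ∀ i, IsWeylSystem ħ (W i)) (s : ℝ) {g : Space → Space}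
    {y : Space → H} (hg : Continuous g) (hy : Continuous y) :
    Continuous fun κ => particleMean (fun i => W i (planeWave s (g κ))) (y κ) := by
  have hp : Continuous fun κ => planeWave s (g κ) :=
    continuous_planeWave.comp (continuous_const.prodMk hg)
  simp only [particleMean_apply]
  exact (continuous_finsetSum _ fun i _ => (hW i).continuous_apply hp hy).const_smul _

theorem norm_particleMean_weyl_le (hW : ∀ i, IsWeylSystem ħ (W i)) (s : ℝ) (κ : Space) (x : H) :
    ‖particleMean (fun i => W i (planeWave s κ)) x‖ ≤ ‖x‖ := by
  have := (particleMean (fun i => W i (planeWave s κ))).le_of_opNorm_le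
    (norm_particleMean_le zero_le_one fun i => (hW i).opNorm_le _) x
  rwa [one_mul] at this

/-- Completing the square in the pair interaction. -/
theorem pairing_fluct_eq (hN : 0 < N) (hW : ∀ i, IsWeylSystem ħ (W i)) (hT : 0 ≤ T)
    (ha : HasCouplingMoment a T) (he : ∀ κ, a (-κ) = a κ) (s : ℝ) {r : Space → ℂ}
    (hrc : Continuous r) (hr1 : ∀ κ, ‖r κ‖ ≤ 1) (x : H) :
    (N / 2 : ℂ) • ∫ κ, a κ • fluct (fun i => W i (planeWave s κ)) (r κ)
        (fluct (fun i => W i (planeWave s (-κ))) (r (-κ)) x) =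
      pairInteraction a W s x - ∑ i, weylPotential (W i) (fun κ => a κ * r (-κ)) s x +
        ((N / 2 : ℂ) * ∫ κ, a κ * (r κ * r (-κ))) • x := by
  have han := ha.integrable_norm hT
  set m : Space → H → H := fun κ y => particleMean (fun i => W i (planeWave s κ)) y with hm
  have hmx : Continuous fun κ => m κ x :=
    continuous_particleMean_apply hW s continuous_id continuous_const
  have hmx' : Continuous fun κ => m (-κ) x :=
    continuous_particleMean_apply hW s continuous_neg continuous_const
  have hmm : Continuous fun κ => m κ (m (-κ) x) :=
    continuous_particleMean_apply hW s continuous_id hmx'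
  have hrn : Continuous fun κ => r (-κ) := hrc.comp continuous_neg
  have hbd : ∀ κ y, ‖m κ y‖ ≤ ‖y‖ := fun κ y => norm_particleMean_weyl_le hW s κ y
  have i0 : ∀ g : Space → H, Continuous g → (∀ κ, ‖g κ‖ ≤ ‖x‖) → Integrable fun κ => a κ • g κ := by
    intro g hg hgb
    refine (han.mul_const ‖x‖).mono' (ha.measurable.smul hg.aestronglyMeasurable)
      (Eventually.of_forall fun κ => ?_)
    rw [norm_smul]; gcongr; exact hgb κ
  have hsm : ∀ (c : ℂ) (y : H), ‖c‖ ≤ 1 → ‖y‖ ≤ ‖x‖ → ‖c • y‖ ≤ ‖x‖ := fun c y hc hy => by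
    rw [norm_smul]; nlinarith [norm_nonneg c, norm_nonneg y]
  have i1 := i0 _ hmm fun κ => (hbd κ _).trans (hbd _ x)
  have i2 := i0 (fun κ => r (-κ) • m κ x) (hrn.smul hmx) fun κ => hsm _ _ (hr1 _) (hbd κ x)
  have i3 := i0 (fun κ => r κ • m (-κ) x) (hrc.smul hmx') fun κ => hsm _ _ (hr1 _) (hbd _ x)
  have i4 := i0 (fun κ => (r κ * r (-κ)) • x) ((hrc.mul hrn).smul continuous_const) fun κ =>
    hsm _ _ (by rw [norm_mul]; nlinarith [hr1 κ, hr1 (-κ), norm_nonneg (r κ), norm_nonneg (r (-κ))])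
      le_rfl
  -- As a is even, the two cross terms of the square coincide; together they are twice half of the
  -- mean-field potential.
  have e1 : ∫ κ, a κ • (r κ • m (-κ) x) = ∫ κ, a κ • (r (-κ) • m κ x) := by
    rw [← integral_neg_eq_self]
    simp only [he, neg_neg]
  have e2 : ∫ κ, a κ • fluct (fun i => W i (planeWave s κ)) (r κ)
      (fluct (fun i => W i (planeWave s (-κ))) (r (-κ)) x) =
      ∫ κ, (a κ • m κ (m (-κ) x) - a κ • (r (-κ) • m κ x) - a κ • (r κ • m (-κ) x) +
        a κ • ((r κ * r (-κ)) • x)) := by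
    congr 1; funext κ
    simp only [fluct_apply, hm, map_sub, map_smul]
    module
  have e3 : ∑ i, weylPotential (W i) (fun κ => a κ * r (-κ)) s x =
      (N : ℂ) • ∫ κ, a κ • (r (-κ) • m κ x) := by
    have hN' : (N : ℂ) ≠ 0 := by exact_mod_cast hN.ne'
    simp only [weylPotential]
    rw [← integral_finsetSum]
    · rw [← integral_smul]
      congr 1; funext κ
      simp only [hm, particleMean_apply]
      rw [smul_comm (r (-κ)), smul_comm (a κ), smul_smul, mul_inv_cancel₀ hN', one_smul, smul_smul,
        Finset.smul_sum]
    · intro i _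
      refine (hW i).integrable_weylPotential hT ha (ha.measurable.mul hrn.aestronglyMeasurable)
        (fun κ => ?_) s x
      rw [Pi.mul_apply, norm_mul]
      exact mul_le_of_le_one_right (norm_nonneg _) (hr1 _)
  have e4 : ∫ κ, a κ • ((r κ * r (-κ)) • x) = (∫ κ, a κ * (r κ * r (-κ))) • x := by
    simp only [smul_smul]
    exact integral_smul_const _ _
  have i12 := i1.sub i2
  have i123 := i12.sub i3
  have e5 : ∫ κ, (a κ • m κ (m (-κ) x) - a κ • (r (-κ) • m κ x) - a κ • (r κ • m (-κ) x) +
        a κ • ((r κ * r (-κ)) • x)) = (∫ κ, a κ • m κ (m (-κ) x)) -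
        (∫ κ, a κ • (r (-κ) • m κ x)) - (∫ κ, a κ • (r κ • m (-κ) x)) +
        ∫ κ, a κ • ((r κ * r (-κ)) • x) := by
    refine (integral_add i123 i4).trans ?_
    congr 1
    refine (integral_sub i12 i3).trans ?_
    congr 1
    exact integral_sub i1 i2
  rw [e2, e5, e1, e3, e4, pairInteraction]
  module

theorem inner_heisenberg (U : H ≃ₗᵢ[ℂ] H) (A : H →L[ℂ] H) (x y : H) :
    inner ℂ x (heisenberg U A y) = inner ℂ (U x) (A (U y)) := by
  rw [heisenberg_apply, ← U.inner_map_map, U.apply_symm_apply]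

theorem opProd_heisenberg (U : H ≃ₗᵢ[ℂ] H) (W : Fin N → Space × Space → H →L[ℂ] H)
    (l : List (Fin N × (Space × Space))) (x : H) :
    opProd (fun i z => heisenberg U (W i z)) l x = U.symm (opProd W l (U x)) := by
  induction l generalizing x with
  | nil => exact (U.symm_apply_apply x).symm
  | cons q l ih =>
    simp only [opProd, ContinuousLinearMap.comp_apply, ih, heisenberg_apply, U.apply_symm_apply]

/-- Propagation of chaos in the interaction picture. -/
theorem IsManyBodyWeyl.norm_inner_opProd_sub_prod_le (hW : IsManyBodyWeyl ħ W₀ W f₀ ι F)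
    (hħ : 0 < ħ) (hN : 0 < N) (hT : 0 ≤ T) (ha : HasCouplingMoment a T)
    (hsmall : T * couplingMoment a T ≤ 1 / 8) (hr : ∀ κ, conj (a κ) = a κ)
    (he : ∀ κ, a (-κ) = a κ) {f : ℝ → H₀} (hfc : ContinuousOn f (Set.Ici 0)) (hf0 : f 0 = f₀)
    (hf : ∀ s, 0 < s → HasDerivAt f (-(Complex.I / ħ) •
      weylPotential W₀ (hartreeCoupling a W₀ s (f s)) s (f s)) s)
    {Φ : ℝ → H} (hΦc : ContinuousOn Φ (Set.Ici 0)) (hΦ0 : Φ 0 = F) {c : ℝ}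
    (hΦ : ∀ s, 0 < s → HasDerivAt Φ (-(Complex.I / ħ) •
      (pairInteraction a W s (Φ s) + (c : ℂ) • Φ s)) s)
    {t : ℝ} (ht : t ∈ Set.Icc 0 T) {ζ : ℝ} (hζ : 0 ≤ ζ)
    (l : List (Fin N × (Space × Space))) (hl : (l.map Prod.fst).Nodup)
    (hlζ : ∀ q ∈ l, ‖q.2‖ ≤ ζ) :
    ‖inner ℂ (Φ t) (opProd W l (Φ t)) - (l.map fun q => inner ℂ (f t) (W₀ q.2 (f t))).prod‖ ≤
      l.length ^ 3 * (18 + 412 * (T * couplingMoment a T) * (1 + ζ) ^ 2) / N := by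
  have hW₀ := hW.weyl₀
  -- The propagators live on all of ℝ whereas the Hartree solution starts at time 0; it is continued
  -- as a constant to negative times.
  set g : ℝ → H₀ := fun s => f (max s 0) with hg
  have hgc : Continuous g :=
    hfc.comp_continuous (continuous_id.max continuous_const) fun s => Set.mem_Ici.2 (le_max_right _ _)
  have hg1 : ∀ s, ‖g s‖ = 1 := fun s =>
    norm_eq_one_of_hartree hT ha hr he hW₀ hfc hf (hf0 ▸ hW.norm_state) (le_max_right _ _)
  have hgf : ∀ s, 0 ≤ s → g s = f s := fun s hs => by rw [hg]; simp [max_eq_left hs]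
  set b : ℝ → Space → ℂ := fun s => hartreeCoupling a W₀ s (g s) with hbdef
  have hb : IsCoupling a b := ⟨fun s => aestronglyMeasurable_hartreeCoupling hW₀ ha.measurable _ _,
    fun s κ => by simpa [hg1] using norm_hartreeCoupling_le (a := a) hW₀ s (g s) κ⟩
  have hbc : ∀ κ, Continuous fun s => b s κ := continuous_hartreeCoupling hW₀ continuous_id hgc
  have hbr : ∀ s κ, b s (-κ) = conj (b s κ) := fun s => hartreeCoupling_neg hW₀ hr he s (g s)
  obtain ⟨U₀, hU₀0, hU₀, hU₀s, hQ₀⟩ := exists_mean_field_propagator (n := 1) (W := fun _ => W₀)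
    (fun _ => hW₀) (fun i j hij => absurd (Subsingleton.elim i j) hij) hT ha hb hbc hbr
  obtain ⟨U, hU0, hU, hUs, hQ⟩ := exists_mean_field_propagator (W := W) hW.weyl hW.commute hT ha
    hb hbc hbr
  simp only [Finset.univ_unique, Finset.sum_singleton] at hU₀ hU₀s
  have hU0s : ∀ x, (U 0).symm x = x := fun x => by
    rw [LinearIsometryEquiv.symm_apply_eq, hU0]
  have hU₀0s : ∀ x, (U₀ 0).symm x = x := fun x => by
    rw [LinearIsometryEquiv.symm_apply_eq, hU₀0]
  have hM : IsMeanFieldFlow ħ T a b (fun s z => heisenberg (U₀ s) (W₀ z))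
      (fun i s z => heisenberg (U s) (W i z)) f₀ ι F :=
    { hbar_pos := hħ, card_pos := hN, time_nonneg := hT, coupling := hb, moment := ha
      small := hsmall, flow₀ := hQ₀ 0, flow := hQ
      commute_zero := fun i j hij z z' x => by
        simp only [heisenberg_apply, hU0, hU0s, hW.commute i j hij]
      intertwine_zero := fun i z x => by
        simp only [heisenberg_apply, hU0, hU0s, hU₀0, hU₀0s, hW.intertwine]
      norm_state := hW.norm_state, norm_embed := hW.norm_embed, embed_state := hW.embed_state
      inner_embed := hW.inner_embed }
  have hsym : IsPermutationSymmetric (fun i s z => heisenberg (U s) (W i z)) F := by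
    intro σ
    obtain ⟨S, h1, h2, h3⟩ := hW.symmetric σ
    exact ⟨S, h1, fun i z x => by simp only [heisenberg_apply, hU0, hU0s, h2], h3⟩
  -- Once the coefficients b are frozen along the Hartree solution the equation is linear; both
  -- curves solve it with the same initial value, and skewness gives uniqueness.
  have hUf : ∀ s, 0 ≤ s → U₀ s f₀ = f s := by
    intro s hs
    have hsub : Set.Icc 0 s ⊆ Set.Ici (0 : ℝ) := fun r hr => hr.1
    obtain hclm := fun r => hW₀.exists_weylPotential_clm hT ha (hb.measurable r) (hb.norm_le r) r
    choose V hV _ using hclm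
    have h := norm_le_add_mul_of_re_inner_le (v := fun r => U₀ r f₀ - f r) (G := 0) hs le_rfl
      (v' := fun r => -(Complex.I / ħ) • weylPotential W₀ (b r) r (U₀ r f₀ - f r))
      ((continuous_iff_continuousAt.2 fun r => (hU₀ r f₀).continuousAt).continuousOn.sub
        (hfc.mono hsub))
      (fun r hr => by
        refine ((hU₀ r f₀).fun_sub (hf r hr.1)).congr_deriv ?_
        rw [← hgf r hr.1.le]
        change -(Complex.I / ħ) • weylPotential W₀ (b r) r _ -
          -(Complex.I / ħ) • weylPotential W₀ (b r) r _ = _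
        rw [← hV, ← hV, ← hV, map_sub, smul_sub])
      (fun r hr => by
        have h1 := hW₀.inner_weylPotential_left hT ha (hb.measurable r) (hb.norm_le r) (hbr r) r
          (U₀ r f₀ - f r) (U₀ r f₀ - f r)
        rw [← inner_conj_symm] at h1
        obtain ⟨x, hx⟩ := Complex.conj_eq_iff_real.1 h1
        rw [inner_smul_right, hx, mul_zero]
        simp [Complex.div_re])
    rw [hU₀0, hf0, sub_self, norm_zero, mul_zero, add_zero] at h
    exact sub_eq_zero.1 (norm_le_zero_iff.1 h)
  set φ : ℝ → H := fun s => (U s).symm (Φ s) with hφdef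
  have hφ : IsFluctuationDynamics ħ T a (fun s z => heisenberg (U₀ s) (W₀ z))
      (fun i s z => heisenberg (U s) (W i z)) f₀ F φ := by
    refine ⟨hr, ?_, by rw [hφdef]; simp only [hU0s, hΦ0], ?_⟩
    · exact continuousOn_isometry_apply (U := fun s => (U s).symm)
        (fun x => continuous_iff_continuousAt.2 fun s => (hUs s x).continuousAt)
        (hΦc.mono fun s hs => hs.1)
    -- The scalar collects the constant c and the constant term of the completed square.
    refine ⟨fun s => c - N / 2 * (∫ κ, a κ * (inner ℂ (f s) (W₀ (planeWave s κ) (f s)) *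
      inner ℂ (f s) (W₀ (planeWave s (-κ)) (f s)))).re, fun s hs => ?_⟩
    have h1 := hasDerivAt_strong_apply (A := fun r => ((U r).symm : H →L[ℂ] H)) (C := 1)
      (fun r y => by simp) (hΦ s hs.1) (hUs s _) (hUs s _).continuousAt
    refine h1.congr_deriv ?_
    set r : Space → ℂ := fun κ => inner ℂ (f s) (W₀ (planeWave s κ) (f s)) with hrdef
    have hfs : ‖f s‖ = 1 := by rw [← hgf s hs.1.le, hg1]
    have hrc : Continuous r := continuous_const.inner ((hW₀.strong_continuous (f s)).comp
      (continuous_planeWave.comp (continuous_const.prodMk continuous_id)))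
    have hr1 : ∀ κ, ‖r κ‖ ≤ 1 := fun κ => by
      refine (norm_inner_le_norm _ _).trans ?_
      rw [hW₀.norm_map, hfs, one_mul]
    have hpair := pairing_fluct_eq hN hW.weyl hT ha he s hrc hr1 (Φ s)
    have hrr : ∀ κ, a κ * (r κ * r (-κ)) = ((a κ * (r κ * r (-κ))).re : ℂ) := by
      intro κ
      refine (Complex.conj_eq_iff_re.1 ?_).symm
      have h2 : conj (r κ) = r (-κ) := by
        simp only [hrdef]
        rw [inner_conj_symm, hW₀.inner_map_left, planeWave_neg]
      have h3 : conj (r (-κ)) = r κ := by rw [← h2, Complex.conj_conj]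
      rw [map_mul, map_mul, hr, h2, h3, mul_comm (r (-κ))]
    have hint : (∫ κ, a κ * (r κ * r (-κ))) = ((∫ κ, a κ * (r κ * r (-κ))).re : ℂ) := by
      have e : (fun κ => a κ * (r κ * r (-κ))) = fun κ => ((a κ * (r κ * r (-κ))).re : ℂ) :=
        funext hrr
      rw [e, integral_complex_ofReal]
      simp
    have hwf : ∀ κ y, waveFluct (fun s z => heisenberg (U₀ s) (W₀ z))
        (fun i s z => heisenberg (U s) (W i z)) f₀ s κ y =
        (U s).symm (fluct (fun i => W i (planeWave s κ)) (r κ) (U s y)) := by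
      intro κ y
      rw [waveFluct, inner_heisenberg, hUf s hs.1.le]
      simp only [fluct_apply, particleMean_apply, heisenberg_apply, map_sub, map_smul, map_sum,
        LinearIsometryEquiv.symm_apply_apply, hrdef]
    have hgen : (N / 2 : ℂ) • ∫ κ, a κ • waveFluct (fun s z => heisenberg (U₀ s) (W₀ z))
        (fun i s z => heisenberg (U s) (W i z)) f₀ s κ (waveFluct
          (fun s z => heisenberg (U₀ s) (W₀ z)) (fun i s z => heisenberg (U s) (W i z)) f₀ s (-κ)
            (φ s)) = (U s).symm ((N / 2 : ℂ) • ∫ κ, a κ • fluct (fun i => W i (planeWave s κ)) (r κ)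
        (fluct (fun i => W i (planeWave s (-κ))) (r (-κ)) (Φ s))) := by
      simp only [hwf, hφdef, LinearIsometryEquiv.apply_symm_apply, map_smul]
      congr 1
      refine Eq.trans ?_ ((U s).symm.toContinuousLinearEquiv.integral_comp_comm _)
      congr 1; funext κ
      simp
    rw [fluctGenerator, hgen, hpair]
    -- The linear term of the completed square is exactly the Hartree potential, so it cancels
    -- against the generator of U. This cancellation is the reason for choosing the Hartree frame.
    have hbs : (fun κ => a κ * r (-κ)) = b s := by
      funext κ
      simp only [hbdef, hartreeCoupling, hrdef, hgf s hs.1.le]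
    rw [hbs, hint]
    change (Complex.I / ħ) • (U s).symm (∑ i, weylPotential (W i) (b s) s (Φ s)) +
      (U s).symm (-(Complex.I / ħ) • (pairInteraction a W s (Φ s) + (c : ℂ) • Φ s)) = _
    simp only [map_smul, map_add, map_sub, Complex.ofReal_sub, Complex.ofReal_mul,
      Complex.ofReal_div, Complex.ofReal_natCast, Complex.ofReal_ofNat, Complex.ofReal_re, hφdef]
    module
  have := hM.norm_inner_opProd_sub_prod_le hφ hsym ht hζ l hl hlζ
  have e1 : inner ℂ (φ t) (opProd (fun i z => heisenberg (U t) (W i z)) l (φ t)) =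
      inner ℂ (Φ t) (opProd W l (Φ t)) := by
    rw [opProd_heisenberg, hφdef]
    simp only [LinearIsometryEquiv.apply_symm_apply, LinearIsometryEquiv.inner_map_map]
  have e2 : ∀ z, inner ℂ f₀ (heisenberg (U₀ t) (W₀ z) f₀) = inner ℂ (f t) (W₀ z (f t)) := by
    intro z
    rw [inner_heisenberg, hUf t ht.1]
  rw [e1] at this
  simpa only [e2] using this

end MeanFieldLimit

/-! ### Modulations and translations on L² -/

section PhaseShift

variable {ι : Type} [Fintype ι]

theorem L2_norm_sq (f : L2 ι) : ‖f‖ ^ 2 = ∫ x, ‖f x‖ ^ 2 := by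
  have h := L2.inner_def (𝕜 := ℂ) f f
  rw [inner_self_eq_norm_sq_to_K] at h
  have e : ∀ x, inner ℂ (f x) (f x) = ((‖f x‖ ^ 2 : ℝ) : ℂ) := fun x => by
    rw [inner_self_eq_norm_sq_to_K]; norm_cast
  simp only [e] at h
  rw [integral_complex_ofReal] at h
  apply Complex.ofReal_injective
  rw [← h]; norm_cast

theorem memLp_phaseShift (θ : C(EuclideanSpace ℝ ι, ℝ)) (v : EuclideanSpace ℝ ι) (Ψ : L2 ι) :
    MemLp (fun x => Complex.exp (Complex.I * θ x) * Ψ (x + v)) 2 volume := by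
  have h1 : MemLp (fun x => Ψ (x + v)) 2 volume :=
    (Lp.memLp Ψ).comp_measurePreserving (measurePreserving_add_right volume v)
  have hc : Continuous fun x => Complex.exp (Complex.I * θ x) := by fun_prop
  refine (memLp_congr_norm (hc.aestronglyMeasurable.mul h1.aestronglyMeasurable)
    h1.aestronglyMeasurable (ae_of_all _ fun x => ?_)).2 h1
  rw [Pi.mul_apply, norm_mul, mul_comm Complex.I, Complex.norm_exp_ofReal_mul_I, one_mul]

theorem ae_comp_add_right {p : EuclideanSpace ℝ ι → Prop} (h : ∀ᵐ x, p x)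
    (v : EuclideanSpace ℝ ι) : ∀ᵐ x, p (x + v) :=
  (measurePreserving_add_right volume v).quasiMeasurePreserving.ae h

/-- The unitary `Ψ ↦ e^{iθ(x)} Ψ(x + v)`. -/
def phaseShift (θ : C(EuclideanSpace ℝ ι, ℝ)) (v : EuclideanSpace ℝ ι) : L2 ι →L[ℂ] L2 ι :=
  LinearMap.mkContinuous
    { toFun := fun Ψ => (memLp_phaseShift θ v Ψ).toLp
      map_add' := fun Ψ Ψ' => by
        rw [← MemLp.toLp_add]
        refine MemLp.toLp_congr _ _ ?_
        filter_upwards [ae_comp_add_right (Lp.coeFn_add Ψ Ψ') v] with x hx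
        simp only [hx, Pi.add_apply, mul_add]
      map_smul' := fun c Ψ => by
        rw [RingHom.id_apply, ← MemLp.toLp_const_smul]
        refine MemLp.toLp_congr _ _ ?_
        filter_upwards [ae_comp_add_right (Lp.coeFn_smul c Ψ) v] with x hx
        simp only [hx, Pi.smul_apply, smul_eq_mul]
        ring } 1
    (fun Ψ => by
      rw [one_mul]
      change ‖(memLp_phaseShift θ v Ψ).toLp‖ ≤ _
      rw [Lp.norm_toLp, Lp.norm_def]
      refine le_of_eq (congrArg _ ?_)
      rw [← eLpNorm_comp_measurePreserving (Lp.aestronglyMeasurable Ψ)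
        (measurePreserving_add_right volume v)]
      refine eLpNorm_congr_norm_ae (ae_of_all _ fun x => ?_)
      rw [norm_mul, mul_comm Complex.I, Complex.norm_exp_ofReal_mul_I, one_mul]
      rfl)

theorem phaseShift_ae (θ : C(EuclideanSpace ℝ ι, ℝ)) (v : EuclideanSpace ℝ ι) (Ψ : L2 ι) :
    phaseShift θ v Ψ =ᵐ[volume] fun x => Complex.exp (Complex.I * θ x) * Ψ (x + v) :=
  (memLp_phaseShift θ v Ψ).coeFn_toLp

theorem norm_phaseShift (θ : C(EuclideanSpace ℝ ι, ℝ)) (v : EuclideanSpace ℝ ι) (Ψ : L2 ι) :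
    ‖phaseShift θ v Ψ‖ = ‖Ψ‖ := by
  change ‖(memLp_phaseShift θ v Ψ).toLp‖ = _
  rw [Lp.norm_toLp, Lp.norm_def]
  refine congrArg _ ?_
  rw [← eLpNorm_comp_measurePreserving (Lp.aestronglyMeasurable Ψ)
    (measurePreserving_add_right volume v)]
  refine eLpNorm_congr_norm_ae (ae_of_all _ fun x => ?_)
  rw [norm_mul, mul_comm Complex.I, Complex.norm_exp_ofReal_mul_I, one_mul]
  rfl

theorem phaseShift_phaseShift {θ θ' θ'' : C(EuclideanSpace ℝ ι, ℝ)} {v v' : EuclideanSpace ℝ ι}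
    {c : ℝ} (h : ∀ x, θ x + θ' (x + v) = c + θ'' x) (Ψ : L2 ι) :
    phaseShift θ v (phaseShift θ' v' Ψ) =
      Complex.exp (Complex.I * c) • phaseShift θ'' (v + v') Ψ := by
  apply Lp.ext
  filter_upwards [phaseShift_ae θ v (phaseShift θ' v' Ψ),
    ae_comp_add_right (phaseShift_ae θ' v' Ψ) v, phaseShift_ae θ'' (v + v') Ψ,
    Lp.coeFn_smul (Complex.exp (Complex.I * c)) (phaseShift θ'' (v + v') Ψ)] with x h1 h2 h3 h4
  rw [h1, h2, h4, Pi.smul_apply, h3, smul_eq_mul, ← mul_assoc, ← mul_assoc, ← Complex.exp_add,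
    ← Complex.exp_add, ← mul_add, ← mul_add, ← Complex.ofReal_add, ← Complex.ofReal_add, h,
    add_assoc]

theorem phaseShift_eq_self {θ : C(EuclideanSpace ℝ ι, ℝ)} (h : ∀ x, θ x = 0) (Ψ : L2 ι) :
    phaseShift θ 0 Ψ = Ψ := by
  apply Lp.ext
  filter_upwards [phaseShift_ae θ 0 Ψ] with x hx
  rw [hx, h]; simp

/-- A dominated convergence theorem for modulations. -/
theorem continuous_phaseShift_zero {X : Type*} [TopologicalSpace X] [FirstCountableTopology X]
    {θ : X → C(EuclideanSpace ℝ ι, ℝ)} (hθ : ∀ x, Continuous fun r => θ r x) (Ψ : L2 ι) :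
    Continuous fun r => phaseShift (θ r) 0 Ψ := by
  rw [continuous_iff_continuousAt]
  intro r₀
  rw [ContinuousAt, tendsto_iff_norm_sub_tendsto_zero]
  have hsq : Tendsto (fun r => ‖phaseShift (θ r) 0 Ψ - phaseShift (θ r₀) 0 Ψ‖ ^ 2) (𝓝 r₀)
      (𝓝 0) := by
    have e : ∀ r, ‖phaseShift (θ r) 0 Ψ - phaseShift (θ r₀) 0 Ψ‖ ^ 2 =
        ∫ x, ‖(Complex.exp (Complex.I * θ r x) - Complex.exp (Complex.I * θ r₀ x)) * Ψ x‖ ^ 2 := by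
      intro r
      rw [L2_norm_sq]
      refine integral_congr_ae ?_
      filter_upwards [Lp.coeFn_sub (phaseShift (θ r) 0 Ψ) (phaseShift (θ r₀) 0 Ψ),
        phaseShift_ae (θ r) 0 Ψ, phaseShift_ae (θ r₀) 0 Ψ] with x h1 h2 h3
      rw [h1, Pi.sub_apply, h2, h3, add_zero, sub_mul]
    simp only [e]
    have hΨ : Integrable fun x => ‖Ψ x‖ ^ 2 := (memLp_two_iff_integrable_sq_norm
      (Lp.aestronglyMeasurable Ψ)).1 (Lp.memLp Ψ)
    have := tendsto_integral_filter_of_dominated_convergence (l := 𝓝 r₀) (μ := volume)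
      (F := fun r x => ‖(Complex.exp (Complex.I * θ r x) -
        Complex.exp (Complex.I * θ r₀ x)) * Ψ x‖ ^ 2) (f := fun _ => 0)
      (fun x => 4 * ‖Ψ x‖ ^ 2) (Eventually.of_forall fun r => ?_)
      (Eventually.of_forall fun r => ae_of_all _ fun x => ?_) (hΨ.const_mul 4)
      (ae_of_all _ fun x => ?_)
    · simpa using this
    · have hc : Continuous fun x => Complex.exp (Complex.I * θ r x) -
        Complex.exp (Complex.I * θ r₀ x) := by fun_prop
      exact ((hc.aestronglyMeasurable.mul (Lp.aestronglyMeasurable Ψ)).norm.pow 2)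
    · rw [Real.norm_of_nonneg (by positivity), norm_mul, mul_pow]
      have h1 : ‖Complex.exp (Complex.I * θ r x) - Complex.exp (Complex.I * θ r₀ x)‖ ≤ 2 := by
        refine (norm_sub_le _ _).trans ?_
        rw [mul_comm, Complex.norm_exp_ofReal_mul_I, mul_comm, Complex.norm_exp_ofReal_mul_I]
        norm_num
      gcongr
      nlinarith [norm_nonneg (Complex.exp (Complex.I * θ r x) - Complex.exp (Complex.I * θ r₀ x))]
    · have hc : Continuous fun r => ‖(Complex.exp (Complex.I * θ r x) -
          Complex.exp (Complex.I * θ r₀ x)) * Ψ x‖ ^ 2 := by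
        have := hθ x
        fun_prop
      have := hc.tendsto r₀
      simpa using this
  have := hsq.sqrt
  simpa [Real.sqrt_sq] using this

theorem continuous_phaseShift_translate {X : Type*} [TopologicalSpace X]
    {v : X → EuclideanSpace ℝ ι} (hv : Continuous v) (Ψ : L2 ι) :
    Continuous fun r => phaseShift 0 (v r) Ψ := by
  have e : ∀ r, phaseShift 0 (v r) Ψ =
      Lp.compMeasurePreserving (ContinuousMap.id _ + ContinuousMap.const _ (v r) :
        C(EuclideanSpace ℝ ι, EuclideanSpace ℝ ι)) (measurePreserving_add_right volume (v r)) Ψ := by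
    intro r
    apply Lp.ext
    filter_upwards [phaseShift_ae 0 (v r) Ψ, Lp.coeFn_compMeasurePreserving Ψ
      (measurePreserving_add_right volume (v r))] with x h1 h2
    rw [h1]
    refine Eq.trans ?_ h2.symm
    simp
  simp only [e]
  refine continuous_const.compMeasurePreservingLp ?_ _ (by simp)
  refine ContinuousMap.continuous_of_continuous_uncurry _ ?_
  simp only [Function.uncurry_def, ContinuousMap.add_apply, ContinuousMap.id_apply,
    ContinuousMap.const_apply]
  fun_prop

theorem continuous_phaseShift {X : Type*} [TopologicalSpace X] [FirstCountableTopology X]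
    {θ : X → C(EuclideanSpace ℝ ι, ℝ)} {v : X → EuclideanSpace ℝ ι}
    (hθ : ∀ x, Continuous fun r => θ r x) (hv : Continuous v) (Ψ : L2 ι) :
    Continuous fun r => phaseShift (θ r) (v r) Ψ := by
  have e : ∀ r, phaseShift (θ r) (v r) Ψ = phaseShift (θ r) 0 (phaseShift 0 (v r) Ψ) := by
    intro r
    rw [phaseShift_phaseShift (θ'' := θ r) (c := 0) (by simp)]
    simp
  rw [continuous_iff_continuousAt]
  intro r₀
  have h1 : Tendsto (fun r => phaseShift (θ r) 0 (phaseShift 0 (v r) Ψ - phaseShift 0 (v r₀) Ψ))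
      (𝓝 r₀) (𝓝 0) := by
    rw [tendsto_zero_iff_norm_tendsto_zero]
    simp only [norm_phaseShift]
    rw [← tendsto_zero_iff_norm_tendsto_zero]
    have := ((continuous_phaseShift_translate hv Ψ).tendsto r₀).sub_const (phaseShift 0 (v r₀) Ψ)
    rwa [sub_self] at this
  have h2 := (continuous_phaseShift_zero hθ (phaseShift 0 (v r₀) Ψ)).tendsto r₀
  have h3 := h1.add h2
  simp only [map_sub, sub_add_cancel, zero_add, ← e] at h3
  exact h3

end PhaseShift

/-! ### Weyl operators on L² -/

section WeylOperators

variable {ι : Type} [Fintype ι] {ħ : ℝ}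

/-- The phase `x ↦ ⟨k, x⟩ + c`. -/
def linearPhase (k : EuclideanSpace ℝ ι) (c : ℝ) : C(EuclideanSpace ℝ ι, ℝ) where
  toFun x := inner ℝ k x + c

theorem linearPhase_apply (k : EuclideanSpace ℝ ι) (c : ℝ) (x : EuclideanSpace ℝ ι) :
    linearPhase k c x = inner ℝ k x + c := rfl

/-- The Weyl operator `Ψ ↦ e^{i(⟨k, x⟩ + ħ⟨k, y⟩/2)} Ψ(x + ħy)`. -/
def weylOp (ħ : ℝ) (k y : EuclideanSpace ℝ ι) : L2 ι →L[ℂ] L2 ι :=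
  phaseShift (linearPhase k (ħ * inner ℝ k y / 2)) (ħ • y)

theorem weylOp_ae (k y : EuclideanSpace ℝ ι) (Ψ : L2 ι) :
    weylOp ħ k y Ψ =ᵐ[volume] fun x =>
      Complex.exp (Complex.I * (inner ℝ k x + ħ * inner ℝ k y / 2 : ℝ)) * Ψ (x + ħ • y) :=
  phaseShift_ae _ _ _

theorem norm_weylOp (k y : EuclideanSpace ℝ ι) (Ψ : L2 ι) : ‖weylOp ħ k y Ψ‖ = ‖Ψ‖ :=
  norm_phaseShift _ _ _

theorem weylOp_zero (Ψ : L2 ι) : weylOp ħ 0 0 Ψ = Ψ := by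
  rw [weylOp, smul_zero]
  exact phaseShift_eq_self (fun x => by simp [linearPhase_apply]) Ψ

theorem weylOp_weylOp (k y k' y' : EuclideanSpace ℝ ι) (Ψ : L2 ι) :
    weylOp ħ k y (weylOp ħ k' y' Ψ) =
      Complex.exp (Complex.I * (ħ * (inner ℝ y k' - inner ℝ k y') / 2 : ℝ)) •
        weylOp ħ (k + k') (y + y') Ψ := by
  rw [weylOp, weylOp, phaseShift_phaseShift (θ'' := linearPhase (k + k')
    (ħ * inner ℝ (k + k') (y + y') / 2)) (c := ħ * (inner ℝ y k' - inner ℝ k y') / 2), weylOp,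
    smul_add]
  intro x
  simp only [linearPhase_apply, inner_add_left, inner_add_right, inner_smul_right,
    real_inner_comm k' y]
  ring

theorem weylOp_comm {k y k' y' : EuclideanSpace ℝ ι} (h : inner ℝ y k' = 0)
    (h' : inner ℝ k y' = 0) (Ψ : L2 ι) :
    weylOp ħ k y (weylOp ħ k' y' Ψ) = weylOp ħ (k + k') (y + y') Ψ := by
  rw [weylOp_weylOp, h, h']; simp

theorem continuous_weylOp {X : Type*} [TopologicalSpace X] [FirstCountableTopology X]
    {k y : X → EuclideanSpace ℝ ι} (hk : Continuous k) (hy : Continuous y) (Ψ : L2 ι) :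
    Continuous fun r => weylOp ħ (k r) (y r) Ψ := by
  refine continuous_phaseShift (fun x => ?_) (hy.const_smul ħ) Ψ
  simp only [linearPhase_apply]
  fun_prop

/-- The isometric embedding L covers at once the one-particle space and each particle of an
N-particle configuration. -/
theorem isWeylSystem_weylOp {L : Space →ₗ[ℝ] EuclideanSpace ℝ ι}
    (hL : ∀ x y, inner ℝ (L x) (L y) = inner ℝ x y) :
    IsWeylSystem ħ fun z : Space × Space => weylOp ħ (L z.1) (L z.2) where
  norm_map z x := norm_weylOp _ _ _
  map_zero x := by simp only [Prod.fst_zero, Prod.snd_zero, map_zero, weylOp_zero]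
  map_map z z' x := by
    rw [weylOp_weylOp, hL, hL, symp, Prod.fst_add, Prod.snd_add, map_add, map_add]
  strong_continuous x := by
    have hc : Continuous L := L.continuous_of_finiteDimensional
    exact continuous_weylOp (hc.comp continuous_fst) (hc.comp continuous_snd) x

end WeylOperators

/-! ### Fourier inversion and the L² Fourier transform -/

section FourierTools

variable {ι : Type} [Fintype ι]

theorem hasTemperateGrowth_cexp_I : (fun t : ℝ => Complex.exp (Complex.I * t)).HasTemperateGrowth := by
  have hd : ∀ t : ℝ, HasDerivAt (fun t : ℝ => Complex.exp (Complex.I * t))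
      (Complex.I * Complex.exp (Complex.I * t)) t := fun t => by
    have := ((Complex.ofRealCLM.hasDerivAt (x := t)).const_mul Complex.I).cexp
    simpa [mul_comm] using this
  have hn : ∀ n : ℕ, iteratedDeriv n (fun t : ℝ => Complex.exp (Complex.I * t)) =
      fun t : ℝ => Complex.I ^ n * Complex.exp (Complex.I * t) := by
    intro n
    induction n with
    | zero => simp
    | succ n ih =>
      rw [iteratedDeriv_succ, ih]
      funext t
      rw [((hd t).const_mul (Complex.I ^ n)).deriv]
      ring
  have hs : ContDiff ℝ (⊤ : ℕ∞) fun t : ℝ => (t : ℂ) := Complex.ofRealCLM.contDiff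
  refine ⟨by fun_prop, fun n => ⟨0, 1, fun t => ?_⟩⟩
  rw [norm_iteratedFDeriv_eq_norm_iteratedDeriv, hn, norm_mul, norm_pow, Complex.norm_I, one_pow,
    mul_comm Complex.I, Complex.norm_exp_ofReal_mul_I]
  simp

theorem hasTemperateGrowth_cexp_norm_sq (r : ℝ) :
    (fun x : EuclideanSpace ℝ ι => Complex.exp (Complex.I * (r * ‖x‖ ^ 2 : ℝ))).HasTemperateGrowth := by
  have h : (fun x : EuclideanSpace ℝ ι => r * ‖x‖ ^ 2).HasTemperateGrowth :=
    (Function.HasTemperateGrowth.const r).mul (Function.hasTemperateGrowth_norm_sq _)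
  exact hasTemperateGrowth_cexp_I.comp h

theorem ae_eq_of_forall_schwartz {f f' : EuclideanSpace ℝ ι → ℂ} (hf : LocallyIntegrable f)
    (hf' : LocallyIntegrable f')
    (h : ∀ χ : 𝓢(EuclideanSpace ℝ ι, ℂ), ∫ x, χ x * f x = ∫ x, χ x * f' x) : f =ᵐ[volume] f' := by
  refine ae_eq_of_integral_contDiff_smul_eq hf hf' fun g hg hg' => ?_
  have hc : HasCompactSupport fun x => (g x : ℂ) := hg'.comp_left (g := Complex.ofReal) (by simp)
  have hs : ContDiff ℝ (⊤ : ℕ∞) fun x => (g x : ℂ) := Complex.ofRealCLM.contDiff.comp hg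
  exact h (hc.toSchwartzMap hs)

theorem integral_fourier_mul_eq {f g : EuclideanSpace ℝ ι → ℂ} (hf : Integrable f)
    (hg : Integrable g) : ∫ x, 𝓕 f x * g x = ∫ x, f x * 𝓕 g x := by
  simpa using! (VectorFourier.integral_fourierIntegral_smul_eq_flip (L := innerₗ _)
      Real.continuous_fourierChar continuous_inner hf hg)

theorem Lp_locallyIntegrable (Ψ : L2 ι) : LocallyIntegrable Ψ :=
  (Lp.memLp Ψ).locallyIntegrable (by norm_num)

/-- The L² transform and the integral transform define the same tempered distribution, because
either can be moved onto the test function. -/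
theorem Lp_fourier_ae_eq (Ψ : L2 ι) (h : Integrable Ψ) :
    (𝓕 Ψ : L2 ι) =ᵐ[volume] 𝓕 (Ψ : EuclideanSpace ℝ ι → ℂ) := by
  have hc : Continuous (𝓕 (Ψ : EuclideanSpace ℝ ι → ℂ)) := by
    simpa using! VectorFourier.fourierIntegral_continuous Real.continuous_fourierChar
      (L := innerₗ (EuclideanSpace ℝ ι)) continuous_inner h
  refine ae_eq_of_forall_schwartz (Lp_locallyIntegrable _) hc.locallyIntegrable fun χ => ?_
  have h1 := DFunLike.congr_fun (Lp.fourier_toTemperedDistribution_eq Ψ) χ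
  rw [TemperedDistribution.fourier_apply, Lp.toTemperedDistribution_apply,
    Lp.toTemperedDistribution_apply] at h1
  simp only [smul_eq_mul] at h1
  rw [← h1, ← integral_fourier_mul_eq χ.integrable h]
  rfl

/-- Tested against Schwartz functions, for which inversion is known; no continuity of f is needed,
as for a potential w that is only integrable. -/
theorem fourierInv_fourier_ae_eq {f : EuclideanSpace ℝ ι → ℂ} (hf : Integrable f)
    (hf' : Integrable (𝓕 f)) : f =ᵐ[volume] 𝓕⁻ (𝓕 f) := by
  have hc : Continuous (𝓕⁻ (𝓕 f)) := by
    have : Continuous (𝓕 (𝓕 f)) := by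
      simpa using! VectorFourier.fourierIntegral_continuous Real.continuous_fourierChar
        (L := innerₗ (EuclideanSpace ℝ ι)) continuous_inner hf'
    simp_rw [funext (Real.fourierInv_eq_fourier_neg (𝓕 f))]
    exact this.comp continuous_neg
  refine ae_eq_of_forall_schwartz hf.locallyIntegrable hc.locallyIntegrable fun χ => ?_
  have h1 : ∀ x, χ x = 𝓕 (𝓕⁻ χ : 𝓢(EuclideanSpace ℝ ι, ℂ)) x := fun x => by
    rw [FourierTransform.fourier_fourierInv_eq]
  have h2 : ∀ x, 𝓕 (χ : EuclideanSpace ℝ ι → ℂ) (-x) = (𝓕⁻ χ : 𝓢(EuclideanSpace ℝ ι, ℂ)) x :=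
    fun x => by rw [SchwartzMap.fourierInv_coe, Real.fourierInv_eq_fourier_neg]
  calc ∫ x, χ x * f x = ∫ x, 𝓕 (𝓕⁻ χ : 𝓢(EuclideanSpace ℝ ι, ℂ)) x * f x := by simp_rw [← h1]
    _ = ∫ x, (𝓕⁻ χ : 𝓢(EuclideanSpace ℝ ι, ℂ)) x * 𝓕 f x :=
      integral_fourier_mul_eq (𝓕⁻ χ : 𝓢(EuclideanSpace ℝ ι, ℂ)).integrable hf
    _ = ∫ x, 𝓕 (χ : EuclideanSpace ℝ ι → ℂ) (-x) * 𝓕 f x := by simp_rw [h2]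
    _ = ∫ x, 𝓕 (χ : EuclideanSpace ℝ ι → ℂ) x * 𝓕 f (-x) := by
      rw [← integral_neg_eq_self]; simp
    _ = ∫ x, χ x * 𝓕 (fun x => 𝓕 f (-x)) x :=
      integral_fourier_mul_eq χ.integrable hf'.comp_neg
    _ = ∫ x, χ x * 𝓕⁻ (𝓕 f) x := by
      simp_rw [Real.fourierInv_eq_fourier_comp_neg]

end FourierTools

/-! ### The free Schrödinger group and its action on Weyl operators -/

section FreeEvolution

variable {ι : Type} [Fintype ι]

theorem L2_ext_of_schwartz {F : Type*} [TopologicalSpace F] [T2Space F] {A B : L2 ι → F}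
    (hA : Continuous A) (hB : Continuous B)
    (h : ∀ χ : 𝓢(EuclideanSpace ℝ ι, ℂ), A (χ.toLp 2) = B (χ.toLp 2)) (Ψ : L2 ι) : A Ψ = B Ψ := by
  have hd := SchwartzMap.denseRange_toLpCLM (E := EuclideanSpace ℝ ι) (F := ℂ) (p := 2)
    (μ := volume) (by norm_num)
  exact congrFun (hd.equalizer hA hB (funext h)) Ψ

theorem fourier_modulate_translate (f : EuclideanSpace ℝ ι → ℂ) (k v : EuclideanSpace ℝ ι)
    (c : ℝ) (q : EuclideanSpace ℝ ι) :
    𝓕 (fun x => Complex.exp (Complex.I * (inner ℝ k x + c : ℝ)) * f (x + v)) q =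
      Complex.exp (Complex.I * (2 * Real.pi * inner ℝ v q - inner ℝ k v + c : ℝ)) *
        𝓕 f (q - (2 * Real.pi)⁻¹ • k) := by
  rw [Real.fourier_eq', Real.fourier_eq', ← integral_const_mul,
    ← integral_add_right_eq_self (fun x => Complex.exp (Complex.I *
      (2 * Real.pi * inner ℝ v q - inner ℝ k v + c : ℝ)) * _) v]
  refine integral_congr_ae (ae_of_all _ fun x => ?_)
  have hp : (Real.pi : ℂ) ≠ 0 := by exact_mod_cast Real.pi_ne_zero
  simp only [smul_eq_mul, ← mul_assoc, ← Complex.exp_add]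
  congr 2
  simp only [inner_add_left, inner_sub_right, inner_smul_right, real_inner_comm k x,
    real_inner_comm k v]
  push_cast
  field_simp
  ring

/-- The Fourier transform exchanges modulations and translations. The identity is computed on
Schwartz functions and extended by density. -/
theorem fourier_weylOp {ħ : ℝ} (k y : EuclideanSpace ℝ ι) (Ψ : L2 ι) :
    (𝓕 (weylOp ħ k y Ψ) : L2 ι) =
      phaseShift (linearPhase ((2 * Real.pi * ħ) • y) (-(ħ * inner ℝ k y / 2)))
        (-((2 * Real.pi)⁻¹ • k)) (𝓕 Ψ) := by
  have hF : Continuous fun Ψ : L2 ι => (𝓕 Ψ : L2 ι) := FourierTransform.continuous_fourier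
  refine L2_ext_of_schwartz (A := fun Ψ : L2 ι => (𝓕 (weylOp ħ k y Ψ) : L2 ι))
    (B := fun Ψ : L2 ι => phaseShift (linearPhase ((2 * Real.pi * ħ) • y) (-(ħ * inner ℝ k y / 2)))
        (-((2 * Real.pi)⁻¹ • k)) (𝓕 Ψ))
    (hF.comp (ContinuousLinearMap.continuous _)) ((ContinuousLinearMap.continuous _).comp hF)
    (fun χ => ?_) Ψ
  have e : weylOp ħ k y (χ.toLp 2) =ᵐ[volume] fun x =>
      Complex.exp (Complex.I * (inner ℝ k x + ħ * inner ℝ k y / 2 : ℝ)) * χ (x + ħ • y) := by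
    filter_upwards [weylOp_ae (ħ := ħ) k y (χ.toLp 2),
      ae_comp_add_right (χ.coeFn_toLp 2 volume) (ħ • y)] with x h1 h2
    rw [h1, h2]
  have hi : Integrable fun x =>
      Complex.exp (Complex.I * (inner ℝ k x + ħ * inner ℝ k y / 2 : ℝ)) * χ (x + ħ • y) := by
    refine (χ.integrable (μ := volume).comp_add_right (ħ • y)).mono (by fun_prop)
      (ae_of_all _ fun x => ?_)
    rw [norm_mul, mul_comm Complex.I, Complex.norm_exp_ofReal_mul_I, one_mul]
  apply Lp.ext
  have h0 : (χ.toLp 2 : L2 ι) =ᵐ[volume] χ := χ.coeFn_toLp 2 volume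
  have hχ : (𝓕 (χ.toLp 2 : L2 ι) : L2 ι) =ᵐ[volume] 𝓕 (χ : EuclideanSpace ℝ ι → ℂ) := by
    rw [SchwartzMap.toLp_fourier_eq]
    exact (𝓕 χ : 𝓢(EuclideanSpace ℝ ι, ℂ)).coeFn_toLp 2 volume
  filter_upwards [Lp_fourier_ae_eq _ (hi.congr e.symm), phaseShift_ae
    (linearPhase ((2 * Real.pi * ħ) • y) (-(ħ * inner ℝ k y / 2)))
        (-((2 * Real.pi)⁻¹ • k)) (𝓕 (χ.toLp 2 : L2 ι)),
    ae_comp_add_right hχ (-((2 * Real.pi)⁻¹ • k))] with q h1 h2 h3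
  rw [h1, h2, h3, Real.fourier_congr_ae e, fourier_modulate_translate, linearPhase_apply,
    ← sub_eq_add_neg]
  congr 4
  simp only [inner_smul_left, inner_smul_right]
  simp
  ring

/-- The phase `q ↦ -r |2πq|²/2` of the free Schrödinger evolution on the Fourier side. -/
def kineticPhase (r : ℝ) : C(EuclideanSpace ℝ ι, ℝ) where
  toFun q := r * (-(2 * Real.pi) ^ 2 / 2 * ‖q‖ ^ 2)

theorem kineticPhase_apply (r : ℝ) (q : EuclideanSpace ℝ ι) :
    kineticPhase r q = r * (-(2 * Real.pi) ^ 2 / 2 * ‖q‖ ^ 2) := rfl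

/-- The free Schrödinger group `e^{irΔ/2}`. -/
def freeEvolution (r : ℝ) : L2 ι →L[ℂ] L2 ι :=
  ((Lp.fourierTransformₗᵢ (EuclideanSpace ℝ ι) ℂ).symm.toContinuousLinearEquiv : L2 ι →L[ℂ] L2 ι) ∘L
    phaseShift (kineticPhase r) 0 ∘L
      ((Lp.fourierTransformₗᵢ (EuclideanSpace ℝ ι) ℂ).toContinuousLinearEquiv : L2 ι →L[ℂ] L2 ι)

theorem freeEvolution_apply (r : ℝ) (Ψ : L2 ι) :
    freeEvolution r Ψ = 𝓕⁻ (phaseShift (kineticPhase r) 0 (𝓕 Ψ) : L2 ι) := rfl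

theorem fourier_freeEvolution (r : ℝ) (Ψ : L2 ι) :
    (𝓕 (freeEvolution r Ψ) : L2 ι) = phaseShift (kineticPhase r) 0 (𝓕 Ψ) := by
  rw [freeEvolution_apply, FourierTransform.fourier_fourierInv_eq]

theorem norm_freeEvolution (r : ℝ) (Ψ : L2 ι) : ‖freeEvolution r Ψ‖ = ‖Ψ‖ := by
  rw [← Lp.norm_fourier_eq, fourier_freeEvolution, norm_phaseShift, Lp.norm_fourier_eq]

theorem L2_fourier_injective {Ψ Φ : L2 ι} (h : (𝓕 Ψ : L2 ι) = 𝓕 Φ) : Ψ = Φ :=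
  (Lp.fourierTransformₗᵢ (EuclideanSpace ℝ ι) ℂ).injective h

theorem freeEvolution_freeEvolution (r r' : ℝ) (Ψ : L2 ι) :
    freeEvolution r (freeEvolution r' Ψ) = freeEvolution (r + r') Ψ := by
  apply L2_fourier_injective
  rw [fourier_freeEvolution, fourier_freeEvolution, fourier_freeEvolution,
    phaseShift_phaseShift (θ'' := kineticPhase (r + r')) (c := 0)]
  · simp
  · intro x; simp only [kineticPhase_apply, add_zero]; ring

theorem freeEvolution_zero (Ψ : L2 ι) : freeEvolution 0 Ψ = Ψ := by
  apply L2_fourier_injective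
  rw [fourier_freeEvolution, phaseShift_eq_self fun x => by simp [kineticPhase_apply]]

theorem freeEvolution_neg_apply (r : ℝ) (Ψ : L2 ι) : freeEvolution (-r) (freeEvolution r Ψ) = Ψ := by
  rw [freeEvolution_freeEvolution, neg_add_cancel, freeEvolution_zero]

theorem freeEvolution_apply_neg (r : ℝ) (Ψ : L2 ι) : freeEvolution r (freeEvolution (-r) Ψ) = Ψ := by
  rw [freeEvolution_freeEvolution, add_neg_cancel, freeEvolution_zero]

theorem inner_freeEvolution (r : ℝ) (Ψ Φ : L2 ι) :
    inner ℂ (freeEvolution r Ψ) Φ = inner ℂ Ψ (freeEvolution (-r) Φ) := by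
  let U : L2 ι →ₗᵢ[ℂ] L2 ι := ⟨(freeEvolution r).toLinearMap, norm_freeEvolution r⟩
  have := U.inner_map_map Ψ (freeEvolution (-r) Φ)
  rw [← this]
  change _ = inner ℂ (freeEvolution r Ψ) (freeEvolution r (freeEvolution (-r) Φ))
  rw [freeEvolution_apply_neg]

theorem continuous_freeEvolution (Ψ : L2 ι) : Continuous fun r => freeEvolution r Ψ := by
  have hF : Continuous fun Ψ : L2 ι => (𝓕⁻ Ψ : L2 ι) := FourierTransform.continuous_fourierInv
  refine hF.comp (continuous_phaseShift_zero (fun x => ?_) _)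
  simp only [kineticPhase_apply]
  fun_prop

/-- The classical free flow is implemented exactly: on the Fourier side a translation changes the
quadratic kinetic phase by a linear one, that is by a further translation s·k in the y variable.
This is the origin of `planeWave`. -/
theorem freeEvolution_weylOp (ħ s : ℝ) (k y : EuclideanSpace ℝ ι) (Ψ : L2 ι) :
    freeEvolution (-(ħ * s)) (weylOp ħ k y (freeEvolution (ħ * s) Ψ)) =
      weylOp ħ k (y + s • k) Ψ := by
  apply L2_fourier_injective
  rw [fourier_freeEvolution, fourier_weylOp, fourier_freeEvolution, fourier_weylOp,
    phaseShift_phaseShift (c := 0) (θ'' := linearPhase ((2 * Real.pi * ħ) • y)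
      (-(ħ * inner ℝ k y / 2)) + kineticPhase (-(ħ * s))), phaseShift_phaseShift (c := 0)
      (θ'' := linearPhase ((2 * Real.pi * ħ) • (y + s • k)) (-(ħ * inner ℝ k (y + s • k) / 2)))]
  · simp
  · intro x
    have hp : Real.pi ≠ 0 := Real.pi_ne_zero
    have hn : ‖x + -((2 * Real.pi)⁻¹ • k)‖ ^ 2 =
        ‖x‖ ^ 2 - Real.pi⁻¹ * inner ℝ k x + ((2 * Real.pi)⁻¹) ^ 2 * ‖k‖ ^ 2 := by
      rw [← sub_eq_add_neg, norm_sub_sq_real, norm_smul, inner_smul_right, mul_pow,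
        real_inner_comm k x, Real.norm_eq_abs, sq_abs, mul_inv]
      ring
    simp only [kineticPhase_apply, linearPhase_apply, ContinuousMap.add_apply, zero_add, add_zero, hn,
      real_inner_smul_left, inner_smul_right, inner_add_left, inner_add_right,
      real_inner_self_eq_norm_sq]
    field_simp
    ring
  · intro x
    simp [add_comm]

end FreeEvolution

/-! ### Differentiating the free evolution -/

section InteractionPicture

variable {ι : Type} [Fintype ι]

theorem norm_cexp_I_sub_one_sub_le (x : ℝ) :
    ‖Complex.exp (Complex.I * x) - 1 - Complex.I * x‖ ≤ 3 * x ^ 2 := by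
  have hn : ‖Complex.I * (x : ℂ)‖ = |x| := by simp
  rcases le_or_gt |x| 1 with h | h
  · have := Complex.norm_exp_sub_one_sub_id_le (x := Complex.I * x) (by rw [hn]; exact h)
    rw [hn, sq_abs] at this
    nlinarith [sq_nonneg x]
  · have h1 : ‖Complex.exp (Complex.I * x) - 1 - Complex.I * x‖ ≤ 1 + 1 + |x| := by
      refine (norm_sub_le _ _).trans (add_le_add ((norm_sub_le _ _).trans ?_) hn.le)
      rw [mul_comm, Complex.norm_exp_ofReal_mul_I, norm_one]
    nlinarith [sq_abs x]

/-- The second-order Taylor remainder of e^{irc} g is pointwise at most 3(r - r₀)²|c² g|, and g''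
puts c² g in L². -/
theorem hasDerivAt_phaseShift {θ : ℝ → C(EuclideanSpace ℝ ι, ℝ)} {c : EuclideanSpace ℝ ι → ℝ}
    (hθ : ∀ r x, θ r x = r * c x) {g g' g'' : L2 ι}
    (h1 : g' =ᵐ[volume] fun x => Complex.I * c x * g x)
    (h2 : g'' =ᵐ[volume] fun x => (c x : ℂ) ^ 2 * g x) (r₀ : ℝ) :
    HasDerivAt (fun r => phaseShift (θ r) 0 g) (phaseShift (θ r₀) 0 g') r₀ := by
  rw [hasDerivAt_iff_isLittleO]
  have hb : ∀ r, ‖phaseShift (θ r) 0 g - phaseShift (θ r₀) 0 g - (r - r₀) • phaseShift (θ r₀) 0 g'‖ ≤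
      3 * ‖g''‖ * ‖(r - r₀) ^ 2‖ := by
    intro r
    have : ‖phaseShift (θ r) 0 g - phaseShift (θ r₀) 0 g - (r - r₀) • phaseShift (θ r₀) 0 g'‖ ≤
        3 * (r - r₀) ^ 2 * ‖g''‖ := by
      refine Lp.norm_le_mul_norm_of_ae_le_mul ?_
      filter_upwards [Lp.coeFn_sub (phaseShift (θ r) 0 g - phaseShift (θ r₀) 0 g)
        ((r - r₀) • phaseShift (θ r₀) 0 g'), Lp.coeFn_sub (phaseShift (θ r) 0 g)
        (phaseShift (θ r₀) 0 g), Lp.coeFn_smul (r - r₀) (phaseShift (θ r₀) 0 g'),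
        phaseShift_ae (θ r) 0 g, phaseShift_ae (θ r₀) 0 g, phaseShift_ae (θ r₀) 0 g', h1, h2]
        with x e1 e2 e3 e4 e5 e6 e7 e8
      rw [e1, Pi.sub_apply, e2, Pi.sub_apply, e3, Pi.smul_apply, e4, e5, e6, add_zero, e7, e8, hθ, hθ]
      have e : Complex.exp (Complex.I * (r * c x : ℝ)) * g x -
          Complex.exp (Complex.I * (r₀ * c x : ℝ)) * g x -
          (r - r₀) • (Complex.exp (Complex.I * (r₀ * c x : ℝ)) * (Complex.I * c x * g x)) =
          Complex.exp (Complex.I * (r₀ * c x : ℝ)) *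
            (Complex.exp (Complex.I * ((r - r₀) * c x : ℝ)) - 1 -
              Complex.I * ((r - r₀) * c x : ℝ)) * g x := by
        have : Complex.exp (Complex.I * (r * c x : ℝ)) = Complex.exp (Complex.I * (r₀ * c x : ℝ)) *
            Complex.exp (Complex.I * ((r - r₀) * c x : ℝ)) := by
          rw [← Complex.exp_add]; congr 1; push_cast; ring
        rw [this, Complex.real_smul]
        push_cast
        ring
      rw [e, norm_mul, norm_mul, mul_comm Complex.I, Complex.norm_exp_ofReal_mul_I, one_mul,
        norm_mul, norm_pow, Complex.norm_real, Real.norm_eq_abs, sq_abs, ← mul_assoc]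
      refine mul_le_mul_of_nonneg_right ((norm_cexp_I_sub_one_sub_le _).trans (le_of_eq ?_))
        (norm_nonneg _)
      ring
    rw [Real.norm_of_nonneg (by positivity)]
    linarith
  exact (Asymptotics.IsBigO.of_bound _ (Eventually.of_forall hb)).trans_isLittleO
    ((Asymptotics.isLittleO_pow_sub_sub r₀ one_lt_two).congr_left fun r => by simp)

/-- The free evolution of a Schwartz function. -/
def schwartzFree (r : ℝ) : 𝓢(EuclideanSpace ℝ ι, ℂ) →L[ℂ] 𝓢(EuclideanSpace ℝ ι, ℂ) :=
  SchwartzMap.fourierMultiplierCLM ℂ fun q : EuclideanSpace ℝ ι =>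
    Complex.exp (Complex.I * (r * (-(2 * Real.pi) ^ 2 / 2) * ‖q‖ ^ 2 : ℝ))

theorem fourier_schwartzFree (r : ℝ) (χ : 𝓢(EuclideanSpace ℝ ι, ℂ)) (q : EuclideanSpace ℝ ι) :
    (𝓕 (schwartzFree r χ) : 𝓢(EuclideanSpace ℝ ι, ℂ)) q =
      Complex.exp (Complex.I * kineticPhase r q) * (𝓕 χ : 𝓢(EuclideanSpace ℝ ι, ℂ)) q := by
  rw [schwartzFree, SchwartzMap.fourierMultiplierCLM_apply, FourierTransform.fourier_fourierInv_eq,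
    SchwartzMap.smulLeftCLM_apply_apply (hasTemperateGrowth_cexp_norm_sq _), kineticPhase_apply,
    smul_eq_mul, mul_assoc]

theorem toLp_schwartzFree (r : ℝ) (χ : 𝓢(EuclideanSpace ℝ ι, ℂ)) :
    (schwartzFree r χ).toLp 2 = freeEvolution r (χ.toLp 2) := by
  apply L2_fourier_injective
  rw [fourier_freeEvolution, SchwartzMap.toLp_fourier_eq, SchwartzMap.toLp_fourier_eq]
  apply Lp.ext
  filter_upwards [SchwartzMap.coeFn_toLp (𝓕 (schwartzFree r χ)) 2 volume,
    SchwartzMap.coeFn_toLp (𝓕 χ) 2 volume,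
    phaseShift_ae (kineticPhase r) 0 ((𝓕 χ : 𝓢(EuclideanSpace ℝ ι, ℂ)).toLp 2)] with q h1 h2 h3
  rw [h1, h3, add_zero, h2, fourier_schwartzFree]

theorem fourier_laplacian (χ : 𝓢(EuclideanSpace ℝ ι, ℂ)) (q : EuclideanSpace ℝ ι) :
    (𝓕 (Δ χ) : 𝓢(EuclideanSpace ℝ ι, ℂ)) q =
      -(2 * Real.pi) ^ 2 * ‖q‖ ^ 2 * (𝓕 χ : 𝓢(EuclideanSpace ℝ ι, ℂ)) q := by
  have hg := Function.hasTemperateGrowth_norm_sq (EuclideanSpace ℝ ι)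
  rw [SchwartzMap.laplacian_eq_fourierMultiplierCLM, FourierTransform.fourier_smul,
    SchwartzMap.fourierMultiplierCLM_apply, FourierTransform.fourier_fourierInv_eq,
    _root_.smul_apply, SchwartzMap.smulLeftCLM_apply_apply hg, Complex.real_smul,
    Complex.real_smul]
  push_cast
  ring

theorem L2_smul_ae (c : ℂ) {A : L2 ι} {f : EuclideanSpace ℝ ι → ℂ} (h : A =ᵐ[volume] f) :
    (c • A : L2 ι) =ᵐ[volume] fun x => c * f x := by
  filter_upwards [Lp.coeFn_smul c A, h] with x h1 h2
  rw [h1, Pi.smul_apply, h2, smul_eq_mul]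

theorem hasDerivAt_freeEvolution_of_fourier {Ψ g' g'' : L2 ι}
    (h1 : g' =ᵐ[volume] fun q => Complex.I * (-(2 * Real.pi) ^ 2 / 2 * ‖q‖ ^ 2 : ℝ) *
      (𝓕 Ψ : L2 ι) q)
    (h2 : g'' =ᵐ[volume] fun q => ((-(2 * Real.pi) ^ 2 / 2 * ‖q‖ ^ 2 : ℝ) : ℂ) ^ 2 *
      (𝓕 Ψ : L2 ι) q) (r : ℝ) :
    HasDerivAt (fun r => freeEvolution r Ψ) (freeEvolution r (𝓕⁻ g')) r := by
  have hd := hasDerivAt_phaseShift (θ := kineticPhase) (fun r x => kineticPhase_apply r x) h1 h2 r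
  have hd' := ((Lp.fourierTransformₗᵢ (EuclideanSpace ℝ ι)
    ℂ).symm.toContinuousLinearEquiv : L2 ι →L[ℂ] L2 ι).hasFDerivAt.restrictScalars ℝ
    |>.comp_hasDerivAt r hd
  refine hd'.congr_deriv ?_
  rw [freeEvolution_apply, FourierTransform.fourier_fourierInv_eq]
  rfl

theorem laplacian_schwartzFree (r : ℝ) (χ : 𝓢(EuclideanSpace ℝ ι, ℂ)) :
    schwartzFree r (Δ χ) = Δ (schwartzFree r χ) := by
  have : (𝓕 (schwartzFree r (Δ χ)) : 𝓢(EuclideanSpace ℝ ι, ℂ)) = 𝓕 (Δ (schwartzFree r χ)) := by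
    ext q
    rw [fourier_schwartzFree, fourier_laplacian, fourier_laplacian, fourier_schwartzFree]
    ring
  have h3 := congrArg (fun f : 𝓢(EuclideanSpace ℝ ι, ℂ) => (𝓕⁻ f : 𝓢(EuclideanSpace ℝ ι, ℂ))) this
  simpa only [FourierTransform.fourierInv_fourier_eq] using h3

theorem toLp_fourier_laplacian_ae (χ : 𝓢(EuclideanSpace ℝ ι, ℂ)) :
    ((𝓕 ((Δ χ).toLp 2 : L2 ι) : L2 ι)) =ᵐ[volume]
      fun q => -(2 * Real.pi) ^ 2 * ‖q‖ ^ 2 * (𝓕 (χ.toLp 2 : L2 ι) : L2 ι) q := by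
  rw [SchwartzMap.toLp_fourier_eq, SchwartzMap.toLp_fourier_eq]
  filter_upwards [SchwartzMap.coeFn_toLp (𝓕 (Δ χ)) 2 volume,
    SchwartzMap.coeFn_toLp (𝓕 χ) 2 volume] with q e1 e2
  rw [e1, e2, fourier_laplacian]

theorem hasDerivAt_freeEvolution (r : ℝ) (χ : 𝓢(EuclideanSpace ℝ ι, ℂ)) :
    HasDerivAt (fun r => freeEvolution r (χ.toLp 2))
      ((Complex.I / 2) • (Δ (schwartzFree r χ)).toLp 2) r := by
  have e1 := toLp_fourier_laplacian_ae χ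
  have e2 := toLp_fourier_laplacian_ae (Δ χ)
  have h1 := L2_smul_ae (Complex.I / 2) e1
  have h2 := L2_smul_ae (1 / 4 : ℂ) e2
  have := hasDerivAt_freeEvolution_of_fourier (h1.trans (ae_of_all _ fun q => by push_cast; ring))
    (h2.trans (e1.mono fun q hq => by simp only [hq]; push_cast; ring)) r
  refine this.congr_deriv ?_
  rw [FourierTransform.fourierInv_smul, FourierTransform.fourierInv_fourier_eq, map_smul,
    ← toLp_schwartzFree, laplacian_schwartzFree]

/-- The complex conjugate of a Schwartz function. -/
def schwartzConj (χ : 𝓢(EuclideanSpace ℝ ι, ℂ)) : 𝓢(EuclideanSpace ℝ ι, ℂ) :=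
  SchwartzMap.postcompCLM (Complex.conjCLE : ℂ →L[ℝ] ℂ) χ

theorem schwartzConj_apply (χ : 𝓢(EuclideanSpace ℝ ι, ℂ)) (x : EuclideanSpace ℝ ι) :
    schwartzConj χ x = conj (χ x) := rfl

theorem laplacian_schwartzConj (χ : 𝓢(EuclideanSpace ℝ ι, ℂ)) (x : EuclideanSpace ℝ ι) :
    (Δ (schwartzConj χ)) x = conj ((Δ χ) x) := by
  have := (χ.contDiffAt (n := 2) (x := x)).laplacian_CLM_comp_left (l := (Complex.conjCLE : ℂ →L[ℝ] ℂ))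
  rw [SchwartzMap.laplacian_apply, SchwartzMap.laplacian_apply]
  exact this

end InteractionPicture

/-! ### Distributional solutions are strong in the interaction picture -/

section WeakSolutions

variable {ι : Type} [Fintype ι]

/-- Tested against a dense set, Φ equals its value at s plus the integral of the continuous curve D;
the fundamental theorem of calculus then differentiates in norm. -/
theorem hasDerivAt_of_forall_inner {H : Type*} [NormedAddCommGroup H] [InnerProductSpace ℂ H]
    [CompleteSpace H] {Φ D : ℝ → H} {S : Set H} (hS : Dense S) (hD : ContinuousOn D (Set.Ioi 0))
    (h : ∀ θ ∈ S, ∀ s, 0 < s → HasDerivAt (fun s => inner ℂ θ (Φ s)) (inner ℂ θ (D s)) s)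
    {s : ℝ} (hs : 0 < s) : HasDerivAt Φ (D s) s := by
  have hsub : ∀ {u : ℝ}, 0 < u → Set.uIcc s u ⊆ Set.Ioi 0 := fun hu x hx =>
    lt_of_lt_of_le (lt_min hs hu) hx.1
  have hY : ∀ u, 0 < u → HasDerivAt (fun u => ∫ r in s..u, D r) (D u) u := fun u hu =>
    intervalIntegral.integral_hasDerivAt_right (hD.mono (hsub hu)).intervalIntegrable
      (hD.stronglyMeasurableAtFilter isOpen_Ioi u hu) (hD.continuousAt (Ioi_mem_nhds hu))
  have hΦ : ∀ u, 0 < u → Φ u = Φ s + ∫ r in s..u, D r := by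
    intro u hu
    refine hS.eq_of_inner_right ℂ fun θ hθ => ?_
    have hd : ∀ r, 0 < r → HasDerivAt
        (fun r => inner ℂ θ (Φ r) - inner ℂ θ (∫ r in s..r, D r)) 0 r := by
      intro r hr
      have h2 : HasDerivAt (fun r => inner ℂ θ (∫ r in s..r, D r)) (inner ℂ θ (D r)) r :=
        ((innerSL ℂ θ).restrictScalars ℝ).hasFDerivAt.comp_hasDerivAt r (hY r hr)
      simpa using (h θ hθ r hr).fun_sub h2
    have := (convex_Ioi (0 : ℝ)).is_const_of_fderivWithin_eq_zero (𝕜 := ℝ)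
      (f := fun r => inner ℂ θ (Φ r) - inner ℂ θ (∫ r in s..r, D r))
      (fun r hr => (hd r hr).differentiableAt.differentiableWithinAt) (fun r hr => by
        rw [fderivWithin_of_isOpen isOpen_Ioi hr]
        ext
        simpa using (hd r hr).deriv) hu hs
    simp only [intervalIntegral.integral_same, inner_zero_right, sub_zero] at this
    rw [inner_add_right, ← this, sub_add_cancel]
  refine HasDerivAt.congr_of_eventuallyEq ((hY s hs).const_add (Φ s)) ?_
  filter_upwards [Ioi_mem_nhds hs] with u hu using hΦ u hu

theorem L2_inner_eq (f g : L2 ι) : inner ℂ f g = ∫ x, conj (f x) * g x := by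
  rw [L2.inner_def]
  exact integral_congr_ae (ae_of_all _ fun x => by simp only [RCLike.inner_apply, mul_comm])

theorem L2_inner_toLp (χ : 𝓢(EuclideanSpace ℝ ι, ℂ)) (g : L2 ι) :
    inner ℂ (χ.toLp 2 volume : L2 ι) g = ∫ x, conj (χ x) * g x := by
  rw [L2_inner_eq]
  exact integral_congr_ae ((χ.coeFn_toLp 2 volume).mono fun x hx => by simp only [hx])

theorem integrable_conj_mul (f g : L2 ι) : Integrable fun x => conj (f x) * g x := by
  refine (L2.integrable_inner (𝕜 := ℂ) f g).congr (ae_of_all _ fun x => ?_)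
  simp only [RCLike.inner_apply]
  ring

theorem IsSchrodingerSolution.hasDerivAt_inner {ħ : ℝ} {V : ℝ → EuclideanSpace ℝ ι → ℝ}
    {Ψ v : ℝ → L2 ι} (h : IsSchrodingerSolution ħ V Ψ)
    (hv : ∀ s, 0 < s → v s =ᵐ[volume] fun x => (V s x : ℂ) * Ψ s x)
    (χ : 𝓢(EuclideanSpace ℝ ι, ℂ)) {s : ℝ} (hs : 0 < s) :
    HasDerivAt (fun r => inner ℂ (χ.toLp 2 volume : L2 ι) (Ψ r))
      ((Complex.I * ħ)⁻¹ * (-((ħ : ℂ) ^ 2 / 2) * inner ℂ ((Δ χ).toLp 2 volume : L2 ι) (Ψ s) +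
        inner ℂ (χ.toLp 2 volume : L2 ι) (v s))) s := by
  have := h.2 (schwartzConj χ) s hs
  simp only [schwartzConj_apply, laplacian_schwartzConj] at this
  simp only [L2_inner_toLp]
  refine this.congr_deriv (congrArg _ ?_)
  have hA := (Δ χ).coeFn_toLp 2 volume
  have hB := χ.coeFn_toLp 2 volume
  have i1 : Integrable fun x => conj ((Δ χ) x) * Ψ s x :=
    (integrable_conj_mul ((Δ χ).toLp 2 volume) (Ψ s)).congr (hA.mono fun x hx => by simp only [hx])
  have i2 : Integrable fun x => conj (χ x) * v s x :=
    (integrable_conj_mul (χ.toLp 2 volume) (v s)).congr (hB.mono fun x hx => by simp only [hx])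
  rw [← integral_const_mul, ← integral_add (i1.const_mul _) i2]
  refine integral_congr_ae ((hv s hs).mono fun x hx => ?_)
  simp only [hx]
  ring

/-- A weak solution of the Schrödinger equation solves a strong equation in the interaction
picture. -/
theorem IsSchrodingerSolution.hasDerivAt_interaction {ħ : ℝ} (hħ : 0 < ħ)
    {V : ℝ → EuclideanSpace ℝ ι → ℝ} {Ψ v : ℝ → L2 ι} (h : IsSchrodingerSolution ħ V Ψ)
    (hv : ∀ s, 0 < s → v s =ᵐ[volume] fun x => (V s x : ℂ) * Ψ s x)
    (hc : ContinuousOn (fun s => freeEvolution (-(ħ * s)) (v s)) (Set.Ioi 0)) {s : ℝ} (hs : 0 < s) :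
    HasDerivAt (fun s => freeEvolution (-(ħ * s)) (Ψ s))
      (-(Complex.I / ħ) • freeEvolution (-(ħ * s)) (v s)) s := by
  have hh : (ħ : ℂ) ≠ 0 := by exact_mod_cast hħ.ne'
  refine hasDerivAt_of_forall_inner (S := Set.range (SchwartzMap.toLpCLM ℝ (E := EuclideanSpace ℝ ι)
    ℂ 2 volume)) (SchwartzMap.denseRange_toLpCLM (by norm_num))
    (D := fun s => -(Complex.I / ħ) • freeEvolution (-(ħ * s)) (v s)) (ContinuousOn.fun_const_smul hc _) ?_ hs
  rintro θ ⟨χ, rfl⟩ s hs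
  change HasDerivAt (fun s => inner ℂ (χ.toLp 2 volume : L2 ι) (freeEvolution (-(ħ * s)) (Ψ s)))
    (inner ℂ (χ.toLp 2 volume : L2 ι) (-(Complex.I / ħ) • freeEvolution (-(ħ * s)) (v s))) s
  simp only [inner_smul_right, ← inner_freeEvolution]
  set η := schwartzFree (ħ * s) χ with hη
  have hηe : (η.toLp 2 volume : L2 ι) = freeEvolution (ħ * s) (χ.toLp 2 volume) := toLp_schwartzFree _ _
  have h1 : HasDerivAt (fun s => freeEvolution (ħ * s) (χ.toLp 2 volume : L2 ι))
      (ħ • (Complex.I / 2) • ((Δ η).toLp 2 volume : L2 ι)) s := by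
    have h2 := (hasDerivAt_freeEvolution (ħ * s) χ).scomp s ((hasDerivAt_id s).const_mul ħ)
    rw [mul_one] at h2
    exact h2
  have h3 := h.hasDerivAt_inner hv η hs
  have e : ∀ (c : ℝ) (x : L2 ι), c • x = (c : ℂ) • x := fun c x => RCLike.real_smul_eq_coe_smul c x
  have hcΨ : ContinuousAt Ψ s := h.1.continuousAt (Ici_mem_nhds hs)
  rw [hasDerivAt_iff_tendsto_slope] at h1 h3 ⊢
  -- A product rule for difference quotients in which the moving test vector is differentiable in
  -- norm. Ψ itself is only continuous; it is differentiable only when paired with the fixed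
  -- Schwartz function η. The two Laplacian terms then cancel.
  have h4 := (h1.inner (𝕜 := ℂ) (hcΨ.tendsto.mono_left nhdsWithin_le_nhds)).add h3
  have h5 : inner ℂ (ħ • (Complex.I / 2) • ((Δ η).toLp 2 volume : L2 ι)) (Ψ s) +
      (Complex.I * ħ)⁻¹ * (-((ħ : ℂ) ^ 2 / 2) * inner ℂ ((Δ η).toLp 2 volume : L2 ι) (Ψ s) +
        inner ℂ (η.toLp 2 volume : L2 ι) (v s)) =
      -(Complex.I / ħ) * inner ℂ (freeEvolution (ħ * s) (χ.toLp 2 volume)) (v s) := by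
    rw [← hηe, e ħ, inner_smul_left, inner_smul_left]
    simp only [map_div₀, Complex.conj_I, Complex.conj_ofReal, map_ofNat]
    rw [mul_inv, Complex.inv_I]
    field_simp
    ring
  rw [h5] at h4
  refine h4.congr' ?_
  filter_upwards with r
  simp only [slope_def_module, hηe]
  rw [e, inner_smul_left, inner_sub_left]
  simp only [Complex.conj_ofReal, Complex.real_smul]
  ring

theorem continuous_uncurry_of_isometry {X E F : Type*} [TopologicalSpace X]
    [NormedAddCommGroup E] [NormedSpace ℂ E] [NormedAddCommGroup F] [NormedSpace ℂ F]
    {G : X → E →L[ℂ] F} (hG : ∀ r x, ‖G r x‖ = ‖x‖) (hc : ∀ x, Continuous fun r => G r x) :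
    Continuous fun p : X × E => G p.1 p.2 := by
  rw [continuous_iff_continuousAt]
  rintro ⟨r₀, x₀⟩
  have h1 : Tendsto (fun p : X × E => G p.1 (p.2 - x₀)) (𝓝 (r₀, x₀)) (𝓝 0) := by
    rw [tendsto_zero_iff_norm_tendsto_zero]
    simp only [hG]
    have : Continuous fun p : X × E => ‖p.2 - x₀‖ := by fun_prop
    simpa using this.tendsto (r₀, x₀)
  have h2 : Tendsto (fun p : X × E => G p.1 x₀) (𝓝 (r₀, x₀)) (𝓝 (G r₀ x₀)) :=
    ((hc x₀).comp continuous_fst).tendsto (r₀, x₀)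
  have h3 := h1.add h2
  simp only [map_sub, sub_add_cancel, zero_add] at h3
  exact h3

theorem continuousOn_freeEvolution {ħ : ℝ} {Ψ : ℝ → L2 ι} {S : Set ℝ} (h : ContinuousOn Ψ S) :
    ContinuousOn (fun s => freeEvolution (-(ħ * s)) (Ψ s)) S := by
  have hc : Continuous fun s : ℝ => -(ħ * s) := by fun_prop
  have hj := continuous_uncurry_of_isometry (G := freeEvolution (ι := ι)) norm_freeEvolution
    continuous_freeEvolution
  exact hj.comp_continuousOn (f := fun s => (-(ħ * s), Ψ s)) (hc.continuousOn.prodMk h)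

end WeakSolutions

/-! ### Superpositions of plane waves as multiplication operators -/

section Multiplication

variable {ι : Type} [Fintype ι]

/-- A Bochner integral in L² has no pointwise values to compute with, so both sides are paired with
an arbitrary θ and Fubini is applied. -/
theorem integral_weylOp_ae {ħ : ℝ} {g : Space → ℂ} (hg : Integrable g)
    {k : Space → EuclideanSpace ℝ ι} (hk : Continuous k) (Ψ : L2 ι) :
    ((∫ κ, g κ • weylOp ħ (k κ) 0 Ψ : L2 ι) : EuclideanSpace ℝ ι → ℂ) =ᵐ[volume] fun x =>
      (∫ κ, g κ * Complex.exp (Complex.I * (inner ℝ (k κ) x : ℝ))) * Ψ x := by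
  set u : EuclideanSpace ℝ ι → ℂ := fun x =>
    ∫ κ, g κ * Complex.exp (Complex.I * (inner ℝ (k κ) x : ℝ)) with hu
  have hn : ∀ κ x, ‖g κ * Complex.exp (Complex.I * (inner ℝ (k κ) x : ℝ))‖ = ‖g κ‖ := fun κ x => by
    rw [norm_mul, mul_comm Complex.I, Complex.norm_exp_ofReal_mul_I, mul_one]
  have hmeas : ∀ x, AEStronglyMeasurable (fun κ =>
      g κ * Complex.exp (Complex.I * (inner ℝ (k κ) x : ℝ))) volume := fun x =>
    hg.aestronglyMeasurable.mul (Continuous.aestronglyMeasurable (by fun_prop))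
  have huc : Continuous u := continuous_of_dominated hmeas
    (fun x => ae_of_all _ fun κ => (hn κ x).le) hg.norm (ae_of_all _ fun κ => by fun_prop)
  have hub : ∀ x, ‖u x‖ ≤ ∫ κ, ‖g κ‖ := fun x =>
    norm_integral_le_of_norm_le hg.norm (ae_of_all _ fun κ => (hn κ x).le)
  have hm : MemLp (fun x => u x * Ψ x) 2 volume := by
    refine (Lp.memLp Ψ).of_le_mul (c := ∫ κ, ‖g κ‖)
      (huc.aestronglyMeasurable.mul (Lp.aestronglyMeasurable Ψ)) (ae_of_all _ fun x => ?_)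
    rw [norm_mul]
    exact mul_le_mul_of_nonneg_right (hub x) (norm_nonneg _)
  have hcW : Continuous fun κ => weylOp ħ (k κ) 0 Ψ := continuous_weylOp hk continuous_const Ψ
  have hint : Integrable fun κ => g κ • weylOp ħ (k κ) 0 Ψ := by
    refine (hg.norm.mul_const ‖Ψ‖).mono' (hg.aestronglyMeasurable.smul hcW.aestronglyMeasurable)
      (ae_of_all _ fun κ => ?_)
    rw [norm_smul, norm_weylOp]
  have : (∫ κ, g κ • weylOp ħ (k κ) 0 Ψ) = hm.toLp := by
    refine ext_inner_left ℂ fun θ => ?_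
    rw [← integral_inner hint, L2_inner_eq]
    have e1 : ∀ κ, inner ℂ θ (g κ • weylOp ħ (k κ) 0 Ψ) = ∫ x,
        g κ * Complex.exp (Complex.I * (inner ℝ (k κ) x : ℝ)) * (conj (θ x) * Ψ x) := by
      intro κ
      rw [inner_smul_right, L2_inner_eq, ← integral_const_mul]
      refine integral_congr_ae ((weylOp_ae (ħ := ħ) (k κ) 0 Ψ).mono fun x hx => ?_)
      simp only [hx, smul_zero, add_zero, inner_zero_right, mul_zero, zero_div]
      ring
    simp only [e1]
    rw [integral_integral_swap]
    · refine integral_congr_ae (hm.coeFn_toLp.mono fun x hx => ?_)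
      simp only [hx]
      rw [integral_mul_const]
      ring
    · have h1 := hg.mul_prod (integrable_conj_mul θ Ψ)
      have hce : Continuous fun z : Space × EuclideanSpace ℝ ι =>
          Complex.exp (Complex.I * (inner ℝ (k z.1) z.2 : ℝ)) := by fun_prop
      refine h1.norm.mono' ((hce.aestronglyMeasurable.mul h1.aestronglyMeasurable).congr
        (ae_of_all _ fun z => ?_)) (ae_of_all _ fun z => ?_)
      · simp only [Pi.mul_apply, Function.uncurry]; ring
      · simp only [Function.uncurry]
        rw [norm_mul, hn, norm_mul (g z.1)]
  rw [this]
  exact hm.coeFn_toLp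

/-- The embedding of one-particle vectors as vectors of particle `i`. -/
def particleEmb {N : ℕ} (i : Fin N) : Space →ₗ[ℝ] Config N where
  toFun k := WithLp.toLp 2 fun c => if c.1 = i then k c.2 else 0
  map_add' k k' := by
    ext c
    simp only [PiLp.add_apply]
    split_ifs <;> simp
  map_smul' r k := by
    ext c
    simp only [PiLp.smul_apply, RingHom.id_apply]
    split_ifs <;> simp

theorem particleEmb_apply {N : ℕ} (i : Fin N) (k : Space) (c : Fin N × Fin 3) :
    particleEmb i k c = if c.1 = i then k c.2 else 0 := rfl

theorem inner_particleEmb {N : ℕ} (i : Fin N) (k : Space) (X : Config N) :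
    inner ℝ (particleEmb i k) X = inner ℝ k (particle X i) := by
  simp only [PiLp.inner_apply, particleEmb_apply, Fintype.sum_prod_type, particle]
  rw [Finset.sum_eq_single i]
  · simp
  · intro j _ hj
    simp [hj]
  · simp

theorem particle_particleEmb {N : ℕ} (i j : Fin N) (k : Space) :
    particle (particleEmb i k) j = if j = i then k else 0 := by
  ext c
  simp only [particle, particleEmb_apply]
  split_ifs <;> simp

theorem inner_particleEmb_particleEmb {N : ℕ} (i j : Fin N) (k k' : Space) :
    inner ℝ (particleEmb i k) (particleEmb j k') = if i = j then inner ℝ k k' else 0 := by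
  rw [inner_particleEmb, particle_particleEmb]
  split_ifs <;> simp

theorem continuous_particleEmb {N : ℕ} (i : Fin N) : Continuous (particleEmb (N := N) i) :=
  LinearMap.continuous_of_finiteDimensional _

theorem measurable_particle {N : ℕ} (i : Fin N) : Measurable fun X : Config N => particle X i := by
  unfold particle
  exact (PiLp.continuous_toLp 2 _).measurable.comp (by fun_prop)

/-- The Weyl operators of particle `i`. -/
def particleWeyl (N : ℕ) (ħ : ℝ) (i : Fin N) (z : Space × Space) : L2 (Fin N × Fin 3) →L[ℂ]
    L2 (Fin N × Fin 3) := weylOp ħ (particleEmb i z.1) (particleEmb i z.2)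

/-- The Weyl operators of one particle. -/
def oneWeyl (ħ : ℝ) (z : Space × Space) : L2 (Fin 3) →L[ℂ] L2 (Fin 3) := weylOp ħ z.1 z.2

theorem isWeylSystem_particleWeyl {N : ℕ} (ħ : ℝ) (i : Fin N) :
    IsWeylSystem ħ (particleWeyl N ħ i) :=
  isWeylSystem_weylOp fun x y => by rw [inner_particleEmb_particleEmb, if_pos rfl]

theorem isWeylSystem_oneWeyl (ħ : ℝ) : IsWeylSystem ħ (oneWeyl ħ) :=
  isWeylSystem_weylOp (L := LinearMap.id) fun _ _ => rfl

end Multiplication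

/-! ### The Hartree potential in Fourier variables -/

section Potentials

variable {w : Space → ℝ}

theorem conj_fourier_ofReal (κ : Space) :
    conj (𝓕 (fun x : Space => (w x : ℂ)) κ) = 𝓕 (fun x : Space => (w x : ℂ)) (-κ) := by
  rw [Real.fourier_eq', Real.fourier_eq', ← integral_conj]
  refine integral_congr_ae (ae_of_all _ fun x => ?_)
  simp only [smul_eq_mul, map_mul, ← Complex.exp_conj, Complex.conj_ofReal, Complex.conj_I,
    inner_neg_right]
  congr 2
  push_cast
  ring

theorem fourier_even (hw : ∀ x, w (-x) = w x) (κ : Space) :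
    𝓕 (fun x : Space => (w x : ℂ)) (-κ) = 𝓕 (fun x : Space => (w x : ℂ)) κ := by
  rw [← Real.fourierInv_eq_fourier_neg, Real.fourierInv_eq_fourier_comp_neg]
  simp only [hw]

theorem integral_mul_cexp_eq_fourierInv (a : Space → ℂ) (x : Space) :
    ∫ κ, a κ * Complex.exp (Complex.I * (inner ℝ ((2 * Real.pi) • κ) x : ℝ)) = 𝓕⁻ a x := by
  rw [Real.fourierInv_eq']
  refine integral_congr_ae (ae_of_all _ fun κ => ?_)
  simp only [smul_eq_mul, real_inner_smul_left]
  rw [mul_comm]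
  congr 2
  push_cast
  ring

theorem planeWave_zero (κ : Space) : planeWave 0 κ = ((2 * Real.pi) • κ, 0) := by
  simp [planeWave]

theorem weylPotential_oneWeyl_ae {ħ : ℝ} {g : Space → ℂ} (hg : Integrable g) (Ψ : L2 (Fin 3)) :
    (weylPotential (oneWeyl ħ) g 0 Ψ : L2 (Fin 3)) =ᵐ[volume] fun x => 𝓕⁻ g x * Ψ x := by
  have := integral_weylOp_ae (ħ := ħ) hg (k := fun κ : Space => (2 * Real.pi) • κ)
    (by fun_prop) Ψ
  simp only [integral_mul_cexp_eq_fourierInv] at this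
  simp only [weylPotential, oneWeyl, planeWave_zero]
  convert! this using 1

/-- The convolution theorem: ⟨ψ, e^{-2πi⟨κ,·⟩} ψ⟩ is the Fourier coefficient of |ψ|². The identity
holds at every x, since w enters only under an integral. -/
theorem hartreePotential_eq {ħ : ℝ} {a : Space → ℂ} (ha : Integrable a)
    (hwa : (fun x => (w x : ℂ)) =ᵐ[volume] 𝓕⁻ a) (ψ : L2 (Fin 3)) (x : Space) :
    (hartreePotential w ψ x : ℂ) = 𝓕⁻ (hartreeCoupling a (oneWeyl ħ) 0 ψ) x := by
  have e1 : ∀ κ, hartreeCoupling a (oneWeyl ħ) 0 ψ κ *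
      Complex.exp (Complex.I * (inner ℝ ((2 * Real.pi) • κ) x : ℝ)) =
      ∫ y, a κ * Complex.exp (Complex.I * (inner ℝ ((2 * Real.pi) • κ) (x - y) : ℝ)) *
        (conj (ψ y) * ψ y) := by
    intro κ
    rw [hartreeCoupling, L2_inner_eq, mul_assoc, mul_comm (∫ _, _), ← integral_const_mul,
      ← integral_const_mul]
    refine integral_congr_ae ?_
    have := weylOp_ae (ħ := ħ) ((2 * Real.pi) • (-κ)) 0 ψ
    filter_upwards [this] with y hy
    simp only [oneWeyl, planeWave_zero]
    rw [hy]
    simp only [smul_zero, add_zero, inner_zero_right, mul_zero,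
      zero_div, inner_sub_right, smul_neg, inner_neg_left]
    push_cast
    rw [mul_sub, sub_eq_add_neg, Complex.exp_add]
    ring_nf
  rw [← integral_mul_cexp_eq_fourierInv]
  simp only [e1]
  rw [integral_integral_swap]
  · rw [hartreePotential, ← integral_complex_ofReal]
    have hq : ∀ᵐ y : Space, (w (x - y) : ℂ) = 𝓕⁻ a (x - y) :=
      (Measure.measurePreserving_sub_left volume x).quasiMeasurePreserving.ae hwa
    refine integral_congr_ae (hq.mono fun y hy => ?_)
    simp only
    rw [integral_mul_const, integral_mul_cexp_eq_fourierInv, ← hy, mul_comm (conj _),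
      Complex.mul_conj, Complex.normSq_eq_norm_sq]
    push_cast
    rfl
  · have h1 := ha.mul_prod (integrable_conj_mul ψ ψ)
    have hce : Continuous fun z : Space × Space =>
        Complex.exp (Complex.I * (inner ℝ ((2 * Real.pi) • z.1) (x - z.2) : ℝ)) := by fun_prop
    refine h1.norm.mono' ((hce.aestronglyMeasurable.mul h1.aestronglyMeasurable).congr
      (ae_of_all _ fun z => ?_)) (ae_of_all _ fun z => ?_)
    · simp only [Pi.mul_apply, Function.uncurry]; ring
    · simp only [Function.uncurry]
      rw [norm_mul, norm_mul, mul_comm Complex.I, Complex.norm_exp_ofReal_mul_I, mul_one, norm_mul (a z.1)]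

end Potentials

/-! ### The pair interaction in Fourier variables -/

section PairPotential

variable {w : Space → ℝ} {a : Space → ℂ} {N : ℕ}

/-- Null sets pull back to null sets under a surjective linear map. This is needed because w agrees
with its inverse Fourier representation only almost everywhere. -/
theorem ae_particle_sub {p : Space → Prop} (hp : ∀ᵐ x, p x) {i j : Fin N} (hij : i ≠ j) :
    ∀ᵐ X : Config N, p (particle X i - particle X j) := by
  let L : Config N →ₗ[ℝ] Space :=
    { toFun := fun X => particle X i - particle X j
      map_add' := fun X Y => by
        ext c
        simp only [particle, PiLp.sub_apply, PiLp.add_apply]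
        ring
      map_smul' := fun r X => by
        ext c
        simp only [particle, PiLp.sub_apply, PiLp.smul_apply, RingHom.id_apply, smul_eq_mul]
        ring }
  have hL : Function.Surjective L := fun x => by
    refine ⟨particleEmb i x, ?_⟩
    change particle (particleEmb i x) i - particle (particleEmb i x) j = x
    rw [particle_particleEmb, particle_particleEmb, if_pos rfl, if_neg hij.symm, sub_zero]
  obtain ⟨c, -, -, hc⟩ := L.exists_map_addHaar_eq_smul_addHaar' volume volume hL
  have hq : Measure.QuasiMeasurePreserving L volume volume :=
    ⟨L.continuous_of_finiteDimensional.measurable, by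
      rw [hc]
      exact Measure.AbsolutelyContinuous.rfl.smul_left _⟩
  exact hq.ae hp

theorem sum_sum_eq_sum_Ioi {f : Fin N → Fin N → ℂ} (hf : ∀ i j, i ≠ j → f j i = f i j) {c : ℂ}
    (hc : ∀ i, f i i = c) :
    ∑ i, ∑ j, f i j = 2 * ∑ i, ∑ j ∈ Finset.Ioi i, f i j + N * c := by
  have h1 := Finset.sum_sum_Ioi_add_eq_sum_sum_off_diag f
  have h2 : ∀ i, ∑ j, f i j = f i i + ∑ j ∈ {i}ᶜ, f j i := fun i => by
    rw [← Finset.sum_add_sum_compl {i} (f i), Finset.sum_singleton]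
    congr 1
    refine Finset.sum_congr rfl fun j hj => ?_
    rw [hf i j]
    rw [Finset.mem_compl, Finset.mem_singleton] at hj
    exact fun h => hj h.symm
  simp only [h2, Finset.sum_add_distrib, ← h1, hc]
  rw [Finset.sum_const, Finset.card_univ, Fintype.card_fin, nsmul_eq_mul, add_comm,
    ← Finset.sum_add_distrib, Finset.mul_sum]
  congr 1
  refine Finset.sum_congr rfl fun i _ => ?_
  rw [← Finset.sum_add_distrib, Finset.mul_sum]
  refine Finset.sum_congr rfl fun j hj => ?_
  rw [hf i j (Finset.mem_Ioi.1 hj).ne]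
  ring

theorem pairInteraction_particleWeyl (ħ : ℝ) (ha : Integrable a) (Ψ : L2 (Fin N × Fin 3)) :
    pairInteraction a (particleWeyl N ħ) 0 Ψ = (N / 2 * ((N : ℂ)⁻¹ * (N : ℂ)⁻¹)) •
      ∑ i, ∑ j, ∫ κ, a κ • weylOp ħ (particleEmb i ((2 * Real.pi) • κ) -
        particleEmb j ((2 * Real.pi) • κ)) 0 Ψ := by
  have hcont : ∀ i, Continuous fun κ : Space => particleEmb (N := N) i ((2 * Real.pi) • κ) :=
    fun i => (continuous_particleEmb i).comp (by fun_prop)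
  have hint : ∀ i j : Fin N, Integrable fun κ => a κ • weylOp ħ (particleEmb i ((2 * Real.pi) • κ) -
        particleEmb j ((2 * Real.pi) • κ)) 0 Ψ := by
    intro i j
    have hc := continuous_weylOp (ħ := ħ) ((hcont i).sub (hcont j)) continuous_const (y := 0) Ψ
    refine (ha.norm.mul_const ‖Ψ‖).mono' (ha.aestronglyMeasurable.smul hc.aestronglyMeasurable)
      (ae_of_all _ fun κ => ?_)
    rw [norm_smul, norm_weylOp]
  have e : ∀ κ, a κ • particleMean (fun i => particleWeyl N ħ i (planeWave 0 κ))
      (particleMean (fun i => particleWeyl N ħ i (planeWave 0 (-κ))) Ψ) =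
      ((N : ℂ)⁻¹ * (N : ℂ)⁻¹) • ∑ i, ∑ j, a κ • weylOp ħ (particleEmb i ((2 * Real.pi) • κ) -
        particleEmb j ((2 * Real.pi) • κ)) 0 Ψ := by
    intro κ
    simp only [particleMean_apply, map_smul, map_sum, ← Finset.smul_sum, smul_smul, particleWeyl,
      planeWave_zero, map_zero, smul_neg, map_neg]
    rw [mul_comm (a κ), Finset.sum_comm]
    congr 1
    refine Finset.sum_congr rfl fun i _ => Finset.sum_congr rfl fun j _ => ?_
    rw [weylOp_weylOp, ← sub_eq_add_neg, add_zero]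
    simp
  rw [pairInteraction]
  simp only [e]
  rw [integral_smul, smul_smul]
  congr 1
  refine (integral_finsetSum _ fun i _ => integrable_finsetSum _ fun j _ => hint i j).trans ?_
  exact Finset.sum_congr rfl fun i _ => integral_finsetSum _ fun j _ => hint i j

theorem L2_sum_ae {ι α : Type} [Fintype ι] (s : Finset α) (g : α → L2 ι) :
    ∀ᵐ x, (∑ i ∈ s, g i : L2 ι) x = ∑ i ∈ s, g i x := by
  classical
  induction s using Finset.induction_on with
  | empty =>
    filter_upwards [Lp.coeFn_zero (E := ℂ) 2 (volume : Measure (EuclideanSpace ℝ ι))] with x hx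
    rw [Finset.sum_empty, hx, Finset.sum_empty, Pi.zero_apply]
  | insert i s hi ih =>
    rw [Finset.sum_insert hi]
    filter_upwards [ih, Lp.coeFn_add (g i) (∑ i ∈ s, g i)] with x h1 h2
    rw [h2, Pi.add_apply, h1, Finset.sum_insert hi]

/-- The double sum counts each pair twice, which the factor 1/2 corrects. The N diagonal terms add
the constant (N/2)·N⁻²·N = 1/2 times the continuous representative of w at 0. This self-energy is a
mere phase in the dynamics. -/
theorem pairInteraction_ae {ħ : ℝ} (hN : 0 < N) (ha : Integrable a)
    (hwa : (fun x => (w x : ℂ)) =ᵐ[volume] 𝓕⁻ a) (hw : ∀ x, w (-x) = w x)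
    (Ψ : L2 (Fin N × Fin 3)) :
    (pairInteraction a (particleWeyl N ħ) 0 Ψ : L2 (Fin N × Fin 3)) =ᵐ[volume] fun X =>
      ((pairPotential w N X : ℂ) + 𝓕⁻ a 0 / 2) * Ψ X := by
  have hcont : ∀ i, Continuous fun κ : Space => particleEmb (N := N) i ((2 * Real.pi) • κ) :=
    fun i => (continuous_particleEmb i).comp (by fun_prop)
  have h1 : ∀ i j : Fin N, ((∫ κ, a κ • weylOp ħ (particleEmb i ((2 * Real.pi) • κ) -
        particleEmb j ((2 * Real.pi) • κ)) 0 Ψ : L2 (Fin N × Fin 3)) : Config N → ℂ) =ᵐ[volume]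
      fun X => 𝓕⁻ a (particle X i - particle X j) * Ψ X := by
    intro i j
    have := integral_weylOp_ae (ħ := ħ) ha ((hcont i).sub (hcont j)) Ψ
    refine this.trans (ae_of_all _ fun X => ?_)
    have e : ∀ κ : Space, inner ℝ (particleEmb i ((2 * Real.pi) • κ) -
        particleEmb j ((2 * Real.pi) • κ)) X =
          inner ℝ ((2 * Real.pi) • κ) (particle X i - particle X j) := fun κ => by
      rw [inner_sub_left, inner_particleEmb, inner_particleEmb, inner_sub_right]
    simp only [Pi.sub_apply, e, integral_mul_cexp_eq_fourierInv]
  have h2 : ∀ᵐ X : Config N, ∀ i j : Fin N, i ≠ j →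
      𝓕⁻ a (particle X i - particle X j) = w (particle X i - particle X j) := by
    rw [ae_all_iff]; intro i
    rw [ae_all_iff]; intro j
    by_cases hij : i = j
    · exact ae_of_all _ fun X h => absurd hij h
    · filter_upwards [ae_particle_sub hwa hij] with X hX _ using hX.symm
  have h3 : ∀ᵐ X : Config N, ∀ i j : Fin N,
      (∫ κ, a κ • weylOp ħ (particleEmb i ((2 * Real.pi) • κ) -
        particleEmb j ((2 * Real.pi) • κ)) 0 Ψ : L2 (Fin N × Fin 3)) X =
      𝓕⁻ a (particle X i - particle X j) * Ψ X := by
    rw [ae_all_iff]; intro i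
    rw [ae_all_iff]; intro j
    exact h1 i j
  rw [pairInteraction_particleWeyl ħ ha]
  have h4 : ∀ᵐ X : Config N, (∑ i, ∑ j, ∫ κ, a κ • weylOp ħ (particleEmb i ((2 * Real.pi) • κ) -
        particleEmb j ((2 * Real.pi) • κ)) 0 Ψ : L2 (Fin N × Fin 3)) X =
      ∑ i, ∑ j, (∫ κ, a κ • weylOp ħ (particleEmb i ((2 * Real.pi) • κ) -
        particleEmb j ((2 * Real.pi) • κ)) 0 Ψ : L2 (Fin N × Fin 3)) X := by
    have hs := fun g : Fin N → L2 (Fin N × Fin 3) => L2_sum_ae Finset.univ g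
    filter_upwards [hs fun i => ∑ j, ∫ κ, a κ • weylOp ħ (particleEmb i ((2 * Real.pi) • κ) -
        particleEmb j ((2 * Real.pi) • κ)) 0 Ψ, ae_all_iff.2 fun i => hs fun j => ∫ κ, a κ •
        weylOp ħ (particleEmb i ((2 * Real.pi) • κ) - particleEmb j ((2 * Real.pi) • κ)) 0 Ψ]
      with X e1 e2
    rw [e1]
    exact Finset.sum_congr rfl fun i _ => e2 i
  filter_upwards [h2, h3, L2_smul_ae (N / 2 * ((N : ℂ)⁻¹ * (N : ℂ)⁻¹)) h4] with X e2 e3 e4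
  rw [e4]
  simp only [e3, ← Finset.sum_mul]
  rw [sum_sum_eq_sum_Ioi (c := 𝓕⁻ a 0) (fun i j hij => by
    rw [e2 j i hij.symm, e2 i j hij, ← hw, neg_sub]) fun i => by rw [sub_self]]
  have hN' : (N : ℂ) ≠ 0 := by exact_mod_cast hN.ne'
  rw [pairPotential]
  push_cast
  have : ∑ i : Fin N, ∑ j ∈ Finset.Ioi i, 𝓕⁻ a (particle X i - particle X j) =
      ∑ i : Fin N, ∑ j ∈ Finset.Ioi i, (w (particle X i - particle X j) : ℂ) :=
    Finset.sum_congr rfl fun i _ => Finset.sum_congr rfl fun j hj =>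
      e2 i j (Finset.mem_Ioi.1 hj).ne
  rw [this]
  field_simp

end PairPotential

/-! ### Continuity of the interaction-picture forces -/

section InteractionContinuity

variable {a : Space → ℂ} {N : ℕ} {ħ : ℝ} {H : Type*} [NormedAddCommGroup H]
  [InnerProductSpace ℂ H] [CompleteSpace H]

theorem continuous_integral_of_norm_le {E : Type*} [NormedAddCommGroup E] [NormedSpace ℝ E]
    (ha : Integrable a) {F : ℝ → Space → E} {B : ℝ → ℝ} (hB : Continuous B)
    (hF : ∀ s κ, ‖F s κ‖ ≤ B s * ‖a κ‖) (hm : ∀ s, AEStronglyMeasurable (F s) volume)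
    (hc : ∀ κ, Continuous fun s => F s κ) : Continuous fun s => ∫ κ, F s κ := by
  rw [continuous_iff_continuousAt]
  intro s
  refine continuousAt_of_dominated (bound := fun κ => (B s + 1) * ‖a κ‖)
    (Eventually.of_forall hm) ?_ (ha.norm.const_mul _) (ae_of_all _ fun κ => (hc κ).continuousAt)
  filter_upwards [hB.continuousAt.eventually (gt_mem_nhds (lt_add_one (B s)))] with r hr
  refine ae_of_all _ fun κ => (hF r κ).trans ?_
  gcongr

theorem integrable_smul_of_norm_le {g : Space → ℂ} (hg : Integrable g) {y : Space → H} (hy : Continuous y) {C : ℝ}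
    (hC : ∀ κ, ‖y κ‖ ≤ C) : Integrable fun κ => g κ • y κ := by
  refine (hg.norm.mul_const C).mono' (hg.aestronglyMeasurable.smul hy.aestronglyMeasurable)
    (ae_of_all _ fun κ => ?_)
  rw [norm_smul]
  gcongr
  exact hC κ

theorem IsWeylSystem.map_weylPotential {W : Space × Space → H →L[ℂ] H} (hW : IsWeylSystem ħ W)
    {g : Space → ℂ} (hg : Integrable g) {s : ℝ} {G : H →L[ℂ] H}
    (hG : ∀ κ x, G (W (planeWave 0 κ) x) = W (planeWave s κ) (G x)) (x : H) :
    G (weylPotential W g 0 x) = weylPotential W g s (G x) := by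
  have hi : Integrable fun κ => g κ • W (planeWave 0 κ) x :=
    integrable_smul_of_norm_le hg ((hW.strong_continuous x).comp
      (continuous_planeWave.comp (continuous_const.prodMk continuous_id))) (C := ‖x‖)
      fun κ => (hW.norm_map _ _).le
  rw [weylPotential, weylPotential, ← ContinuousLinearMap.integral_comp_comm _ hi]
  simp only [map_smul, hG]

theorem map_pairInteraction {W : Fin N → Space × Space → H →L[ℂ] H}
    (hW : ∀ i, IsWeylSystem ħ (W i)) (ha : Integrable a) {s : ℝ} {G : H →L[ℂ] H}
    (hG : ∀ i κ x, G (W i (planeWave 0 κ) x) = W i (planeWave s κ) (G x)) (x : H) :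
    G (pairInteraction a W 0 x) = pairInteraction a W s (G x) := by
  have hm : ∀ κ y, G (particleMean (fun i => W i (planeWave 0 κ)) y) =
      particleMean (fun i => W i (planeWave s κ)) (G y) := by
    intro κ y
    simp only [particleMean_apply, map_smul, map_sum, hG]
  have hi : Integrable fun κ => a κ • particleMean (fun i => W i (planeWave 0 κ))
      (particleMean (fun i => W i (planeWave 0 (-κ))) x) :=
    integrable_smul_of_norm_le ha (continuous_particleMean_apply hW 0
      continuous_id (continuous_particleMean_apply hW 0 continuous_neg
        continuous_const)) (C := ‖x‖) fun κ =>
      (norm_particleMean_weyl_le hW 0 κ _).trans (norm_particleMean_weyl_le hW 0 _ x)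
  rw [pairInteraction, pairInteraction, map_smul, ← ContinuousLinearMap.integral_comp_comm _ hi]
  simp only [map_smul, hm]

theorem continuous_weylPotential_hartree (ha : Integrable a) {W : Space × Space → H →L[ℂ] H}
    (hW : IsWeylSystem ħ W) {g : ℝ → H} (hg : Continuous g) :
    Continuous fun s => weylPotential W (hartreeCoupling a W s (g s)) s (g s) := by
  refine continuous_integral_of_norm_le ha (B := fun s => ‖g s‖ ^ 2 * ‖g s‖) (by fun_prop)
    (fun s κ => ?_) (fun s => ?_) fun κ => ?_
  · rw [norm_smul, hW.norm_map]
    have := norm_hartreeCoupling_le (a := a) hW s (g s) κ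
    nlinarith [norm_nonneg (g s)]
  · exact (aestronglyMeasurable_hartreeCoupling hW ha.aestronglyMeasurable s (g s)).smul
      ((hW.strong_continuous _).comp (continuous_planeWave.comp
        (continuous_const.prodMk continuous_id))).aestronglyMeasurable
  · exact (continuous_hartreeCoupling hW continuous_id hg κ).smul
      (hW.continuous_apply (continuous_planeWave.comp (continuous_id.prodMk continuous_const)) hg)

theorem continuous_pairInteraction (ha : Integrable a)
    {W : Fin N → Space × Space → H →L[ℂ] H} (hW : ∀ i, IsWeylSystem ħ (W i)) {g : ℝ → H} (hg : Continuous g) :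
    Continuous fun s => pairInteraction a W s (g s) := by
  refine Continuous.fun_const_smul (continuous_integral_of_norm_le ha (B := fun s => ‖g s‖) (by fun_prop)
    (fun s κ => ?_) (fun s => ?_) fun κ => ?_) _
  · rw [norm_smul, mul_comm]
    gcongr
    exact (norm_particleMean_weyl_le hW s κ _).trans (norm_particleMean_weyl_le hW s _ _)
  · exact ha.aestronglyMeasurable.smul (continuous_particleMean_apply hW s continuous_id
      (continuous_particleMean_apply hW s continuous_neg continuous_const)).aestronglyMeasurable
  · have hmean : ∀ (κ : Space) {y : ℝ → H}, Continuous y →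
        Continuous fun s => particleMean (fun i => W i (planeWave s κ)) (y s) := by
      intro κ y hy
      simp only [particleMean_apply]
      exact (continuous_finsetSum _ fun i _ => (hW i).continuous_apply
        (continuous_planeWave.comp (continuous_id.prodMk continuous_const)) hy).const_smul _
    exact (hmean κ (hmean (-κ) hg)).const_smul _

end InteractionContinuity

/-! ### The two equations in the interaction picture -/

section ConcreteInteraction

variable {w : Space → ℝ} {a : Space → ℂ} {N : ℕ} {ħ : ℝ}

/-- The interaction-picture curve Φ is strongly differentiable, and its pairing with the force is
the real number ∫ V|Ψ|², so ⟨Φ, Φ⟩ has derivative zero. -/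
theorem IsSchrodingerSolution.norm_eq {ι : Type} [Fintype ι] (hħ : 0 < ħ)
    {V : ℝ → EuclideanSpace ℝ ι → ℝ} {Ψ v : ℝ → L2 ι} (h : IsSchrodingerSolution ħ V Ψ)
    (hv : ∀ s, 0 < s → v s =ᵐ[volume] fun x => (V s x : ℂ) * Ψ s x)
    (hc : ContinuousOn (fun s => freeEvolution (-(ħ * s)) (v s)) (Set.Ioi 0)) {t : ℝ} (ht : 0 ≤ t) :
    ‖Ψ t‖ = ‖Ψ 0‖ := by
  set Φ := fun s => freeEvolution (-(ħ * s)) (Ψ s) with hΦ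
  have hΦc : ContinuousOn Φ (Set.Ici 0) := continuousOn_freeEvolution h.1
  have hsub : Set.Icc 0 t ⊆ Set.Ici (0 : ℝ) := fun s hs => hs.1
  have key := norm_le_add_mul_of_re_inner_le (v := fun s => (inner ℂ (Φ s) (Φ s) : ℂ) -
    inner ℂ (Φ 0) (Φ 0)) (G := 0) ht le_rfl (v' := fun _ => 0)
    (((hΦc.mono hsub).inner (hΦc.mono hsub)).sub continuousOn_const) (fun s hs => by
      have h1 := h.hasDerivAt_interaction hħ hv hc hs.1
      refine ((h1.inner ℂ h1).sub_const _).congr_deriv ?_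
      have e : inner ℂ (Φ s) (freeEvolution (-(ħ * s)) (v s)) =
          ((∫ x, V s x * ‖Ψ s x‖ ^ 2 : ℝ) : ℂ) := by
        rw [hΦ]
        simp only
        rw [inner_freeEvolution, neg_neg, freeEvolution_apply_neg, L2_inner_eq,
          ← integral_complex_ofReal]
        refine integral_congr_ae ((hv s hs.1).mono fun x hx => ?_)
        simp only [hx]
        rw [mul_left_comm, mul_comm (conj _), Complex.mul_conj, Complex.normSq_eq_norm_sq]
        push_cast
        rfl
      have e' : inner ℂ (freeEvolution (-(ħ * s)) (v s)) (Φ s) =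
          ((∫ x, V s x * ‖Ψ s x‖ ^ 2 : ℝ) : ℂ) := by
        rw [← inner_conj_symm, e, Complex.conj_ofReal]
      rw [inner_smul_left, inner_smul_right, e, e']
      simp only [map_neg, map_div₀, Complex.conj_I, Complex.conj_ofReal]
      ring) (fun s _ => by simp)
  simp only [sub_self, norm_zero, zero_mul, mul_zero, add_zero] at key
  have h2 := sub_eq_zero.1 (norm_le_zero_iff.1 key)
  rw [inner_self_eq_norm_sq_to_K, inner_self_eq_norm_sq_to_K] at h2
  have h3 : ‖Φ t‖ ^ 2 = ‖Φ 0‖ ^ 2 := by exact_mod_cast h2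
  have h4 := (pow_left_inj₀ (norm_nonneg _) (norm_nonneg _) two_ne_zero).1 h3
  simpa only [hΦ, norm_freeEvolution] using h4

theorem freeEvolution_oneWeyl (s : ℝ) (κ : Space) (x : L2 (Fin 3)) :
    freeEvolution (-(ħ * s)) (oneWeyl ħ (planeWave 0 κ) x) =
      oneWeyl ħ (planeWave s κ) (freeEvolution (-(ħ * s)) x) := by
  have := freeEvolution_weylOp ħ s ((2 * Real.pi) • κ) 0 (freeEvolution (-(ħ * s)) x)
  rw [freeEvolution_apply_neg, zero_add, smul_smul] at this
  rw [oneWeyl, oneWeyl, planeWave_zero]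
  exact this

theorem freeEvolution_particleWeyl (i : Fin N) (s : ℝ) (κ : Space) (x : L2 (Fin N × Fin 3)) :
    freeEvolution (-(ħ * s)) (particleWeyl N ħ i (planeWave 0 κ) x) =
      particleWeyl N ħ i (planeWave s κ) (freeEvolution (-(ħ * s)) x) := by
  have := freeEvolution_weylOp ħ s (particleEmb i ((2 * Real.pi) • κ)) 0 (freeEvolution (-(ħ * s)) x)
  rw [freeEvolution_apply_neg, zero_add, ← map_smul, smul_smul] at this
  rw [particleWeyl, particleWeyl, planeWave_zero, map_zero]
  exact this

theorem freeEvolution_weylPotential {g : Space → ℂ} (hg : Integrable g) (s : ℝ) (x : L2 (Fin 3)) :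
    freeEvolution (-(ħ * s)) (weylPotential (oneWeyl ħ) g 0 x) =
      weylPotential (oneWeyl ħ) g s (freeEvolution (-(ħ * s)) x) :=
  (isWeylSystem_oneWeyl ħ).map_weylPotential hg (freeEvolution_oneWeyl s) x

theorem freeEvolution_pairInteraction (ha : Integrable a) (s : ℝ) (x : L2 (Fin N × Fin 3)) :
    freeEvolution (-(ħ * s)) (pairInteraction a (particleWeyl N ħ) 0 x) =
      pairInteraction a (particleWeyl N ħ) s (freeEvolution (-(ħ * s)) x) :=
  map_pairInteraction (isWeylSystem_particleWeyl ħ) ha (fun i => freeEvolution_particleWeyl i s) x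

theorem continuous_extend_Ici {E : Type*} [TopologicalSpace E] {f : ℝ → E}
    (hf : ContinuousOn f (Set.Ici 0)) : Continuous fun s => f (max s 0) :=
  hf.comp_continuous (continuous_id.max continuous_const) fun _ => Set.mem_Ici.2 (le_max_right _ _)

theorem integrable_hartreeCoupling (ha : Integrable a) (s : ℝ) (φ : L2 (Fin 3)) :
    Integrable (hartreeCoupling a (oneWeyl ħ) s φ) :=
  (ha.norm.const_mul (‖φ‖ ^ 2)).mono' (aestronglyMeasurable_hartreeCoupling
    (isWeylSystem_oneWeyl ħ) ha.aestronglyMeasurable s φ)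
    (ae_of_all _ (norm_hartreeCoupling_le (isWeylSystem_oneWeyl ħ) s φ))

theorem weylPotential_hartree_ae (ha : Integrable a)
    (hwa : (fun x => (w x : ℂ)) =ᵐ[volume] 𝓕⁻ a) (φ : L2 (Fin 3)) :
    (weylPotential (oneWeyl ħ) (hartreeCoupling a (oneWeyl ħ) 0 φ) 0 φ : L2 (Fin 3)) =ᵐ[volume]
      fun x => (hartreePotential w φ x : ℂ) * φ x := by
  refine (weylPotential_oneWeyl_ae (integrable_hartreeCoupling ha 0 φ) φ).trans
    (ae_of_all _ fun x => ?_)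
  simp only [hartreePotential_eq (ħ := ħ) ha hwa]

/-- State and plane wave are moved by the same free evolution, so the expectation does not change.
-/
theorem hartreeCoupling_freeEvolution (s : ℝ) (φ : L2 (Fin 3)) :
    hartreeCoupling a (oneWeyl ħ) s (freeEvolution (-(ħ * s)) φ) =
      hartreeCoupling a (oneWeyl ħ) 0 φ := by
  funext κ
  rw [hartreeCoupling, hartreeCoupling, ← freeEvolution_oneWeyl, inner_freeEvolution, neg_neg,
    freeEvolution_apply_neg]

theorem freeEvolution_hartree (ha : Integrable a) (s : ℝ) (φ : L2 (Fin 3)) :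
    freeEvolution (-(ħ * s)) (weylPotential (oneWeyl ħ) (hartreeCoupling a (oneWeyl ħ) 0 φ) 0 φ) =
      weylPotential (oneWeyl ħ) (hartreeCoupling a (oneWeyl ħ) s (freeEvolution (-(ħ * s)) φ)) s
        (freeEvolution (-(ħ * s)) φ) := by
  rw [freeEvolution_weylPotential (integrable_hartreeCoupling ha 0 φ), hartreeCoupling_freeEvolution]

theorem continuousOn_freeEvolution_hartree (ha : Integrable a) {ψ : ℝ → L2 (Fin 3)}
    (hψ : ContinuousOn ψ (Set.Ici 0)) : ContinuousOn (fun s => freeEvolution (-(ħ * s))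
      (weylPotential (oneWeyl ħ) (hartreeCoupling a (oneWeyl ħ) 0 (ψ s)) 0 (ψ s))) (Set.Ioi 0) := by
  simp only [freeEvolution_hartree ha]
  have hg := continuous_extend_Ici (continuousOn_freeEvolution (ħ := ħ) hψ)
  refine (continuous_weylPotential_hartree ha (isWeylSystem_oneWeyl ħ) hg).continuousOn.congr
    fun s hs => ?_
  simp only [max_eq_left (le_of_lt (Set.mem_Ioi.1 hs))]

theorem IsHartreeSolution.hasDerivAt (hħ : 0 < ħ) (ha : Integrable a)
    (hwa : (fun x => (w x : ℂ)) =ᵐ[volume] 𝓕⁻ a) {ψ : ℝ → L2 (Fin 3)}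
    (h : IsHartreeSolution ħ w ψ) {s : ℝ} (hs : 0 < s) :
    HasDerivAt (fun s => freeEvolution (-(ħ * s)) (ψ s)) (-(Complex.I / ħ) •
      weylPotential (oneWeyl ħ) (hartreeCoupling a (oneWeyl ħ) s (freeEvolution (-(ħ * s)) (ψ s))) s
        (freeEvolution (-(ħ * s)) (ψ s))) s := by
  rw [← freeEvolution_hartree ha]
  exact IsSchrodingerSolution.hasDerivAt_interaction hħ h
    (fun s _ => weylPotential_hartree_ae (ħ := ħ) ha hwa (ψ s))
    (continuousOn_freeEvolution_hartree ha h.1) hs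

theorem IsHartreeSolution.norm_eq (hħ : 0 < ħ) (ha : Integrable a)
    (hwa : (fun x => (w x : ℂ)) =ᵐ[volume] 𝓕⁻ a) {ψ : ℝ → L2 (Fin 3)}
    (h : IsHartreeSolution ħ w ψ) {t : ℝ} (ht : 0 ≤ t) : ‖ψ t‖ = ‖ψ 0‖ :=
  IsSchrodingerSolution.norm_eq hħ h (fun s _ => weylPotential_hartree_ae (ħ := ħ) ha hwa (ψ s))
    (continuousOn_freeEvolution_hartree ha h.1) ht

/-- The self-energy is subtracted as a scalar; it has to be real for the generator to remain skew,
which follows from a being real. -/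
theorem pairPotential_mul_ae (hN : 0 < N) (ha : Integrable a) (hr : ∀ κ, conj (a κ) = a κ)
    (hwa : (fun x => (w x : ℂ)) =ᵐ[volume] 𝓕⁻ a) (hw : ∀ x, w (-x) = w x)
    (Ψ : L2 (Fin N × Fin 3)) :
    (pairInteraction a (particleWeyl N ħ) 0 Ψ + ((-(𝓕⁻ a 0).re / 2 : ℝ) : ℂ) • Ψ :
      L2 (Fin N × Fin 3)) =ᵐ[volume] fun X => (pairPotential w N X : ℂ) * Ψ X := by
  have h0 : 𝓕⁻ a 0 = ((𝓕⁻ a 0).re : ℂ) := by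
    refine (Complex.conj_eq_iff_re.1 ?_).symm
    rw [Real.fourierInv_eq', ← integral_conj]
    refine integral_congr_ae (ae_of_all _ fun κ => ?_)
    simp [hr]
  filter_upwards [pairInteraction_ae (ħ := ħ) hN ha hwa hw Ψ, Lp.coeFn_add
    (pairInteraction a (particleWeyl N ħ) 0 Ψ) (((-(𝓕⁻ a 0).re / 2 : ℝ) : ℂ) • Ψ),
    Lp.coeFn_smul ((-(𝓕⁻ a 0).re / 2 : ℝ) : ℂ) Ψ] with X h1 h2 h3
  rw [h2, Pi.add_apply, h1, h3, Pi.smul_apply, smul_eq_mul]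
  generalize 𝓕⁻ a 0 = b at h0 ⊢
  rw [h0]
  push_cast [Complex.ofReal_re]
  ring

theorem continuousOn_freeEvolution_pair (ha : Integrable a) {Ψ : ℝ → L2 (Fin N × Fin 3)} (c : ℂ)
    (hΨ : ContinuousOn Ψ (Set.Ici 0)) : ContinuousOn (fun s => freeEvolution (-(ħ * s))
      (pairInteraction a (particleWeyl N ħ) 0 (Ψ s) + c • Ψ s)) (Set.Ioi 0) := by
  simp only [map_add, map_smul, freeEvolution_pairInteraction ha]
  have hg := continuous_extend_Ici (continuousOn_freeEvolution (ħ := ħ) hΨ)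
  refine ((continuous_pairInteraction ha (isWeylSystem_particleWeyl ħ) hg).fun_add
    (hg.fun_const_smul c)).continuousOn.congr fun s hs => ?_
  simp only [max_eq_left (le_of_lt (Set.mem_Ioi.1 hs))]

theorem IsNBodySolution.hasDerivAt (hħ : 0 < ħ) (hN : 0 < N) (ha : Integrable a)
    (hr : ∀ κ, conj (a κ) = a κ) (hwa : (fun x => (w x : ℂ)) =ᵐ[volume] 𝓕⁻ a)
    (hw : ∀ x, w (-x) = w x) {Ψ : ℝ → L2 (Fin N × Fin 3)}
    (h : IsNBodySolution ħ w N Ψ) {s : ℝ} (hs : 0 < s) :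
    HasDerivAt (fun s => freeEvolution (-(ħ * s)) (Ψ s)) (-(Complex.I / ħ) •
      (pairInteraction a (particleWeyl N ħ) s (freeEvolution (-(ħ * s)) (Ψ s)) +
        ((-(𝓕⁻ a 0).re / 2 : ℝ) : ℂ) • freeEvolution (-(ħ * s)) (Ψ s))) s := by
  rw [← freeEvolution_pairInteraction ha, ← map_smul, ← map_add]
  exact IsSchrodingerSolution.hasDerivAt_interaction hħ h
    (fun s _ => pairPotential_mul_ae hN ha hr hwa hw (Ψ s))
    (continuousOn_freeEvolution_pair ha _ h.1) hs

theorem IsNBodySolution.norm_eq (hħ : 0 < ħ) (hN : 0 < N) (ha : Integrable a)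
    (hr : ∀ κ, conj (a κ) = a κ) (hwa : (fun x => (w x : ℂ)) =ᵐ[volume] 𝓕⁻ a)
    (hw : ∀ x, w (-x) = w x) {Ψ : ℝ → L2 (Fin N × Fin 3)}
    (h : IsNBodySolution ħ w N Ψ) {t : ℝ} (ht : 0 ≤ t) : ‖Ψ t‖ = ‖Ψ 0‖ :=
  IsSchrodingerSolution.norm_eq hħ h
    (fun s _ => pairPotential_mul_ae (ħ := ħ) hN ha hr hwa hw (Ψ s))
    (continuousOn_freeEvolution_pair ha _ h.1) ht

end ConcreteInteraction

/-! ### Product states, slots and permutations in the concrete N-particle space -/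

section ParticleDecomposition

variable {N : ℕ}

/-- Configurations as families of particle positions. -/
def particleEquiv (N : ℕ) : Config N ≃ᵐ (Fin N → Space) where
  toFun X i := particle X i
  invFun x := WithLp.toLp 2 fun c => x c.1 c.2
  left_inv X := rfl
  right_inv x := rfl
  measurable_toFun := measurable_pi_lambda _ fun i => measurable_particle i
  measurable_invFun := (PiLp.continuous_toLp 2 _).measurable.comp (by fun_prop)

theorem measurePreserving_uncurry :
    MeasurePreserving fun (x : Fin N → Fin 3 → ℝ) (c : Fin N × Fin 3) => x c.1 c.2 := by
  refine ⟨by fun_prop, (Measure.pi_eq fun s hs => ?_).symm⟩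
  rw [Measure.map_apply (by fun_prop) (MeasurableSet.univ_pi hs)]
  have : (fun (x : Fin N → Fin 3 → ℝ) (c : Fin N × Fin 3) => x c.1 c.2) ⁻¹' Set.univ.pi s =
      Set.univ.pi fun i => Set.univ.pi fun j => s (i, j) := by
    ext x
    simp
  rw [this, volume_pi_pi]
  simp only [volume_pi_pi]
  rw [Fintype.prod_prod_type]

theorem measurePreserving_particleEquiv_symm : MeasurePreserving (particleEquiv N).symm := by
  have h1 : MeasurePreserving fun (x : Fin N → Space) i => WithLp.ofLp (x i) :=
    volume_preserving_pi fun _ => PiLp.volume_preserving_ofLp (Fin 3)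
  exact (PiLp.volume_preserving_toLp (Fin N × Fin 3)).comp (measurePreserving_uncurry.comp h1)

theorem measurePreserving_particleEquiv : MeasurePreserving (particleEquiv N) :=
  measurePreserving_particleEquiv_symm.symm _

theorem ae_particle {p : Space → Prop} (hp : ∀ᵐ x, p x) (i : Fin N) :
    ∀ᵐ X : Config N, p (particle X i) := by
  have h2 : Measure.QuasiMeasurePreserving (Function.eval i : (Fin N → Space) → Space) volume volume :=
    Measure.quasiMeasurePreserving_eval (μ := fun _ : Fin N => (volume : Measure Space)) i
  exact (h2.comp measurePreserving_particleEquiv.quasiMeasurePreserving).ae hp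

theorem integral_prod_particle (f : Fin N → Space → ℂ) :
    ∫ X : Config N, ∏ i, f i (particle X i) = ∏ i, ∫ x, f i x := by
  rw [← integral_fintype_prod_volume_eq_prod, ← measurePreserving_particleEquiv.integral_comp']
  rfl

theorem integrable_prod_particle {f : Fin N → Space → ℂ} (hf : ∀ i, Integrable (f i)) :
    Integrable fun X : Config N => ∏ i, f i (particle X i) :=
  (measurePreserving_particleEquiv.integrable_comp_emb (particleEquiv N).measurableEmbedding).2
    (Integrable.fintype_prod (μ := fun _ : Fin N => (volume : Measure Space)) hf)

theorem memLp_tensor (g : Fin N → L2 (Fin 3)) :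
    MemLp (fun X : Config N => ∏ i, g i (particle X i)) 2 volume := by
  have hm : AEStronglyMeasurable (fun X : Config N => ∏ i, g i (particle X i)) volume :=
    (Finset.univ.stronglyMeasurable_fun_prod fun i _ =>
      (Lp.stronglyMeasurable (g i)).comp_measurable (measurable_particle i)).aestronglyMeasurable
  rw [memLp_two_iff_integrable_sq_norm hm]
  have := (integrable_prod_particle (fun i => integrable_conj_mul (g i) (g i))).norm
  refine this.congr (ae_of_all _ fun X => ?_)
  simp only [norm_prod, norm_mul, RCLike.norm_conj, sq, Finset.prod_mul_distrib]

/-- The product state `g₁(x₁) ⋯ g_N(x_N)`. -/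
def tensor (g : Fin N → L2 (Fin 3)) : L2 (Fin N × Fin 3) := (memLp_tensor g).toLp

theorem tensor_ae (g : Fin N → L2 (Fin 3)) :
    tensor g =ᵐ[volume] fun X : Config N => ∏ i, g i (particle X i) :=
  (memLp_tensor g).coeFn_toLp

theorem inner_tensor (g h : Fin N → L2 (Fin 3)) :
    inner ℂ (tensor g) (tensor h) = ∏ i, inner ℂ (g i) (h i) := by
  simp only [L2_inner_eq]
  rw [← integral_prod_particle fun i x => conj (g i x) * h i x]
  refine integral_congr_ae ?_
  filter_upwards [tensor_ae g, tensor_ae h] with X h1 h2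
  rw [h1, h2, map_prod, Finset.prod_mul_distrib]

theorem norm_tensor (g : Fin N → L2 (Fin 3)) : ‖tensor g‖ = ∏ i, ‖g i‖ := by
  have h := inner_tensor g g
  simp only [inner_self_eq_norm_sq_to_K] at h
  rw [Finset.prod_pow] at h
  have h2 : ‖tensor g‖ ^ 2 = (∏ i, ‖g i‖) ^ 2 := by exact_mod_cast h
  exact (pow_left_inj₀ (norm_nonneg _) (Finset.prod_nonneg fun i _ => norm_nonneg _) two_ne_zero).1 h2

theorem particle_add_smul_particleEmb (X : Config N) (r : ℝ) (i j : Fin N) (y : Space) :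
    particle (X + r • particleEmb i y) j = particle X j + if j = i then r • y else 0 := by
  ext c
  simp only [particle, PiLp.add_apply, PiLp.smul_apply, particleEmb_apply]
  split_ifs <;> simp

theorem particleWeyl_tensor (ħ : ℝ) (i : Fin N) (z : Space × Space) (g : Fin N → L2 (Fin 3)) :
    particleWeyl N ħ i z (tensor g) = tensor (Function.update g i (oneWeyl ħ z (g i))) := by
  apply Lp.ext
  filter_upwards [weylOp_ae (ħ := ħ) (particleEmb i z.1) (particleEmb i z.2) (tensor g),
    ae_comp_add_right (tensor_ae g) (ħ • particleEmb i z.2),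
    tensor_ae (Function.update g i (oneWeyl ħ z (g i))),
    ae_particle (weylOp_ae (ħ := ħ) z.1 z.2 (g i)) i] with X h1 h2 h3 h4
  rw [particleWeyl, h1, h2, h3, ← Finset.mul_prod_erase _ _ (Finset.mem_univ i),
    ← Finset.mul_prod_erase Finset.univ (fun j => Function.update g i (oneWeyl ħ z (g i)) j _)
      (Finset.mem_univ i), Function.update_self, oneWeyl, h4, ← mul_assoc, inner_particleEmb,
    inner_particleEmb_particleEmb, if_pos rfl, particle_add_smul_particleEmb, if_pos rfl]
  congr 1
  refine Finset.prod_congr rfl fun j hj => ?_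
  rw [Function.update_of_ne (Finset.ne_of_mem_erase hj), particle_add_smul_particleEmb,
    if_neg (Finset.ne_of_mem_erase hj), add_zero]

/-- The product state with `g` in slot `i` and `f` in all other slots. -/
def slotEmbed (f : L2 (Fin 3)) (i : Fin N) : L2 (Fin 3) →L[ℂ] L2 (Fin N × Fin 3) :=
  LinearMap.mkContinuous
    { toFun := fun g => tensor (Function.update (fun _ => f) i g)
      map_add' := fun g g' => by
        apply Lp.ext
        filter_upwards [tensor_ae (Function.update (fun _ => f) i (g + g')),
          Lp.coeFn_add (tensor (Function.update (fun _ => f) i g))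
            (tensor (Function.update (fun _ => f) i g')),
          tensor_ae (Function.update (fun _ => f) i g),
          tensor_ae (Function.update (fun _ => f) i g'), ae_particle (Lp.coeFn_add g g') i]
          with X h1 h2 h3 h4 h5
        rw [h1, h2, Pi.add_apply, h3, h4]
        simp only [← Finset.mul_prod_erase _ _ (Finset.mem_univ i), Function.update_self]
        rw [h5, Pi.add_apply, add_mul]
        congr 1 <;> congr 1 <;> refine Finset.prod_congr rfl fun j hj => ?_ <;>
          rw [Function.update_of_ne (Finset.ne_of_mem_erase hj),
            Function.update_of_ne (Finset.ne_of_mem_erase hj)]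
      map_smul' := fun c g => by
        apply Lp.ext
        filter_upwards [tensor_ae (Function.update (fun _ => f) i (c • g)),
          Lp.coeFn_smul c (tensor (Function.update (fun _ => f) i g)),
          tensor_ae (Function.update (fun _ => f) i g), ae_particle (Lp.coeFn_smul c g) i]
          with X h1 h2 h3 h5
        rw [RingHom.id_apply, h1, h2, Pi.smul_apply, h3]
        simp only [← Finset.mul_prod_erase _ _ (Finset.mem_univ i), Function.update_self]
        rw [h5, Pi.smul_apply, smul_mul_assoc]
        congr 2
        refine Finset.prod_congr rfl fun j hj => ?_
        rw [Function.update_of_ne (Finset.ne_of_mem_erase hj),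
          Function.update_of_ne (Finset.ne_of_mem_erase hj)] } (‖f‖ ^ (N - 1))
    (fun g => by
      change ‖tensor (Function.update (fun _ => f) i g)‖ ≤ _
      rw [norm_tensor, ← Finset.mul_prod_erase _ _ (Finset.mem_univ i), Function.update_self,
        mul_comm]
      refine mul_le_mul_of_nonneg_right (le_of_eq ?_) (norm_nonneg _)
      rw [Finset.prod_congr rfl fun j hj => by
        rw [Function.update_of_ne (Finset.ne_of_mem_erase hj)], Finset.prod_const,
        Finset.card_erase_of_mem (Finset.mem_univ i), Finset.card_univ, Fintype.card_fin])

theorem slotEmbed_apply (f g : L2 (Fin 3)) (i : Fin N) :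
    slotEmbed f i g = tensor (Function.update (fun _ => f) i g) := rfl

/-- The relabelling of the particles. -/
def permuteConfig (σ : Equiv.Perm (Fin N)) : Config N ≃ₗᵢ[ℝ] Config N :=
  LinearIsometryEquiv.piLpCongrLeft 2 ℝ ℝ (σ⁻¹.prodCongr (Equiv.refl (Fin 3)))

theorem permuteConfig_apply (σ : Equiv.Perm (Fin N)) (X : Config N) (c : Fin N × Fin 3) :
    permuteConfig σ X c = X (σ c.1, c.2) := by
  rfl

theorem particle_permuteConfig (σ : Equiv.Perm (Fin N)) (X : Config N) (i : Fin N) :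
    particle (permuteConfig σ X) i = particle X (σ i) := by
  ext c
  simp only [particle, permuteConfig_apply]

theorem permuteConfig_particleEmb (σ : Equiv.Perm (Fin N)) (i : Fin N) (y : Space) :
    permuteConfig σ (particleEmb (σ i) y) = particleEmb i y := by
  ext c
  simp only [permuteConfig_apply, particleEmb_apply, σ.injective.eq_iff]

theorem exists_permutation_clm (σ : Equiv.Perm (Fin N)) (ħ : ℝ) :
    ∃ S : L2 (Fin N × Fin 3) →L[ℂ] L2 (Fin N × Fin 3), (∀ x, ‖S x‖ = ‖x‖) ∧
      (∀ i z x, S (particleWeyl N ħ i z x) = particleWeyl N ħ (σ i) z (S x)) ∧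
        ∀ f, S (tensor fun _ => f) = tensor fun _ => f := by
  have hπ : MeasurePreserving (permuteConfig σ) volume volume :=
    (permuteConfig σ).measurePreserving
  let S := Lp.compMeasurePreservingₗᵢ (E := ℂ) (p := 2) ℂ (permuteConfig σ) hπ
  have hS : ∀ x : L2 (Fin N × Fin 3), S x =ᵐ[volume] fun X => x (permuteConfig σ X) :=
    fun x => Lp.coeFn_compMeasurePreserving x hπ
  refine ⟨S.toContinuousLinearMap, fun x => S.norm_map x, fun i z x => ?_, fun f => ?_⟩
  · apply Lp.ext
    change S (particleWeyl N ħ i z x) =ᵐ[volume] particleWeyl N ħ (σ i) z (S x)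
    filter_upwards [hS (particleWeyl N ħ i z x), hπ.quasiMeasurePreserving.ae
      (weylOp_ae (ħ := ħ) (particleEmb i z.1) (particleEmb i z.2) x),
      weylOp_ae (ħ := ħ) (particleEmb (σ i) z.1) (particleEmb (σ i) z.2) (S x),
      ae_comp_add_right (hS x) (ħ • particleEmb (σ i) z.2)] with X h1 h2 h3 h4
    rw [h1, particleWeyl, h2, particleWeyl, h3, h4]
    simp only [inner_particleEmb, particle_permuteConfig, particle_particleEmb, if_true, map_add,
      map_smul, permuteConfig_particleEmb]
  · apply Lp.ext
    change S (tensor fun _ => f) =ᵐ[volume] tensor fun _ => f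
    filter_upwards [hS (tensor fun _ => f), hπ.quasiMeasurePreserving.ae (tensor_ae fun _ => f),
      tensor_ae fun _ : Fin N => f] with X h1 h2 h3
    rw [h1, h2, h3]
    simp only [particle_permuteConfig]
    exact Equiv.prod_comp σ fun i => f (particle X i)

theorem particleWeyl_comm {ħ : ℝ} {i j : Fin N} (hij : i ≠ j) (z z' : Space × Space)
    (x : L2 (Fin N × Fin 3)) :
    particleWeyl N ħ i z (particleWeyl N ħ j z' x) =
      particleWeyl N ħ j z' (particleWeyl N ħ i z x) := by
  simp only [particleWeyl]
  rw [weylOp_comm, weylOp_comm, add_comm, add_comm (particleEmb i z.2)]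
  all_goals rw [inner_particleEmb_particleEmb]
  all_goals first | exact if_neg hij | exact if_neg hij.symm

/-- The Weyl operators of `N` particles acting on a product state. -/
theorem isManyBodyWeyl {ħ : ℝ} {f : L2 (Fin 3)} (hf : ‖f‖ = 1) :
    IsManyBodyWeyl ħ (oneWeyl ħ) (particleWeyl N ħ) f (slotEmbed f) (tensor fun _ => f) where
  weyl₀ := isWeylSystem_oneWeyl ħ
  weyl := isWeylSystem_particleWeyl ħ
  commute i j hij z z' x := particleWeyl_comm hij z z' x
  intertwine i z g := by
    rw [slotEmbed_apply, slotEmbed_apply, particleWeyl_tensor, Function.update_self,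
      Function.update_idem]
  norm_state := hf
  norm_embed i g := by
    rw [slotEmbed_apply, norm_tensor, ← Finset.mul_prod_erase _ _ (Finset.mem_univ i),
      Function.update_self, Finset.prod_eq_one, mul_one]
    intro j hj
    rw [Function.update_of_ne (Finset.ne_of_mem_erase hj), hf]
  embed_state i := by
    rw [slotEmbed_apply]
    congr 1
    exact Function.update_eq_self i _
  inner_embed i j hij g h := by
    rw [slotEmbed_apply, slotEmbed_apply, inner_tensor, ← Finset.mul_prod_erase _ _ (Finset.mem_univ i),
      ← Finset.mul_prod_erase _ _ (Finset.mem_erase.2 ⟨hij.symm, Finset.mem_univ j⟩),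
      Function.update_self, Function.update_self, Function.update_of_ne hij,
      Function.update_of_ne hij.symm, Finset.prod_eq_one, mul_one]
    intro k hk
    rw [Function.update_of_ne (Finset.ne_of_mem_erase (Finset.mem_of_mem_erase hk)),
      Function.update_of_ne (Finset.ne_of_mem_erase hk), inner_self_eq_norm_sq_to_K, hf]
    simp
  symmetric σ := by
    obtain ⟨S, h1, h2, h3⟩ := exists_permutation_clm (N := N) σ ħ
    exact ⟨S, h1, h2, h3 f⟩

theorem IsProductState.eq_tensor {ψ : L2 (Fin 3)} {Ψ : L2 (Fin N × Fin 3)}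
    (h : IsProductState ψ Ψ) : Ψ = tensor fun _ => ψ := by
  apply Lp.ext
  filter_upwards [h, tensor_ae fun _ : Fin N => ψ] with X h1 h2
  rw [h1, h2]

/-- Vectors belonging to distinct particles are orthogonal, so all cocycle phases vanish and the
product is a single Weyl operator at the sum of the frequencies. -/
theorem opProd_particleWeyl {ħ : ℝ} (l : List (Fin N × (Space × Space)))
    (hl : (l.map Prod.fst).Nodup) (x : L2 (Fin N × Fin 3)) :
    opProd (particleWeyl N ħ) l x = weylOp ħ (l.map fun q => particleEmb q.1 q.2.1).sum
      (l.map fun q => particleEmb q.1 q.2.2).sum x := by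
  have horth : ∀ (i : Fin N) (y : Space) (l : List (Fin N × (Space × Space)))
      (g : Space × Space → Space), i ∉ l.map Prod.fst →
      inner ℝ (l.map fun q => particleEmb q.1 (g q.2)).sum (particleEmb i y) = 0 := by
    intro i y l g
    induction l with
    | nil => simp
    | cons q l ih =>
      intro hi
      rw [List.map_cons, List.mem_cons, not_or] at hi
      rw [List.map_cons, List.sum_cons, inner_add_left, ih hi.2, inner_particleEmb_particleEmb,
        if_neg (Ne.symm hi.1), add_zero]
  induction l generalizing x with
  | nil => simp [opProd, weylOp_zero]
  | cons q l ih =>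
    rw [List.map_cons, List.nodup_cons] at hl
    rw [opProd, ContinuousLinearMap.comp_apply, ih hl.2, particleWeyl,
      weylOp_comm (horth _ _ l _ hl.1) (horth _ _ l _ hl.1), List.map_cons, List.map_cons,
      List.sum_cons, List.sum_cons, add_comm, add_comm (particleEmb q.1 q.2.2)]

end ParticleDecomposition

/-! ### Convergence of the reduced characteristic functions -/

section WeylConvergence

variable {N p : ℕ} {ħ : ℝ}

theorem inner_eq_sum_particle (X Y : Config N) :
    inner ℝ X Y = ∑ i, inner ℝ (particle X i) (particle Y i) := by
  simp only [PiLp.inner_apply, Fintype.sum_prod_type, particle]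

theorem norm_particle_le (X : Config N) (i : Fin N) : ‖particle X i‖ ≤ ‖X‖ := by
  have h : ‖particle X i‖ ^ 2 ≤ ‖X‖ ^ 2 := by
    rw [← real_inner_self_eq_norm_sq, ← real_inner_self_eq_norm_sq, inner_eq_sum_particle X X]
    exact Finset.single_le_sum (f := fun i => inner ℝ (particle X i) (particle X i))
      (fun j _ => real_inner_self_nonneg) (Finset.mem_univ i)
  exact (sq_le_sq₀ (norm_nonneg _) (norm_nonneg _)).1 h

theorem weylOp_tensor (k y : Config N) (g : Fin N → L2 (Fin 3)) :
    weylOp ħ k y (tensor g) =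
      tensor fun j => oneWeyl ħ (particle k j, particle y j) (g j) := by
  apply Lp.ext
  filter_upwards [weylOp_ae (ħ := ħ) k y (tensor g), ae_comp_add_right (tensor_ae g) (ħ • y),
    tensor_ae fun j => oneWeyl ħ (particle k j, particle y j) (g j),
    ae_all_iff.2 fun j => ae_particle (weylOp_ae (ħ := ħ) (particle k j) (particle y j) (g j)) j]
    with X h1 h2 h3 h4
  rw [h1, h2, h3]
  simp only [oneWeyl, h4]
  rw [Finset.prod_mul_distrib, ← Complex.exp_sum, ← Finset.mul_sum, inner_eq_sum_particle,
    inner_eq_sum_particle k y]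
  congr 3
  push_cast
  rw [Finset.sum_add_distrib, Finset.mul_sum, Finset.sum_div]

theorem joinConfig_zero (h : p ≤ N) (k : Config p) :
    joinConfig k (0 : Config (N - p)) =
      ∑ j, particleEmb (Fin.castLE h j) (particle k j) := by
  ext c
  rw [WithLp.ofLp_sum, Finset.sum_apply]
  simp only [particleEmb_apply, particle, joinConfig]
  split_ifs with hc
  · rw [Finset.sum_eq_single ⟨c.1.1, hc⟩]
    · simp
    · intro j _ hj
      rw [if_neg]
      intro h'
      apply hj
      ext
      simp [h']
    · simp
  · rw [Finset.sum_eq_zero]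
    · simp
    · intro j _
      rw [if_neg]
      intro h'
      apply hc
      rw [h']
      simp

theorem freeEvolution_oneWeyl_neg (s : ℝ) (z : Space × Space) (x : L2 (Fin 3)) :
    freeEvolution (-(ħ * s)) (oneWeyl ħ z x) =
      oneWeyl ħ (z.1, z.2 + s • z.1) (freeEvolution (-(ħ * s)) x) := by
  have := freeEvolution_weylOp ħ s z.1 z.2 (freeEvolution (-(ħ * s)) x)
  rwa [freeEvolution_apply_neg] at this

theorem freeEvolution_opProd (s : ℝ) (l : List (Fin N × (Space × Space)))
    (x : L2 (Fin N × Fin 3)) :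
    freeEvolution (-(ħ * s)) (opProd (particleWeyl N ħ) l x) =
      opProd (particleWeyl N ħ) (l.map fun q => (q.1, (q.2.1, q.2.2 + s • q.2.1)))
        (freeEvolution (-(ħ * s)) x) := by
  induction l generalizing x with
  | nil => rfl
  | cons q l ih =>
    have := freeEvolution_weylOp ħ s (particleEmb q.1 q.2.1) (particleEmb q.1 q.2.2)
      (freeEvolution (-(ħ * s)) x)
    rw [freeEvolution_apply_neg, ← map_smul, ← map_add] at this
    rw [opProd, ContinuousLinearMap.comp_apply, ih, List.map_cons, opProd,
      ContinuousLinearMap.comp_apply, particleWeyl, this, particleWeyl]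

theorem inner_freeEvolution_freeEvolution {ι : Type} [Fintype ι] (r : ℝ) (Ψ Φ : L2 ι) :
    inner ℂ (freeEvolution r Ψ) (freeEvolution r Φ) = inner ℂ Ψ Φ := by
  rw [inner_freeEvolution, freeEvolution_neg_apply]

variable {w : Space → ℝ} {a : Space → ℂ}

/-- Convergence of the reduced characteristic functions to those of the Hartree state. -/
theorem norm_inner_weylOp_sub_tensor_le (hħ : 0 < ħ) (hN : 0 < N) (hpN : p ≤ N) {T : ℝ}
    (hT : 0 ≤ T) (ha : HasCouplingMoment a T) (hsmall : T * couplingMoment a T ≤ 1 / 8)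
    (hr : ∀ κ, conj (a κ) = a κ) (he : ∀ κ, a (-κ) = a κ)
    (hwa : (fun x => (w x : ℂ)) =ᵐ[volume] 𝓕⁻ a) (hw : ∀ x, w (-x) = w x)
    {ψ : ℝ → L2 (Fin 3)} {Ψ : ℝ → L2 (Fin N × Fin 3)} (hψ : IsHartreeSolution ħ w ψ)
    (hψ1 : ‖ψ 0‖ = 1) (hΨ : IsNBodySolution ħ w N Ψ) (hprod : IsProductState (ψ 0) (Ψ 0))
    {t : ℝ} (ht : t ∈ Set.Icc 0 T) (k y : Config p) :
    ‖inner ℂ (Ψ t) (weylOp ħ (joinConfig k (0 : Config (N - p))) (joinConfig y 0) (Ψ t)) -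
        inner ℂ (tensor fun _ : Fin p => ψ t) (weylOp ħ k y (tensor fun _ : Fin p => ψ t))‖ ≤
      p ^ 3 * (18 + 412 * (T * couplingMoment a T) * (1 + (1 + T) * (‖k‖ + ‖y‖)) ^ 2) / N := by
  have hai : Integrable a :=
    (integrable_norm_iff ha.measurable).1 (ha.integrable_norm hT)
  set l : List (Fin N × (Space × Space)) := (List.finRange p).map fun j =>
    (Fin.castLE hpN j, (particle k j, particle y j)) with hl
  -- In the interaction picture the observables at time t are displaced by the free flow, y ↦ y +
  -- t·k, for both the N-body and the Hartree state.
  set l' : List (Fin N × (Space × Space)) := l.map fun q => (q.1, (q.2.1, q.2.2 + t • q.2.1)) with hl'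
  have hnod : (l.map Prod.fst).Nodup := by
    rw [hl, List.map_map]
    exact (List.nodup_finRange p).map (Fin.castLE_injective hpN)
  have hnod' : (l'.map Prod.fst).Nodup := by
    rw [hl', List.map_map]
    exact hnod
  have hsum : ∀ x : Config p, ((List.finRange p).map fun j =>
      particleEmb (Fin.castLE hpN j) (particle x j)).sum = joinConfig x (0 : Config (N - p)) :=
    fun x => by rw [joinConfig_zero hpN, ← List.ofFn_eq_map, List.sum_ofFn]
  have e1 : inner ℂ (Ψ t) (weylOp ħ (joinConfig k (0 : Config (N - p))) (joinConfig y 0) (Ψ t)) =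
      inner ℂ (freeEvolution (-(ħ * t)) (Ψ t))
        (opProd (particleWeyl N ħ) l' (freeEvolution (-(ħ * t)) (Ψ t))) := by
    rw [hl', ← freeEvolution_opProd, inner_freeEvolution_freeEvolution, opProd_particleWeyl l hnod,
      hl, List.map_map, List.map_map]
    simp only [Function.comp_def]
    rw [hsum, hsum]
  have e2 : inner ℂ (tensor fun _ : Fin p => ψ t) (weylOp ħ k y (tensor fun _ : Fin p => ψ t)) =
      (l'.map fun q => inner ℂ (freeEvolution (-(ħ * t)) (ψ t))
        (oneWeyl ħ q.2 (freeEvolution (-(ħ * t)) (ψ t)))).prod := by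
    rw [weylOp_tensor, inner_tensor, hl', hl, List.map_map, List.map_map, ← List.ofFn_eq_map,
      List.prod_ofFn]
    refine Finset.prod_congr rfl fun j _ => ?_
    simp only [Function.comp_apply]
    rw [← freeEvolution_oneWeyl_neg t (particle k j, particle y j),
      inner_freeEvolution_freeEvolution]
  rw [e1, e2]
  have hlen : l'.length = p := by rw [hl', hl, List.length_map, List.length_map, List.length_finRange]
  have hzero : ∀ {ι : Type} [Fintype ι] (x : L2 ι), freeEvolution (-(ħ * 0)) x = x := by
    intro ι _ x
    rw [mul_zero, neg_zero, freeEvolution_zero]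
  have key := (isManyBodyWeyl (N := N) (ħ := ħ) hψ1).norm_inner_opProd_sub_prod_le hħ hN hT ha
    hsmall hr he (f := fun s => freeEvolution (-(ħ * s)) (ψ s))
    (continuousOn_freeEvolution hψ.1) (hzero _) (fun s hs => hψ.hasDerivAt hħ hai hwa hs)
    (Φ := fun s => freeEvolution (-(ħ * s)) (Ψ s)) (continuousOn_freeEvolution hΨ.1)
    ((hzero _).trans hprod.eq_tensor) (fun s hs => hΨ.hasDerivAt hħ hN hai hr hwa hw hs) ht
    -- The bound ζ must dominate each displaced pair (k_j, y_j + t·k_j) with t ≤ T.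
    (ζ := (1 + T) * (‖k‖ + ‖y‖)) (by positivity) l' hnod' (fun q hq => by
      rw [hl', hl, List.map_map, List.mem_map] at hq
      obtain ⟨j, -, rfl⟩ := hq
      simp only [Function.comp_apply]
      have hk := norm_particle_le k j
      have hy := norm_particle_le y j
      have h1 : ‖particle y j + t • particle k j‖ ≤ ‖y‖ + T * ‖k‖ := by
        refine (norm_add_le _ _).trans (add_le_add hy ?_)
        rw [norm_smul, Real.norm_of_nonneg ht.1]
        exact mul_le_mul ht.2 hk (norm_nonneg _) hT
      have hT' := mul_nonneg hT (norm_nonneg y)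
      have hT'' := mul_nonneg hT (norm_nonneg k)
      refine max_le (hk.trans ?_) (h1.trans ?_) <;>
        nlinarith [norm_nonneg k, norm_nonneg y])
  rw [hlen] at key
  exact key

end WeylConvergence

/-! ### Wigner functions paired with superpositions of plane waves -/

section WignerPairing

variable {ι : Type} [Fintype ι] {ħ : ℝ}

/-- The off-diagonal density `Ψ(x + ħy/2) conj(Ψ(x - ħy/2))`. -/
def offDiag (ħ : ℝ) (Ψ : L2 ι) (x y : EuclideanSpace ℝ ι) : ℂ :=
  Ψ (x + (ħ / 2) • y) * conj (Ψ (x - (ħ / 2) • y))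

theorem measurable_offDiag (Ψ : L2 ι) {X : Type*} [MeasurableSpace X]
    {f g : X → EuclideanSpace ℝ ι} (hf : Measurable f) (hg : Measurable g) :
    Measurable fun x => offDiag ħ Ψ (f x) (g x) := by
  have hΨ : Measurable Ψ := (Lp.stronglyMeasurable Ψ).measurable
  unfold offDiag
  exact (hΨ.comp (by fun_prop)).mul (Complex.continuous_conj.measurable.comp
    (hΨ.comp (by fun_prop)))

theorem norm_offDiag_le (Ψ : L2 ι) (x y : EuclideanSpace ℝ ι) :
    ‖offDiag ħ Ψ x y‖ ≤ ‖Ψ (x + (ħ / 2) • y)‖ ^ 2 / 2 + ‖Ψ (x + (-(ħ / 2)) • y)‖ ^ 2 / 2 := by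
  rw [offDiag, norm_mul, RCLike.norm_conj, neg_smul, ← sub_eq_add_neg]
  nlinarith [sq_nonneg (‖Ψ (x + (ħ / 2) • y)‖ - ‖Ψ (x - (ħ / 2) • y)‖)]

theorem integrable_norm_sq (Ψ : L2 ι) : Integrable fun x => ‖Ψ x‖ ^ 2 :=
  (memLp_two_iff_integrable_sq_norm (Lp.aestronglyMeasurable Ψ)).1 (Lp.memLp Ψ)

theorem integrable_norm_sq_affine (Ψ : L2 ι) (x : EuclideanSpace ℝ ι) {c : ℝ} (hc : c ≠ 0) :
    Integrable fun y => ‖Ψ (x + c • y)‖ ^ 2 :=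
  ((integrable_norm_sq Ψ).comp_add_left x).comp_smul hc

theorem integral_norm_sq_affine (Ψ : L2 ι) (x : EuclideanSpace ℝ ι) (c : ℝ) :
    ∫ y, ‖Ψ (x + c • y)‖ ^ 2 = |(c ^ Fintype.card ι)⁻¹| * ‖Ψ‖ ^ 2 := by
  rw [Measure.integral_comp_smul volume (fun y => ‖Ψ (x + y)‖ ^ 2),
    integral_add_left_eq_self (fun y => ‖Ψ y‖ ^ 2) x, ← L2_norm_sq, finrank_euclideanSpace,
    smul_eq_mul]

theorem integrable_offDiag_right (hħ : 0 < ħ) (Ψ : L2 ι) (x : EuclideanSpace ℝ ι) :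
    Integrable fun y => offDiag ħ Ψ x y :=
  (((integrable_norm_sq_affine Ψ x (half_pos hħ).ne').div_const 2).add
    ((integrable_norm_sq_affine Ψ x (neg_ne_zero.2 (half_pos hħ).ne')).div_const 2)).mono'
    (measurable_offDiag Ψ measurable_const measurable_id).aestronglyMeasurable
    (ae_of_all _ (norm_offDiag_le Ψ x))

/-- The negative power of ħ serves only for absolute convergence in Fubini's theorem and does not
reach the final estimate. -/
theorem integral_norm_offDiag_right_le (hħ : 0 < ħ) (Ψ : L2 ι) (x : EuclideanSpace ℝ ι) :
    ∫ y, ‖offDiag ħ Ψ x y‖ ≤ |((ħ / 2) ^ Fintype.card ι)⁻¹| * ‖Ψ‖ ^ 2 := by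
  have i1 := (integrable_norm_sq_affine Ψ x (half_pos hħ).ne').div_const 2
  have i2 := (integrable_norm_sq_affine Ψ x (neg_ne_zero.2 (half_pos hħ).ne')).div_const 2
  refine (integral_mono (integrable_offDiag_right hħ Ψ x).norm (i1.add i2)
    (norm_offDiag_le Ψ x)).trans (le_of_eq ?_)
  simp only [Pi.add_apply]
  rw [integral_add i1 i2, integral_div, integral_div, integral_norm_sq_affine,
    integral_norm_sq_affine]
  simp only [abs_inv, abs_pow, abs_neg]
  ring

theorem integrable_offDiag_left (Ψ : L2 ι) (y : EuclideanSpace ℝ ι) :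
    Integrable fun x => offDiag ħ Ψ x y :=
  ((((integrable_norm_sq Ψ).comp_add_right ((ħ / 2) • y)).div_const 2).add
    (((integrable_norm_sq Ψ).comp_add_right ((-(ħ / 2)) • y)).div_const 2)).mono'
    (measurable_offDiag Ψ measurable_id measurable_const).aestronglyMeasurable
    (ae_of_all _ fun x => norm_offDiag_le Ψ x y)

theorem integral_norm_offDiag_left_le (Ψ : L2 ι) (y : EuclideanSpace ℝ ι) :
    ∫ x, ‖offDiag ħ Ψ x y‖ ≤ ‖Ψ‖ ^ 2 := by
  have i1 := ((integrable_norm_sq Ψ).comp_add_right ((ħ / 2) • y)).div_const 2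
  have i2 := ((integrable_norm_sq Ψ).comp_add_right ((-(ħ / 2)) • y)).div_const 2
  refine (integral_mono (integrable_offDiag_left Ψ y).norm (i1.add i2)
    (fun x => norm_offDiag_le Ψ x y)).trans (le_of_eq ?_)
  simp only [Pi.add_apply]
  rw [integral_add i1 i2, integral_div, integral_div,
    integral_add_right_eq_self (fun x => ‖Ψ x‖ ^ 2),
    integral_add_right_eq_self (fun x => ‖Ψ x‖ ^ 2), ← L2_norm_sq]
  ring

/-- The shift of x by ħy/2 makes the two arguments symmetric and absorbs the phase ħ⟨k, y⟩/2 of the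
Weyl operator. -/
theorem inner_weylOp_eq_integral (Ψ : L2 ι) (k y : EuclideanSpace ℝ ι) :
    inner ℂ Ψ (weylOp ħ k y Ψ) =
      ∫ x, Complex.exp (Complex.I * (inner ℝ k x : ℝ)) * offDiag ħ Ψ x y := by
  rw [L2_inner_eq, ← integral_sub_right_eq_self _ ((ħ / 2) • y)]
  have h := (measurePreserving_sub_right volume ((ħ / 2) • y)).quasiMeasurePreserving.ae
    (weylOp_ae (ħ := ħ) k y Ψ)
  refine integral_congr_ae (h.mono fun x hx => ?_)
  simp only [hx, offDiag]
  have e1 : x - (ħ / 2) • y + ħ • y = x + (ħ / 2) • y := by module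
  rw [e1, inner_sub_right, inner_smul_right]
  have e2 : inner ℝ k x - ħ / 2 * inner ℝ k y + ħ * inner ℝ k y / 2 = inner ℝ k x := by ring
  rw [e2]
  ring

theorem wigner_eq (Ψ : L2 ι) (x ξ : EuclideanSpace ℝ ι) :
    wigner ħ Ψ x ξ = (((2 * Real.pi) ^ Fintype.card ι : ℝ) : ℂ)⁻¹ *
      ∫ y, Complex.exp (Complex.I * (inner ℝ y ξ : ℝ)) * offDiag ħ Ψ x y := by
  simp only [wigner, offDiag, mul_assoc]

theorem norm_cexp_I_mul (r : ℝ) : ‖Complex.exp (Complex.I * r)‖ = 1 := by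
  rw [mul_comm, Complex.norm_exp_ofReal_mul_I]

/-- The plane wave with frequency `q` on phase space. -/
def phaseWave (q z : EuclideanSpace ℝ ι × EuclideanSpace ℝ ι) : ℂ :=
  Complex.exp (Complex.I * (2 * Real.pi * (inner ℝ q.1 z.1 + inner ℝ q.2 z.2) : ℝ))

/-- Fubini turns the ξ-integral into a Fourier transform of f, which recovers h almost everywhere;
the substitution y = -2πη supplies the power of 2π that the Wigner function divides by. -/
theorem integral_cexp_mul_offDiag_mul (hħ : 0 < ħ) (Ψ : L2 ι) (x : EuclideanSpace ℝ ι)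
    {h f : EuclideanSpace ℝ ι → ℂ} (hh : Integrable h) (hf : Integrable f)
    (hfh : ∀ ξ, f ξ = 𝓕⁻ h ξ) :
    ∫ ξ, (∫ y, Complex.exp (Complex.I * (inner ℝ y ξ : ℝ)) * offDiag ħ Ψ x y) * f ξ =
      (((2 * Real.pi) ^ Fintype.card ι : ℝ) : ℂ) *
        ∫ η, offDiag ħ Ψ x ((-(2 * Real.pi)) • η) * h η := by
  have hinv : h =ᵐ[volume] 𝓕 f := by
    have e : f = fun ξ => 𝓕 h (-ξ) := by
      funext ξ
      rw [hfh, Real.fourierInv_eq_fourier_neg]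
    have hF : Integrable (𝓕 h) := by
      have := hf.comp_neg
      simpa [e] using this
    have h1 := fourierInv_fourier_ae_eq hh hF
    refine h1.trans (ae_of_all _ fun η => ?_)
    rw [Real.fourierInv_eq_fourier_comp_neg, e]
  have hi : Integrable (Function.uncurry fun ξ y =>
      Complex.exp (Complex.I * (inner ℝ y ξ : ℝ)) * offDiag ħ Ψ x y * f ξ) := by
    have h1 := hf.mul_prod (integrable_offDiag_right hħ Ψ x)
    have hce : Continuous fun z : EuclideanSpace ℝ ι × EuclideanSpace ℝ ι =>
        Complex.exp (Complex.I * (inner ℝ z.2 z.1 : ℝ)) := by fun_prop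
    refine h1.norm.mono' ((hce.aestronglyMeasurable.mul h1.aestronglyMeasurable).congr
      (ae_of_all _ fun z => ?_)) (ae_of_all _ fun z => ?_)
    · simp only [Pi.mul_apply, Function.uncurry]; ring
    · simp only [Function.uncurry]
      rw [norm_mul, norm_mul, norm_cexp_I_mul, one_mul, norm_mul, mul_comm]
  simp only [← integral_mul_const]
  rw [integral_integral_swap hi]
  have e1 : ∀ y, ∫ ξ, Complex.exp (Complex.I * (inner ℝ y ξ : ℝ)) * offDiag ħ Ψ x y * f ξ =
      offDiag ħ Ψ x y * 𝓕 f (-(2 * Real.pi)⁻¹ • y) := by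
    intro y
    rw [Real.fourier_eq', ← integral_const_mul]
    refine integral_congr_ae (ae_of_all _ fun ξ => ?_)
    have hp : Real.pi ≠ 0 := Real.pi_ne_zero
    have : -2 * Real.pi * inner ℝ ξ (-(2 * Real.pi)⁻¹ • y) = inner ℝ y ξ := by
      rw [inner_smul_right, real_inner_comm y ξ]
      field_simp
    simp only [this, smul_eq_mul]
    rw [mul_comm Complex.I]
    ring
  simp only [e1]
  have hs := Measure.integral_comp_smul volume
    (fun y => offDiag ħ Ψ x y * 𝓕 f (-(2 * Real.pi)⁻¹ • y)) (-(2 * Real.pi))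
  have hp : (2 * Real.pi) ≠ 0 := by positivity
  have hn : ∀ η : EuclideanSpace ℝ ι, -(2 * Real.pi)⁻¹ • (-(2 * Real.pi)) • η = η := fun η => by
    rw [smul_smul, neg_mul_neg, inv_mul_cancel₀ hp, one_smul]
  simp only [hn, finrank_euclideanSpace] at hs
  have h2 : ∫ η, offDiag ħ Ψ x ((-(2 * Real.pi)) • η) * h η =
      ∫ η, offDiag ħ Ψ x ((-(2 * Real.pi)) • η) * 𝓕 f η :=
    integral_congr_ae (hinv.mono fun η hη => by simp only [hη])
  rw [h2, hs, abs_inv, abs_pow, abs_neg, abs_of_pos (by positivity : 0 < 2 * Real.pi),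
    Complex.real_smul, ← mul_assoc, Complex.ofReal_inv, mul_inv_cancel₀, one_mul]
  exact_mod_cast (pow_ne_zero _ hp)

theorem measurable_offDiag_uncurry (Ψ : L2 ι) (r : ℝ) {X : Type*} [MeasurableSpace X]
    {f g : X → EuclideanSpace ℝ ι} (hf : Measurable f) (hg : Measurable g) :
    Measurable fun x => offDiag ħ Ψ (f x) (r • g x) :=
  measurable_offDiag Ψ hf (hg.const_smul r)

theorem integrable_mul_cexp {G : EuclideanSpace ℝ ι × EuclideanSpace ℝ ι → ℂ} (hG : Integrable G)
    {r : EuclideanSpace ℝ ι × EuclideanSpace ℝ ι → ℝ} (hr : Continuous r) :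
    Integrable fun q => G q * Complex.exp (Complex.I * r q) := by
  have hce : Continuous fun q => Complex.exp (Complex.I * r q) := by fun_prop
  refine hG.norm.mono' (hG.aestronglyMeasurable.mul hce.aestronglyMeasurable)
    (ae_of_all _ fun q => ?_)
  rw [norm_mul, norm_cexp_I_mul, mul_one]

theorem integral_mul_phaseWave {G : EuclideanSpace ℝ ι × EuclideanSpace ℝ ι → ℂ}
    (hG : Integrable G) (x ξ : EuclideanSpace ℝ ι) :
    ∫ q, G q * phaseWave q (x, ξ) = 𝓕⁻ (fun η => ∫ κ, G (κ, η) *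
      Complex.exp (Complex.I * (inner ℝ ((2 * Real.pi) • κ) x : ℝ))) ξ := by
  have hgz : Integrable fun q => G q * phaseWave q (x, ξ) :=
    integrable_mul_cexp hG (by fun_prop)
  rw [Real.fourierInv_eq']
  refine (integral_prod_symm (fun q => G q * phaseWave q (x, ξ)) hgz).trans
    (integral_congr_ae (ae_of_all _ fun η => ?_))
  simp only [smul_eq_mul, ← integral_const_mul]
  refine integral_congr_ae (ae_of_all _ fun κ => ?_)
  simp only [phaseWave]
  rw [mul_left_comm, ← Complex.exp_add]
  congr 2
  simp only [real_inner_smul_left]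
  push_cast
  ring

/-- The Weyl transform: the pairing of a Wigner function with a superposition of plane waves. -/
theorem integral_wigner_mul (hħ : 0 < ħ) (Ψ : L2 ι)
    {G Φ : EuclideanSpace ℝ ι × EuclideanSpace ℝ ι → ℂ} (hG : Integrable G) (hΦ : Integrable Φ)
    (hGΦ : ∀ z, Φ z = ∫ q, G q * phaseWave q z) :
    ∫ z, wigner ħ Ψ z.1 z.2 * Φ z =
      ∫ q, G q * inner ℂ Ψ (weylOp ħ ((2 * Real.pi) • q.1) ((-(2 * Real.pi)) • q.2) Ψ) := by
  set c : ℂ := (((2 * Real.pi) ^ Fintype.card ι : ℝ) : ℂ) with hc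
  have hc0 : c ≠ 0 := by
    rw [hc]
    exact_mod_cast pow_ne_zero _ (by positivity : (2 * Real.pi) ≠ 0)
  set M : ℝ := |((ħ / 2) ^ Fintype.card ι)⁻¹| * ‖Ψ‖ ^ 2 with hM
  have hi1 : Integrable (fun z : EuclideanSpace ℝ ι × EuclideanSpace ℝ ι =>
      (∫ y, Complex.exp (Complex.I * (inner ℝ y z.2 : ℝ)) * offDiag ħ Ψ z.1 y) * Φ z) := by
    have hmeas : AEStronglyMeasurable (fun z : EuclideanSpace ℝ ι × EuclideanSpace ℝ ι =>
        ∫ y, Complex.exp (Complex.I * (inner ℝ y z.2 : ℝ)) * offDiag ħ Ψ z.1 y) volume := by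
      have hm : StronglyMeasurable (Function.uncurry fun
          (z : EuclideanSpace ℝ ι × EuclideanSpace ℝ ι) (y : EuclideanSpace ℝ ι) =>
          Complex.exp (Complex.I * (inner ℝ y z.2 : ℝ)) * offDiag ħ Ψ z.1 y) := by
        have hce : Continuous fun w : (EuclideanSpace ℝ ι × EuclideanSpace ℝ ι) ×
            EuclideanSpace ℝ ι => Complex.exp (Complex.I * (inner ℝ w.2 w.1.2 : ℝ)) := by fun_prop
        exact (hce.measurable.mul (measurable_offDiag Ψ measurable_fst.fst
          measurable_snd)).stronglyMeasurable
      exact hm.integral_prod_right.aestronglyMeasurable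
    refine (hΦ.norm.const_mul M).mono' (hmeas.mul hΦ.aestronglyMeasurable)
      (ae_of_all _ fun z => ?_)
    rw [norm_mul]
    refine mul_le_mul_of_nonneg_right ?_ (norm_nonneg _)
    refine (norm_integral_le_integral_norm _).trans ?_
    simp only [norm_mul, norm_cexp_I_mul, one_mul]
    exact integral_norm_offDiag_right_le hħ Ψ z.1
  have hK : Integrable (Function.uncurry fun (x : EuclideanSpace ℝ ι)
      (q : EuclideanSpace ℝ ι × EuclideanSpace ℝ ι) =>
      G q * (Complex.exp (Complex.I * (inner ℝ ((2 * Real.pi) • q.1) x : ℝ)) *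
        offDiag ħ Ψ x ((-(2 * Real.pi)) • q.2))) := by
    have hce : Continuous fun w : EuclideanSpace ℝ ι × (EuclideanSpace ℝ ι × EuclideanSpace ℝ ι) =>
        Complex.exp (Complex.I * (inner ℝ ((2 * Real.pi) • w.2.1) w.1 : ℝ)) := by fun_prop
    have hm : AEStronglyMeasurable (Function.uncurry fun (x : EuclideanSpace ℝ ι)
        (q : EuclideanSpace ℝ ι × EuclideanSpace ℝ ι) =>
        G q * (Complex.exp (Complex.I * (inner ℝ ((2 * Real.pi) • q.1) x : ℝ)) *
          offDiag ħ Ψ x ((-(2 * Real.pi)) • q.2)))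
        ((volume : Measure (EuclideanSpace ℝ ι)).prod volume) :=
      hG.aestronglyMeasurable.comp_snd.mul (hce.measurable.mul (measurable_offDiag_uncurry Ψ _
        measurable_fst measurable_snd.snd)).aestronglyMeasurable
    have hn : ∀ q : EuclideanSpace ℝ ι × EuclideanSpace ℝ ι, Integrable fun x =>
        Complex.exp (Complex.I * (inner ℝ ((2 * Real.pi) • q.1) x : ℝ)) *
          offDiag ħ Ψ x ((-(2 * Real.pi)) • q.2) := fun q => by
      have hce' : Continuous fun x =>
        Complex.exp (Complex.I * (inner ℝ ((2 * Real.pi) • q.1) x : ℝ)) := by fun_prop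
      have h1 := integrable_offDiag_left (ħ := ħ) Ψ ((-(2 * Real.pi)) • q.2)
      refine h1.norm.mono' (hce'.aestronglyMeasurable.mul h1.aestronglyMeasurable)
        (ae_of_all _ fun x => ?_)
      rw [norm_mul, norm_cexp_I_mul, one_mul]
    refine (integrable_prod_iff' hm).2 ⟨ae_of_all _ fun q => (hn q).const_mul (G q), ?_⟩
    refine (hG.norm.mul_const (‖Ψ‖ ^ 2)).mono' hm.norm.prod_swap.integral_prod_right'
      (ae_of_all _ fun q => ?_)
    simp only [Function.uncurry]
    rw [Real.norm_of_nonneg (integral_nonneg fun x => norm_nonneg _)]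
    simp only [norm_mul, norm_cexp_I_mul, one_mul]
    rw [integral_const_mul]
    exact mul_le_mul_of_nonneg_left (integral_norm_offDiag_left_le Ψ _) (norm_nonneg _)
  have e1 : ∫ z : EuclideanSpace ℝ ι × EuclideanSpace ℝ ι, wigner ħ Ψ z.1 z.2 * Φ z =
      c⁻¹ * ∫ x, ∫ ξ, (∫ y, Complex.exp (Complex.I * (inner ℝ y ξ : ℝ)) * offDiag ħ Ψ x y) *
        Φ (x, ξ) := by
    simp only [wigner_eq, mul_assoc]
    rw [integral_const_mul, ← hc]
    congr 1
    exact integral_prod _ hi1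
  -- For fixed x this is Fourier inversion in the momentum variable. The slices of Φ and of the
  -- kernel are integrable only for almost every x.
  have e2 : ∀ᵐ x, ∫ ξ, (∫ y, Complex.exp (Complex.I * (inner ℝ y ξ : ℝ)) * offDiag ħ Ψ x y) *
      Φ (x, ξ) = c * ∫ q : EuclideanSpace ℝ ι × EuclideanSpace ℝ ι,
        G q * (Complex.exp (Complex.I * (inner ℝ ((2 * Real.pi) • q.1) x : ℝ)) *
          offDiag ħ Ψ x ((-(2 * Real.pi)) • q.2)) := by
    filter_upwards [hΦ.prod_right_ae, hK.prod_right_ae] with x hx1 hx2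
    have hgx : Integrable fun q : EuclideanSpace ℝ ι × EuclideanSpace ℝ ι =>
        G q * Complex.exp (Complex.I * (inner ℝ ((2 * Real.pi) • q.1) x : ℝ)) :=
      integrable_mul_cexp hG (by fun_prop)
    have hh : Integrable fun η => ∫ κ, G (κ, η) *
        Complex.exp (Complex.I * (inner ℝ ((2 * Real.pi) • κ) x : ℝ)) := hgx.integral_prod_right
    rw [integral_cexp_mul_offDiag_mul hħ Ψ x hh hx1 fun ξ => by
      rw [hGΦ, integral_mul_phaseWave hG], ← hc]
    congr 1
    refine Eq.trans ?_ (integral_prod_symm (fun q : EuclideanSpace ℝ ι × EuclideanSpace ℝ ι =>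
      G q * (Complex.exp (Complex.I * (inner ℝ ((2 * Real.pi) • q.1) x : ℝ)) *
        offDiag ħ Ψ x ((-(2 * Real.pi)) • q.2))) hx2).symm
    refine integral_congr_ae (ae_of_all _ fun η => ?_)
    simp only [← integral_const_mul]
    refine integral_congr_ae (ae_of_all _ fun κ => ?_)
    simp only
    ring
  rw [e1, integral_congr_ae e2, integral_const_mul, ← mul_assoc, inv_mul_cancel₀ hc0, one_mul,
    integral_integral_swap hK]
  refine integral_congr_ae (ae_of_all _ fun q => ?_)
  simp only
  rw [integral_const_mul, inner_weylOp_eq_integral]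

end WignerPairing

/-! ### Fourier transform on phase space and Schwartz norms -/

section PhaseFourier

variable {ι : Type} [Fintype ι]

instance : (volume : Measure (EuclideanSpace ℝ ι × EuclideanSpace ℝ ι)).IsAddHaarMeasure :=
  inferInstanceAs (Measure.IsAddHaarMeasure
    ((volume : Measure (EuclideanSpace ℝ ι)).prod (volume : Measure (EuclideanSpace ℝ ι))))

/-- The Fourier transform of Schwartz functions on phase space. -/
def phaseFourier (ι : Type) [Fintype ι] :
    𝓢(EuclideanSpace ℝ ι × EuclideanSpace ℝ ι, ℂ) →L[ℂ]
      𝓢(EuclideanSpace ℝ ι × EuclideanSpace ℝ ι, ℂ) :=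
  (SchwartzMap.compCLMOfContinuousLinearEquiv ℂ (WithLp.prodContinuousLinearEquiv 2 ℝ
    (EuclideanSpace ℝ ι) (EuclideanSpace ℝ ι)).symm).comp
    ((FourierTransform.fourierCLM ℂ 𝓢(WithLp 2 (EuclideanSpace ℝ ι × EuclideanSpace ℝ ι), ℂ)).comp
      (SchwartzMap.compCLMOfContinuousLinearEquiv ℂ (WithLp.prodContinuousLinearEquiv 2 ℝ
        (EuclideanSpace ℝ ι) (EuclideanSpace ℝ ι))))

theorem integral_phaseFourier_mul_phaseWave
    (φ : 𝓢(EuclideanSpace ℝ ι × EuclideanSpace ℝ ι, ℂ))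
    (z : EuclideanSpace ℝ ι × EuclideanSpace ℝ ι) :
    ∫ q, phaseFourier ι φ q * phaseWave q z = φ z := by
  set e := WithLp.prodContinuousLinearEquiv 2 ℝ (EuclideanSpace ℝ ι) (EuclideanSpace ℝ ι) with he
  set f := SchwartzMap.compCLMOfContinuousLinearEquiv ℂ e φ with hf
  have h1 : φ z = 𝓕⁻ (⇑(𝓕 f : 𝓢(WithLp 2 (EuclideanSpace ℝ ι × EuclideanSpace ℝ ι), ℂ))) (WithLp.toLp 2 z) := by
    rw [← SchwartzMap.fourierInv_coe, FourierTransform.fourierInv_fourier_eq, hf]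
    rfl
  rw [h1, Real.fourierInv_eq', ← (WithLp.volume_preserving_toLp (EuclideanSpace ℝ ι)
    (EuclideanSpace ℝ ι)).integral_comp (MeasurableEquiv.toLp 2 _).measurableEmbedding]
  refine integral_congr_ae (ae_of_all _ fun q => ?_)
  simp only [phaseWave, WithLp.prod_inner_apply, smul_eq_mul]
  rw [mul_comm, mul_comm Complex.I]
  rfl

/-- The Schwartz norm of the theorem comes from here. The weight 1 + |q|² is the growth of the chaos
estimate in the frequencies, and the Fourier transform is continuous on Schwartz space. -/
theorem exists_integral_phaseFourier_le (p : ℕ) : ∃ (C : ℝ) (k n : ℕ), 0 < C ∧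
    ∀ φ : 𝓢(Phase p, ℂ),
      ∫ q, (1 + ‖q‖ ^ 2) * ‖phaseFourier (Fin p × Fin 3) φ q‖ ≤ C * schwartzNorm k n φ := by
  set P := (volume : Measure (Phase p)).integrablePower with hP
  set M : ℝ := 2 ^ P * ∫ x : Phase p, (1 + ‖x‖) ^ (-(P : ℝ)) with hM
  have hM0 : 0 ≤ M := by
    refine mul_nonneg (by positivity) (integral_nonneg fun x => ?_)
    positivity
  set S : Seminorm ℂ 𝓢(Phase p, ℂ) :=
    (SchwartzMap.seminorm ℂ 0 0 + SchwartzMap.seminorm ℂ (0 + P) 0 +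
      (SchwartzMap.seminorm ℂ 0 0 + SchwartzMap.seminorm ℂ (2 + P) 0)).comp
      (phaseFourier (Fin p × Fin 3)).toLinearMap with hS
  have hc : ∀ k, Continuous (SchwartzMap.seminorm ℂ k 0 : Seminorm ℂ 𝓢(Phase p, ℂ)) := fun k =>
    (schwartz_withSeminorms ℂ (Phase p) ℂ).continuous_seminorm (k, 0)
  have hScont : Continuous S := by
    have : Continuous fun f : 𝓢(Phase p, ℂ) =>
      SchwartzMap.seminorm ℂ 0 0 f + SchwartzMap.seminorm ℂ (0 + P) 0 f +
      (SchwartzMap.seminorm ℂ 0 0 f + SchwartzMap.seminorm ℂ (2 + P) 0 f) :=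
      ((hc 0).add (hc _)).add ((hc 0).add (hc _))
    exact this.comp (phaseFourier (Fin p × Fin 3)).continuous
  obtain ⟨s, C, -, hsC⟩ := Seminorm.bound_of_continuous
    (schwartz_withSeminorms ℂ (Phase p) ℂ) S hScont
  -- The finitely many seminorms given by continuity are all among those with indices at most (k,
  -- n).
  set k := s.sup Prod.fst with hk
  set n := s.sup Prod.snd with hn
  have hsub : s ⊆ Finset.Iic (k, n) := fun i hi => Finset.mem_Iic.2
    ⟨Finset.le_sup (f := Prod.fst) hi, Finset.le_sup (f := Prod.snd) hi⟩
  refine ⟨M * C + 1, k, n, by positivity, fun φ => ?_⟩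
  set g := phaseFourier (Fin p × Fin 3) φ with hg
  have h0 := g.integral_pow_mul_iteratedFDeriv_le (μ := volume) ℂ 0 0
  have h2 := g.integral_pow_mul_iteratedFDeriv_le (μ := volume) ℂ 2 0
  simp only [norm_iteratedFDeriv_zero, pow_zero, one_mul] at h0 h2
  have i0 : Integrable fun q => ‖g q‖ := g.integrable.norm
  have i2 : Integrable fun q => ‖q‖ ^ 2 * ‖g q‖ := g.integrable_pow_mul volume 2
  have e : ∫ q, (1 + ‖q‖ ^ 2) * ‖g q‖ = (∫ q, ‖g q‖) + ∫ q, ‖q‖ ^ 2 * ‖g q‖ := by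
    rw [← integral_add i0 i2]
    exact integral_congr_ae (ae_of_all _ fun q => by simp only; ring)
  have hSle : S φ ≤ C * schwartzNorm k n φ := by
    refine (hsC φ).trans ?_
    rw [_root_.smul_apply, NNReal.smul_def, smul_eq_mul, schwartzNorm]
    exact mul_le_mul_of_nonneg_left (Finset.sup_mono (f := schwartzSeminormFamily ℂ (Phase p) ℂ) hsub φ) C.2
  have hs0 : 0 ≤ schwartzNorm k n φ := apply_nonneg _ _
  have hSv : S φ = SchwartzMap.seminorm ℂ 0 0 g + SchwartzMap.seminorm ℂ (0 + P) 0 g +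
      (SchwartzMap.seminorm ℂ 0 0 g + SchwartzMap.seminorm ℂ (2 + P) 0 g) := rfl
  rw [e]
  calc _ ≤ M * S φ := by rw [hSv, mul_add]; exact add_le_add h0 h2
    _ ≤ M * (C * schwartzNorm k n φ) := mul_le_mul_of_nonneg_left hSle hM0
    _ ≤ (M * C + 1) * schwartzNorm k n φ := by nlinarith

/-- The Fourier transform of the Wigner function. -/
def wignerHat (ħ : ℝ) (Ψ : L2 ι) (q : EuclideanSpace ℝ ι × EuclideanSpace ℝ ι) : ℂ :=
  inner ℂ Ψ (weylOp ħ ((2 * Real.pi) • q.1) ((-(2 * Real.pi)) • q.2) Ψ)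

theorem continuous_wignerHat (ħ : ℝ) (Ψ : L2 ι) : Continuous (wignerHat ħ Ψ) :=
  continuous_const.inner (continuous_weylOp (by fun_prop) (by fun_prop) Ψ)

theorem norm_wignerHat_le (ħ : ℝ) (Ψ : L2 ι) (q : EuclideanSpace ℝ ι × EuclideanSpace ℝ ι) :
    ‖wignerHat ħ Ψ q‖ ≤ ‖Ψ‖ ^ 2 := by
  refine (norm_inner_le_norm _ _).trans (le_of_eq ?_)
  rw [norm_weylOp, sq]

/-- The tempered distribution whose Fourier transform is a bounded continuous function. -/
theorem exists_temperedDistribution {p : ℕ} {B : Phase p → ℂ} (hB : Continuous B) {M : ℝ}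
    (hM : ∀ q, ‖B q‖ ≤ M) :
    ∃ T : 𝓢'(Phase p, ℂ), ∀ φ, T φ = ∫ q, phaseFourier (Fin p × Fin 3) φ q * B q := by
  have hM0 : 0 ≤ M := (norm_nonneg _).trans (hM 0)
  have hi : ∀ φ : 𝓢(Phase p, ℂ), Integrable fun q => phaseFourier (Fin p × Fin 3) φ q * B q :=
    fun φ => (phaseFourier (Fin p × Fin 3) φ).integrable.mul_bdd hB.aestronglyMeasurable
      (ae_of_all _ hM)
  obtain ⟨C, k, n, hC, hle⟩ := exists_integral_phaseFourier_le p
  refine ⟨ContinuousLinearMap.toPointwiseConvergenceCLM ℂ (RingHom.id ℂ) _ _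
    (SchwartzMap.mkCLMtoNormedSpace (𝕜 := ℂ) (σ := RingHom.id ℂ)
      (fun φ : 𝓢(Phase p, ℂ) => ∫ q, phaseFourier (Fin p × Fin 3) φ q * B q)
      (fun f g => ?_) (fun c f => ?_) ⟨Finset.Iic (k, n), M * C, by positivity, fun φ => ?_⟩),
      fun φ => rfl⟩
  · rw [← integral_add (hi f) (hi g)]
    refine integral_congr_ae (ae_of_all _ fun q => ?_)
    simp only [map_add, _root_.add_apply, add_mul]
  · rw [smul_eq_mul, ← integral_const_mul]
    refine integral_congr_ae (ae_of_all _ fun q => ?_)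
    simp only [map_smul, _root_.smul_apply, smul_eq_mul, RingHom.id_apply, mul_assoc]
  · set g := phaseFourier (Fin p × Fin 3) φ with hg
    have i0 : Integrable fun q => ‖g q‖ := g.integrable.norm
    have i2 : Integrable fun q => ‖q‖ ^ 2 * ‖g q‖ := g.integrable_pow_mul volume 2
    have i : Integrable fun q => (1 + ‖q‖ ^ 2) * ‖g q‖ :=
      (i0.add i2).congr (ae_of_all _ fun q => by simp only [Pi.add_apply]; ring)
    calc _ ≤ ∫ q, ‖g q * B q‖ := norm_integral_le_integral_norm _
      _ ≤ ∫ q, M * ((1 + ‖q‖ ^ 2) * ‖g q‖) := by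
        refine integral_mono (hi φ).norm (i.const_mul M) fun q => ?_
        simp only [norm_mul]
        have := hM q
        have h1 : 0 ≤ ‖q‖ ^ 2 * ‖g q‖ := by positivity
        nlinarith [mul_le_mul_of_nonneg_left this (norm_nonneg (g q)), mul_nonneg hM0 h1]
      _ ≤ M * (C * schwartzNorm k n φ) := by
        rw [integral_const_mul]
        exact mul_le_mul_of_nonneg_left (hle φ) hM0
      _ = _ := by rw [schwartzNorm]; ring

end PhaseFourier

/-! ### Marginals as restrictions of the Fourier transform -/

section Marginal

variable {p N : ℕ}

theorem inner_joinConfig (h : p ≤ N) (X X' : Config p) (Y Y' : Config (N - p)) :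
    inner ℝ (joinConfig X Y : Config N) (joinConfig X' Y') = inner ℝ X X' + inner ℝ Y Y' := by
  obtain ⟨m, rfl⟩ := Nat.exists_eq_add_of_le h
  rw [inner_eq_sum_particle, inner_eq_sum_particle, inner_eq_sum_particle Y, Fin.sum_univ_add]
  congr 1
  · refine Finset.sum_congr rfl fun i _ => ?_
    simp only [PiLp.inner_apply, particle, joinConfig, Fin.val_castAdd, Fin.is_lt, dite_true]
  · refine Fintype.sum_equiv (finCongr (Nat.add_sub_cancel_left (n := p) (m := m)).symm) _ _
      fun i => ?_
    simp [PiLp.inner_apply, particle, joinConfig]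
    rfl

/-- Joining configurations, as a linear isometry. -/
def joinIsometry (h : p ≤ N) : WithLp 2 (Config p × Config (N - p)) ≃ₗᵢ[ℝ] Config N :=
  LinearIsometry.toLinearIsometryEquiv
    (LinearMap.isometryOfInner
      { toFun := fun q => joinConfig q.fst q.snd
        map_add' := fun q q' => by
          ext c
          simp only [joinConfig, WithLp.add_fst, WithLp.add_snd, PiLp.add_apply]
          split_ifs <;> rfl
        map_smul' := fun r q => by
          ext c
          simp only [joinConfig, WithLp.smul_fst, WithLp.smul_snd, PiLp.smul_apply]
          split_ifs <;> rfl } fun q q' => inner_joinConfig h _ _ _ _)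
    (by
      rw [(WithLp.linearEquiv 2 ℝ (Config p × Config (N - p))).finrank_eq,
        Module.finrank_prod, finrank_euclideanSpace, finrank_euclideanSpace,
        finrank_euclideanSpace]
      simp only [Fintype.card_prod, Fintype.card_fin]
      omega)

/-- Joining configurations, as a measurable equivalence. -/
def joinEquiv (h : p ≤ N) : Config p × Config (N - p) ≃ᵐ Config N :=
  (MeasurableEquiv.toLp 2 _).trans (joinIsometry h).toHomeomorph.toMeasurableEquiv

theorem measurePreserving_joinEquiv (h : p ≤ N) : MeasurePreserving (joinEquiv h) :=
  (joinIsometry h).measurePreserving.comp (WithLp.volume_preserving_toLp _ _)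

theorem continuous_joinConfig (h : p ≤ N) :
    Continuous fun q : Config p × Config (N - p) => (joinConfig q.1 q.2 : Config N) :=
  (joinIsometry h).continuous.comp (WithLp.prod_continuous_toLp 2 _ _)

/-- The exchange of the two inner factors of a product of four spaces. -/
def MeasurableEquiv.prodProdProdComm (A B C D : Type*) [MeasurableSpace A] [MeasurableSpace B]
    [MeasurableSpace C] [MeasurableSpace D] : (A × B) × C × D ≃ᵐ (A × C) × B × D where
  toEquiv := Equiv.prodProdProdComm A B C D
  measurable_toFun := (measurable_fst.fst.prodMk measurable_snd.fst).prodMk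
    (measurable_fst.snd.prodMk measurable_snd.snd)
  measurable_invFun := (measurable_fst.fst.prodMk measurable_snd.fst).prodMk
    (measurable_fst.snd.prodMk measurable_snd.snd)

theorem measurePreserving_prodProdProdComm {A B C D : Type*} [MeasureSpace A] [MeasureSpace B]
    [MeasureSpace C] [MeasureSpace D] [SigmaFinite (volume : Measure A)]
    [SigmaFinite (volume : Measure B)] [SigmaFinite (volume : Measure C)]
    [SigmaFinite (volume : Measure D)] :
    MeasurePreserving (MeasurableEquiv.prodProdProdComm A B C D) := by
  have a := volume_preserving_prodAssoc (α₁ := A) (β₁ := B) (γ₁ := C × D)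
  have a' := volume_preserving_prodAssoc (α₁ := A) (β₁ := C) (γ₁ := B × D)
  have b := volume_preserving_prodAssoc (α₁ := B) (β₁ := C) (γ₁ := D)
  have b' := volume_preserving_prodAssoc (α₁ := C) (β₁ := B) (γ₁ := D)
  have s := (Measure.measurePreserving_swap (μ := (volume : Measure B))
    (ν := (volume : Measure C))).prod (MeasurePreserving.id (volume : Measure D))
  exact (a'.symm).comp (((MeasurePreserving.id (volume : Measure A)).prod
    (b'.comp (s.comp b.symm))).comp a)

/-- Joining points of phase space, as a measurable equivalence. -/
def joinPhaseEquiv (h : p ≤ N) : Phase p × Phase (N - p) ≃ᵐ Phase N :=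
  (MeasurableEquiv.prodProdProdComm _ _ _ _).trans ((joinEquiv h).prodCongr (joinEquiv h))

theorem joinPhaseEquiv_apply (h : p ≤ N) (q : Phase p × Phase (N - p)) :
    joinPhaseEquiv h q = (joinConfig q.1.1 q.2.1, joinConfig q.1.2 q.2.2) := rfl

theorem continuous_joinPhaseEquiv (h : p ≤ N) : Continuous (joinPhaseEquiv h) := by
  have hc := continuous_joinConfig h
  have h1 : Continuous fun q : Phase p × Phase (N - p) => (q.1.1, q.2.1) := by fun_prop
  have h2 : Continuous fun q : Phase p × Phase (N - p) => (q.1.2, q.2.2) := by fun_prop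
  exact (hc.comp h1).prodMk (hc.comp h2)

theorem measurePreserving_joinPhaseEquiv (h : p ≤ N) : MeasurePreserving (joinPhaseEquiv h) :=
  ((measurePreserving_joinEquiv h).prod (measurePreserving_joinEquiv h)).comp
    measurePreserving_prodProdProdComm

theorem phaseWave_joinPhaseEquiv (h : p ≤ N) (k z : Phase p × Phase (N - p)) :
    phaseWave (joinPhaseEquiv h k) (joinPhaseEquiv h z) =
      phaseWave k.1 z.1 * phaseWave k.2 z.2 := by
  simp only [phaseWave, joinPhaseEquiv_apply, inner_joinConfig h]
  rw [← Complex.exp_add]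
  congr 1
  push_cast
  ring

theorem integral_scaled_mul (m : ℕ) {f g : Phase m → ℂ} {R : ℝ} (hR : 0 < R) :
    ∫ u, ((R ^ Module.finrank ℝ (Phase m) : ℝ) : ℂ) * f (R • u) * g u =
      ∫ u, f u * g (R⁻¹ • u) := by
  have h := Measure.integral_comp_smul volume (fun u => f u * g (R⁻¹ • u)) R
  simp only [smul_smul, inv_mul_cancel₀ hR.ne', one_smul] at h
  simp only [mul_assoc]
  rw [integral_const_mul, h, abs_inv, abs_of_pos (pow_pos hR _), Complex.real_smul, ← mul_assoc,
    Complex.ofReal_inv, mul_inv_cancel₀, one_mul]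
  exact_mod_cast (pow_pos hR _).ne'

/-- The cutoff η(·/R) has a transform concentrated at scale 1/R. Rescaling the frequency variable
moves R into the argument of the bounded function `wignerHat`. -/
theorem integral_wigner_joinConfig (h : p ≤ N) {ħ : ℝ} (hħ : 0 < ħ) (Ψ : L2 (Fin N × Fin 3))
    (φ : 𝓢(Phase p, ℂ)) (η : 𝓢(Phase (N - p), ℂ)) {R : ℝ} (hR : 0 < R) :
    ∫ q : Phase p × Phase (N - p), wigner ħ Ψ (joinConfig q.1.1 q.2.1) (joinConfig q.1.2 q.2.2) *
      φ q.1 * η (R⁻¹ • q.2) =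
    ∫ q : Phase p × Phase (N - p), phaseFourier (Fin p × Fin 3) φ q.1 *
      phaseFourier (Fin (N - p) × Fin 3) η q.2 *
      wignerHat ħ Ψ (joinPhaseEquiv h (q.1, R⁻¹ • q.2)) := by
  set J := joinPhaseEquiv h with hJ
  have hJm : MeasurePreserving J := measurePreserving_joinPhaseEquiv h
  set c : ℂ := ((R ^ Module.finrank ℝ (Phase (N - p)) : ℝ) : ℂ) with hc
  set φ' := phaseFourier (Fin p × Fin 3) φ with hφ'
  set η' := phaseFourier (Fin (N - p) × Fin 3) η with hη'
  have hRη : Integrable fun u => η (R⁻¹ • u) := η.integrable.comp_smul (inv_ne_zero hR.ne')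
  have hRη' : Integrable fun u => c * η' (R • u) := (η'.integrable.comp_smul hR.ne').const_mul c
  have iΦ : Integrable fun q : Phase p × Phase (N - p) => φ q.1 * η (R⁻¹ • q.2) :=
    φ.integrable.mul_prod hRη
  have iG : Integrable fun q : Phase p × Phase (N - p) => φ' q.1 * (c * η' (R • q.2)) :=
    φ'.integrable.mul_prod hRη'
  have key := integral_wigner_mul hħ Ψ
    (G := fun z => φ' (J.symm z).1 * (c * η' (R • (J.symm z).2)))
    (Φ := fun z => φ (J.symm z).1 * η (R⁻¹ • (J.symm z).2))
    ((hJm.symm J).integrable_comp_of_integrable iG)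
    ((hJm.symm J).integrable_comp_of_integrable iΦ) fun z => by
      obtain ⟨z, rfl⟩ := J.surjective z
      rw [← hJm.integral_comp J.measurableEmbedding]
      simp only [J.symm_apply_apply]
      simp only [hJ, phaseWave_joinPhaseEquiv]
      rw [← integral_phaseFourier_mul_phaseWave φ, ← integral_phaseFourier_mul_phaseWave η]
      have e : ∫ q, phaseFourier (Fin (N - p) × Fin 3) η q * phaseWave q (R⁻¹ • z.2) =
          ∫ u, c * η' (R • u) * phaseWave u z.2 := by
        rw [hc, integral_scaled_mul _ hR]
        refine integral_congr_ae (ae_of_all _ fun q => ?_)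
        simp only [phaseWave, Prod.smul_fst, Prod.smul_snd, real_inner_smul_left,
          real_inner_smul_right, hη']
      rw [e]
      refine (integral_prod_mul _ _).symm.trans (integral_congr_ae (ae_of_all _ fun q => ?_))
      simp only [hφ']
      ring
  rw [← hJm.integral_comp J.measurableEmbedding, ← hJm.integral_comp J.measurableEmbedding] at key
  simp only [J.symm_apply_apply] at key
  have hb : ∀ {f : Phase p × Phase (N - p) → Phase N}, Continuous f →
      AEStronglyMeasurable (fun q => wignerHat ħ Ψ (f q)) volume := fun hf =>
    ((continuous_wignerHat ħ Ψ).comp hf).aestronglyMeasurable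
  have hJc : Continuous J := continuous_joinPhaseEquiv h
  have i1 : Integrable fun q : Phase p × Phase (N - p) =>
      φ' q.1 * (c * η' (R • q.2)) * wignerHat ħ Ψ (J q) :=
    iG.mul_bdd (hb hJc) (ae_of_all _ fun q => norm_wignerHat_le ħ Ψ _)
  have i2 : Integrable fun q : Phase p × Phase (N - p) =>
      φ' q.1 * η' q.2 * wignerHat ħ Ψ (J (q.1, R⁻¹ • q.2)) :=
    (φ'.integrable.mul_prod η'.integrable).mul_bdd (hb (hJc.comp (by fun_prop)))
      (ae_of_all _ fun q => norm_wignerHat_le ħ Ψ _)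
  refine Eq.trans ?_ (key.trans ?_)
  · refine integral_congr_ae (ae_of_all _ fun q => ?_)
    simp only [hJ, joinPhaseEquiv_apply, mul_assoc]
  · refine (integral_prod _ i1).trans (Eq.trans ?_ (integral_prod _ i2).symm)
    refine integral_congr_ae (ae_of_all _ fun q => ?_)
    have e : ∫ u, c * η' (R • u) * wignerHat ħ Ψ (J (q, u)) =
      ∫ u, η' u * wignerHat ħ Ψ (J (q, R⁻¹ • u)) := integral_scaled_mul _ hR
    simp only [mul_assoc] at e ⊢
    rw [integral_const_mul (φ' q), integral_const_mul (φ' q), e]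

/-- As R → ∞ the frequencies of the last N - p particles tend to 0, and the transform of η has
integral η(0) = 1. Dominated convergence gives the limit, the same for all η: the transform of the
marginal is the characteristic function at zero frequencies of the last particles. -/
theorem exists_isMarginal_wigner (h : p ≤ N) {ħ : ℝ} (hħ : 0 < ħ) (Ψ : L2 (Fin N × Fin 3)) :
    ∃ T : 𝓢'(Phase p, ℂ), IsMarginal (wigner ħ Ψ) T ∧
      ∀ φ, T φ = ∫ q, phaseFourier (Fin p × Fin 3) φ q *
        wignerHat ħ Ψ (joinPhaseEquiv h (q, 0)) := by
  have hJc := continuous_joinPhaseEquiv h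
  have hB : Continuous fun q : Phase p => wignerHat ħ Ψ (joinPhaseEquiv h (q, 0)) :=
    (continuous_wignerHat ħ Ψ).comp (hJc.comp (by fun_prop))
  obtain ⟨T, hT⟩ := exists_temperedDistribution hB fun q => norm_wignerHat_le ħ Ψ _
  refine ⟨T, fun φ η hη => ?_, hT⟩
  set φ' := phaseFourier (Fin p × Fin 3) φ with hφ'
  set η' := phaseFourier (Fin (N - p) × Fin 3) η with hη'
  have iprod : Integrable fun q : Phase p × Phase (N - p) => φ' q.1 * η' q.2 :=
    φ'.integrable.mul_prod η'.integrable
  have hη1 : ∫ u, η' u = 1 := by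
    rw [← hη, ← integral_phaseFourier_mul_phaseWave η]
    refine integral_congr_ae (ae_of_all _ fun q => ?_)
    simp [phaseWave, hη']
  have hlim : T φ = ∫ q : Phase p × Phase (N - p), φ' q.1 * η' q.2 *
      wignerHat ħ Ψ (joinPhaseEquiv h (q.1, 0)) := by
    rw [hT, ← mul_one (∫ q, _), ← hη1]
    refine (integral_prod_mul _ _).symm.trans (integral_congr_ae (ae_of_all _ fun q => ?_))
    simp only [hφ']
    ring
  rw [hlim]
  refine Tendsto.congr' ((eventually_gt_atTop 0).mono fun R hR =>
    (integral_wigner_joinConfig h hħ Ψ φ η hR).symm) ?_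
  refine tendsto_integral_filter_of_dominated_convergence
    (fun q => ‖φ' q.1 * η' q.2‖ * ‖Ψ‖ ^ 2) (Eventually.of_forall fun R => ?_)
    (Eventually.of_forall fun R => ae_of_all _ fun q => ?_) (iprod.norm.mul_const _)
    (ae_of_all _ fun q => ?_)
  · exact iprod.aestronglyMeasurable.mul
      ((continuous_wignerHat ħ Ψ).comp (hJc.comp (by fun_prop))).aestronglyMeasurable
  · rw [norm_mul]
    exact mul_le_mul_of_nonneg_left (norm_wignerHat_le ħ Ψ _) (norm_nonneg _)
  · refine Tendsto.const_mul _ (((continuous_wignerHat ħ Ψ).comp hJc).continuousAt.tendsto.comp ?_)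
    refine tendsto_const_nhds.prodMk_nhds ?_
    have := (tendsto_inv_atTop_zero (𝕜 := ℝ)).smul_const q.2
    rwa [zero_smul] at this

end Marginal

/-! ### The Wigner function of a product state -/

section ProductWigner

variable {p : ℕ} {ħ : ℝ}

theorem ae_comp_add_smul {ι : Type} [Fintype ι] {P : EuclideanSpace ℝ ι → Prop} (h : ∀ᵐ x, P x)
    (v : EuclideanSpace ℝ ι) {c : ℝ} (hc : c ≠ 0) : ∀ᵐ y, P (v + c • y) := by
  have h1 : ∀ᵐ y, P (v + y) :=
    (measurePreserving_add_left volume v).quasiMeasurePreserving.ae h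
  have h2 : Measure.QuasiMeasurePreserving (fun y : EuclideanSpace ℝ ι => c • y) volume volume := by
    refine ⟨by fun_prop, ?_⟩
    rw [Measure.map_addHaar_smul volume hc]
    exact Measure.smul_absolutelyContinuous
  exact h2.ae h1

/-- The defining integral factorizes over the particles. The product form of the state, known almost
everywhere, is pulled back along Y ↦ X ± ħY/2, which preserves null sets because ħ ≠ 0. -/
theorem prod_wigner_eq (hħ : 0 < ħ) (ψ : L2 (Fin 3)) (X Ξ : Config p) :
    ∏ j, wigner ħ ψ (particle X j) (particle Ξ j) = wigner ħ (tensor fun _ : Fin p => ψ) X Ξ := by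
  have h := tensor_ae fun _ : Fin p => ψ
  have h1 := ae_comp_add_smul h X (half_pos hħ).ne'
  have h2 := ae_comp_add_smul h X (neg_ne_zero.2 (half_pos hħ).ne')
  simp only [wigner, Finset.prod_mul_distrib, Finset.prod_const, Finset.card_univ,
    Fintype.card_fin, Fintype.card_prod]
  rw [← integral_prod_particle]
  congr 1
  · rw [inv_pow, mul_comm p 3, pow_mul]
    push_cast
    rfl
  · refine integral_congr_ae ?_
    filter_upwards [h1, h2] with Y e1 e2
    have e2' : (tensor fun _ : Fin p => ψ) (X - (ħ / 2) • Y) =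
        ∏ j, ψ (particle (X - (ħ / 2) • Y) j) := by
      rw [sub_eq_add_neg, ← neg_smul]
      exact e2
    rw [e1, e2', inner_eq_sum_particle, map_prod, Finset.prod_mul_distrib,
      Finset.prod_mul_distrib, ← Complex.exp_sum]
    push_cast
    rw [Finset.mul_sum]
    rfl

theorem integral_prod_wigner_mul (hħ : 0 < ħ) (ψ : L2 (Fin 3)) (φ : 𝓢(Phase p, ℂ)) :
    ∫ z : Phase p, (∏ j, wigner ħ ψ (particle z.1 j) (particle z.2 j)) * φ z =
      ∫ q, phaseFourier (Fin p × Fin 3) φ q * wignerHat ħ (tensor fun _ : Fin p => ψ) q := by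
  simp only [prod_wigner_eq hħ]
  exact integral_wigner_mul hħ _ (phaseFourier (Fin p × Fin 3) φ).integrable φ.integrable
    fun z => (integral_phaseFourier_mul_phaseWave φ z).symm

theorem norm_integral_mul_sub_integral_mul_le {φ : 𝓢(Phase p, ℂ)} {A B : Phase p → ℂ}
    (hA : Continuous A) (hB : Continuous B) {M : ℝ} (hMA : ∀ q, ‖A q‖ ≤ M) (hMB : ∀ q, ‖B q‖ ≤ M)
    {D : ℝ} (hD : ∀ q, ‖A q - B q‖ ≤ D * (1 + ‖q‖ ^ 2)) :
    ‖(∫ q, phaseFourier (Fin p × Fin 3) φ q * A q) - ∫ q, phaseFourier (Fin p × Fin 3) φ q * B q‖ ≤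
      D * ∫ q, (1 + ‖q‖ ^ 2) * ‖phaseFourier (Fin p × Fin 3) φ q‖ := by
  set g := phaseFourier (Fin p × Fin 3) φ with hg
  have iA : Integrable fun q => g q * A q :=
    g.integrable.mul_bdd hA.aestronglyMeasurable (ae_of_all _ hMA)
  have iB : Integrable fun q => g q * B q :=
    g.integrable.mul_bdd hB.aestronglyMeasurable (ae_of_all _ hMB)
  have i0 : Integrable fun q => ‖g q‖ := g.integrable.norm
  have i2 : Integrable fun q => ‖q‖ ^ 2 * ‖g q‖ := g.integrable_pow_mul volume 2
  have i : Integrable fun q => (1 + ‖q‖ ^ 2) * ‖g q‖ :=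
    (i0.add i2).congr (ae_of_all _ fun q => by simp only [Pi.add_apply]; ring)
  rw [← integral_sub iA iB, ← integral_const_mul]
  refine (norm_integral_le_integral_norm _).trans (integral_mono (iA.sub iB).norm
    (i.const_mul D) fun q => ?_)
  simp only [← mul_sub, norm_mul]
  calc _ ≤ ‖g q‖ * (D * (1 + ‖q‖ ^ 2)) := mul_le_mul_of_nonneg_left (hD q) (norm_nonneg _)
    _ = _ := by ring

end ProductWigner

/-! ### Consequences of the analytic class -/

section AnalyticPotential

variable {σ : ℝ} {w : Space → ℝ}

/-- The fourth power of x + 1 ≤ e^x at x = σs/4. -/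
theorem one_add_mul_pow_four_le (hσ : 0 < σ) {c s : ℝ} (hc : 0 ≤ c) (hs : 0 ≤ s) :
    (1 + c * s) ^ 4 ≤ (1 + 4 * c / σ) ^ 4 * Real.exp (σ * s) := by
  have h1 : σ * s / 4 + 1 ≤ Real.exp (σ * s / 4) := Real.add_one_le_exp _
  have h2 : 1 + c * s ≤ (1 + 4 * c / σ) * Real.exp (σ * s / 4) := by
    have h3 : 4 * c / σ * (σ * s / 4) = c * s := by field_simp
    have h4 : 0 ≤ 4 * c / σ := by positivity
    have h5 : 0 ≤ σ * s / 4 := by positivity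
    nlinarith [mul_le_mul_of_nonneg_left h1 h4]
  calc _ ≤ ((1 + 4 * c / σ) * Real.exp (σ * s / 4)) ^ 4 := by gcongr
    _ = _ := by
      rw [mul_pow, ← Real.exp_nat_mul]
      congr 2
      push_cast
      ring

theorem MemAnalyticClass.continuous_fourier (hw : MemAnalyticClass σ w) :
    Continuous (𝓕 fun x : Space => (w x : ℂ)) := by
  simpa using! VectorFourier.fourierIntegral_continuous Real.continuous_fourierChar
    (L := innerₗ Space) continuous_inner hw.1.ofReal

/-- The exponential weight is used only to dominate this fourth-order polynomial moment, for every
T. -/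
theorem MemAnalyticClass.hasCouplingMoment (hσ : 0 < σ) (hw : MemAnalyticClass σ w) {T : ℝ}
    (hT : 0 ≤ T) : HasCouplingMoment (𝓕 fun x : Space => (w x : ℂ)) T := by
  have hc := hw.continuous_fourier
  have hcw : Continuous fun κ : Space => waveBound T κ := by unfold waveBound; fun_prop
  refine ⟨hc.aestronglyMeasurable, (hw.2.norm.const_mul ((1 + 4 * (1 + T) / σ) ^ 4)).mono'
    (hc.norm.mul ((continuous_const.add hcw).pow 4)).aestronglyMeasurable
    (ae_of_all _ fun κ => ?_)⟩
  have h := one_add_mul_pow_four_le hσ (add_nonneg zero_le_one hT)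
    (norm_nonneg ((2 * Real.pi) • κ))
  have e : waveBound T κ = (1 + T) * ‖(2 * Real.pi) • κ‖ := by
    rw [waveBound, norm_smul, Real.norm_of_nonneg (by positivity)]; ring
  rw [Real.norm_of_nonneg (by positivity), norm_mul, e, Complex.norm_real,
    Real.norm_of_nonneg (Real.exp_pos _).le]
  calc _ ≤ ‖𝓕 (fun x : Space => (w x : ℂ)) κ‖ * _ :=
        mul_le_mul_of_nonneg_left h (norm_nonneg _)
    _ = _ := by ring

theorem MemAnalyticClass.integrable_fourier (hσ : 0 < σ) (hw : MemAnalyticClass σ w) :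
    Integrable (𝓕 fun x : Space => (w x : ℂ)) :=
  (integrable_norm_iff hw.continuous_fourier.aestronglyMeasurable).1
    ((hw.hasCouplingMoment hσ le_rfl).integrable_norm le_rfl)

theorem MemAnalyticClass.ae_eq_fourierInv (hσ : 0 < σ) (hw : MemAnalyticClass σ w) :
    (fun x => (w x : ℂ)) =ᵐ[volume] 𝓕⁻ (𝓕 fun x : Space => (w x : ℂ)) :=
  fourierInv_fourier_ae_eq hw.1.ofReal (hw.integrable_fourier hσ)

theorem MemAnalyticClass.couplingMoment_le (hσ : 0 < σ) (hw : MemAnalyticClass σ w) {T S : ℝ}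
    (hT : 0 ≤ T) (hTS : T ≤ S) :
    couplingMoment (𝓕 fun x : Space => (w x : ℂ)) T ≤
      couplingMoment (𝓕 fun x : Space => (w x : ℂ)) S := by
  refine integral_mono (hw.hasCouplingMoment hσ hT).integrable
    (hw.hasCouplingMoment hσ (hT.trans hTS)).integrable fun κ => ?_
  simp only [waveBound]
  gcongr

/-- Since `supNorm` is a `toReal`, its vanishing could also mean an infinite supremum. That is
excluded, because w is bounded by the L¹ norm of its Fourier transform. -/
theorem MemAnalyticClass.fourier_eq_zero (hσ : 0 < σ) (hw : MemAnalyticClass σ w)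
    (h0 : supNorm w = 0) : (𝓕 fun x : Space => (w x : ℂ)) = 0 := by
  set a := 𝓕 fun x : Space => (w x : ℂ) with ha
  have hb : ∀ᵐ x, ‖w x‖ ≤ ∫ κ, ‖a κ‖ := by
    filter_upwards [hw.ae_eq_fourierInv hσ] with x hx
    rw [← Complex.norm_real, hx, Real.fourierInv_eq']
    refine (norm_integral_le_integral_norm _).trans (le_of_eq ?_)
    refine integral_congr_ae (ae_of_all _ fun κ => ?_)
    simp only [norm_smul, Complex.norm_exp_ofReal_mul_I, one_mul, ha]
  have hfin : eLpNorm w ⊤ volume ≠ ⊤ := (memLp_top_of_bound hw.1.aestronglyMeasurable _ hb).2.ne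
  have hz : eLpNorm w ⊤ volume = 0 := by
    rcases (ENNReal.toReal_eq_zero_iff _).1 h0 with h | h
    · exact h
    · exact absurd h hfin
  have hae := (eLpNorm_eq_zero_iff hw.1.aestronglyMeasurable ENNReal.top_ne_zero).1 hz
  funext κ
  rw [ha, Real.fourier_eq', Pi.zero_apply]
  refine integral_eq_zero_of_ae (hae.mono fun x hx => ?_)
  simp [hx]

end AnalyticPotential

/-! ### Short-time and all-time bounds for the marginals -/

section Convergence

variable {p N : ℕ} {ħ : ℝ} {w : Space → ℝ} {a : Space → ℂ}

theorem norm_wignerHat_sub_le (hħ : 0 < ħ) (hN : 0 < N) (hpN : p ≤ N) {T : ℝ}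
    (hT : 0 ≤ T) (ha : HasCouplingMoment a T) (hsmall : T * couplingMoment a T ≤ 1 / 8)
    (hT1 : T ≤ 1 ∨ couplingMoment a T = 0)
    (hr : ∀ κ, conj (a κ) = a κ) (he : ∀ κ, a (-κ) = a κ)
    (hwa : (fun x => (w x : ℂ)) =ᵐ[volume] 𝓕⁻ a) (hw : ∀ x, w (-x) = w x)
    {ψ : ℝ → L2 (Fin 3)} {Ψ : ℝ → L2 (Fin N × Fin 3)} (hψ : IsHartreeSolution ħ w ψ)
    (hψ1 : ‖ψ 0‖ = 1) (hΨ : IsNBodySolution ħ w N Ψ) (hprod : IsProductState (ψ 0) (Ψ 0))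
    {t : ℝ} (ht : t ∈ Set.Icc 0 T) (q : Phase p) :
    ‖wignerHat ħ (Ψ t) (joinPhaseEquiv hpN (q, 0)) -
        wignerHat ħ (tensor fun _ : Fin p => ψ t) q‖ ≤
      106000 * p ^ 3 / N * (1 + ‖q‖ ^ 2) := by
  have hj : ∀ (c : ℝ) (X : Config p),
      c • (joinConfig X (0 : Config (N - p)) : Config N) = joinConfig (c • X) 0 := fun c X => by
    ext k
    simp only [joinConfig, PiLp.smul_apply, PiLp.zero_apply]
    split_ifs <;> simp
  have key := norm_inner_weylOp_sub_tensor_le hħ hN hpN hT ha hsmall hr he hwa hw hψ hψ1 hΨ hprod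
    ht ((2 * Real.pi) • q.1) ((-(2 * Real.pi)) • q.2)
  have e : joinPhaseEquiv hpN (q, 0) =
    (joinConfig q.1 (0 : Config (N - p)), joinConfig q.2 (0 : Config (N - p))) := rfl
  rw [wignerHat, wignerHat, e, hj, hj]
  refine key.trans ?_
  set s := ‖(2 * Real.pi) • q.1‖ + ‖(-(2 * Real.pi)) • q.2‖ with hs
  have hs0 : 0 ≤ s := by positivity
  -- Two components with a factor 2π each give 4π ≤ 16.
  have hs1 : s ≤ 16 * ‖q‖ := by
    have h1 : ‖q.1‖ ≤ ‖q‖ := norm_fst_le q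
    have h2 : ‖q.2‖ ≤ ‖q‖ := norm_snd_le q
    have hπ := Real.pi_le_four
    have hπ0 := Real.pi_pos
    rw [hs, norm_smul, norm_smul, norm_neg, Real.norm_of_nonneg (by positivity)]
    nlinarith [norm_nonneg q]
  have hq0 : 0 ≤ T * couplingMoment a T := mul_nonneg hT (couplingMoment_nonneg a hT)
  -- If T ≤ 1, the frequencies at most double along the free flow, and 412/8·(1 + 32|q|)² fits under
  -- the generous 106000. If the moment vanishes, the only term containing T is absent, and T is
  -- arbitrary.
  have hmain : 18 + 412 * (T * couplingMoment a T) * (1 + (1 + T) * s) ^ 2 ≤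
      106000 * (1 + ‖q‖ ^ 2) := by
    have hqn : 0 ≤ ‖q‖ := norm_nonneg q
    rcases hT1 with h | h
    · have h1 : (1 + T) * s ≤ 32 * ‖q‖ := by nlinarith
      have h0 : 0 ≤ (1 + T) * s := by positivity
      have h2 : (1 + (1 + T) * s) ^ 2 ≤ (1 + 32 * ‖q‖) ^ 2 := by gcongr
      have h3 : 412 * (T * couplingMoment a T) * (1 + (1 + T) * s) ^ 2 ≤
          412 * (1 / 8) * (1 + 32 * ‖q‖) ^ 2 := by gcongr
      nlinarith [sq_nonneg (‖q‖ - 1)]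
    · rw [h, mul_zero, mul_zero, zero_mul]
      nlinarith [sq_nonneg ‖q‖]
  calc _ ≤ (p : ℝ) ^ 3 * (106000 * (1 + ‖q‖ ^ 2)) / N := by gcongr
    _ = _ := by ring

/-- For short times the marginals agree with the Hartree product up to `O(1/N)`, for all times the
difference is bounded. -/
theorem exists_isMarginal_norm_sub_le (hħ : 0 < ħ) (hN : 0 < N) (hpN : p ≤ N)
    (hai : Integrable a) (hr : ∀ κ, conj (a κ) = a κ) (he : ∀ κ, a (-κ) = a κ)
    (hwa : (fun x => (w x : ℂ)) =ᵐ[volume] 𝓕⁻ a) (hw : ∀ x, w (-x) = w x)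
    {ψ : ℝ → L2 (Fin 3)} {Ψ : ℝ → L2 (Fin N × Fin 3)} (hψ : IsHartreeSolution ħ w ψ)
    (hψ1 : ‖ψ 0‖ = 1) (hΨ : IsNBodySolution ħ w N Ψ) (hprod : IsProductState (ψ 0) (Ψ 0))
    {t : ℝ} (ht : 0 ≤ t) :
    ∃ Wp : 𝓢'(Phase p, ℂ), IsMarginal (wigner ħ (Ψ t)) Wp ∧ ∀ φ : 𝓢(Phase p, ℂ),
      (‖Wp φ - ∫ z : Phase p, (∏ j, wigner ħ (ψ t) (particle z.1 j) (particle z.2 j)) * φ z‖ ≤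
        2 * ∫ q, (1 + ‖q‖ ^ 2) * ‖phaseFourier (Fin p × Fin 3) φ q‖) ∧
      ∀ T, HasCouplingMoment a T → T * couplingMoment a T ≤ 1 / 8 →
        T ≤ 1 ∨ couplingMoment a T = 0 → t ≤ T →
        ‖Wp φ - ∫ z : Phase p, (∏ j, wigner ħ (ψ t) (particle z.1 j) (particle z.2 j)) * φ z‖ ≤
        106000 * p ^ 3 / N * ∫ q, (1 + ‖q‖ ^ 2) * ‖phaseFourier (Fin p × Fin 3) φ q‖ := by
  obtain ⟨Wp, hWp, hval⟩ := exists_isMarginal_wigner hpN hħ (Ψ t)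
  have hψt : ‖ψ t‖ = 1 := (hψ.norm_eq hħ hai hwa ht).trans hψ1
  have hΨt : ‖Ψ t‖ = 1 := by
    rw [hΨ.norm_eq hħ hN hai hr hwa hw ht, hprod.eq_tensor, norm_tensor]
    simp [hψ1]
  have hten : ‖tensor fun _ : Fin p => ψ t‖ = 1 := by simp [norm_tensor, hψt]
  have hA : Continuous fun q : Phase p => wignerHat ħ (Ψ t) (joinPhaseEquiv hpN (q, 0)) :=
    (continuous_wignerHat ħ _).comp ((continuous_joinPhaseEquiv hpN).comp (by fun_prop))
  have hMA : ∀ q : Phase p, ‖wignerHat ħ (Ψ t) (joinPhaseEquiv hpN (q, 0))‖ ≤ 1 := fun q =>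
    (norm_wignerHat_le ħ _ _).trans (by rw [hΨt, one_pow])
  have hMB : ∀ q : Phase p, ‖wignerHat ħ (tensor fun _ : Fin p => ψ t) q‖ ≤ 1 := fun q =>
    (norm_wignerHat_le ħ _ _).trans (by rw [hten, one_pow])
  refine ⟨Wp, hWp, fun φ => ⟨?_, fun T ha hsmall hT1 htT => ?_⟩⟩
  · rw [hval, integral_prod_wigner_mul hħ]
    refine norm_integral_mul_sub_integral_mul_le hA (continuous_wignerHat ħ _) hMA hMB fun q => ?_
    refine (norm_sub_le _ _).trans ((add_le_add (hMA q) (hMB q)).trans ?_)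
    nlinarith [sq_nonneg ‖q‖]
  · rw [hval, integral_prod_wigner_mul hħ]
    exact norm_integral_mul_sub_integral_mul_le hA (continuous_wignerHat ħ _) hMA hMB
      (norm_wignerHat_sub_le hħ hN hpN (ht.trans htT) ha hsmall hT1 hr he hwa hw hψ hψ1 hΨ hprod
        ⟨ht, htT⟩)

end Convergence

end

/-! ### Short times by propagation of chaos, long times by the lower bound on e^{-1/√ε} -/

theorem theorem1p2 (σ : ℝ) (hσ : 0 < σ) (w : Space → ℝ) (hw : MemAnalyticClass σ w)
    (hw_even : ∀ x, w (-x) = w x) (p : ℕ) (hp : 1 ≤ p) :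
    ∃ (C K : ℝ) (k n : ℕ), 0 < C ∧ 0 < K ∧
      ∀ (ħ : ℝ), 0 < ħ → ∀ (N : ℕ), p ≤ N →
      ∀ (ψ : ℝ → L2 (Fin 3)) (Ψ : ℝ → L2 (Fin N × Fin 3)),
        IsHartreeSolution ħ w ψ → ‖ψ 0‖ = 1 →
        IsNBodySolution ħ w N Ψ → IsProductState (ψ 0) (Ψ 0) →
        ∀ t : ℝ, 0 ≤ t →
          ∃ Wp : 𝓢'(Phase p, ℂ), IsMarginal (wigner ħ (Ψ t)) Wp ∧
            ∀ φ : 𝓢(Phase p, ℂ),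
              ‖Wp φ - ∫ z : Phase p,
                  (∏ j, wigner ħ (ψ t) (particle z.1 j) (particle z.2 j)) * φ z‖ ≤
                (C / N + K * expSmall (supNorm w * t)) * schwartzNorm k n φ := by
  obtain ⟨A, k, n, hA, hle⟩ := exists_integral_phaseFourier_le p
  set a := 𝓕 fun x : Space => (w x : ℂ) with ha
  have hai : Integrable a := hw.integrable_fourier hσ
  have he : ∀ κ, a (-κ) = a κ := fun κ => fourier_even hw_even κ
  have hr : ∀ κ, conj (a κ) = a κ := fun κ => (conj_fourier_ofReal κ).trans (he κ)
  have hwa : (fun x => (w x : ℂ)) =ᵐ[volume] 𝓕⁻ a := hw.ae_eq_fourierInv hσ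
  have hΛ := couplingMoment_nonneg a zero_le_one
  have hs : 0 ≤ supNorm w := ENNReal.toReal_nonneg
  -- The largest time of validity, fixed by the moment at time 1, which dominates the one at T₀; the
  -- added 1 keeps the denominator positive.
  set T₀ : ℝ := min 1 (1 / (8 * (couplingMoment a 1 + 1))) with hT₀
  have hT₀0 : 0 < T₀ := lt_min one_pos (by positivity)
  have hT₀1 : T₀ ≤ 1 := min_le_left _ _
  have hsmall : T₀ * couplingMoment a T₀ ≤ 1 / 8 :=
    calc _ ≤ 1 / (8 * (couplingMoment a 1 + 1)) * (couplingMoment a 1 + 1) := by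
          refine mul_le_mul (min_le_right _ _) ?_ (couplingMoment_nonneg a hT₀0.le) (by positivity)
          exact (hw.couplingMoment_le hσ hT₀0.le hT₀1).trans (by linarith)
      _ = 1 / 8 := by field_simp
  have hp0 : (0 : ℝ) < p := by exact_mod_cast hp
  -- The value of e^{-1/√ε} at the end of the short-time interval. Dividing by it in K makes the
  -- trivial bound 2A admissible at all later times.
  set δ : ℝ := Real.exp (-1 / Real.sqrt (supNorm w * T₀)) with hδ
  have hδ0 : 0 < δ := Real.exp_pos _
  refine ⟨106000 * p ^ 3 * A, 2 * A / δ, k, n, by positivity, by positivity, ?_⟩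
  intro ħ hħ N hpN ψ Ψ hψ hψ1 hΨ hprod t ht
  have hN : 0 < N := hp.trans hpN
  have hN0 : (0 : ℝ) < N := by exact_mod_cast hN
  obtain ⟨Wp, hWp, hbd⟩ := exists_isMarginal_norm_sub_le hħ hN hpN hai hr he hwa hw_even hψ hψ1 hΨ
    hprod ht
  refine ⟨Wp, hWp, fun φ => ?_⟩
  obtain ⟨hlong, hshort⟩ := hbd φ
  have hφ0 : 0 ≤ schwartzNorm k n φ := apply_nonneg _ _
  have hexp : 0 ≤ expSmall (supNorm w * t) := by
    unfold expSmall
    split_ifs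
    exacts [le_rfl, (Real.exp_pos _).le]
  have hshort' : ∀ T, HasCouplingMoment a T → T * couplingMoment a T ≤ 1 / 8 →
      T ≤ 1 ∨ couplingMoment a T = 0 → t ≤ T →
      ‖Wp φ - ∫ z : Phase p, (∏ j, wigner ħ (ψ t) (particle z.1 j) (particle z.2 j)) * φ z‖ ≤
        (106000 * p ^ 3 * A / N + 2 * A / δ * expSmall (supNorm w * t)) *
          schwartzNorm k n φ := fun T h1 h2 h3 h4 => by
    refine (hshort T h1 h2 h3 h4).trans ((mul_le_mul_of_nonneg_left (hle φ)
      (by positivity)).trans ?_)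
    rw [add_mul]
    refine (le_of_eq (by ring)).trans (le_add_of_nonneg_right (by positivity))
  -- If w vanishes, then ε = 0 and the exponential term is absent at all times. There is then no
  -- interaction, the moment is zero, and the 1/N estimate holds on [0, t] for any t.
  rcases hs.eq_or_lt with h0 | h0
  · have hz : a = 0 := hw.fourier_eq_zero hσ h0.symm
    have hm : couplingMoment a t = 0 := by simp [couplingMoment, hz]
    exact hshort' t (hw.hasCouplingMoment hσ ht) (by rw [hm]; norm_num) (Or.inr hm) le_rfl
  rcases le_or_gt t T₀ with htT | htT
  · exact hshort' T₀ (hw.hasCouplingMoment hσ hT₀0.le) hsmall (Or.inl hT₀1) htT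
  -- For t > T₀ monotonicity of ε ↦ e^{-1/√ε} bounds the exponential term below by δ.
  · have hst : 0 < supNorm w * T₀ := mul_pos h0 hT₀0
    have hδle : δ ≤ expSmall (supNorm w * t) := by
      rw [expSmall, if_neg (mul_pos h0 (hT₀0.trans htT)).ne', hδ]
      refine Real.exp_le_exp.2 ?_
      rw [neg_div, neg_div, neg_le_neg_iff]
      exact one_div_le_one_div_of_le (Real.sqrt_pos.2 hst)
        (Real.sqrt_le_sqrt (mul_le_mul_of_nonneg_left htT.le hs))
    refine hlong.trans ((mul_le_mul_of_nonneg_left (hle φ) two_pos.le).trans ?_)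
    rw [← mul_assoc]
    refine mul_le_mul_of_nonneg_right ?_ hφ0
    have h1 : 2 * A ≤ 2 * A / δ * expSmall (supNorm w * t) := by
      rw [div_mul_eq_mul_div, le_div_iff₀ hδ0]
      exact mul_le_mul_of_nonneg_left hδle (by positivity)
    exact h1.trans (le_add_of_nonneg_left (by positivity))
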